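/- **Setting.** Let $V\in\mathcal S(\mathbb R^3,\mathbb R)$ and $H=-\Delta+V$ on $L^2(\mathbb R^3,\mathbb C)$ with domain $H^2$. Assume that for some $N\ge 2$ the discrete spectrum of $H$ is $\{\omega_1<\dots<\omega_N\}\subset(-\infty,0)$, that all $\omega_j$ are simple eigenvalues, and that $\mathbf m\cdot\boldsymbol\omega\ne 0$ for all $\mathbf m\in\mathbb Z^N\setminus\{0\}$, where $\boldsymbol\omega=(\omega_1,\dots,\omega_N)$. Let $\phi_j$ be a real-valued eigenfunction for $\omega_j$ with $\|\phi_j\|_{L^2}=1$, and put $\boldsymbol\phi=(\phi_1,\dots,\phi_N)$. Let $g\in C^\infty(\mathbb R,\mathbb R)$ with $g(0)=0$ and, for every $n\ge 0$, $|g^{(n)}(s)|\le C_n(1+s^2)^{(2-n)/2}$ for all $s$. Consider $$ i\partial_t u=Hu+g(|u|^2)u,\qquad (t,x)\in\mathbb R^{1+3}.\tag{NLS}$$ "Solution" of (NLS), or of (NLS) with a forcing term, means $u\in C(\mathbb R;H^2)\cap C^1(\mathbb R;L^2)$ satisfying the equation in $L^2$ for every $t$. For $\gamma>0$, $s\ge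 0$ let $H^s_\gamma=\{u\in H^s: \cosh(\gamma|x|)u\in H^s\}$ with norm $\|\cosh(\gamma|x|)u\|_{H^s}$. **Indices.** For $\mathbf m\in\mathbb Z^N$ let $|\mathbf m|=(|m_1|,\dots,|m_N|)$; $\mathbf n\prec\mathbf m$ means $n_j\le m_j$ for all $j$ and $\mathbf n\neq\mathbf m$. Let $\mathbf e_j$ be the standard basis vectors, $\mathbf{NR}_0=\{\mathbf e_1,\dots,\mathbf e_N\}$, $\mathbf R=\{\mathbf m:\sum_j m_j=1,\ \mathbf m\cdot\boldsymbol\omega>0\}$, $\mathbf{NR}=\{\mathbf m:\sum_j m_j=1,\ \mathbf m\cdot\boldsymbol\omega<0\}$, $\mathbf R_{\min}=\{\mathbf m\in\mathbf R:\nexists\,\mathbf n\in\mathbf R,\ |\mathbf n|\prec|\mathbf m|\}$, $\mathbf{NR}_1=\{\mathbf m\in\mathbf{NR}:\forall\mathbf n\in\mathbf R_{\min},\ |\mathbf n|\not\prec|\mathbf m|\}$ (the last two are finite). For $k\ge1$ let $A(k,\mathbf m)$ be the set of $(\mathbf m_1,\dots,\mathbf m_{2k+1})\in(\mathbf{NR}_1)^{2k+1}$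 with $\sum_{l=1}^{2k+1}(-1)^{l+1}\mathbf m_l=\mathbf m$ and $\sum_{l=1}^{2k+1}|\mathbf m_l|=|\mathbf m|$. Put $\widetilde\phi_{\mathbf e_j}(0)=\phi_j$ and, recursively, $\widetilde\phi_{\mathbf m}(0)=-(H-\mathbf m\cdot\boldsymbol\omega)^{-1}G_{\mathbf m}$ for $\mathbf m\in\mathbf{NR}_1\setminus\mathbf{NR}_0$, where, for $\mathbf m\in(\mathbf{NR}_1\setminus\mathbf{NR}_0)\cup\mathbf R_{\min}$, $$G_{\mathbf m}=\sum_{k\ge1}\frac{g^{(k)}(0)}{k!}\sum_{(\mathbf m_1,\dots,\mathbf m_{2k+1})\in A(k,\mathbf m)}\widetilde\phi_{\mathbf m_1}(0)\cdots\widetilde\phi_{\mathbf m_{2k+1}}(0)$$ (a finite sum). For $\mathbf z\in\mathbb C^N$ let $\mathbf z^{\mathbf m}=\prod_j z_j^{(m_j)}$ with $z^{(m)}=z^m$ for $m\ge0$ and $z^{(m)}=\bar z^{-m}$ for $m<0$, $|\mathbf z|^2=(|z_1|^2,\dots,|z_N|^2)$, and $\|\cdot\|=\sum_j|\cdot_j|$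 on $\mathbb C^N$ and $\mathbb R^N$; $\mathcal B(0,r)$ denotes the open ball for $\|\cdot\|$. **Refined profiles.** A refined profile (with weight $\gamma$) consists, for every $s\ge 0$, of constants $\delta_s,C_s>0$ with $\delta_s$ nonincreasing in $s$, and of maps $\psi_{\mathbf m}=\psi^{(s)}_{\mathbf m}\in C^\infty(\mathcal B_{\mathbb R^N}(0,\delta_s^2),H^s_\gamma)$ ($\mathbf m\in\mathbf{NR}_1$), $\boldsymbol\varpi=\boldsymbol\varpi^{(s)}\in C^\infty(\mathcal B_{\mathbb R^N}(0,\delta_s^2),\mathbb R^N)$, $\mathcal R=\mathcal R^{(s)}\in C^\infty(\mathcal B_{\mathbb C^N}(0,\delta_s),H^s_\gamma)$ such that: $\boldsymbol\varpi(0)=\boldsymbol\omega$; $\psi_{\mathbf e_j}(0)=0$ for all $j$, and $\psi_{\mathbf m}(0)=\widetilde\phi_{\mathbf m}(0)$ for $\mathbf m\in\mathbf{NR}_1\setminus\mathbf{NR}_0$; $\|\mathcal R(\mathbf z)\|_{H^s_\gamma}\le C_s\|\mathbf z\|^2\sum_{\mathbf m\in\mathbf R_{\min}}|\mathbf z^{\mathbf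 m}|$ for $\|\mathbf z\|<\delta_s$; $G_{\mathbf m}\in\bigcap_{r\ge0}H^r_\gamma$ for $\mathbf m\in\mathbf R_{\min}$; for $\|\mathbf z\|<\delta_s$, with $$\phi(\mathbf z)=\mathbf z\cdot\boldsymbol\phi+\sum_{\mathbf m\in\mathbf{NR}_1}\mathbf z^{\mathbf m}\psi_{\mathbf m}(|\mathbf z|^2),\qquad z_j(t)=e^{-i\varpi_j(|\mathbf z|^2)t}z_j,$$ the function $u(t)=\phi(\mathbf z(t))$ is a solution of $i\partial_tu=Hu+g(|u|^2)u-\sum_{\mathbf m\in\mathbf R_{\min}}\mathbf z(t)^{\mathbf m}G_{\mathbf m}-\mathcal R(\mathbf z(t))$; and for $s_1<s_2$ and $\|\mathbf z\|<\delta_{s_2}$ one has $\psi^{(s_1)}_{\mathbf m}(|\mathbf z|^2)=\psi^{(s_2)}_{\mathbf m}(|\mathbf z|^2)$ for all $\mathbf m\in\mathbf{NR}_1$, $\boldsymbol\varpi^{(s_1)}(|\mathbf z|^2)=\boldsymbol\varpi^{(s_2)}(|\mathbf z|^2)$ and $\mathcal R^{(s_1)}(\mathbf z)=\mathcal R^{(s_2)}(\mathbf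 z)$. **Statement.** There is $\gamma>0$, independent of $g$, such that $\phi_j\in\bigcap_{s\ge0}H^s_\gamma$ for all $j$ and such that, for every $g$ as above, a refined profile with weight $\gamma$ exists; and for every refined profile with weight $\gamma$, every $s>0$ and every $j\in\{1,\dots,N\}$: 1. for every $z\in\mathbb C$ with $|z|<\delta_s$, setting $z(t)=e^{-i\varpi_j(|z\mathbf e_j|^2)t}z$, the function $t\mapsto\phi(z(t)\mathbf e_j)$ is a solution of (NLS), and it is a standing wave: $\phi(z(t)\mathbf e_j)=e^{-i\varpi_j(|z\mathbf e_j|^2)t}\phi(z\mathbf e_j)$ for all $t\in\mathbb R$; 2. these standing waves bifurcate from the eigenvalue $\omega_j$: as $z\to0$ in $\mathbb C$, $\varpi_j(|z\mathbf e_j|^2)\to\omega_j$ and $\|\phi(z\mathbf e_j)-z\phi_j\|_{H^s_\gamma}=o(|z|)$. -/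

import Mathlib

open MeasureTheory Filter Topology TemperedDistribution Asymptotics
open scoped SchwartzMap Laplacian NNReal

noncomputable section

namespace NLS

/-- Physical space `ℝ³`. -/
abbrev X : Type := EuclideanSpace ℝ (Fin 3)

/-- `L²(ℝ³, ℂ)`. -/
abbrev L2 : Type := Lp ℂ 2 (volume : Measure X)

/-! ### Sobolev spaces and weighted Sobolev spaces -/

/-- The tempered distribution defined by an `L²` function determines the function. -/
theorem toDistr_injective :
    Function.Injective (Lp.toTemperedDistributionCLM ℂ (volume : Measure X) 2) :=
  LinearMap.ker_eq_bot.mp Lp.ker_toTemperedDistributionCLM_eq_bot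

/-- The Sobolev space `H^s(ℝ³, ℂ)`, `s ≥ 0`, as a subspace of `L²`. -/
def Hs (s : ℝ) : Submodule ℂ L2 where
  carrier := {u | MemSobolev s 2 (u : 𝓢'(X, ℂ))}
  add_mem' {u v} hu hv := by
    have h := MemSobolev.add hu hv
    have e : ((u + v : L2) : 𝓢'(X, ℂ)) = (u : 𝓢'(X, ℂ)) + (v : 𝓢'(X, ℂ)) :=
      map_add (Lp.toTemperedDistributionCLM ℂ (volume : Measure X) 2) u v
    simpa only [Set.mem_ofPred_eq, e] using h
  zero_mem' := by
    have h := memSobolev_fun_zero (E := X) (F := ℂ) s 2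
    have e : ((0 : L2) : 𝓢'(X, ℂ)) = 0 :=
      map_zero (Lp.toTemperedDistributionCLM ℂ (volume : Measure X) 2)
    simpa only [Set.mem_ofPred_eq, e] using h
  smul_mem' c {u} hu := by
    have h := MemSobolev.smul c hu
    have e : ((c • u : L2) : 𝓢'(X, ℂ)) = c • (u : 𝓢'(X, ℂ)) :=
      map_smul (Lp.toTemperedDistributionCLM ℂ (volume : Measure X) 2) c u
    simpa only [Set.mem_ofPred_eq, e] using h

/-- A linear map from a subspace `S` of `L²` to distributions, all of whose values are (given by)
`L²` functions, regarded as a linear map to `L²`. -/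
def liftL2 {S : Submodule ℂ L2} (T : S →ₗ[ℂ] 𝓢'(X, ℂ))
    (h : ∀ u : S, ∃ f : L2, T u = (f : 𝓢'(X, ℂ))) : S →ₗ[ℂ] L2 where
  toFun u := (h u).choose
  map_add' u v := by
    apply toDistr_injective
    have e1 := (h u).choose_spec
    have e2 := (h v).choose_spec
    have e3 := (h (u + v)).choose_spec
    have e4 := T.map_add u v
    rw [e1, e2, e3] at e4
    exact e4.trans (map_add (Lp.toTemperedDistributionCLM ℂ (volume : Measure X) 2) _ _).symm
  map_smul' c u := by
    apply toDistr_injective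
    have e1 := (h u).choose_spec
    have e3 := (h (c • u)).choose_spec
    have e4 := T.map_smul c u
    rw [e1, e3] at e4
    exact e4.trans (map_smul (Lp.toTemperedDistributionCLM ℂ (volume : Measure X) 2) c _).symm

/-- The defining property of `liftL2`. -/
theorem liftL2_spec {S : Submodule ℂ L2} (T : S →ₗ[ℂ] 𝓢'(X, ℂ))
    (h : ∀ u : S, ∃ f : L2, T u = (f : 𝓢'(X, ℂ))) (u : S) :
    T u = (liftL2 T h u : 𝓢'(X, ℂ)) := (h u).choose_spec

/-- An `L²` function viewed as a tempered distribution, on a subspace of `L²`. -/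
def toDistr (S : Submodule ℂ L2) : S →ₗ[ℂ] 𝓢'(X, ℂ) :=
  (Lp.toTemperedDistributionCLM ℂ (volume : Measure X) 2).toLinearMap ∘ₗ S.subtype

/-- The Bessel potential isomorphism `H^s → L²`: the Fourier multiplier `(1 + |ξ|²)^{s/2}`. -/
def bessel (s : ℝ) : Hs s →ₗ[ℂ] L2 :=
  liftL2 ((besselPotential X ℂ s).toLinearMap ∘ₗ toDistr (Hs s)) (fun u => u.2)

theorem bessel_spec (s : ℝ) (u : Hs s) :
    besselPotential X ℂ s ((u : L2) : 𝓢'(X, ℂ)) = (bessel s u : 𝓢'(X, ℂ)) :=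
  liftL2_spec ((besselPotential X ℂ s).toLinearMap ∘ₗ toDistr (Hs s)) (fun u => u.2) u

theorem bessel_injective (s : ℝ) : Function.Injective (bessel s) := by
  intro u v huv
  have h : besselPotential X ℂ s ((u : L2) : 𝓢'(X, ℂ)) =
      besselPotential X ℂ s ((v : L2) : 𝓢'(X, ℂ)) := by
    rw [bessel_spec, bessel_spec, huv]
  have h2 := congrArg (besselPotential X ℂ (-s)) h
  simp only [besselPotential_besselPotential_apply, add_neg_cancel, besselPotential_zero,
    ContinuousLinearMap.id_apply] at h2
  exact Subtype.ext (toDistr_injective h2)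

/-- The weighted Sobolev space `H^s_γ = {u ∈ H^s : cosh(γ|x|) u ∈ H^s}` as a subspace of `L²`. -/
def weighted (γ : ℝ) (s : ℝ≥0) : Submodule ℂ L2 where
  carrier := {u | u ∈ Hs s ∧ ∃ w : Hs s, ∀ᵐ x, (w : L2) x = (Real.cosh (γ * ‖x‖) : ℂ) * u x}
  add_mem' {u v} hu hv := by
    obtain ⟨hu, w, hw⟩ := hu
    obtain ⟨hv, w', hw'⟩ := hv
    refine ⟨(Hs s).add_mem hu hv, w + w', ?_⟩
    filter_upwards [hw, hw', Lp.coeFn_add u v, Lp.coeFn_add (w : L2) (w' : L2)] with x h1 h2 h3 h4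
    rw [h3, Submodule.coe_add, h4, Pi.add_apply, Pi.add_apply, h1, h2, mul_add]
  zero_mem' := by
    refine ⟨(Hs s).zero_mem, 0, ?_⟩
    filter_upwards [Lp.coeFn_zero ℂ 2 (volume : Measure X)] with x h1
    rw [Submodule.coe_zero, h1, Pi.zero_apply, mul_zero]
  smul_mem' c {u} hu := by
    obtain ⟨hu, w, hw⟩ := hu
    refine ⟨(Hs s).smul_mem c hu, c • w, ?_⟩
    filter_upwards [hw, Lp.coeFn_smul c u, Lp.coeFn_smul c (w : L2)] with x h1 h3 h4
    rw [h3, Submodule.coe_smul, h4, Pi.smul_apply, Pi.smul_apply, h1, smul_eq_mul, smul_eq_mul]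
    ring

theorem weighted_exists {γ : ℝ} {s : ℝ≥0} (u : weighted γ s) :
    ∃ w : Hs s, ∀ᵐ x, (w : L2) x = (Real.cosh (γ * ‖x‖) : ℂ) * (u : L2) x := u.2.2

/-- Multiplication by `cosh(γ|x|)` from `H^s_γ` to `H^s`. -/
def coshMul (γ : ℝ) (s : ℝ≥0) : weighted γ s →ₗ[ℂ] Hs s where
  toFun u := (weighted_exists u).choose
  map_add' u v := by
    apply Subtype.ext
    apply Lp.ext
    have h1 := (weighted_exists u).choose_spec
    have h2 := (weighted_exists v).choose_spec
    have h3 := (weighted_exists (u + v)).choose_spec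
    generalize (weighted_exists u).choose = a at *
    generalize (weighted_exists v).choose = b at *
    generalize (weighted_exists (u + v)).choose = c at *
    filter_upwards [h1, h2, h3, Lp.coeFn_add (u : L2) (v : L2),
      Lp.coeFn_add (a : L2) (b : L2)] with x h1 h2 h3 h4 h5
    rw [Submodule.coe_add, h5, Pi.add_apply, h1, h2, h3, Submodule.coe_add, h4, Pi.add_apply,
      mul_add]
  map_smul' c u := by
    apply Subtype.ext
    apply Lp.ext
    have h1 := (weighted_exists u).choose_spec
    have h3 := (weighted_exists (c • u)).choose_spec
    generalize (weighted_exists u).choose = a at *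
    generalize (weighted_exists (c • u)).choose = b at *
    filter_upwards [h1, h3, Lp.coeFn_smul c (u : L2), Lp.coeFn_smul c (a : L2)] with x h1 h3 h4 h5
    rw [RingHom.id_apply, Submodule.coe_smul, h5, Pi.smul_apply, h1, h3, Submodule.coe_smul, h4,
      Pi.smul_apply, smul_eq_mul, smul_eq_mul]
    ring

theorem coshMul_spec (γ : ℝ) (s : ℝ≥0) (u : weighted γ s) :
    ∀ᵐ x, (coshMul γ s u : L2) x = (Real.cosh (γ * ‖x‖) : ℂ) * (u : L2) x :=
  (weighted_exists u).choose_spec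

theorem coshMul_injective (γ : ℝ) (s : ℝ≥0) : Function.Injective (coshMul γ s) := by
  intro u v huv
  apply Subtype.ext
  apply Lp.ext
  filter_upwards [coshMul_spec γ s u, coshMul_spec γ s v] with x h1 h2
  rw [huv, h2] at h1
  have hc : (Real.cosh (γ * ‖x‖) : ℂ) ≠ 0 := by
    exact_mod_cast (Real.cosh_pos _).ne'
  exact (mul_left_cancel₀ hc h1).symm

/-- The normed space `H^s_γ`, with norm `‖u‖ = ‖cosh(γ|x|) u‖_{H^s}`
(a type of its own: its norm is not the `L²` norm). For `γ = 0` it is `H^s`. -/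
def WSob (γ : ℝ) (s : ℝ≥0) : Type := weighted γ s

instance (γ : ℝ) (s : ℝ≥0) : AddCommGroup (WSob γ s) :=
  inferInstanceAs (AddCommGroup (weighted γ s))

instance (γ : ℝ) (s : ℝ≥0) : Module ℂ (WSob γ s) :=
  inferInstanceAs (Module ℂ (weighted γ s))

/-- The inclusion `H^s_γ ⊆ L²`. -/
def WSob.toL2 {γ : ℝ} {s : ℝ≥0} : WSob γ s →ₗ[ℂ] L2 := (weighted γ s).subtype

/-- An element of `L²` which lies in `H^s_γ`, as an element of `H^s_γ`. -/
def WSob.mk {γ : ℝ} {s : ℝ≥0} (u : L2) (hu : u ∈ weighted γ s) : WSob γ s := ⟨u, hu⟩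

/-- The map `u ↦ (1 - Δ)^{s/2} (cosh(γ|x|) u)` from `H^s_γ` to `L²`. -/
def WSob.besselCosh (γ : ℝ) (s : ℝ≥0) : WSob γ s →ₗ[ℂ] L2 := bessel s ∘ₗ coshMul γ s

theorem WSob.besselCosh_injective (γ : ℝ) (s : ℝ≥0) :
    Function.Injective (WSob.besselCosh γ s) :=
  (bessel_injective s).comp (coshMul_injective γ s)

instance (γ : ℝ) (s : ℝ≥0) : NormedAddCommGroup (WSob γ s) :=
  NormedAddCommGroup.induced (WSob γ s) L2 (WSob.besselCosh γ s) (WSob.besselCosh_injective γ s)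

instance (γ : ℝ) (s : ℝ≥0) : NormedSpace ℂ (WSob γ s) :=
  NormedSpace.induced ℂ (WSob γ s) L2 (WSob.besselCosh γ s)

/-! ### The Schrödinger operator -/

theorem laplacian_exists (u : Hs 2) : ∃ f : L2,
    ((LineDeriv.laplacianCLM ℂ X 𝓢'(X, ℂ)).toLinearMap ∘ₗ toDistr (Hs 2)) u =
      (f : 𝓢'(X, ℂ)) := by
  have h : MemSobolev (2 - 2) 2 (Δ ((u : L2) : 𝓢'(X, ℂ))) := MemSobolev.laplacian u.2
  rw [sub_self, memSobolev_zero_iff] at h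
  obtain ⟨f, hf⟩ := h
  refine ⟨f, ?_⟩
  rw [← hf]
  exact TemperedDistribution.laplacianCLM_apply _

/-- `Δ : H² → L²`, the distributional Laplacian. -/
def laplacianL2 : Hs 2 →ₗ[ℂ] L2 :=
  liftL2 ((LineDeriv.laplacianCLM ℂ X 𝓢'(X, ℂ)).toLinearMap ∘ₗ toDistr (Hs 2)) laplacian_exists

theorem laplacianL2_spec (u : Hs 2) :
    Δ ((u : L2) : 𝓢'(X, ℂ)) = (laplacianL2 u : 𝓢'(X, ℂ)) := by
  rw [← TemperedDistribution.laplacianCLM_apply]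
  exact liftL2_spec _ laplacian_exists u

/-- The product of a Schwartz function and an `L²` function is an `L²` function. -/
theorem memLp_potential_mul (V : 𝓢(X, ℝ)) (u : L2) :
    MemLp (fun x => (V x : ℂ) * u x) 2 (volume : Measure X) := by
  obtain ⟨C, hC⟩ := V.decay 0 0
  refine MemLp.of_le_mul (c := C) (Lp.memLp u) ?_ (Eventually.of_forall fun x => ?_)
  · exact (Complex.continuous_ofReal.comp V.continuous).aestronglyMeasurable.mul
      (Lp.aestronglyMeasurable u)
  · have h := hC.2 x
    simp only [pow_zero, norm_iteratedFDeriv_zero, one_mul] at h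
    rw [norm_mul, Complex.norm_real]
    gcongr

/-- Multiplication by the potential `V` on `L²`. -/
def potential (V : 𝓢(X, ℝ)) : L2 →ₗ[ℂ] L2 where
  toFun u := (memLp_potential_mul V u).toLp _
  map_add' u v := by
    rw [← MemLp.toLp_add]
    apply MemLp.toLp_congr
    filter_upwards [Lp.coeFn_add u v] with x h
    simp only [h, Pi.add_apply, mul_add]
  map_smul' c u := by
    rw [RingHom.id_apply, ← MemLp.toLp_const_smul]
    apply MemLp.toLp_congr
    filter_upwards [Lp.coeFn_smul c u] with x h
    simp only [h, Pi.smul_apply, smul_eq_mul]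
    ring

/-- `H = -Δ + V` with domain `H²`. -/
def schrodinger (V : 𝓢(X, ℝ)) : Hs 2 →ₗ[ℂ] L2 :=
  -laplacianL2 + potential V ∘ₗ (Hs 2).subtype

/-- `H - lam : H² → L²`. -/
def shifted (V : 𝓢(X, ℝ)) (lam : ℂ) : Hs 2 →ₗ[ℂ] L2 :=
  schrodinger V - lam • (Hs 2).subtype

/-- The spectrum of (the closed operator) `H`. -/
def spectrumH (V : 𝓢(X, ℝ)) : Set ℂ := {lam | ¬ Function.Bijective (shifted V lam)}

/-- The eigenspace `ker (H - lam)`. -/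
def eigenspaceH (V : 𝓢(X, ℝ)) (lam : ℂ) : Submodule ℂ L2 :=
  (LinearMap.ker (shifted V lam)).map (Hs 2).subtype

/-- The discrete spectrum of the self-adjoint operator `H`: the isolated points of the spectrum
which are eigenvalues of finite multiplicity. -/
def discreteSpectrumH (V : 𝓢(X, ℝ)) : Set ℂ :=
  {lam | lam ∈ spectrumH V ∧ (∃ ε > 0, ∀ μ ∈ spectrumH V, dist μ lam < ε → μ = lam) ∧
    eigenspaceH V lam ≠ ⊥ ∧ FiniteDimensional ℂ (eigenspaceH V lam)}

open Classical in
/-- `(H - lam)⁻¹ f`, for `lam` outside the spectrum and `f ∈ L²` (and `0` if there is no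
solution `u ∈ H²` of `(H - lam) u = f`). -/
def resolventH (V : 𝓢(X, ℝ)) (lam : ℂ) (f : X → ℂ) : L2 :=
  if h : ∃ u : Hs 2, ∀ᵐ x, shifted V lam u x = f x then (h.choose : L2) else 0

/-! ### Resonant and nonresonant multi-indices -/

/-- Multi-indices `m ∈ ℤ^N`. -/
abbrev Idx (N : ℕ) : Type := Fin N → ℤ

section Indices

variable {N : ℕ}

/-- The standard basis vector `e_j`. -/
def stdIdx (j : Fin N) : Idx N := Pi.single j 1

/-- `|m| = (|m_1|, …, |m_N|)`. -/
def absIdx (m : Idx N) : Idx N := fun j => |m j|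

/-- `m · ω`. -/
def dotIdx (ω : Fin N → ℝ) (m : Idx N) : ℝ := ∑ j, (m j : ℝ) * ω j

/-- The set of the `e_j`. -/
def NR0 : Set (Idx N) := Set.range stdIdx

/-- The resonant indices. -/
def Res (ω : Fin N → ℝ) : Set (Idx N) := {m | ∑ j, m j = 1 ∧ 0 < dotIdx ω m}

/-- The nonresonant indices. -/
def NR (ω : Fin N → ℝ) : Set (Idx N) := {m | ∑ j, m j = 1 ∧ dotIdx ω m < 0}

/-- The minimal resonant indices (`<` is the strict part of the componentwise order). -/
def Rmin (ω : Fin N → ℝ) : Set (Idx N) :=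
  {m | m ∈ Res ω ∧ ¬ ∃ n ∈ Res ω, absIdx n < absIdx m}

/-- The nonresonant indices which are not larger than a minimal resonant index. -/
def NR1 (ω : Fin N → ℝ) : Set (Idx N) :=
  {m | m ∈ NR ω ∧ ∀ n ∈ Rmin ω, ¬ absIdx n < absIdx m}

/-- The set `A(k, m)` of `(2k+1)`-tuples `(m_1, …, m_{2k+1})` in `NR_1` with
`m_1 - m_2 + m_3 - ⋯ + m_{2k+1} = m` and `|m_1| + ⋯ + |m_{2k+1}| = |m|`. -/
def decomp (ω : Fin N → ℝ) (k : ℕ) (m : Idx N) : Set (Fin (2 * k + 1) → Idx N) :=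
  {p | (∀ i, p i ∈ NR1 ω) ∧ ∑ i : Fin (2 * k + 1), (-1 : ℤ) ^ (i : ℕ) • p i = m ∧ ∑ i, absIdx (p i) = absIdx m}

/-- `‖m‖ = ∑ |m_j|`. -/
def sizeIdx (m : Idx N) : ℕ := ∑ j, (m j).natAbs

theorem sizeIdx_pos (ω : Fin N → ℝ) {m : Idx N} (hm : m ∈ NR1 ω) : 0 < sizeIdx m := by
  by_contra h
  have h0 : ∀ j, m j = 0 := by
    simpa [sizeIdx, Finset.sum_eq_zero_iff] using h
  have h1 : ∑ j, m j = 1 := hm.1.1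
  simp [h0] at h1

/-- The members of a tuple in `A(k, m)`, `k ≥ 1`, are smaller than `m`. -/
theorem sizeIdx_lt (ω : Fin N → ℝ) {k : ℕ} {m : Idx N} {p : Fin (2 * (k + 1) + 1) → Idx N}
    (hp : p ∈ decomp ω (k + 1) m) (i : Fin (2 * (k + 1) + 1)) : sizeIdx (p i) < sizeIdx m := by
  obtain ⟨h1, -, h3⟩ := hp
  have hs : ∑ i, sizeIdx (p i) = sizeIdx m := by
    simp only [sizeIdx]
    rw [Finset.sum_comm]
    refine Finset.sum_congr rfl fun j _ => ?_
    have := congrFun h3 j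
    simp only [Finset.sum_apply, absIdx] at this
    zify
    exact this
  have hne : ∃ i', i' ≠ i := exists_ne i
  obtain ⟨i', hi'⟩ := hne
  rw [← hs]
  exact Finset.single_lt_sum (f := fun i => sizeIdx (p i)) hi' (Finset.mem_univ i) (Finset.mem_univ i')
    (sizeIdx_pos ω (h1 i')) (fun _ _ _ => Nat.zero_le _)

/-- `z^{(m)}`: the power `z^m` for `m ≥ 0`, and `(conj z)^{-m}` for `m < 0`. -/
def cpowIdx (z : ℂ) (m : ℤ) : ℂ :=
  if 0 ≤ m then z ^ m.toNat else (starRingEnd ℂ z) ^ (-m).toNat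

/-- The monomial `z^m = z_1^{(m_1)} ⋯ z_N^{(m_N)}`. -/
def monom (z : Fin N → ℂ) (m : Idx N) : ℂ := ∏ j, cpowIdx (z j) (m j)

/-- `|z|² = (|z_1|², …, |z_N|²)`. -/
def absSq (z : Fin N → ℂ) : Fin N → ℝ := fun j => ‖z j‖ ^ 2

/-- `‖z‖ = ∑ |z_j|`. -/
def norm1 {K : Type*} [Norm K] (z : Fin N → K) : ℝ := ∑ j, ‖z j‖

/-! ### The coefficients of the refined profile at the origin -/

open Classical in
/-- The functions `φ̃_m(0)`: `φ̃_{e_j}(0) = φ_j` and, for the other `m ∈ NR_1`, recursively,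
`φ̃_m(0) = -(H - m·ω)⁻¹ g_m(0)`, where
`g_m(0) = ∑_{k ≥ 1} g^{(k)}(0)/k! ∑_{(m_1, …, m_{2k+1}) ∈ A(k, m)} φ̃_{m_1}(0) ⋯ φ̃_{m_{2k+1}}(0)`.
All the sums are finite. -/
def phiTilde (V : 𝓢(X, ℝ)) (g : ℝ → ℝ) (ω : Fin N → ℝ) (φ : Fin N → L2) (m : Idx N) : L2 :=
  if h : ∃ j, m = stdIdx j then φ h.choose
  else -resolventH V (dotIdx ω m) (fun x => ∑ᶠ k : ℕ,
    ((iteratedDeriv (k + 1) g 0 / (Nat.factorial (k + 1) : ℝ) : ℝ) : ℂ) *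
      ∑ᶠ p : decomp ω (k + 1) m, ∏ i, phiTilde V g ω φ (p.1 i) x)
termination_by sizeIdx m
decreasing_by exact sizeIdx_lt ω p.2 i

/-- The functions `G_m`, `m ∈ R_min`. -/
def Gres (V : 𝓢(X, ℝ)) (g : ℝ → ℝ) (ω : Fin N → ℝ) (φ : Fin N → L2) (m : Idx N) (x : X) : ℂ :=
  ∑ᶠ k : ℕ, ((iteratedDeriv (k + 1) g 0 / (Nat.factorial (k + 1) : ℝ) : ℝ) : ℂ) *
    ∑ᶠ p : decomp ω (k + 1) m, ∏ i, phiTilde V g ω φ (p.1 i) x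

end Indices

/-! ### Solutions of the (forced) nonlinear Schrödinger equation -/

/-- `u` is a global strong solution of `i ∂ₜ u = H u + g(|u|²) u - F(t, x)`:
`u ∈ C(ℝ; H²) ∩ C¹(ℝ; L²)`, and the equation holds in `L²` for every `t`. -/
def IsForcedSolution (V : 𝓢(X, ℝ)) (g : ℝ → ℝ) (F : ℝ → X → ℂ) (u : ℝ → L2) : Prop :=
  (∃ v : ℝ → WSob 0 2, Continuous v ∧ ∀ t, WSob.toL2 (v t) = u t) ∧ ContDiff ℝ 1 u ∧
  ∀ t, ∃ h : u t ∈ Hs 2, ∀ᵐ x, Complex.I * deriv u t x =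
    schrodinger V ⟨u t, h⟩ x + (g (‖u t x‖ ^ 2) : ℂ) * u t x - F t x

/-- `u` is a global strong solution of `i ∂ₜ u = H u + g(|u|²) u`. -/
def IsSolution (V : 𝓢(X, ℝ)) (g : ℝ → ℝ) (u : ℝ → L2) : Prop :=
  IsForcedSolution V g (fun _ _ => 0) u

/-! ### Refined profiles -/

section Profile

variable {N : ℕ} {γ : ℝ}

/-- The data of a refined profile, for every regularity index `s ≥ 0`. -/
structure ProfileData (N : ℕ) (γ : ℝ) where
  /-- the radius `δ_s` -/
  δ : ℝ≥0 → ℝ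
  /-- the constant `C_s` -/
  C : ℝ≥0 → ℝ
  /-- the corrections `ψ_m` (only `m ∈ NR_1` matters) -/
  ψ : (s : ℝ≥0) → Idx N → (Fin N → ℝ) → WSob γ s
  /-- the frequencies `ϖ = (ϖ_1, …, ϖ_N)` -/
  ϖ : ℝ≥0 → (Fin N → ℝ) → Fin N → ℝ
  /-- the remainder `𝓡` -/
  R : (s : ℝ≥0) → (Fin N → ℂ) → WSob γ s

/-- The profile `φ(z) = z·φ + ∑_{m ∈ NR_1} z^m ψ_m(|z|²)` (a finite sum), in `H^s_γ`. -/
def ProfileData.profile (P : ProfileData N γ) (ω : Fin N → ℝ) {φ : Fin N → L2}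
    (hφ : ∀ (s : ℝ≥0) (j : Fin N), φ j ∈ weighted γ s) (s : ℝ≥0) (z : Fin N → ℂ) : WSob γ s :=
  ∑ j, z j • WSob.mk (φ j) (hφ s j) + ∑ᶠ m : NR1 ω, monom z m.1 • P.ψ s m.1 (absSq z)

/-- The evolution `z_j(t) = e^{-i ϖ_j(|z|²) t} z_j`. -/
def ProfileData.flow (P : ProfileData N γ) (s : ℝ≥0) (z : Fin N → ℂ) (t : ℝ) : Fin N → ℂ :=
  fun j => Complex.exp (-Complex.I * (P.ϖ s (absSq z) j : ℂ) * (t : ℂ)) * z j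

/-- `P` is a refined profile. -/
structure IsRefinedProfile (V : 𝓢(X, ℝ)) (g : ℝ → ℝ) (ω : Fin N → ℝ) {φ : Fin N → L2}
    (hφ : ∀ (s : ℝ≥0) (j : Fin N), φ j ∈ weighted γ s) (P : ProfileData N γ) : Prop where
  δ_pos : ∀ s, 0 < P.δ s
  C_pos : ∀ s, 0 < P.C s
  δ_anti : Antitone P.δ
  ψ_smooth : ∀ s, ∀ m ∈ NR1 ω, ContDiffOn ℝ (⊤ : ℕ∞) (P.ψ s m) {w | norm1 w < P.δ s ^ 2}
  ϖ_smooth : ∀ s, ContDiffOn ℝ (⊤ : ℕ∞) (P.ϖ s) {w | norm1 w < P.δ s ^ 2}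
  R_smooth : ∀ s, ContDiffOn ℝ (⊤ : ℕ∞) (P.R s) {z | norm1 z < P.δ s}
  ϖ_zero : ∀ s, P.ϖ s 0 = ω
  /-- `ψ_{e_j}(0) = 0` -/
  ψ_zero : ∀ s, ∀ m ∈ NR0, P.ψ s m 0 = 0
  /-- `ψ_m(0) = φ̃_m(0)` for the other indices -/
  ψ_init : ∀ s, ∀ m ∈ NR1 ω \ NR0, WSob.toL2 (P.ψ s m 0) = phiTilde V g ω φ m
  /-- `‖𝓡(z)‖ ≤ C_s ‖z‖² ∑_{m ∈ R_min} |z^m|` (a finite sum) -/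
  R_bound : ∀ s z, norm1 z < P.δ s →
    ‖P.R s z‖ ≤ P.C s * norm1 z ^ 2 * ∑ᶠ m : Rmin ω, ‖monom z m.1‖
  /-- the functions `G_m` lie in `H^s_γ` for all `s` -/
  G_mem : ∀ m ∈ Rmin ω, ∀ s, ∃ G ∈ weighted γ s, ∀ᵐ x, G x = Gres V g ω φ m x
  /-- `u(t) = φ(z(t))` solves
  `i ∂ₜ u = H u + g(|u|²) u - ∑_{m ∈ R_min} z(t)^m G_m - 𝓡(z(t))` -/
  solves : ∀ s z, norm1 z < P.δ s →
    IsForcedSolution V g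
      (fun t x => ∑ᶠ m : Rmin ω, monom (P.flow s z t) m.1 * Gres V g ω φ m.1 x +
        WSob.toL2 (P.R s (P.flow s z t)) x)
      (fun t => WSob.toL2 (P.profile ω hφ s (P.flow s z t)))
  /-- the objects for `s₁ < s₂` agree on the smaller ball -/
  compat : ∀ s₁ s₂ : ℝ≥0, s₁ < s₂ → ∀ z, norm1 z < P.δ s₂ →
    (∀ m ∈ NR1 ω, WSob.toL2 (P.ψ s₁ m (absSq z)) = WSob.toL2 (P.ψ s₂ m (absSq z))) ∧
    P.ϖ s₁ (absSq z) = P.ϖ s₂ (absSq z) ∧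
    WSob.toL2 (P.R s₁ z) = WSob.toL2 (P.R s₂ z)

end Profile

end NLS

end

/-!
Along an axis `ℂ e_j` all the monomials `z^m` with `m` resonant vanish: an index of sum `1` which is
supported at `j` is `e_j`, and `e_j·ω = ω_j < 0`. Hence the forcing term and the remainder of a
refined profile vanish there (`IsRefinedProfile.R_single`), only the monomial `z_j` survives in the
profile, and the standing waves and their bifurcation can be read off from the definition. The work
lies in the existence of refined profiles.

**The equations of the profile.** Write `I` for the finite set `NR₁` (`finite_NR1`), `w` for `|z|²`,
and `u = ∑_{m ∈ I} z^m Φ_m(w)` with real functions `Φ_m`. The diagonal part of `|u|²` is a function of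
`w`; the off-diagonal part is small, being a sum of products of two different monomials. The Taylor
expansion of `g(|u|²) u` at the diagonal part is a sum of terms `z^m g_m(w, Φ)` (`gCoeff`,
`taylor_eq_sum_gCoeff`). So `u(t)` solves the equation up to the forcing term and the remainder if
`H Φ_m = (m·ϖ) Φ_m - g_m(w, Φ)` for all `m ∈ I` (`isForcedSolution_sum`). For `m ≠ e_j` the
operator `H - m·ω` is invertible, by the nonresonance of `ω` (`eigenspaceH_eq_bot`); for `m = e_j`
its kernel is spanned by `φ_j`, and the equation is solvable if the shift of the frequency is
`ϖ_j - ω_j = ⟨φ_j, g_{e_j}⟩` and `Φ_{e_j}` is normalized by `⟨φ_j, Φ_{e_j}⟩ = 1`. Thus the equations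
are those of a fixed point of `profileMap` (`schrodinger_of_profileMap`).

**Solving them.** At `w = 0` only products of monomials without cancellation contribute to `g_m`, so
that `g_m(0, Φ)` depends only on the `Φ_n` with `n` smaller than `m` (`gCoeff_zero_congr`). The fixed
point at `w = 0` is therefore obtained by a recursion, which is the one defining `φ̃_m(0)`
(`exists_phiTilde`), and the linearization of `Φ - profileMap(Φ)` is `1` minus a nilpotent operator
(`isUnit_fderiv_of_triangular`). The implicit function theorem (`exists_implicit_function`) gives
smooth solutions near `w = 0`, and by its uniqueness part the solutions of all regularities agree
(`exists_profile_family`).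

**The remainder.** A monomial outside `I ∪ R_min` which occurs in the expansion lies strictly above
some `n ∈ R_min` (`exists_Rmin_lt`), and as the sizes of all indices of sum `1` are odd, it is smaller
than `|z^n|` by a factor `‖z‖²` (`norm_monom_le_of_lt`). Taylor's remainder is a high power of the
products `|z_i| |z_j|`, `i ≠ j`; these powers are dominated by the resonant monomials with indices
`(A+1) e_j - A e_i` (`exists_crossSum_pow_le`). This proves `exists_remainder_le`.

**Function spaces.** The fixed point problem is posed in the Banach spaces `RegSpace W k` of real
functions whose derivatives of order at most `k`, multiplied by the weight `W(x) = ∏ cosh(a x_j)`, are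
bounded and square integrable. They embed into the spaces `H^s_γ` for `γ < a`, `s ≤ k` (`toWSob`), and
superposition operators are smooth on them (`contDiff_nem`). Conjugation by the weight with a small
rate `a` perturbs the free resolvent by an operator of norm less than one; this gives the decay and
the regularity of the solutions of `(H - λ) u = f` for `λ < 0` (`exists_reg_of_shifted`). As
finitely many `λ = m·ω` occur, one rate `a` serves all of them, for every `g`. On `L²` the
equations are solved by a reduced resolvent (`exists_reducedResolvent`), from the compactness of
`V (-Δ + κ²)⁻¹` and the Fredholm alternative.
-/


section

open scoped LineDeriv ContDiff ENNReal

noncomputable section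

namespace NLS

/-! ### Tempered distributions, Sobolev regularity and smooth multipliers -/

/-- The standard basis vectors of `ℝ³`. -/
def bvec (j : Fin 3) : X := EuclideanSpace.basisFun (Fin 3) ℝ j

/-- Tempered distributions on `ℝ³`. -/
abbrev Distr : Type := 𝓢'(X, ℂ)

/-- An `L²` function as a tempered distribution. -/
abbrev L2.toD (u : L2) : Distr := (u : 𝓢'(X, ℂ))

theorem L2.toD_add (u v : L2) : (u + v).toD = u.toD + v.toD :=
  map_add (Lp.toTemperedDistributionCLM ℂ (volume : Measure X) 2) u v

theorem L2.toD_sub (u v : L2) : (u - v).toD = u.toD - v.toD :=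
  map_sub (Lp.toTemperedDistributionCLM ℂ (volume : Measure X) 2) u v

theorem L2.toD_smul (c : ℂ) (u : L2) : (c • u).toD = c • u.toD :=
  map_smul (Lp.toTemperedDistributionCLM ℂ (volume : Measure X) 2) c u

theorem L2.continuous_toD : Continuous L2.toD :=
  (Lp.toTemperedDistributionCLM ℂ (volume : Measure X) 2).continuous

theorem L2.toD_inj {u v : L2} (h : u.toD = v.toD) : u = v := toDistr_injective h

theorem L2.toD_sum {ι : Type*} (s : Finset ι) (u : ι → L2) :
    (∑ i ∈ s, u i).toD = ∑ i ∈ s, (u i).toD :=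
  map_sum (Lp.toTemperedDistributionCLM ℂ (volume : Measure X) 2) u s

theorem laplacian_eq_sum_bvec (f : Distr) : Δ f = ∑ j, ∂_{bvec j} (∂_{bvec j} f) :=
  TemperedDistribution.laplacian_eq_sum (EuclideanSpace.basisFun (Fin 3) ℝ) f

theorem fourierMultiplier_add {g₁ g₂ : X → ℂ} (h₁ : g₁.HasTemperateGrowth)
    (h₂ : g₂.HasTemperateGrowth) (f : Distr) :
    fourierMultiplierCLM ℂ (g₁ + g₂) f =
      fourierMultiplierCLM ℂ g₁ f + fourierMultiplierCLM ℂ g₂ f := by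
  simp only [fourierMultiplierCLM_apply, smulLeftCLM_add h₁ h₂]
  simp [FourierTransform.fourierInv_add]

theorem besselPotential_two (f : Distr) :
    besselPotential X ℂ 2 f = f - ((2 * Real.pi) ^ 2 : ℝ)⁻¹ • Δ f := by
  have h1 : (fun x : X ↦ (((1 + ‖x‖ ^ 2) ^ ((2 : ℝ) / 2) : ℝ) : ℂ)) =
      (fun _ : X => (1 : ℂ)) + fun x : X ↦ Complex.ofReal (‖x‖ ^ 2) := by
    ext x; simp
  rw [besselPotential, h1, fourierMultiplier_add (by fun_prop) (by fun_prop),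
    laplacian_eq_fourierMultiplierCLM, fourierMultiplierCLM_const, smul_smul]
  simp only [one_smul, ContinuousLinearMap.coe_id', id]
  rw [show ((2 * Real.pi) ^ 2 : ℝ)⁻¹ * -(2 * Real.pi) ^ 2 = -1 by
    field_simp]
  simp

theorem memSobolev_sum {ι : Type*} {t : ℝ} (s : Finset ι) (f : ι → Distr)
    (h : ∀ i ∈ s, MemSobolev t 2 (f i)) : MemSobolev t 2 (∑ i ∈ s, f i) := by
  classical
  induction s using Finset.induction_on with
  | empty => simp
  | insert a s ha ih =>
    rw [Finset.sum_insert ha]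
    exact (h a (by simp)).add (ih fun i hi => h i (by simp [hi]))

theorem MemSobolev.real_smul {t : ℝ} {f : Distr} (h : MemSobolev t 2 f) (c : ℝ) :
    MemSobolev t 2 (c • f) := by
  have := h.smul (c : ℂ)
  rwa [Complex.coe_smul] at this

/-- A distribution in `H^s` whose partial derivatives are in `H^s` belongs to `H^{s+1}`. -/
theorem memSobolev_succ {s : ℝ} {f : Distr} (hf : MemSobolev s 2 f)
    (hd : ∀ j, MemSobolev s 2 (∂_{bvec j} f)) : MemSobolev (s + 1) 2 f := by
  have h : MemSobolev (s - 1) 2 (besselPotential X ℂ 2 f) := by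
    rw [besselPotential_two]
    refine (hf.mono (by linarith)).sub (MemSobolev.real_smul ?_ _)
    rw [laplacian_eq_sum_bvec]
    exact memSobolev_sum _ _ fun j _ => (hd j).lineDerivOp
  rw [memSobolev_besselPotential_iff] at h
  convert h using 1; ring

/-- Smooth functions all of whose derivatives are bounded. -/
def BddSmooth (b : X → ℂ) : Prop :=
  ContDiff ℝ ∞ b ∧ ∀ n : ℕ, ∃ C, ∀ x, ‖iteratedFDeriv ℝ n b x‖ ≤ C

theorem BddSmooth.temperate {b : X → ℂ} (hb : BddSmooth b) : b.HasTemperateGrowth :=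
  ⟨hb.1, fun n => ⟨0, by simpa using hb.2 n⟩⟩

theorem BddSmooth.bdd {b : X → ℂ} (hb : BddSmooth b) : ∃ C, ∀ x, ‖b x‖ ≤ C := by
  obtain ⟨C, hC⟩ := hb.2 0
  exact ⟨C, fun x => by simpa using hC x⟩

theorem BddSmooth.differentiable {b : X → ℂ} (hb : BddSmooth b) : Differentiable ℝ b :=
  hb.1.differentiable (by simp)

theorem BddSmooth.deriv {b : X → ℂ} (hb : BddSmooth b) (m : X) :
    BddSmooth (fun x => fderiv ℝ b x m) := by
  have h1 : ContDiff ℝ ∞ (fderiv ℝ b) := hb.1.fderiv_right (by simp)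
  refine ⟨h1.clm_apply contDiff_const, fun n => ?_⟩
  obtain ⟨C, hC⟩ := hb.2 (n + 1)
  refine ⟨‖m‖ * C, fun x => ?_⟩
  have h2 := norm_iteratedFDeriv_clm_apply_const (f := fderiv ℝ b) (c := m) (x := x) (n := n)
    (N := ∞) h1.contDiffAt (by exact_mod_cast le_top)
  refine h2.trans ?_
  rw [norm_iteratedFDeriv_fderiv]
  gcongr
  exact hC x

theorem BddSmooth.mul {b c : X → ℂ} (hb : BddSmooth b) (hc : BddSmooth c) :
    BddSmooth (fun x => b x * c x) := by
  refine ⟨hb.1.mul hc.1, fun n => ?_⟩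
  choose B hB using hb.2
  choose D hD using hc.2
  refine ⟨∑ i ∈ Finset.range (n + 1), (n.choose i : ℝ) * B i * D (n - i), fun x => ?_⟩
  refine (norm_iteratedFDeriv_mul_le (N := ∞) hb.1 hc.1 x (by exact_mod_cast le_top)).trans ?_
  refine Finset.sum_le_sum fun i _ => ?_
  have h1 := (norm_nonneg _).trans (hB i x)
  gcongr
  · exact hB i x
  · exact hD _ x

theorem BddSmooth.const (c : ℂ) : BddSmooth (fun _ => c) := by
  refine ⟨contDiff_const, fun n => ?_⟩
  rcases Nat.eq_zero_or_pos n with rfl | hn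
  · exact ⟨‖c‖, fun x => by simp⟩
  · exact ⟨0, fun x => by simp [iteratedFDeriv_const_of_ne hn.ne']⟩

theorem BddSmooth.prod {ι : Type*} (s : Finset ι) {b : ι → X → ℂ} (hb : ∀ i ∈ s, BddSmooth (b i)) :
    BddSmooth (fun x => ∏ i ∈ s, b i x) := by
  classical
  induction s using Finset.induction_on with
  | empty => simpa using BddSmooth.const 1
  | insert a s ha ih =>
    simp only [Finset.prod_insert ha]
    exact (hb a (by simp)).mul (ih fun i hi => hb i (by simp [hi]))

/-- The Leibniz rule for a smooth multiple of a tempered distribution. -/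
theorem lineDeriv_smulLeft {b : X → ℂ} (hb : BddSmooth b) (m : X) (f : Distr) :
    ∂_{m} (smulLeftCLM ℂ b f) =
      smulLeftCLM ℂ b (∂_{m} f) + smulLeftCLM ℂ (fun x => fderiv ℝ b x m) f := by
  ext η
  have key : SchwartzMap.smulLeftCLM ℂ b (-∂_{m} η) =
      -∂_{m} (SchwartzMap.smulLeftCLM ℂ b η) +
        SchwartzMap.smulLeftCLM ℂ (fun x => fderiv ℝ b x m) η := by
    ext x
    have h1 : ∂_{m} (SchwartzMap.smulLeftCLM ℂ b η) x =
        b x * ∂_{m} η x + fderiv ℝ b x m * η x := by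
      rw [SchwartzMap.lineDerivOp_apply_eq_fderiv, SchwartzMap.lineDerivOp_apply_eq_fderiv]
      have h2 : ⇑(SchwartzMap.smulLeftCLM ℂ b η) = fun x => b x * η x := by
        ext y; simp [hb.temperate]
      rw [h2, fderiv_fun_mul hb.differentiable.differentiableAt η.differentiableAt]
      simp [mul_comm]
    simp only [add_apply, neg_apply, h1,
      SchwartzMap.smulLeftCLM_apply_apply hb.temperate,
      SchwartzMap.smulLeftCLM_apply_apply (hb.deriv m).temperate, smul_eq_mul]
    ring
  simp only [lineDerivOp_apply_apply, smulLeftCLM_apply_apply, key, map_add]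
  rfl

/-- Multiplication of an `L²` function by a bounded function is in `L²`. -/
theorem memLp_bdd_mul {b : X → ℂ} (hb : Continuous b) (hC : ∃ C, ∀ x, ‖b x‖ ≤ C) (u : L2) :
    MemLp (fun x => b x * u x) 2 (volume : Measure X) := by
  obtain ⟨C, hC⟩ := hC
  refine MemLp.of_le_mul (c := C) (Lp.memLp u) ?_ (Eventually.of_forall fun x => ?_)
  · exact hb.aestronglyMeasurable.mul (Lp.aestronglyMeasurable u)
  · rw [norm_mul]; gcongr; exact hC x

theorem toD_ext {f : X → ℂ} (hf : MemLp f 2 (volume : Measure X)) (η : 𝓢(X, ℂ)) :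
    L2.toD (hf.toLp f) η = ∫ x, η x * f x := by
  rw [L2.toD, Lp.toTemperedDistribution_apply]
  apply integral_congr_ae
  filter_upwards [hf.coeFn_toLp] with x hx
  rw [hx, smul_eq_mul]

theorem smulLeft_toD {b : X → ℂ} (hb : BddSmooth b) (u : L2) :
    smulLeftCLM ℂ b u.toD = L2.toD ((memLp_bdd_mul hb.1.continuous hb.bdd u).toLp _) := by
  ext η
  rw [toD_ext, smulLeftCLM_apply_apply, L2.toD, Lp.toTemperedDistribution_apply]
  apply integral_congr_ae
  filter_upwards with x
  rw [SchwartzMap.smulLeftCLM_apply_apply hb.temperate]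
  simp only [smul_eq_mul]; ring

/-- Multiplication by a smooth function with bounded derivatives preserves `H^k`. -/
theorem memSobolev_smulLeft (k : ℕ) : ∀ {b : X → ℂ} (_ : BddSmooth b) {f : Distr}
    (_ : MemSobolev k 2 f), MemSobolev k 2 (smulLeftCLM ℂ b f) := by
  induction k with
  | zero =>
    intro b hb f hf
    rw [Nat.cast_zero, memSobolev_zero_iff] at hf ⊢
    obtain ⟨u, rfl⟩ := hf
    exact ⟨_, smulLeft_toD hb u⟩
  | succ k ih =>
    intro b hb f hf
    push_cast at hf ⊢
    refine memSobolev_succ (ih hb (hf.mono (by linarith))) fun j => ?_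
    rw [lineDeriv_smulLeft hb]
    have h1 : MemSobolev (k : ℝ) 2 (∂_{bvec j} f) := by
      have := hf.lineDerivOp (m := bvec j)
      rwa [add_sub_cancel_right] at this
    exact (ih hb h1).add (ih (hb.deriv _) (hf.mono (by linarith)))

/-- A form of the closed graph theorem: continuity of a linear map between Banach spaces can be
tested after an injective continuous map into any Hausdorff space. -/
theorem continuous_of_comp_injective {𝕜 E F G : Type*} [NontriviallyNormedField 𝕜]
    [NormedAddCommGroup E] [NormedSpace 𝕜 E] [CompleteSpace E]
    [NormedAddCommGroup F] [NormedSpace 𝕜 F] [CompleteSpace F] [TopologicalSpace G] [T2Space G]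
    (T : E →ₗ[𝕜] F) (j : F → G) (hj : Continuous j) (hinj : Function.Injective j)
    (h : Continuous fun x => j (T x)) : Continuous T := by
  apply LinearMap.continuous_of_isClosed_graph
  have : (T.graph : Set (E × F)) = {p | j p.2 = j (T p.1)} := by
    ext p
    simp [LinearMap.mem_graph_iff, hinj.eq_iff]
  rw [this]
  exact isClosed_eq (hj.comp continuous_snd) (h.comp continuous_fst)

end NLS

end

noncomputable section

namespace NLS

/-! ### Representation of distributions by functions -/

/-- Locally integrable functions are determined by their integrals against Schwartz functions. -/
theorem ae_eq_of_schwartz {f g : X → ℂ} (hf : LocallyIntegrable f) (hg : LocallyIntegrable g)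
    (h : ∀ η : 𝓢(X, ℂ), ∫ x, η x * f x = ∫ x, η x * g x) : f =ᵐ[volume] g := by
  refine ae_eq_of_integral_contDiff_smul_eq hf hg fun η h1 h2 => ?_
  have hg₁ : HasCompactSupport (Complex.ofRealCLM ∘ η) := h2.comp_left rfl
  have hg₂ : ContDiff ℝ ∞ (Complex.ofRealCLM ∘ η) := by fun_prop
  have := h (hg₁.toSchwartzMap hg₂)
  simpa using this

theorem ae_eq_of_toD {u : L2} {f : X → ℂ} (hf : LocallyIntegrable f)
    (h : ∀ η : 𝓢(X, ℂ), u.toD η = ∫ x, η x * f x) : u =ᵐ[volume] f := by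
  refine ae_eq_of_schwartz ((Lp.memLp u).locallyIntegrable (by norm_num)) hf fun η => ?_
  rw [← h, L2.toD, Lp.toTemperedDistribution_apply]
  rfl

theorem Lp1_toD_apply (v : Lp ℂ 1 (volume : Measure X)) (η : 𝓢(X, ℂ)) :
    (v : Distr) η = ∫ x, η x * v x := Lp.toTemperedDistribution_apply v η

open FourierTransform in
/-- The distributional inverse Fourier transform of an integrable function is its inverse Fourier
integral. -/
theorem fourierInv_Lp1_apply (v : Lp ℂ 1 (volume : Measure X)) (η : 𝓢(X, ℂ)) :
    (𝓕⁻ (v : Distr)) η = ∫ x, η x * Real.Lp.fourierTransformInv v x := by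
  rw [TemperedDistribution.fourierInv_apply, Lp1_toD_apply]
  have hv : Integrable (v : X → ℂ) := L1.integrable_coeFn v
  have h := VectorFourier.integral_fourierIntegral_smul_eq_flip (e := Real.fourierChar)
    (μ := (volume : Measure X)) (ν := (volume : Measure X)) (L := -innerₗ X)
    (f := η) (g := v)
    Real.continuous_fourierChar (by simp only [LinearMap.neg_apply]; exact continuous_inner.neg) η.integrable hv
  have e1 : ∀ ξ, (𝓕⁻ η) ξ = VectorFourier.fourierIntegral Real.fourierChar volume (-innerₗ X) η ξ := by
    intro ξ
    rw [SchwartzMap.fourierInv_coe, Real.fourierInv_eq]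
    simp [VectorFourier.fourierIntegral]
  have e2 : ∀ x, Real.Lp.fourierTransformInv v x =
      VectorFourier.fourierIntegral Real.fourierChar volume ((-innerₗ X).flip) v x := by
    intro x
    rw [Real.Lp.fourierTransformInv_apply, Real.fourierInv_eq]
    simp [VectorFourier.fourierIntegral, LinearMap.flip_apply, real_inner_comm]
  simp only [e1, e2, smul_eq_mul] at h ⊢
  exact h

/-- An element of `H²` is represented by the inverse Fourier transform of an integrable function;
in particular it has a bounded continuous representative. -/
theorem exists_fourier_repr {u : L2} (hu : u ∈ Hs 2) :
    ∃ v : Lp ℂ 1 (volume : Measure X), FourierTransform.fourier u.toD = (v : Distr) ∧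
      u =ᵐ[volume] Real.Lp.fourierTransformInv v := by
  obtain ⟨v, hv⟩ := MemSobolev.fourier_memL1 (E := X) (F := ℂ) (s := 2)
    (by simp; norm_num) (f := u.toD) hu
  refine ⟨v, hv, ae_eq_of_toD ?_ fun η => ?_⟩
  · exact (Real.Lp.fourierTransformInv v).continuous.locallyIntegrable
  · rw [← fourierInv_Lp1_apply, ← hv, FourierTransform.fourierInv_fourier_eq]

theorem mem_Hs_mono {s t : ℝ} (h : s ≤ t) {u : L2} (hu : u ∈ Hs t) : u ∈ Hs s :=
  MemSobolev.mono h hu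

/-- If `u ∈ H²` and its partial derivatives are in `H²`, the continuous representative of `u` is
differentiable, and its partial derivatives are the continuous representatives of the
distributional ones. -/
theorem exists_hasFDerivAt_repr {u : L2} (hu : u ∈ Hs 2) {w : Fin 3 → L2} (hw : ∀ j, w j ∈ Hs 2)
    (hd : ∀ j, ∂_{bvec j} u.toD = (w j).toD) {f : X → ℂ} (hf : Continuous f)
    (hfu : u =ᵐ[volume] f) {h : Fin 3 → X → ℂ} (hh : ∀ j, Continuous (h j))
    (hhw : ∀ j, w j =ᵐ[volume] h j) :
    Differentiable ℝ f ∧ ∀ j x, fderiv ℝ f x (bvec j) = h j x := by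
  obtain ⟨v, hv, hvu⟩ := exists_fourier_repr hu
  choose V hV hVu using fun j => exists_fourier_repr (hw j)
  have hvint : Integrable (v : X → ℂ) := L1.integrable_coeFn v
  -- the Fourier transform of `w_j = ∂_j u` is `2πi ξ_j v`
  have hVv : ∀ j, V j =ᵐ[volume] fun ξ => (2 * Real.pi * Complex.I) * (inner ℝ ξ (bvec j) * v ξ) := by
    intro j
    refine ae_eq_of_schwartz (L1.integrable_coeFn (V j)).locallyIntegrable ?_ fun η => ?_
    · have h1 : LocallyIntegrable (fun ξ : X => v ξ) := hvint.locallyIntegrable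
      have hc : Continuous fun ξ : X => (2 * Real.pi * Complex.I) * (inner ℝ ξ (bvec j) : ℂ) := by
        fun_prop
      have := (locallyIntegrableOn_univ.2 h1).continuousOn_mul hc.continuousOn
        isOpen_univ.isLocallyClosed
      rw [locallyIntegrableOn_univ] at this
      refine this.congr ?_
      filter_upwards with ξ
      ring
    · rw [← Lp1_toD_apply, ← hV, ← hd, fourier_lineDerivOp_eq, hv]
      have ht : (fun x : X => ((inner ℝ x (bvec j) : ℝ) : ℂ)).HasTemperateGrowth := by fun_prop
      rw [smul_apply, smulLeftCLM_apply_apply, Lp1_toD_apply, smul_eq_mul, ← integral_const_mul]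
      congr 1; ext ξ
      rw [SchwartzMap.smulLeftCLM_apply_apply ht]
      simp only [smul_eq_mul]; ring
  have hf' : f = Real.Lp.fourierTransformInv v :=
    Measure.eq_of_ae_eq (hfu.symm.trans hvu) hf (Real.Lp.fourierTransformInv v).continuous
  have hh' : ∀ j, h j = Real.Lp.fourierTransformInv (V j) := fun j =>
    Measure.eq_of_ae_eq ((hhw j).symm.trans (hVu j)) (hh j)
      (Real.Lp.fourierTransformInv (V j)).continuous
  -- hence `|ξ| v` is integrable, and one may differentiate under the Fourier integral
  have hxv : Integrable (fun ξ : X => ‖ξ‖ * ‖v ξ‖) := by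
    have h1 : Integrable (fun ξ : X => ∑ j, ‖V j ξ‖) :=
      integrable_finsetSum _ fun j _ => (L1.integrable_coeFn (V j)).norm
    refine h1.mono' (by fun_prop) ?_
    filter_upwards [hVv 0, hVv 1, hVv 2] with ξ h0 h1 h2
    have hb : ∀ j, inner ℝ ξ (bvec j) = ξ j := fun j => by
      simp [bvec, EuclideanSpace.inner_single_right]
    simp only [Fin.sum_univ_three, h0, h1, h2, norm_mul, hb, Complex.norm_real, Real.norm_eq_abs,
      Complex.norm_I, Complex.norm_ofNat, mul_one, abs_of_pos Real.pi_pos, abs_norm]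
    have hx : ‖ξ‖ ≤ |ξ 0| + |ξ 1| + |ξ 2| := by
      rw [EuclideanSpace.norm_eq, Real.sqrt_le_left (by positivity)]
      simp only [Fin.sum_univ_three, Real.norm_eq_abs]
      nlinarith [abs_nonneg (ξ 0), abs_nonneg (ξ 1), abs_nonneg (ξ 2),
        mul_nonneg (abs_nonneg (ξ 0)) (abs_nonneg (ξ 1)),
        mul_nonneg (abs_nonneg (ξ 0)) (abs_nonneg (ξ 2)),
        mul_nonneg (abs_nonneg (ξ 1)) (abs_nonneg (ξ 2))]
    have hpi : 1 ≤ 2 * Real.pi := by linarith [Real.pi_gt_three]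
    have h3 : ‖ξ‖ * ‖v ξ‖ ≤ (|ξ 0| + |ξ 1| + |ξ 2|) * ‖v ξ‖ := by gcongr
    have h4 : 0 ≤ (|ξ 0| + |ξ 1| + |ξ 2|) * ‖v ξ‖ := by positivity
    nlinarith
  have hder : ∀ x, HasFDerivAt f
      (-(FourierTransform.fourier (VectorFourier.fourierSMulRight (innerSL ℝ) (v : X → ℂ)) (-x))) x := by
    intro x
    have h1 := Real.hasFDerivAt_fourier hvint hxv (-x)
    have h2 := h1.comp x (hasFDerivAt_id x).neg
    have h3 : f = FourierTransform.fourier (v : X → ℂ) ∘ fun y => -y := by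
      rw [hf']; ext y
      rw [Real.Lp.fourierTransformInv_apply, Real.fourierInv_eq_fourier_neg]; rfl
    rw [h3]
    exact h2.congr_fderiv (by ext y; simp)
  refine ⟨fun x => (hder x).differentiableAt, fun j x => ?_⟩
  have hint : Integrable (VectorFourier.fourierSMulRight (innerSL ℝ) (v : X → ℂ)) := by
    refine (hxv.const_mul (2 * Real.pi * ‖innerSL ℝ (E := X)‖)).mono' ?_ ?_
    · exact hvint.1.fourierSMulRight
    · filter_upwards with ξ
      exact (VectorFourier.norm_fourierSMulRight_le _ _ _).trans (by rw [mul_assoc])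
  rw [(hder x).fderiv, hh', Real.Lp.fourierTransformInv_apply, Real.fourierInv_eq_fourier_neg,
    neg_apply, Real.fourier_continuousLinearMap_apply hint]
  have h4 : (fun y : X => VectorFourier.fourierSMulRight (innerSL ℝ) (v : X → ℂ) y (bvec j)) =ᵐ[volume]
      fun y => (-1 : ℂ) * V j y := by
    filter_upwards [hVv j] with y hy
    rw [hy, VectorFourier.fourierSMulRight_apply, innerSL_apply_apply]
    simp only [Complex.real_smul, smul_eq_mul]
    ring
  rw [Real.fourier_congr_ae h4, Real.fourier_eq, Real.fourier_eq, ← integral_neg]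
  congr 1; ext y
  simp [Circle.smul_def]

/-! ### The free resolvent -/

/-- An operator on tempered distributions which preserves `L²` is bounded on `L²`: its graph is
closed, since `L²` embeds continuously into the distributions. -/
theorem exists_clm_lift (Q : Distr →L[ℂ] Distr) (h : ∀ u : L2, ∃ w : L2, Q u.toD = w.toD) :
    ∃ T : L2 →L[ℂ] L2, ∀ u, (T u).toD = Q u.toD := by
  choose T hT using h
  let T' : L2 →ₗ[ℂ] L2 :=
    { toFun := T
      map_add' := fun u v => L2.toD_inj (by
        rw [← hT, L2.toD_add, map_add, L2.toD_add, hT, hT])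
      map_smul' := fun c u => L2.toD_inj (by
        rw [← hT, L2.toD_smul, map_smul, RingHom.id_apply, L2.toD_smul, hT]) }
  have hc : Continuous T' := by
    refine continuous_of_comp_injective T' L2.toD L2.continuous_toD (fun _ _ => L2.toD_inj) ?_
    have : (fun u => (T' u).toD) = fun u => Q u.toD := by ext1 u; exact (hT u).symm
    rw [this]
    exact Q.continuous.comp L2.continuous_toD
  exact ⟨⟨T', hc⟩, fun u => (hT u).symm⟩

/-- The symbol `(κ² + 4π²|ξ|²)⁻¹` of `(-Δ + κ²)⁻¹`. -/
def resSymbol (κ : ℝ) (ξ : X) : ℝ := (κ ^ 2 + (2 * Real.pi) ^ 2 * ‖ξ‖ ^ 2)⁻¹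

theorem resSymbol_temperate {κ : ℝ} (hκ : 0 < κ) :
    (fun ξ => (resSymbol κ ξ : ℂ)).HasTemperateGrowth := by
  have h1 : (fun ξ : X => (resSymbol κ ξ : ℂ)) = fun ξ : X =>
      (((κ ^ 2)⁻¹ : ℝ) : ℂ) * (((1 + ‖(2 * Real.pi / κ) • ξ‖ ^ 2) ^ (-1 : ℝ) : ℝ) : ℂ) := by
    ext ξ
    rw [← Complex.ofReal_mul, resSymbol, Real.rpow_neg_one, ← mul_inv, norm_smul, Real.norm_eq_abs,
      mul_pow |2 * Real.pi / κ|, sq_abs]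
    congr 2
    field_simp
  have h2 : (fun ξ : X => ((1 + ‖(2 * Real.pi / κ) • ξ‖ ^ 2) ^ (-1 : ℝ) : ℝ)).HasTemperateGrowth :=
    (Function.hasTemperateGrowth_one_add_norm_sq_rpow X (-1)).comp
      (ContinuousLinearMap.hasTemperateGrowth ((2 * Real.pi / κ) • ContinuousLinearMap.id ℝ X))
  have h3 := Function.HasTemperateGrowth.comp (Complex.ofRealCLM).hasTemperateGrowth h2
  rw [h1]
  exact (Function.HasTemperateGrowth.const _).mul h3

/-- `(-Δ + κ²)⁻¹` on tempered distributions. -/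
def freeResD (κ : ℝ) : Distr →L[ℂ] Distr := fourierMultiplierCLM ℂ (fun ξ => (resSymbol κ ξ : ℂ))

/-- The symbol of `-Δ + κ²`. The factor `(2π)²` comes from the normalization of the Fourier
transform. -/
theorem freeSymbol_eq (κ : ℝ) (f : Distr) :
    fourierMultiplierCLM ℂ (fun ξ => ((κ ^ 2 + (2 * Real.pi) ^ 2 * ‖ξ‖ ^ 2 : ℝ) : ℂ)) f =
      (κ ^ 2) • f - Δ f := by
  have h1 : (fun ξ : X => ((κ ^ 2 + (2 * Real.pi) ^ 2 * ‖ξ‖ ^ 2 : ℝ) : ℂ)) =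
      (fun _ : X => ((κ ^ 2 : ℝ) : ℂ)) +
        (((2 * Real.pi) ^ 2 : ℝ) : ℂ) • fun x : X ↦ Complex.ofReal (‖x‖ ^ 2) := by
    ext x; simp
  have h2 : (((((2 * Real.pi) ^ 2 : ℝ) : ℂ) • fun x : X ↦ Complex.ofReal (‖x‖ ^ 2))).HasTemperateGrowth :=
    (Function.HasTemperateGrowth.const _).mul (by fun_prop)
  rw [h1, fourierMultiplier_add (by fun_prop) h2,
    laplacian_eq_fourierMultiplierCLM, fourierMultiplierCLM_const,
    fourierMultiplierCLM_smul (by fun_prop), neg_smul, sub_neg_eq_add]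
  simp only [smul_apply, Complex.coe_smul]
  rfl

theorem freeSymbol_temperate (κ : ℝ) :
    (fun ξ : X => ((κ ^ 2 + (2 * Real.pi) ^ 2 * ‖ξ‖ ^ 2 : ℝ) : ℂ)).HasTemperateGrowth := by
  fun_prop

theorem freeResD_left {κ : ℝ} (hκ : 0 < κ) (f : Distr) :
    freeResD κ ((κ ^ 2) • f - Δ f) = f := by
  rw [← freeSymbol_eq, freeResD, fourierMultiplierCLM_fourierMultiplierCLM_apply
    (freeSymbol_temperate κ) (resSymbol_temperate hκ)]
  have : ((fun ξ : X => ((κ ^ 2 + (2 * Real.pi) ^ 2 * ‖ξ‖ ^ 2 : ℝ) : ℂ)) * fun ξ =>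
      (resSymbol κ ξ : ℂ)) = fun _ => 1 := by
    ext ξ
    rw [Pi.mul_apply, ← Complex.ofReal_mul, resSymbol, mul_inv_cancel₀ (by positivity)]
    simp
  rw [this]; simp

theorem freeResD_right {κ : ℝ} (hκ : 0 < κ) (f : Distr) :
    (κ ^ 2) • freeResD κ f - Δ (freeResD κ f) = f := by
  rw [← freeSymbol_eq, freeResD, fourierMultiplierCLM_fourierMultiplierCLM_apply
    (resSymbol_temperate hκ) (freeSymbol_temperate κ)]
  have : ((fun ξ => (resSymbol κ ξ : ℂ)) *
      (fun ξ : X => ((κ ^ 2 + (2 * Real.pi) ^ 2 * ‖ξ‖ ^ 2 : ℝ) : ℂ))) = fun _ => 1 := by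
    ext ξ
    rw [Pi.mul_apply, ← Complex.ofReal_mul, resSymbol, inv_mul_cancel₀ (by positivity)]
    simp
  rw [this]; simp

theorem memSobolev_freeResD {κ : ℝ} (hκ : 0 < κ) {s : ℝ} {f : Distr} (hf : MemSobolev s 2 f) :
    MemSobolev (s + 2) 2 (freeResD κ f) := by
  rw [add_comm, ← memSobolev_besselPotential_iff, besselPotential, freeResD,
    fourierMultiplierCLM_fourierMultiplierCLM_apply (resSymbol_temperate hκ) (by fun_prop)]
  refine hf.fourierMultiplierCLM_of_bounded ((resSymbol_temperate hκ).mul (by fun_prop)) ?_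
  refine ⟨(κ ^ 2)⁻¹ + 1, fun ξ => ?_⟩
  rw [Pi.mul_apply, ← Complex.ofReal_mul, Complex.norm_real, resSymbol, Real.norm_eq_abs,
    abs_of_nonneg (by positivity)]
  norm_num
  rw [inv_mul_le_iff₀ (by positivity)]
  have h1 : (κ ^ 2)⁻¹ * κ ^ 2 = 1 := by field_simp
  have h2 : 1 ≤ (2 * Real.pi) ^ 2 := by nlinarith [Real.pi_gt_three]
  have h3 : 0 ≤ (κ ^ 2)⁻¹ * ((2 * Real.pi) ^ 2 * ‖ξ‖ ^ 2) := by positivity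
  nlinarith [sq_nonneg ‖ξ‖, sq_nonneg κ]

theorem toD_memSobolev (u : L2) : MemSobolev 0 2 u.toD := memSobolev_zero_iff.2 ⟨u, rfl⟩

theorem exists_freeRes {κ : ℝ} (hκ : 0 < κ) :
    ∃ T : L2 →L[ℂ] L2, ∀ u, (T u).toD = freeResD κ u.toD := by
  refine exists_clm_lift _ fun u => ?_
  have := (memSobolev_freeResD hκ (toD_memSobolev u)).mono (s' := 0) (by norm_num)
  exact memSobolev_zero_iff.1 this

/-- `(-Δ + κ²)⁻¹` on `L²`. -/
def freeRes {κ : ℝ} (hκ : 0 < κ) : L2 →L[ℂ] L2 := (exists_freeRes hκ).choose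

theorem freeRes_toD {κ : ℝ} (hκ : 0 < κ) (u : L2) : (freeRes hκ u).toD = freeResD κ u.toD :=
  (exists_freeRes hκ).choose_spec u

theorem freeRes_mem {κ : ℝ} (hκ : 0 < κ) (u : L2) : freeRes hκ u ∈ Hs 2 := by
  change MemSobolev 2 2 (freeRes hκ u).toD
  rw [freeRes_toD]
  simpa using memSobolev_freeResD hκ (toD_memSobolev u)

theorem exists_derivFreeRes {κ : ℝ} (hκ : 0 < κ) (j : Fin 3) :
    ∃ T : L2 →L[ℂ] L2, ∀ u, (T u).toD = ∂_{bvec j} (freeRes hκ u).toD := by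
  obtain ⟨T, hT⟩ := exists_clm_lift
    ((LineDeriv.lineDerivOpCLM ℂ Distr (bvec j)).comp (freeResD κ)) fun u => by
      have h := (memSobolev_freeResD hκ (toD_memSobolev u)).lineDerivOp (m := bvec j)
      exact memSobolev_zero_iff.1 (h.mono (by norm_num))
  exact ⟨T, fun u => by rw [hT, freeRes_toD]; rfl⟩

/-- `∂_j (-Δ + κ²)⁻¹` on `L²`. -/
def derivFreeRes {κ : ℝ} (hκ : 0 < κ) (j : Fin 3) : L2 →L[ℂ] L2 := (exists_derivFreeRes hκ j).choose

theorem derivFreeRes_toD {κ : ℝ} (hκ : 0 < κ) (j : Fin 3) (u : L2) :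
    (derivFreeRes hκ j u).toD = ∂_{bvec j} (freeRes hκ u).toD :=
  (exists_derivFreeRes hκ j).choose_spec u

theorem laplacianL2_toD (u : Hs 2) : (laplacianL2 u).toD = Δ (u : L2).toD :=
  (laplacianL2_spec u).symm

theorem freeRes_right {κ : ℝ} (hκ : 0 < κ) (u : L2) :
    (κ ^ 2 : ℂ) • freeRes hκ u - laplacianL2 ⟨freeRes hκ u, freeRes_mem hκ u⟩ = u := by
  apply L2.toD_inj
  rw [L2.toD_sub, L2.toD_smul, laplacianL2_toD, freeRes_toD]
  have := freeResD_right hκ u.toD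
  have h2 := Complex.coe_smul (κ ^ 2) (freeResD κ u.toD)
  rw [Complex.ofReal_pow] at h2
  rwa [h2]

theorem freeRes_left {κ : ℝ} (hκ : 0 < κ) (u : Hs 2) :
    freeRes hκ ((κ ^ 2 : ℂ) • (u : L2) - laplacianL2 u) = u := by
  apply L2.toD_inj
  rw [freeRes_toD, L2.toD_sub, L2.toD_smul, laplacianL2_toD]
  have := freeResD_left hκ (u : L2).toD
  have h2 := Complex.coe_smul (κ ^ 2) (u : L2).toD
  rw [Complex.ofReal_pow] at h2
  rwa [h2]

open FourierTransform in
theorem fourier_freeRes {κ : ℝ} (hκ : 0 < κ) (u : L2) :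
    (𝓕 (freeRes hκ u) : L2) =ᵐ[volume] fun ξ => (resSymbol κ ξ : ℂ) * (𝓕 u : L2) ξ := by
  have hb : ∃ C, ∀ ξ, ‖(resSymbol κ ξ : ℂ)‖ ≤ C := by
    refine ⟨(κ ^ 2)⁻¹, fun ξ => ?_⟩
    rw [Complex.norm_real, resSymbol, Real.norm_eq_abs, abs_of_nonneg (by positivity)]
    gcongr
    nlinarith [sq_nonneg (2 * Real.pi), sq_nonneg ‖ξ‖, mul_nonneg (sq_nonneg (2 * Real.pi)) (sq_nonneg ‖ξ‖)]
  have hm := memLp_bdd_mul (resSymbol_temperate hκ).1.continuous hb (𝓕 u : L2)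
  have : (𝓕 (freeRes hκ u) : L2) = hm.toLp _ := by
    apply L2.toD_inj
    rw [L2.toD, ← Lp.fourier_toTemperedDistribution_eq]
    change 𝓕 (freeRes hκ u).toD = _
    rw [freeRes_toD, freeResD, fourierMultiplierCLM_apply, FourierTransform.fourier_fourierInv_eq,
      Lp.fourier_toTemperedDistribution_eq]
    ext η
    rw [toD_ext, smulLeftCLM_apply_apply, Lp.toTemperedDistribution_apply]
    apply integral_congr_ae
    filter_upwards with x
    rw [SchwartzMap.smulLeftCLM_apply_apply (resSymbol_temperate hκ)]
    simp only [smul_eq_mul]; ring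
  rw [this]
  exact hm.coeFn_toLp

theorem freeRes_symm {κ : ℝ} (hκ : 0 < κ) (u v : L2) :
    inner ℂ (freeRes hκ u) v = inner ℂ u (freeRes hκ v) := by
  rw [← Lp.inner_fourier_eq, ← Lp.inner_fourier_eq u, L2.inner_def, L2.inner_def]
  apply integral_congr_ae
  filter_upwards [fourier_freeRes hκ u, fourier_freeRes hκ v] with ξ h1 h2
  rw [h1, h2]
  simp only [RCLike.inner_apply, map_mul, Complex.conj_ofReal]
  ring

end NLS

end

noncomputable section

namespace NLS

/-! ### Weighted spaces of functions with bounded and square integrable derivatives -/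

/-- A continuous weight function, bounded below by `1`. -/
structure Weight where
  /-- the weight -/
  toFun : X → ℝ
  continuous : Continuous toFun
  one_le : ∀ x, 1 ≤ toFun x

instance : CoeFun Weight (fun _ => X → ℝ) := ⟨Weight.toFun⟩

/-- The trivial weight. -/
def Weight.one : Weight := ⟨fun _ => 1, continuous_const, fun _ => le_rfl⟩

theorem Weight.pos (W : Weight) (x : X) : 0 < W x := one_pos.trans_le (W.one_le x)

section Reg

variable {F F' : Type*} [NormedAddCommGroup F] [NormedSpace ℝ F]
  [NormedAddCommGroup F'] [NormedSpace ℝ F']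

/-- The `j`-th classical partial derivative. -/
def pd (j : Fin 3) (f : X → F) : X → F := fun x => fderiv ℝ f x (bvec j)

/-- `f` is continuous, and `W f` is bounded and square integrable. -/
def Reg0 (W : Weight) (f : X → F) : Prop :=
  Continuous f ∧ (∃ C, ∀ x, W x * ‖f x‖ ≤ C) ∧ MemLp (fun x => W x • f x) 2 (volume : Measure X)

/-- All the partial derivatives of `f` of order at most `k` are continuous and, multiplied by `W`,
bounded and square integrable. -/
def Reg (W : Weight) : ℕ → (X → F) → Prop
  | 0, f => Reg0 W f
  | k + 1, f => Reg0 W f ∧ Differentiable ℝ f ∧ ∀ j, Reg W k (pd j f)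

/-- Multipliers from the weight `W₁` to the weight `W₂`: all the partial derivatives of `b` of order
at most `k` are continuous and bounded by a multiple of `W₁ / W₂`. -/
def MBdd (W₁ W₂ : X → ℝ) : ℕ → (X → ℝ) → Prop
  | 0, b => Continuous b ∧ ∃ C, ∀ x, W₂ x * ‖b x‖ ≤ C * W₁ x
  | k + 1, b => (Continuous b ∧ ∃ C, ∀ x, W₂ x * ‖b x‖ ≤ C * W₁ x) ∧ Differentiable ℝ b ∧
      ∀ j, MBdd W₁ W₂ k (pd j b)

theorem Reg.reg0 {W : Weight} {k : ℕ} {f : X → F} (h : Reg W k f) : Reg0 W f := by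
  cases k with
  | zero => exact h
  | succ k => exact h.1

theorem Reg.of_succ {W : Weight} {k : ℕ} : ∀ {f : X → F} (_ : Reg W (k + 1) f), Reg W k f := by
  induction k with
  | zero => exact fun h => h.1
  | succ k ih => exact fun h => ⟨h.1, h.2.1, fun j => ih (h.2.2 j)⟩

theorem Reg.mono {W : Weight} {k l : ℕ} (hkl : k ≤ l) {f : X → F} (h : Reg W l f) : Reg W k f := by
  induction l, hkl using Nat.le_induction with
  | base => exact h
  | succ l _ ih => exact ih h.of_succ

theorem pd_add {j : Fin 3} {f g : X → F} (hf : Differentiable ℝ f) (hg : Differentiable ℝ g) :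
    pd j (f + g) = pd j f + pd j g := by
  ext1 x
  simp [pd, fderiv_add (hf x) (hg x)]

theorem pd_smul {j : Fin 3} {f : X → F} (c : ℝ) (hf : Differentiable ℝ f) :
    pd j (c • f) = c • pd j f := by
  ext1 x
  simp [pd, fderiv_const_smul (hf x)]

theorem pd_clm {j : Fin 3} (L : F →L[ℝ] F') {f : X → F} (hf : Differentiable ℝ f) :
    pd j (fun x => L (f x)) = fun x => L (pd j f x) := by
  ext1 x
  have := (L.hasFDerivAt.comp x (hf x).hasFDerivAt).fderiv
  simp only [Function.comp_def] at this
  simp [pd, this]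

theorem pd_mul_smul {j : Fin 3} {b : X → ℝ} {f : X → F} (hb : Differentiable ℝ b)
    (hf : Differentiable ℝ f) :
    pd j (fun x => b x • f x) = (fun x => b x • pd j f x) + fun x => pd j b x • f x := by
  ext1 x
  have := fderiv_fun_smul (hb x) (hf x)
  simp [pd, this]

theorem Reg0.add {W : Weight} {f g : X → F} (hf : Reg0 W f) (hg : Reg0 W g) : Reg0 W (f + g) := by
  obtain ⟨h1, ⟨C, hC⟩, h3⟩ := hf
  obtain ⟨g1, ⟨D, hD⟩, g3⟩ := hg
  refine ⟨h1.add g1, ⟨C + D, fun x => ?_⟩, ?_⟩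
  · have := norm_add_le (f x) (g x)
    have hW := W.pos x
    calc W x * ‖(f + g) x‖ ≤ W x * (‖f x‖ + ‖g x‖) := by gcongr; exact this
      _ ≤ C + D := by rw [mul_add]; exact add_le_add (hC x) (hD x)
  · simpa [smul_add] using! h3.add g3

/-- Regularity of vector valued functions is preserved by continuous linear maps, such as the real
part. -/
theorem Reg0.clm {W : Weight} (L : F →L[ℝ] F') {f : X → F} (hf : Reg0 W f) :
    Reg0 W (fun x => L (f x)) := by
  obtain ⟨h1, ⟨C, hC⟩, h3⟩ := hf
  refine ⟨L.continuous.comp h1, ⟨‖L‖ * C, fun x => ?_⟩, ?_⟩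
  · have hW := W.pos x
    calc W x * ‖L (f x)‖ ≤ W x * (‖L‖ * ‖f x‖) := by gcongr; exact L.le_opNorm _
      _ = ‖L‖ * (W x * ‖f x‖) := by ring
      _ ≤ _ := by gcongr; exact hC x
  · have := L.comp_memLp' h3
    refine this.congr_norm ?_ ?_
    · exact (W.continuous.smul (L.continuous.comp h1)).aestronglyMeasurable
    · filter_upwards with x; simp

theorem Reg.add {W : Weight} {k : ℕ} : ∀ {f g : X → F}, Reg W k f → Reg W k g → Reg W k (f + g) := by
  induction k with
  | zero => exact fun h1 h2 => Reg0.add h1 h2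
  | succ k ih =>
    exact fun h1 h2 => ⟨h1.1.add h2.1, h1.2.1.add h2.2.1, fun j => by
      rw [pd_add h1.2.1 h2.2.1]; exact ih (h1.2.2 j) (h2.2.2 j)⟩

theorem Reg.clm {W : Weight} {k : ℕ} (L : F →L[ℝ] F') : ∀ {f : X → F}, Reg W k f →
    Reg W k (fun x => L (f x)) := by
  induction k with
  | zero => exact fun h => Reg0.clm L h
  | succ k ih =>
    exact fun h => ⟨h.1.clm L, L.differentiable.comp h.2.1, fun j => by
      rw [pd_clm L h.2.1]; exact ih (h.2.2 j)⟩

theorem Reg.smul {W : Weight} {k : ℕ} (c : ℝ) {f : X → F} (h : Reg W k f) : Reg W k (c • f) :=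
  h.clm (c • ContinuousLinearMap.id ℝ F)

theorem Reg.zero (W : Weight) (k : ℕ) : Reg W k (0 : X → F) := by
  induction k with
  | zero => exact ⟨continuous_const, ⟨0, by simp⟩, by simp⟩
  | succ k ih =>
    refine ⟨⟨continuous_const, ⟨0, by simp⟩, by simp⟩, differentiable_const 0, fun j => ?_⟩
    convert ih using 1
    ext1 x; simp [pd]

theorem MBdd.of_succ {W₁ W₂ : X → ℝ} {k : ℕ} : ∀ {f : X → ℝ} (_ : MBdd W₁ W₂ (k + 1) f),
    MBdd W₁ W₂ k f := by
  induction k with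
  | zero => exact fun h => h.1
  | succ k ih => exact fun h => ⟨h.1, h.2.1, fun j => ih (h.2.2 j)⟩

theorem MBdd.zero_level {W₁ W₂ : X → ℝ} {k : ℕ} {f : X → ℝ} (h : MBdd W₁ W₂ k f) :
    MBdd W₁ W₂ 0 f := by
  cases k with
  | zero => exact h
  | succ k => exact h.1

/-- Multiplication by a multiplier from the weight `W₁` to the weight `W₂`. -/
theorem MBdd.reg {W₁ W₂ : Weight} {k : ℕ} : ∀ {b : X → ℝ} {f : X → F}, MBdd W₁ W₂ k b →
    Reg W₁ k f → Reg W₂ k (fun x => b x • f x) := by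
  have base : ∀ {b : X → ℝ} {f : X → F}, MBdd W₁ W₂ 0 b → Reg W₁ 0 f →
      Reg0 W₂ (fun x => b x • f x) := by
    intro b f hb hf
    obtain ⟨h1, ⟨C, hC⟩, h3⟩ := hf
    obtain ⟨g1, D, hD⟩ := hb
    have key : ∀ x, ‖W₂ x • b x • f x‖ ≤ D * ‖W₁ x • f x‖ := by
      intro x
      rw [norm_smul, norm_smul, norm_smul, Real.norm_of_nonneg (W₁.pos x).le,
        Real.norm_of_nonneg (W₂.pos x).le]
      calc W₂ x * (‖b x‖ * ‖f x‖) = W₂ x * ‖b x‖ * ‖f x‖ := by ring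
        _ ≤ D * W₁ x * ‖f x‖ := mul_le_mul_of_nonneg_right (hD x) (norm_nonneg _)
        _ = D * (W₁ x * ‖f x‖) := by ring
    have hm : Continuous fun x => W₂ x • b x • f x := W₂.continuous.smul (g1.smul h1)
    refine ⟨g1.smul h1, ⟨|D| * C, fun x => ?_⟩, h3.of_le_mul hm.aestronglyMeasurable
      (Eventually.of_forall key)⟩
    have := key x
    rw [norm_smul, Real.norm_of_nonneg (W₂.pos x).le, norm_smul (W₁ x),
      Real.norm_of_nonneg (W₁.pos x).le] at this
    refine this.trans ?_
    have h0 : 0 ≤ W₁ x * ‖f x‖ := mul_nonneg (W₁.pos x).le (norm_nonneg _)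
    exact mul_le_mul (le_abs_self D) (hC x) h0 (abs_nonneg D)
  -- for `k + 1` the product rule applies to `∂_j (b f)`
  induction k with
  | zero => exact fun hb hf => base hb hf
  | succ k ih =>
    intro b f hb hf
    refine ⟨base hb.zero_level hf.1, hb.2.1.smul hf.2.1, fun j => ?_⟩
    rw [pd_mul_smul hb.2.1 hf.2.1]
    exact (ih hb.of_succ (hf.2.2 j)).add (ih (hb.2.2 j) hf.of_succ)

theorem MBdd.add {W₁ W₂ : X → ℝ} (hW₂ : ∀ x, 0 ≤ W₂ x) {k : ℕ} : ∀ {b c : X → ℝ},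
    MBdd W₁ W₂ k b → MBdd W₁ W₂ k c → MBdd W₁ W₂ k (b + c) := by
  have base : ∀ {b c : X → ℝ}, MBdd W₁ W₂ 0 b → MBdd W₁ W₂ 0 c → MBdd W₁ W₂ 0 (b + c) := by
    intro b c hb hc
    obtain ⟨h1, C, hC⟩ := hb
    obtain ⟨g1, D, hD⟩ := hc
    refine ⟨h1.add g1, C + D, fun x => ?_⟩
    have := norm_add_le (b x) (c x)
    have h2 := hW₂ x
    calc W₂ x * ‖(b + c) x‖ ≤ W₂ x * (‖b x‖ + ‖c x‖) := by gcongr; exact this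
      _ ≤ _ := by rw [mul_add, add_mul]; exact add_le_add (hC x) (hD x)
  induction k with
  | zero => exact base
  | succ k ih =>
    exact fun h1 h2 => ⟨base h1.1 h2.1, h1.2.1.add h2.2.1, fun j => by
      rw [pd_add h1.2.1 h2.2.1]; exact ih (h1.2.2 j) (h2.2.2 j)⟩

/-- By the Leibniz rule, the weights of multipliers multiply. -/
theorem MBdd.mul {U₁ U₂ V₁ V₂ : X → ℝ} (hU : ∀ x, 0 ≤ U₂ x) (hV : ∀ x, 0 ≤ V₂ x) {k : ℕ} :
    ∀ {b c : X → ℝ},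
    MBdd U₁ U₂ k b → MBdd V₁ V₂ k c →
      MBdd (fun x => U₁ x * V₁ x) (fun x => U₂ x * V₂ x) k (fun x => b x * c x) := by
  have base : ∀ {b c : X → ℝ}, MBdd U₁ U₂ 0 b → MBdd V₁ V₂ 0 c →
      MBdd (fun x => U₁ x * V₁ x) (fun x => U₂ x * V₂ x) 0 (fun x => b x * c x) := by
    intro b c hb hc
    obtain ⟨h1, C, hC⟩ := hb
    obtain ⟨g1, D, hD⟩ := hc
    refine ⟨h1.mul g1, C * D, fun x => ?_⟩
    rw [norm_mul]
    calc U₂ x * V₂ x * (‖b x‖ * ‖c x‖) = (U₂ x * ‖b x‖) * (V₂ x * ‖c x‖) := by ring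
      _ ≤ (C * U₁ x) * (D * V₁ x) := by
        have h2 := mul_nonneg (hU x) (norm_nonneg (b x))
        exact mul_le_mul (hC x) (hD x) (mul_nonneg (hV x) (norm_nonneg _)) (h2.trans (hC x))
      _ = _ := by ring
  induction k with
  | zero => exact base
  | succ k ih =>
    intro b c hb hc
    refine ⟨base hb.zero_level hc.zero_level, hb.2.1.mul hc.2.1, fun j => ?_⟩
    have h1 := pd_mul_smul (j := j) hb.2.1 hc.2.1
    simp only [smul_eq_mul] at h1
    rw [h1]
    exact MBdd.add (fun x => mul_nonneg (hU x) (hV x)) (ih hb.of_succ (hc.2.2 j))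
      (ih (hb.2.2 j) hc.of_succ)

theorem MBdd.mono {U₁ U₂ V₁ V₂ : X → ℝ} (hU : ∀ x, 0 ≤ U₁ x) (h1 : ∀ x, U₁ x ≤ V₁ x)
    (h2 : ∀ x, V₂ x ≤ U₂ x) {k : ℕ} : ∀ {b : X → ℝ}, MBdd U₁ U₂ k b → MBdd V₁ V₂ k b := by
  have base : ∀ {b : X → ℝ}, MBdd U₁ U₂ 0 b → MBdd V₁ V₂ 0 b := by
    rintro b ⟨h, C, hC⟩
    refine ⟨h, |C|, fun x => ?_⟩
    calc V₂ x * ‖b x‖ ≤ U₂ x * ‖b x‖ := by gcongr; exact h2 x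
      _ ≤ C * U₁ x := hC x
      _ ≤ |C| * U₁ x := by have := hU x; gcongr; exact le_abs_self C
      _ ≤ |C| * V₁ x := by gcongr; exact h1 x
  induction k with
  | zero => exact base
  | succ k ih => exact fun h => ⟨base h.1, h.2.1, fun j => ih (h.2.2 j)⟩

theorem Reg.mbdd {W : Weight} {k : ℕ} : ∀ {f : X → ℝ}, Reg W k f →
    MBdd (fun _ => 1) (fun _ => 1) k f := by
  have base : ∀ {f : X → ℝ}, Reg0 W f → MBdd (fun _ => 1) (fun _ => 1) 0 f := by
    rintro f ⟨h1, ⟨C, hC⟩, -⟩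
    refine ⟨h1, C, fun x => ?_⟩
    rw [one_mul, mul_one]
    exact (le_mul_of_one_le_left (norm_nonneg _) (W.one_le x)).trans (hC x)
  induction k with
  | zero => exact base
  | succ k ih => exact fun h => ⟨base h.1, h.2.1, fun j => ih (h.2.2 j)⟩

theorem MBdd.reg_one {W : Weight} {k : ℕ} {b : X → ℝ} {f : X → F}
    (hb : MBdd (fun _ => 1) (fun _ => 1) k b) (hf : Reg W k f) : Reg W k (fun x => b x • f x) := by
  refine MBdd.reg (W₁ := W) ?_ hf
  have : ∀ {k : ℕ} {b : X → ℝ}, MBdd (fun _ => 1) (fun _ => 1) k b → MBdd W W k b := by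
    have base : ∀ {b : X → ℝ}, MBdd (fun _ => 1) (fun _ => 1) 0 b → MBdd W W 0 b := by
      rintro b ⟨h1, C, hC⟩
      refine ⟨h1, C, fun x => ?_⟩
      have := hC x
      rw [one_mul, mul_one] at this
      rw [mul_comm]
      exact mul_le_mul_of_nonneg_right this (W.pos x).le
    intro k
    induction k with
    | zero => exact base
    | succ k ih => exact fun h => ⟨base h.1, h.2.1, fun j => ih (h.2.2 j)⟩
  exact this hb

theorem Reg.mul {W : Weight} {k : ℕ} {f g : X → ℝ} (hf : Reg W k f) (hg : Reg W k g) :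
    Reg W k (fun x => f x * g x) := by
  simpa using! hf.mbdd.reg_one hg

theorem Reg.memLp {W : Weight} {k : ℕ} {f : X → F} (hf : Reg W k f) :
    MemLp f 2 (volume : Measure X) := by
  obtain ⟨h1, -, h3⟩ := hf.reg0
  refine h3.mono h1.aestronglyMeasurable (Eventually.of_forall fun x => ?_)
  rw [norm_smul, Real.norm_of_nonneg (W.pos x).le]
  exact le_mul_of_one_le_left (norm_nonneg _) (W.one_le x)

theorem Reg.continuous {W : Weight} {k : ℕ} {f : X → F} (hf : Reg W k f) : Continuous f :=
  hf.reg0.1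

end Reg

end NLS

end

open scoped BoundedContinuousFunction

noncomputable section

namespace NLS

/-! ### The Banach spaces of real functions with weighted derivatives -/

/-- The real functions `f` with `Reg W k f`, as a space of functions. -/
def regSubmodule (W : Weight) (k : ℕ) : Submodule ℝ (X → ℝ) where
  carrier := {f | Reg W k f}
  add_mem' := Reg.add
  zero_mem' := Reg.zero W k
  smul_mem' c _ h := Reg.smul c h

/-- The space of real functions `f` with `Reg W k f` (a type of its own: its topology is not that of
pointwise convergence). -/
def RegSpace (W : Weight) (k : ℕ) : Type := regSubmodule W k

namespace RegSpace

instance (W : Weight) (k : ℕ) : AddCommGroup (RegSpace W k) :=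
  inferInstanceAs (AddCommGroup (regSubmodule W k))

instance (W : Weight) (k : ℕ) : Module ℝ (RegSpace W k) :=
  inferInstanceAs (Module ℝ (regSubmodule W k))

/-- A function with `Reg W k f`, as an element of the space. -/
def mk {W : Weight} {k : ℕ} (f : X → ℝ) (hf : Reg W k f) : RegSpace W k := ⟨f, hf⟩

variable {W : Weight} {k : ℕ}

/-- The underlying function. -/
def toFun (f : RegSpace W k) : X → ℝ := Subtype.val (p := (· ∈ regSubmodule W k)) f

instance : CoeFun (RegSpace W k) (fun _ => X → ℝ) := ⟨toFun⟩

theorem reg (f : RegSpace W k) : Reg W k f := f.2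

theorem ext' {f g : RegSpace W k} (h : ∀ x, f x = g x) : f = g := Subtype.ext (p := (· ∈ regSubmodule W k)) (funext h)

theorem add_apply' (f g : RegSpace W k) (x : X) : (f + g) x = f x + g x := rfl
theorem sub_apply' (f g : RegSpace W k) (x : X) : (f - g) x = f x - g x := rfl
theorem smul_apply' (c : ℝ) (f : RegSpace W k) (x : X) : (c • f) x = c * f x := rfl
theorem zero_apply' (x : X) : (0 : RegSpace W k) x = 0 := rfl

theorem sum_apply' {ι : Type*} (s : Finset ι) (f : ι → RegSpace W k) (x : X) :
    (∑ i ∈ s, f i) x = ∑ i ∈ s, f i x := by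
  classical
  induction s using Finset.induction_on with
  | empty => rfl
  | insert i s hi ih => rw [Finset.sum_insert hi, Finset.sum_insert hi, add_apply', ih]

/-- Inclusion between the spaces of different orders. -/
def incl {k l : ℕ} (h : k ≤ l) : RegSpace W l →ₗ[ℝ] RegSpace W k :=
  Submodule.inclusion (p := regSubmodule W l) (p' := regSubmodule W k) fun _ hf => Reg.mono h hf

/-- The partial derivatives as maps between the spaces. -/
def pdₗ (j : Fin 3) : RegSpace W (k + 1) →ₗ[ℝ] RegSpace W k where
  toFun f := ⟨pd j f, f.reg.2.2 j⟩
  map_add' f g := Subtype.ext (pd_add f.reg.2.1 g.reg.2.1)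
  map_smul' c f := Subtype.ext (pd_smul c f.reg.2.1)

/-- `W f` as a bounded continuous function. -/
def bcf (f : RegSpace W 0) : X →ᵇ ℝ :=
  BoundedContinuousFunction.ofNormedAddCommGroup (fun x => W x • f x)
    (W.continuous.smul f.reg.1) (f.reg.2.1.choose) fun x => by
      rw [norm_smul, Real.norm_of_nonneg (W.pos x).le]
      exact f.reg.2.1.choose_spec x

/-- The embedding `f ↦ (W f, W f)` into `C_b × L²`. -/
def emb0 : RegSpace W 0 →ₗ[ℝ] (X →ᵇ ℝ) × Lp ℝ 2 (volume : Measure X) where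
  toFun f := (bcf f, MemLp.toLp (fun x => W x • f x) f.reg.2.2)
  map_add' f g := by
    refine Prod.ext ?_ ?_
    · ext x; simp [bcf, add_apply', mul_add]
    · refine Eq.trans ?_ (MemLp.toLp_add f.reg.2.2 g.reg.2.2)
      refine MemLp.toLp_congr (f + g).reg.2.2 (f.reg.2.2.add g.reg.2.2) (Eventually.of_forall fun x => ?_)
      simp [add_apply', mul_add]
  map_smul' c f := by
    refine Prod.ext ?_ ?_
    · ext x; simp [bcf, smul_apply']; ring
    · refine Eq.trans ?_ (MemLp.toLp_const_smul c f.reg.2.2)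
      refine MemLp.toLp_congr (c • f).reg.2.2 (f.reg.2.2.const_smul c) (Eventually.of_forall fun x => ?_)
      simp [smul_apply']; ring

theorem emb0_fst_apply (f : RegSpace W 0) (x : X) : (emb0 f).1 x = W x * f x := rfl

theorem emb0_injective : Function.Injective (emb0 (W := W)) := by
  intro f g h
  refine ext' fun x => ?_
  have := congrArg (fun p => p.1 x) h
  simp only [emb0_fst_apply] at this
  exact mul_left_cancel₀ (W.pos x).ne' this

/-- The norm of `RegSpace W k`: the sum over the partial derivatives of order at most `k` (counted
with repetitions) of the larger of the sup norm and the `L²` norm of `W ∂^α f`. -/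
def nrm (W : Weight) : (k : ℕ) → AddGroupNorm (RegSpace W k)
  | 0 =>
    { toFun := fun f => ‖emb0 f‖
      map_zero' := by simp
      add_le' := fun f g => by rw [map_add]; exact norm_add_le _ _
      neg' := fun f => by rw [map_neg, norm_neg]
      eq_zero_of_map_eq_zero' := fun f h => emb0_injective (by simpa using h) }
  | k + 1 =>
    { toFun := fun f => ‖emb0 (incl (Nat.zero_le _) f)‖ + ∑ j, nrm W k (pdₗ j f)
      map_zero' := by simp
      add_le' := fun f g => by
        simp only [map_add]
        have h1 := norm_add_le (emb0 (incl (Nat.zero_le _) f)) (emb0 (incl (Nat.zero_le _) g))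
        have h2 := Finset.sum_le_sum fun (j : Fin 3) (_ : j ∈ Finset.univ) =>
          map_add_le_add (nrm W k) (pdₗ j f) (pdₗ j g)
        rw [Finset.sum_add_distrib] at h2
        linarith
      neg' := fun f => by
        simp only [map_neg, norm_neg]
        congr 1
        exact Finset.sum_congr rfl fun j _ => map_neg_eq_map (nrm W k) _
      eq_zero_of_map_eq_zero' := fun f h => by
        have h2 : 0 ≤ ∑ j, nrm W k (pdₗ j f) := Finset.sum_nonneg fun j _ => apply_nonneg _ _
        have h3 : ‖emb0 (incl (Nat.zero_le _) f)‖ = 0 := by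
          have := norm_nonneg (emb0 (incl (Nat.zero_le _) f))
          linarith
        have h4 := emb0_injective (a₁ := incl (Nat.zero_le _) f) (a₂ := 0) (by simpa using h3)
        exact ext' fun x => congrFun (congrArg toFun h4) x }

instance : NormedAddCommGroup (RegSpace W k) := (nrm W k).toNormedAddCommGroup

theorem norm_zero_eq (f : RegSpace W 0) : ‖f‖ = ‖emb0 f‖ := rfl

theorem norm_succ_eq (f : RegSpace W (k + 1)) :
    ‖f‖ = ‖incl (Nat.zero_le _) f‖ + ∑ j, ‖pdₗ j f‖ := rfl

instance : NormedSpace ℝ (RegSpace W k) where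
  norm_smul_le := by
    induction k with
    | zero =>
      intro c f
      rw [norm_zero_eq, norm_zero_eq, map_smul, norm_smul]
    | succ k ih =>
      intro c f
      rw [norm_succ_eq, norm_succ_eq, map_smul, norm_zero_eq, map_smul, norm_smul, mul_add,
        Finset.mul_sum, ← norm_zero_eq]
      gcongr with j
      rw [map_smul]
      exact ih c _

theorem norm_incl_zero_le (f : RegSpace W k) : ‖incl (Nat.zero_le k) f‖ ≤ ‖f‖ := by
  cases k with
  | zero => exact le_rfl
  | succ k =>
    rw [norm_succ_eq]
    exact le_add_of_nonneg_right (Finset.sum_nonneg fun j _ => norm_nonneg _)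

theorem norm_pdₗ_le (j : Fin 3) (f : RegSpace W (k + 1)) : ‖pdₗ j f‖ ≤ ‖f‖ := by
  rw [norm_succ_eq]
  refine le_add_of_nonneg_of_le (norm_nonneg _) ?_
  exact Finset.single_le_sum (f := fun j => ‖pdₗ j f‖) (fun j _ => norm_nonneg _) (Finset.mem_univ j)

theorem norm_incl_succ_le (f : RegSpace W (k + 1)) : ‖incl (Nat.le_succ k) f‖ ≤ ‖f‖ := by
  induction k with
  | zero => exact norm_incl_zero_le f
  | succ k ih =>
    rw [norm_succ_eq, norm_succ_eq]
    refine add_le_add le_rfl (Finset.sum_le_sum fun j _ => ?_)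
    exact ih (pdₗ j f)

theorem norm_incl_le {k l : ℕ} (h : k ≤ l) (f : RegSpace W l) : ‖incl h f‖ ≤ ‖f‖ := by
  induction l, h using Nat.le_induction with
  | base => exact le_rfl
  | succ l hl ih => exact (ih (incl (Nat.le_succ l) f)).trans (norm_incl_succ_le f)

/-- The inclusion as a continuous linear map. -/
def inclL {k l : ℕ} (h : k ≤ l) : RegSpace W l →L[ℝ] RegSpace W k :=
  (incl h).mkContinuous 1 fun f => by rw [one_mul]; exact norm_incl_le h f

theorem inclL_apply {k l : ℕ} (h : k ≤ l) (f : RegSpace W l) (x : X) : inclL h f x = f x := rfl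

/-- The partial derivative as a continuous linear map. -/
def pdL (j : Fin 3) : RegSpace W (k + 1) →L[ℝ] RegSpace W k :=
  (pdₗ j).mkContinuous 1 fun f => by rw [one_mul]; exact norm_pdₗ_le j f

theorem abs_apply_le (f : RegSpace W k) (x : X) : |f x| ≤ ‖f‖ := by
  refine le_trans ?_ (norm_incl_zero_le f)
  rw [norm_zero_eq]
  refine le_trans ?_ (norm_fst_le _)
  refine le_trans ?_ (BoundedContinuousFunction.norm_coe_le_norm _ x)
  rw [emb0_fst_apply, norm_mul, Real.norm_of_nonneg (W.pos x).le]
  exact le_mul_of_one_le_left (abs_nonneg _) (W.one_le x)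

/-- Evaluation at a point. -/
def evalL (x : X) : RegSpace W k →L[ℝ] ℝ :=
  LinearMap.mkContinuous
    { toFun := fun f : RegSpace W k => f x, map_add' := fun _ _ => rfl, map_smul' := fun _ _ => rfl } 1
    fun f => by rw [one_mul]; exact abs_apply_le f x

theorem evalL_apply (x : X) (f : RegSpace W k) : evalL x f = f x := rfl

/-- The isometric embedding into `C_b × L²`. -/
def embL : RegSpace W 0 →L[ℝ] (X →ᵇ ℝ) × Lp ℝ 2 (volume : Measure X) :=
  emb0.mkContinuous 1 fun f => by rw [one_mul]; rfl

/-- The embedding `f ↦ (f, ∂₁f, ∂₂f, ∂₃f)`. -/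
def jet : RegSpace W (k + 1) →L[ℝ] RegSpace W 0 × (Fin 3 → RegSpace W k) :=
  (inclL (Nat.zero_le _)).prod (ContinuousLinearMap.pi pdL)

/-- The jet controls the norm, because the norm is the sum of the norms of the components of the
jet. -/
theorem norm_le_jet (f : RegSpace W (k + 1)) : ‖f‖ ≤ 4 * ‖jet f‖ := by
  rw [norm_succ_eq]
  have h1 : ‖incl (Nat.zero_le _) f‖ ≤ ‖jet f‖ := norm_fst_le (jet f)
  have h2 : ∀ j, ‖pdₗ j f‖ ≤ ‖jet f‖ := fun j =>
    (norm_le_pi_norm (jet f).2 j).trans (norm_snd_le (jet f))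
  have h3 := Finset.sum_le_sum fun (j : Fin 3) (_ : j ∈ Finset.univ) => h2 j
  simp at h3 ⊢
  linarith

/-- The range consists of the pairs whose components agree almost everywhere. Convergence in `L²`
implies convergence almost everywhere of a subsequence, so this relation is closed. -/
theorem isClosed_range_embL : IsClosed (Set.range (embL (W := W))) := by
  have : Set.range (embL (W := W)) = {p | ∀ᵐ x, p.2 x = p.1 x} := by
    ext p
    constructor
    · rintro ⟨f, rfl⟩
      exact MemLp.coeFn_toLp (μ := volume) (f := fun x => W x • f x) f.reg.2.2
    · intro (h : ∀ᵐ x, p.2 x = p.1 x)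
      have hW : ∀ x, W x * ((W x)⁻¹ * p.1 x) = p.1 x := fun x =>
        mul_inv_cancel_left₀ (W.pos x).ne' _
      have hm : MemLp p.1 2 (volume : Measure X) := (memLp_congr_ae h).1 (Lp.memLp p.2)
      have hr : Reg W 0 fun x => (W x)⁻¹ * p.1 x := by
        refine ⟨(W.continuous.inv₀ fun x => (W.pos x).ne').mul p.1.continuous, ⟨‖p.1‖, fun x => ?_⟩,
          ?_⟩
        · have e : W x * ‖(W x)⁻¹ * p.1 x‖ = ‖p.1 x‖ := by
            rw [← congrArg norm (hW x), norm_mul (W x), Real.norm_of_nonneg (W.pos x).le]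
          exact e.trans_le (p.1.norm_coe_le_norm x)
        · simpa only [smul_eq_mul, hW] using hm
      refine ⟨⟨_, hr⟩, Prod.ext ?_ ?_⟩
      · ext x
        exact hW x
      · apply Lp.ext
        refine (MemLp.coeFn_toLp hr.2.2).trans ?_
        filter_upwards [h] with x hx
        rw [hx]
        exact hW x
  rw [this]
  refine IsSeqClosed.isClosed fun u p hu hp => ?_
  have h2 : Tendsto (fun n => (u n).2) atTop (𝓝 p.2) := (continuous_snd.tendsto p).comp hp
  have h1 : Tendsto (fun n => (u n).1) atTop (𝓝 p.1) := (continuous_fst.tendsto p).comp hp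
  obtain ⟨ns, hn, hns⟩ := (tendstoInMeasure_of_tendsto_Lp h2).exists_seq_tendsto_ae
  have hu' : ∀ᵐ x, ∀ n, (u n).2 x = (u n).1 x := ae_all_iff.2 hu
  show ∀ᵐ x, p.2 x = p.1 x
  filter_upwards [hns, hu'] with x hx hux
  refine tendsto_nhds_unique hx ?_
  simp only [hux]
  exact ((BoundedContinuousFunction.evalCLM ℝ x).continuous.tendsto p.1).comp
    (h1.comp hn.tendsto_atTop)

/-- The range consists of the tuples `(f, f₁, f₂, f₃)` in which the `f_j` are the partial
derivatives of `f`. This relation is closed, since a uniform limit of derivatives is the derivative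
of the limit. -/
theorem isClosed_range_jet : IsClosed (Set.range (jet (W := W) (k := k))) := by
  have : Set.range (jet (W := W) (k := k)) = {p | ∀ x, HasFDerivAt (fun y => p.1 y)
      (∑ j, p.2 j x • (EuclideanSpace.proj j : X →L[ℝ] ℝ)) x} := by
    have hsum : ∀ L : X →L[ℝ] ℝ, L = ∑ j, L (bvec j) • (EuclideanSpace.proj j : X →L[ℝ] ℝ) := by
      intro L
      ext v
      have hv := (EuclideanSpace.basisFun (Fin 3) ℝ).sum_repr v
      conv_lhs => rw [← hv]
      simp [bvec, mul_comm]
    ext p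
    constructor
    · rintro ⟨f, rfl⟩ x
      have := (f.reg.2.1 x).hasFDerivAt
      rw [hsum (fderiv ℝ _ x)] at this
      exact this
    · intro (h : ∀ x, HasFDerivAt _ _ x)
      have hp : ∀ j x, pd j (fun y => p.1 y) x = p.2 j x := by
        intro j x
        rw [pd, (h x).fderiv]
        simp [bvec, Fin.sum_univ_three]
        fin_cases j <;> simp
      have hr : Reg W (k + 1) fun y => p.1 y :=
        ⟨p.1.reg, fun x => (h x).differentiableAt, fun j => by
          have e : pd j (fun y => p.1 y) = fun x => p.2 j x := funext (hp j)
          rw [e]; exact (p.2 j).reg⟩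
      refine ⟨mk _ hr, Prod.ext rfl (funext fun j => ext' fun x => hp j x)⟩
  rw [this]
  refine IsSeqClosed.isClosed fun u p hu hp => ?_
  have h1 : Tendsto (fun n => (u n).1) atTop (𝓝 p.1) := (continuous_fst.tendsto p).comp hp
  have h2 : ∀ j, Tendsto (fun n => (u n).2 j) atTop (𝓝 (p.2 j)) := fun j =>
    (((continuous_apply j).comp continuous_snd).tendsto p).comp hp
  -- the norm of `RegSpace W k` controls uniform convergence
  have hunif : ∀ j, TendstoUniformly (fun n x => (u n).2 j x) (fun x => p.2 j x) atTop := by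
    intro j
    rw [Metric.tendstoUniformly_iff]
    intro ε hε
    filter_upwards [(Metric.tendsto_nhds.1 (h2 j)) ε hε] with n hn x
    refine lt_of_le_of_lt ?_ hn
    rw [dist_comm ((u n).2 j), dist_eq_norm, dist_eq_norm]
    exact abs_apply_le (p.2 j - (u n).2 j) x
  show ∀ x, HasFDerivAt _ _ x
  intro x
  refine hasFDerivAt_of_tendstoUniformly (f := fun n y => (u n).1 y)
    (f' := fun n y => ∑ j, (u n).2 j y • (EuclideanSpace.proj j : X →L[ℝ] ℝ)) (l := atTop)
    (g := fun y => p.1 y)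
    (g' := fun y => ∑ j, p.2 j y • (EuclideanSpace.proj j : X →L[ℝ] ℝ)) ?_
    (fun n y => hu n y) (fun y => ?_) x
  · rw [Metric.tendstoUniformly_iff]
    intro ε hε
    have hC : 0 < ∑ j : Fin 3, (‖(EuclideanSpace.proj j : X →L[ℝ] ℝ)‖ + 1) := by positivity
    have := fun j => Metric.tendstoUniformly_iff.1 (hunif j)
      (ε / ∑ j : Fin 3, (‖(EuclideanSpace.proj j : X →L[ℝ] ℝ)‖ + 1)) (by positivity)
    filter_upwards [eventually_all.2 this] with n hn y
    rw [dist_eq_norm, ← Finset.sum_sub_distrib]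
    refine (norm_sum_le _ _).trans_lt ?_
    simp only [← sub_smul, norm_smul]
    calc ∑ j, ‖p.2 j y - (u n).2 j y‖ * ‖(EuclideanSpace.proj j : X →L[ℝ] ℝ)‖
        < ∑ j, (ε / ∑ j : Fin 3, (‖(EuclideanSpace.proj j : X →L[ℝ] ℝ)‖ + 1)) *
          (‖(EuclideanSpace.proj j : X →L[ℝ] ℝ)‖ + 1) := by
          refine Finset.sum_lt_sum_of_nonempty Finset.univ_nonempty fun j _ => ?_
          have := hn j y
          rw [dist_eq_norm] at this
          exact mul_lt_mul' this.le (lt_add_one _) (norm_nonneg _) (by positivity)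
      _ = ε := by rw [← Finset.mul_sum, div_mul_cancel₀ _ hC.ne']
  · exact ((evalL y).continuous.tendsto p.1).comp h1

theorem antilipschitz_jet : AntilipschitzWith 4 (jet (W := W) (k := k)) :=
  (jet (W := W) (k := k)).antilipschitz_of_bound norm_le_jet

theorem antilipschitz_embL : AntilipschitzWith 1 (embL (W := W)) :=
  (embL (W := W)).antilipschitz_of_bound fun f => by
    rw [NNReal.coe_one, one_mul]; rfl

instance : CompleteSpace (RegSpace W k) := by
  have h0 : CompleteSpace (RegSpace W 0) := by
    have h := antilipschitz_embL (W := W)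
    rw [completeSpace_iff_isComplete_range
      (h.isUniformInducing (embL (W := W)).uniformContinuous)]
    exact isClosed_range_embL.isComplete
  induction k with
  | zero => exact h0
  | succ k ih =>
    have h := antilipschitz_jet (W := W) (k := k)
    rw [completeSpace_iff_isComplete_range
      (h.isUniformInducing (jet (W := W) (k := k)).uniformContinuous)]
    exact isClosed_range_jet.isComplete

end RegSpace

end NLS

end

noncomputable section

namespace NLS

/-! ### Smooth maps into a space embedded with closed range -/

section Lift

variable {E F G : Type} [NormedAddCommGroup E] [NormedSpace ℝ E] [NormedAddCommGroup F]
  [NormedSpace ℝ F] [CompleteSpace F] [NormedAddCommGroup G] [NormedSpace ℝ G]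

/-- If `J ∘ f` is differentiable, then its derivative takes values in the closed range of `J`, being
a limit of difference quotients, and factors through `J`. -/
theorem exists_hasFDerivAt_of_comp (J : F →L[ℝ] G) {c : ℝ≥0} (hJ : AntilipschitzWith c J)
    {f : E → F} {D : E →L[ℝ] G} {x : E} (h : HasFDerivAt (fun y => J (f y)) D x) :
    ∃ D₀ : E →L[ℝ] F, HasFDerivAt f D₀ x := by
  have hcl : IsClosed (Set.range J) := hJ.isClosed_range J.uniformContinuous
  have hmem : ∀ v, ∃ w, J w = D v := by
    intro v
    have h1 : HasDerivAt (fun t : ℝ => J (f (x + t • v))) (D v) 0 := by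
      have h2 : HasDerivAt (fun t : ℝ => x + t • v) v 0 := by
        simpa using ((hasDerivAt_id (0 : ℝ)).smul_const v).const_add x
      have h' : HasFDerivAt (fun y => J (f y)) D (x + (0 : ℝ) • v) := by simpa using h
      exact h'.comp_hasDerivAt (0 : ℝ) h2
    have h3 := h1.tendsto_slope_zero
    refine hcl.mem_of_tendsto h3 (Eventually.of_forall fun t => ?_)
    exact ⟨t⁻¹ • (f (x + (0 + t) • v) - f (x + (0 : ℝ) • v)), by simp⟩
  choose L hL using hmem
  have hinj := hJ.injective
  let D₀ : E →L[ℝ] F := LinearMap.mkContinuous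
    { toFun := L
      map_add' := fun a b => hinj (by simp [hL])
      map_smul' := fun r a => hinj (by simp [hL]) } (c * ‖D‖) (fun v => by
        have := hJ.le_mul_norm (x := L v) (map_zero J)
        refine this.trans ?_
        rw [hL, mul_assoc]
        gcongr
        exact D.le_opNorm v)
  refine ⟨D₀, ?_⟩
  rw [hasFDerivAt_iff_isLittleO_nhds_zero] at h ⊢
  refine (IsBigO.of_bound c (Eventually.of_forall fun v => ?_)).trans_isLittleO h
  have := hJ.le_mul_norm (x := f (x + v) - f x - D₀ v) (map_zero J)
  refine this.trans_eq ?_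
  have e : J (D₀ v) = D v := hL v
  rw [map_sub, map_sub, e]

/-- The derivative of `f` composed with `J` is the derivative of `J ∘ f`. As `L ↦ J ∘ L` is again
bounded below, this permits an induction on the order of differentiability, over all pairs of spaces
at once. -/
theorem contDiff_nat_of_comp (n : ℕ) : ∀ {F G : Type} [NormedAddCommGroup F]
    [NormedSpace ℝ F] [CompleteSpace F] [NormedAddCommGroup G] [NormedSpace ℝ G]
    (J : F →L[ℝ] G) {c : ℝ≥0} (_ : AntilipschitzWith c J) {f : E → F}
    (_ : ContDiff ℝ n (fun y => J (f y))), ContDiff ℝ n f := by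
  induction n with
  | zero =>
    intro F G _ _ _ _ _ J c hJ f h
    rw [Nat.cast_zero, contDiff_zero] at h ⊢
    exact (hJ.isUniformInducing J.uniformContinuous).isInducing.continuous_iff.2 h
  | succ n ih =>
    intro F G _ _ _ _ _ J c hJ f h
    rw [Nat.cast_succ, contDiff_succ_iff_fderiv] at h ⊢
    have hd : Differentiable ℝ f := fun x =>
      (exists_hasFDerivAt_of_comp J hJ (h.1 x).hasFDerivAt).choose_spec.differentiableAt
    refine ⟨hd, by simp, ?_⟩
    have e : fderiv ℝ (fun y => J (f y)) =
        fun x => ContinuousLinearMap.compL ℝ E F G J (fderiv ℝ f x) := by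
      ext1 x
      exact (J.hasFDerivAt.comp x (hd x).hasFDerivAt).fderiv
    have h2 := h.2.2
    rw [e] at h2
    refine ih (ContinuousLinearMap.compL ℝ E F G J) (c := c)
      ((ContinuousLinearMap.compL ℝ E F G J).antilipschitz_of_bound fun L => ?_) h2
    refine ContinuousLinearMap.opNorm_le_bound _ (by positivity) fun v => ?_
    have := hJ.le_mul_norm (x := L v) (map_zero J)
    refine this.trans ?_
    rw [mul_assoc]
    gcongr
    exact (ContinuousLinearMap.compL ℝ E F G J L).le_opNorm v

/-- Smoothness can be tested after an embedding with closed range. -/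
theorem contDiff_of_comp (J : F →L[ℝ] G) {c : ℝ≥0} (hJ : AntilipschitzWith c J)
    {f : E → F} (h : ContDiff ℝ ∞ (fun y => J (f y))) : ContDiff ℝ ∞ f := by
  rw [contDiff_infty] at h ⊢
  exact fun n => contDiff_nat_of_comp n J hJ (h n)

end Lift

/-! ### Superposition operators -/

theorem contDiff_deriv {g : ℝ → ℝ} (hg : ContDiff ℝ ∞ g) : ContDiff ℝ ∞ (deriv g) :=
  ((contDiff_infty_iff_deriv (𝕜 := ℝ) (f := g)).1 hg).2

/-- `g ∘ a` as a bounded continuous function. -/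
def bcfComp (g : ℝ → ℝ) (hg : Continuous g) (a : X →ᵇ ℝ) : X →ᵇ ℝ :=
  BoundedContinuousFunction.ofNormedAddCommGroup (fun x => g (a x)) (hg.comp a.continuous)
    ((isCompact_closedBall (0 : ℝ) ‖a‖).exists_bound_of_continuousOn hg.continuousOn).choose
    fun x => ((isCompact_closedBall (0 : ℝ) ‖a‖).exists_bound_of_continuousOn
      hg.continuousOn).choose_spec (a x) (by
        rw [mem_closedBall_zero_iff]; exact a.norm_coe_le_norm x)

/-- The derivative of `a ↦ g ∘ a` on bounded continuous functions is multiplication by `g' ∘ a`. -/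
theorem hasFDerivAt_bcfComp {g : ℝ → ℝ} (hg : ContDiff ℝ ∞ g) (a : X →ᵇ ℝ) :
    HasFDerivAt (bcfComp g hg.continuous)
      (ContinuousLinearMap.mul ℝ (X →ᵇ ℝ) (bcfComp (deriv g) (contDiff_deriv hg).continuous a)) a := by
  -- a bound for the second derivative on a neighbourhood of the range of `a`
  obtain ⟨C, hC⟩ := (isCompact_closedBall (0 : ℝ) (‖a‖ + 1)).exists_bound_of_continuousOn
    (contDiff_deriv (contDiff_deriv hg)).continuous.continuousOn
  have hC0 : 0 ≤ C := (norm_nonneg _).trans (hC 0 (by simp; positivity))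
  have hconv := convex_closedBall (0 : ℝ) (‖a‖ + 1)
  rw [hasFDerivAt_iff_isLittleO_nhds_zero]
  have hO : (fun h : X →ᵇ ℝ => bcfComp g hg.continuous (a + h) - bcfComp g hg.continuous a -
      (ContinuousLinearMap.mul ℝ (X →ᵇ ℝ)
        (bcfComp (deriv g) (contDiff_deriv hg).continuous a)) h) =O[𝓝 0]
      fun h => ‖h‖ ^ 2 := by
    refine IsBigO.of_bound C ?_
    filter_upwards [Metric.closedBall_mem_nhds (0 : X →ᵇ ℝ) one_pos] with h hh
    rw [mem_closedBall_zero_iff] at hh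
    refine (BoundedContinuousFunction.norm_le (by positivity)).2 fun x => ?_
    have hax := a.norm_coe_le_norm x
    have hhx := h.norm_coe_le_norm x
    show ‖g (a x + h x) - g (a x) - deriv g (a x) * h x‖ ≤ _
    -- the mean value inequality for `t ↦ g (a + t) - g' (a) t`
    have hmv : ∀ t ∈ Set.uIcc 0 (h x), ‖deriv g (a x + t) - deriv g (a x)‖ ≤ C * ‖h x‖ := by
      intro t ht
      have ht' : ‖t‖ ≤ ‖h x‖ := by
        have := Set.abs_sub_left_of_mem_uIcc ht
        simpa using this
      have := hconv.norm_image_sub_le_of_norm_deriv_le (f := deriv g) (C := C)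
        (fun y _ => ((contDiff_deriv hg).differentiable (by simp)) y) hC
        (x := a x) (y := a x + t) (by rw [mem_closedBall_zero_iff]; linarith)
        (by rw [mem_closedBall_zero_iff]; linarith [norm_add_le (a x) t])
      rw [add_sub_cancel_left] at this
      exact this.trans (by gcongr)
    have hd : ∀ t ∈ Set.uIcc 0 (h x), HasDerivWithinAt
        (fun t => g (a x + t) - deriv g (a x) * t) (deriv g (a x + t) - deriv g (a x))
        (Set.uIcc 0 (h x)) t := by
      intro t _
      refine HasDerivAt.hasDerivWithinAt ?_
      have h1 : HasDerivAt g (deriv g (a x + t)) (a x + t) :=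
        (hg.differentiable (by simp) _).hasDerivAt
      have h2 := h1.comp_const_add (a x) t
      have h3 := (hasDerivAt_id t).const_mul (deriv g (a x))
      have h4 := h2.sub h3
      rw [mul_one] at h4
      exact h4
    have := (convex_uIcc 0 (h x)).norm_image_sub_le_of_norm_hasDerivWithin_le hd hmv
      Set.left_mem_uIcc Set.right_mem_uIcc
    simp only [add_zero, mul_zero, sub_zero] at this
    rw [sub_right_comm] at this
    refine this.trans ?_
    rw [norm_pow, norm_norm, mul_assoc, ← sq]
    gcongr
  refine hO.trans_isLittleO ?_
  simpa using (isLittleO_norm_pow_id (E' := X →ᵇ ℝ) one_lt_two)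

theorem contDiff_bcfComp {g : ℝ → ℝ} (hg : ContDiff ℝ ∞ g) :
    ContDiff ℝ ∞ (bcfComp g hg.continuous) := by
  rw [contDiff_infty]
  intro n
  induction n generalizing g with
  | zero =>
    rw [Nat.cast_zero, contDiff_zero]
    exact continuous_iff_continuousAt.2 fun a => (hasFDerivAt_bcfComp hg a).continuousAt
  | succ n ih =>
    rw [Nat.cast_succ, contDiff_succ_iff_hasFDerivAt]
    · exact ⟨fun a => ContinuousLinearMap.mul ℝ (X →ᵇ ℝ)
          (bcfComp (deriv g) (contDiff_deriv hg).continuous a),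
        ContDiff.comp (g := fun a : X →ᵇ ℝ => ContinuousLinearMap.mul ℝ (X →ᵇ ℝ) a)
          (ContinuousLinearMap.mul ℝ (X →ᵇ ℝ)).isBoundedLinearMap.contDiff (ih (contDiff_deriv hg)),
        fun a => hasFDerivAt_bcfComp hg a⟩

namespace RegSpace

variable {W : Weight} {k : ℕ}

/-- A function in `RegSpace W k` as a bounded continuous function. -/
def toBCF : RegSpace W k →L[ℝ] X →ᵇ ℝ :=
  LinearMap.mkContinuous
    { toFun := fun f : RegSpace W k => BoundedContinuousFunction.ofNormedAddCommGroup f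
        f.reg.continuous ‖f‖ (abs_apply_le f)
      map_add' := fun _ _ => rfl
      map_smul' := fun _ _ => rfl } 1 fun f => by
        rw [one_mul]
        exact (BoundedContinuousFunction.norm_le (norm_nonneg _)).2 (abs_apply_le f)

theorem reg_bcf_mul (b : X →ᵇ ℝ) (f : RegSpace W 0) : Reg W 0 (fun x => b x * f x) := by
  have hb : MBdd (fun _ => 1) (fun _ => 1) 0 b :=
    ⟨b.continuous, ‖b‖, fun x => by simpa using b.norm_coe_le_norm x⟩
  exact hb.reg_one f.reg

/-- Multiplication of a function in `RegSpace W 0` by a bounded continuous function. -/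
def bcfMul : (X →ᵇ ℝ) →L[ℝ] RegSpace W 0 →L[ℝ] RegSpace W 0 :=
  LinearMap.mkContinuous₂ (LinearMap.mk₂ ℝ (fun b f => mk _ (reg_bcf_mul b f))
    (fun _ _ _ => ext' fun _ => add_mul _ _ _) (fun _ _ _ => ext' fun _ => mul_assoc _ _ _)
    (fun _ _ _ => ext' fun _ => mul_add _ _ _)
    (fun _ _ _ => ext' fun _ => mul_left_comm _ _ _)) 1 fun b f => by
      rw [one_mul]
      have h0 : 0 ≤ ‖b‖ := norm_nonneg _
      refine (norm_prod_le_iff).2 ⟨?_, ?_⟩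
      · refine (BoundedContinuousFunction.norm_le (by positivity)).2 fun x => ?_
        have h1 : ‖(emb0 f).1 x‖ ≤ ‖f‖ :=
          ((emb0 f).1.norm_coe_le_norm x).trans (norm_fst_le (emb0 f))
        have h2 := b.norm_coe_le_norm x
        have e : ‖W x * (b x * f x)‖ = ‖b x‖ * ‖(emb0 f).1 x‖ := by
          rw [emb0_fst_apply, ← norm_mul]; ring_nf
        exact e.trans_le (by gcongr)
      · have h1 : ‖(emb0 f).2‖ ≤ ‖f‖ := norm_snd_le (emb0 f)
        refine le_trans ?_ (mul_le_mul_of_nonneg_left h1 h0)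
        refine Lp.norm_le_mul_norm_of_ae_le_mul ?_
        filter_upwards [MemLp.coeFn_toLp (μ := volume) (f := fun x => W x • f x) f.reg.2.2,
          MemLp.coeFn_toLp (μ := volume) (f := fun x => W x • (b x * f x))
            (reg_bcf_mul b f).2.2] with x hx hx'
        have e1 : (emb0 f).2 x = W x • f x := hx
        refine (congrArg norm hx').trans_le ?_
        rw [e1, smul_eq_mul, smul_eq_mul, mul_left_comm, norm_mul]
        gcongr
        exact b.norm_coe_le_norm x

/-- Superposition operators are smooth. -/
theorem exists_nem (k : ℕ) : ∀ {g : ℝ → ℝ} (_ : ContDiff ℝ ∞ g),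
    ∃ M : RegSpace W k × RegSpace W k → RegSpace W k, ContDiff ℝ ∞ M ∧
      ∀ a b x, M (a, b) x = g (a x) * b x := by
  have h0 : ∀ {g : ℝ → ℝ} (_ : ContDiff ℝ ∞ g),
      ∃ M : RegSpace W 0 × RegSpace W 0 → RegSpace W 0, ContDiff ℝ ∞ M ∧
        ∀ a b x, M (a, b) x = g (a x) * b x := by
    intro g hg
    -- the weight is carried by the linear factor `b`
    refine ⟨fun p => bcfMul (bcfComp g hg.continuous (toBCF p.1)) p.2, ?_, fun a b x => rfl⟩
    refine ContDiff.clm_apply (bcfMul.contDiff.comp ((contDiff_bcfComp hg).comp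
      (toBCF.contDiff.comp contDiff_fst))) contDiff_snd
  induction k with
  | zero => exact h0
  | succ k ih =>
    intro g hg
    obtain ⟨M₀, hM₀, hM₀'⟩ := h0 hg
    obtain ⟨M₁, hM₁, hM₁'⟩ := ih hg
    obtain ⟨M₂, hM₂, hM₂'⟩ := ih (contDiff_deriv hg)
    obtain ⟨M₃, hM₃, hM₃'⟩ := ih (contDiff_id (𝕜 := ℝ) (E := ℝ))
    -- the jet of `g(a) b`, by `∂_j (g(a) b) = g(a) ∂_j b + g'(a) ∂_j a b`
    let J : RegSpace W (k + 1) × RegSpace W (k + 1) → RegSpace W 0 × (Fin 3 → RegSpace W k) :=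
      fun p => (M₀ (inclL (Nat.zero_le _) p.1, inclL (Nat.zero_le _) p.2), fun j =>
        M₁ (inclL (Nat.le_succ k) p.1, pdL j p.2) +
          M₂ (inclL (Nat.le_succ k) p.1, M₃ (pdL j p.1, inclL (Nat.le_succ k) p.2)))
    have hJ : ContDiff ℝ ∞ J := by
      refine ContDiff.prodMk ?_ (contDiff_pi.2 fun j => ContDiff.add ?_ ?_)
      · exact hM₀.comp (by fun_prop)
      · exact hM₁.comp (by fun_prop)
      · refine hM₂.comp (ContDiff.prodMk (by fun_prop) (hM₃.comp (by fun_prop)))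
    have hpd : ∀ (p : RegSpace W (k + 1) × RegSpace W (k + 1)) j,
        pd j (fun x => g (p.1 x) * p.2 x) = (J p).2 j := by
      intro p j
      ext1 x
      have h1 : HasDerivAt g (deriv g (p.1 x)) (p.1 x) :=
        (hg.differentiable (by simp) _).hasDerivAt
      have h2 := (h1.comp_hasFDerivAt x (p.1.reg.2.1 x).hasFDerivAt).mul (p.2.reg.2.1 x).hasFDerivAt
      have h3 : (J p).2 j x = g (p.1 x) * pd j p.2 x + deriv g (p.1 x) * (pd j p.1 x * p.2 x) := by
        show M₁ _ x + M₂ _ x = _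
        rw [hM₁', hM₂', hM₃']; rfl
      rw [h3, pd]
      erw [h2.fderiv]
      simp [pd]
      ring
    have hr : ∀ p : RegSpace W (k + 1) × RegSpace W (k + 1),
        Reg W (k + 1) (fun x => g (p.1 x) * p.2 x) := by
      intro p
      refine ⟨?_, ?_, fun j => ?_⟩
      · have e : (fun x => g (p.1 x) * p.2 x) = ((J p).1 : X → ℝ) :=
          funext fun x => (hM₀' (inclL (Nat.zero_le _) p.1) (inclL (Nat.zero_le _) p.2) x).symm
        rw [e]; exact (J p).1.reg
      · exact ((hg.differentiable (by simp)).comp p.1.reg.2.1).mul p.2.reg.2.1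
      · rw [hpd]; exact ((J p).2 j).reg
    refine ⟨fun p => mk _ (hr p), contDiff_of_comp jet antilipschitz_jet ?_, fun _ _ _ => rfl⟩
    have e : (fun p => jet (mk _ (hr p))) = J := by
      ext1 p
      refine Prod.ext (ext' fun x => (hM₀' (inclL (Nat.zero_le _) p.1) (inclL (Nat.zero_le _) p.2) x).symm) (funext fun j => ext' fun x => ?_)
      exact congrFun (hpd p j) x
    rw [e]
    exact hJ

open Classical in
/-- The function `g(a) b`, linear in `b`, for smooth `g` (and `0` if it is not regular). -/
def nem (g : ℝ → ℝ) (a b : RegSpace W k) : RegSpace W k :=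
  if h : Reg W k (fun x => g (a x) * b x) then mk _ h else 0

theorem nem_apply {g : ℝ → ℝ} (hg : ContDiff ℝ ∞ g) (a b : RegSpace W k) (x : X) :
    nem g a b x = g (a x) * b x := by
  obtain ⟨M, -, hM⟩ := exists_nem (W := W) k hg
  have h : Reg W k (fun x => g (a x) * b x) := by
    have := (M (a, b)).reg
    rwa [show (M (a, b)).toFun = fun x => g (a x) * b x from funext fun x => hM a b x] at this
  rw [nem, dif_pos h]
  rfl

theorem contDiff_nem {g : ℝ → ℝ} (hg : ContDiff ℝ ∞ g) :
    ContDiff ℝ ∞ fun p : RegSpace W k × RegSpace W k => nem g p.1 p.2 := by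
  obtain ⟨M, h, hM⟩ := exists_nem (W := W) k hg
  have : (fun p : RegSpace W k × RegSpace W k => nem g p.1 p.2) = M :=
    funext fun p => ext' fun x => by rw [nem_apply hg, ← hM]
  rwa [this]

/-- Near the origin, `g(a) b` is bounded by a multiple of the norm of `b`. -/
theorem exists_nem_le {g : ℝ → ℝ} (hg : ContDiff ℝ ∞ g) :
    ∃ δ > 0, ∃ C, 0 ≤ C ∧ ∀ a b : RegSpace W k, ‖a‖ ≤ δ → ‖nem g a b‖ ≤ C * ‖b‖ := by
  have hz : ∀ a : RegSpace W k, nem g a 0 = 0 := fun a => ext' fun x => by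
    rw [nem_apply hg, zero_apply', mul_zero]
  have hcont := ((contDiff_nem (W := W) (k := k) hg).continuous.tendsto (0, 0))
  have := Metric.tendsto_nhds.1 hcont 1 one_pos
  obtain ⟨δ, hδ, h⟩ := Metric.eventually_nhds_iff.1 this
  simp only [hz, dist_zero_right] at h
  refine ⟨δ / 2, by positivity, (δ / 2)⁻¹, by positivity, fun a b ha => ?_⟩
  by_cases hb : b = 0
  · simp [hb, hz]
  have hb' : 0 < ‖b‖ := norm_pos_iff.2 hb
  have hs : ∀ c : ℝ, nem g a (c • b) = c • nem g a b := fun c => ext' fun x => by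
    rw [smul_apply', nem_apply hg, nem_apply hg, smul_apply']; ring
  have h2 := @h (a, ((δ / 2) / ‖b‖) • b) (by
    rw [Prod.dist_eq, dist_eq_norm, dist_eq_norm]
    rw [sub_zero, sub_zero, norm_smul, Real.norm_of_nonneg (by positivity),
      div_mul_cancel₀ _ hb'.ne']
    refine max_lt ?_ ?_ <;> linarith)
  simp only [hs] at h2
  rw [norm_smul, Real.norm_of_nonneg (by positivity), div_mul_eq_mul_div, div_lt_one hb'] at h2
  rw [inv_mul_eq_div, le_div_iff₀ (by positivity)]
  linarith

theorem reg_mul (a b : RegSpace W k) : Reg W k (fun x => a x * b x) := a.reg.mul b.reg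

theorem exists_mul_le (W : Weight) (k : ℕ) : ∃ C, ∀ a b : RegSpace W k,
    ‖mk _ (reg_mul a b)‖ ≤ C * ‖a‖ * ‖b‖ := by
  have e : ∀ a b : RegSpace W k, nem id a b = mk _ (reg_mul a b) := fun a b =>
    ext' fun x => nem_apply contDiff_id a b x
  obtain ⟨δ, hδ, C, hC, h⟩ := exists_nem_le (W := W) (k := k) (contDiff_id (𝕜 := ℝ) (E := ℝ))
  refine ⟨C / δ, fun a b => ?_⟩
  by_cases ha : a = 0
  · have : mk _ (reg_mul a b) = 0 := ext' fun x => by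
      show a x * b x = 0
      rw [ha, zero_apply', zero_mul]
    rw [this, norm_zero, ha, norm_zero]; simp
  have ha' : 0 < ‖a‖ := norm_pos_iff.2 ha
  have h2 := h ((δ / ‖a‖) • a) b (by
    rw [norm_smul, norm_div, norm_norm, div_mul_cancel₀ _ ha'.ne', Real.norm_of_nonneg hδ.le])
  have e2 : nem id ((δ / ‖a‖) • a) b = (δ / ‖a‖) • mk _ (reg_mul a b) := ext' fun x => by
    rw [nem_apply contDiff_id, smul_apply', smul_apply', id, mul_assoc]; rfl
  rw [e2, norm_smul, norm_div, norm_norm, Real.norm_of_nonneg hδ.le, div_mul_eq_mul_div,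
    div_le_iff₀ ha'] at h2
  rw [div_mul_eq_mul_div, div_mul_eq_mul_div, le_div_iff₀ hδ]
  linarith

/-- Multiplication on `RegSpace W k`. -/
def mulL : RegSpace W k →L[ℝ] RegSpace W k →L[ℝ] RegSpace W k :=
  LinearMap.mkContinuous₂ (LinearMap.mk₂ ℝ (fun a b => mk _ (reg_mul a b))
    (fun _ _ _ => ext' fun _ => add_mul _ _ _) (fun _ _ _ => ext' fun _ => mul_assoc _ _ _)
    (fun _ _ _ => ext' fun _ => mul_add _ _ _)
    (fun _ _ _ => ext' fun _ => mul_left_comm _ _ _)) (exists_mul_le W k).choose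
    (exists_mul_le W k).choose_spec

theorem mulL_apply (a b : RegSpace W k) (x : X) : mulL a b x = a x * b x := rfl

theorem mulL_pow_apply (a b : RegSpace W k) (p : ℕ) (x : X) :
    (mulL a ^ p) b x = a x ^ p * b x := by
  induction p with
  | zero => simp
  | succ p ih =>
    rw [pow_succ', mul_apply_eq_comp, mulL_apply, ih]; ring

theorem contDiff_iteratedDeriv {g : ℝ → ℝ} (hg : ContDiff ℝ ∞ g) (p : ℕ) :
    ContDiff ℝ ∞ (iteratedDeriv p g) := by
  induction p with
  | zero => simpa [iteratedDeriv_zero] using hg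
  | succ p ih => rw [iteratedDeriv_succ]; exact contDiff_deriv ih

/-- The chain rule along a segment. Since the curve is known to be differentiable, the derivative is
identified by evaluation at the points of space. -/
theorem hasDerivAt_nem {g : ℝ → ℝ} (hg : ContDiff ℝ ∞ g) (q d b : RegSpace W k) (s : ℝ) :
    HasDerivAt (fun s : ℝ => nem g (q + s • d) b) (nem (deriv g) (q + s • d) (mulL d b)) s := by
  have hd : DifferentiableAt ℝ (fun s : ℝ => nem g (q + s • d) b) s := by
    have : ContDiff ℝ ∞ (fun s : ℝ => nem g (q + s • d) b) :=
      (contDiff_nem hg).comp (g := fun p : RegSpace W k × RegSpace W k => nem g p.1 p.2)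
        (f := fun s : ℝ => (q + s • d, b)) (by fun_prop)
    exact this.differentiable (by simp) s
  refine hd.hasDerivAt.congr_deriv (ext' fun x => ?_)
  have h1 := (evalL (W := W) (k := k) x).hasFDerivAt.comp_hasDerivAt s hd.hasDerivAt
  have h2 : HasDerivAt (fun s : ℝ => g (q x + s * d x) * b x)
      (deriv g (q x + s * d x) * d x * b x) s := by
    have h3 : HasDerivAt g (deriv g (q x + s * d x)) (q x + s * d x) :=
      (hg.differentiable (by simp) _).hasDerivAt
    have h4 : HasDerivAt (fun s : ℝ => q x + s * d x) (d x) s := by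
      simpa using ((hasDerivAt_id s).mul_const (d x)).const_add (q x)
    exact (h3.comp s h4).mul_const (b x)
  have e : (evalL (W := W) (k := k) x) ∘ (fun s : ℝ => nem g (q + s • d) b) =
      fun s : ℝ => g (q x + s * d x) * b x := by
    ext1 s
    rw [Function.comp_apply, evalL_apply, nem_apply hg, add_apply', smul_apply']
  rw [e] at h1
  have := h2.unique h1
  rw [evalL_apply] at this
  rw [← this, nem_apply (contDiff_deriv hg), add_apply', smul_apply', mulL_apply]
  ring

/-- Taylor's formula for superposition operators. -/
theorem exists_nem_taylor (K : ℕ) : ∀ {g : ℝ → ℝ} (_ : ContDiff ℝ ∞ g),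
    ∃ δ > 0, ∃ C, 0 ≤ C ∧ ∀ q d b : RegSpace W k, ‖q‖ ≤ δ → ‖d‖ ≤ δ →
      ‖nem g (q + d) b - ∑ p ∈ Finset.range K,
        ((p.factorial : ℝ)⁻¹) • nem (iteratedDeriv p g) q ((mulL d ^ p) b)‖ ≤
          C * ‖d‖ ^ K * ‖b‖ := by
  induction K with
  | zero =>
    intro g hg
    obtain ⟨δ, hδ, C, hC, h⟩ := exists_nem_le (W := W) (k := k) hg
    refine ⟨δ / 2, by positivity, C, hC, fun q d b hq hd => ?_⟩
    simp only [Finset.range_zero, Finset.sum_empty, sub_zero, pow_zero, mul_one]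
    exact h _ _ ((norm_add_le q d).trans (by linarith))
  | succ K ih =>
    intro g hg
    obtain ⟨δ, hδ, C, hC, h⟩ := ih (contDiff_deriv hg)
    obtain ⟨D, hD⟩ : ∃ D, D = ‖mulL (W := W) (k := k)‖ := ⟨_, rfl⟩
    have hD0 : 0 ≤ D := hD ▸ norm_nonneg mulL
    refine ⟨δ, hδ, C * D, by positivity, fun q d b hq hd => ?_⟩
    -- the remainder `T(s)` at `q + s d` vanishes at `s = 0`, and `T'(s)` is a remainder of
    -- order `K` for `g'`
    let T : ℝ → RegSpace W k := fun s => nem g (q + s • d) b - ∑ p ∈ Finset.range (K + 1),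
        ((p.factorial : ℝ)⁻¹ * s ^ p) • nem (iteratedDeriv p g) q ((mulL d ^ p) b)
    let T' : ℝ → RegSpace W k := fun s => nem (deriv g) (q + s • d) (mulL d b) -
      ∑ p ∈ Finset.range K,
        ((p.factorial : ℝ)⁻¹) • nem (iteratedDeriv p (deriv g)) q ((mulL (s • d) ^ p) (mulL d b))
    have hT : ∀ s, HasDerivAt T (T' s) s := by
      intro s
      refine (hasDerivAt_nem hg q d b s).sub ?_
      have : HasDerivAt (fun s : ℝ => ∑ p ∈ Finset.range (K + 1),
          ((p.factorial : ℝ)⁻¹ * s ^ p) • nem (iteratedDeriv p g) q ((mulL d ^ p) b))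
          (∑ p ∈ Finset.range (K + 1),
          ((p.factorial : ℝ)⁻¹ * (p * s ^ (p - 1))) • nem (iteratedDeriv p g) q ((mulL d ^ p) b))
          s := by
        refine HasDerivAt.fun_sum fun p _ => ?_
        exact (((hasDerivAt_pow p s)).const_mul _).smul_const _
      refine this.congr_deriv ?_
      rw [Finset.sum_range_succ']
      simp only [Nat.cast_zero, zero_mul, mul_zero, zero_smul, add_zero]
      refine Finset.sum_congr rfl fun p _ => ext' fun x => ?_
      rw [smul_apply', smul_apply', nem_apply (contDiff_iteratedDeriv hg _),
        nem_apply (contDiff_iteratedDeriv (contDiff_deriv hg) _), mulL_pow_apply, mulL_pow_apply,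
        smul_apply', mulL_apply, iteratedDeriv_succ', Nat.factorial_succ]
      have h1 : (p.factorial : ℝ) ≠ 0 := by exact_mod_cast p.factorial_ne_zero
      have h2 : (p : ℝ) + 1 ≠ 0 := by positivity
      push_cast
      field_simp
      ring
    have hT0 : T 0 = 0 := by
      refine ext' fun x => ?_
      show nem g (q + (0 : ℝ) • d) b x - (∑ p ∈ Finset.range (K + 1), _ : RegSpace W k) x = _
      rw [Finset.sum_range_succ']
      simp [nem_apply hg, iteratedDeriv_zero, zero_apply']
    have hb : ∀ s ∈ Set.Ico (0 : ℝ) 1, ‖T' s‖ ≤ C * D * ‖d‖ ^ (K + 1) * ‖b‖ := by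
      intro s hs
      have hsd : ‖s • d‖ ≤ ‖d‖ := by
        rw [norm_smul, Real.norm_of_nonneg hs.1]
        exact mul_le_of_le_one_left (norm_nonneg _) hs.2.le
      refine (h q (s • d) (mulL d b) hq (hsd.trans hd)).trans ?_
      have h1 : ‖mulL d b‖ ≤ D * ‖d‖ * ‖b‖ := hD ▸ mulL.le_opNorm₂ d b
      calc C * ‖s • d‖ ^ K * ‖mulL d b‖ ≤ C * ‖d‖ ^ K * (D * ‖d‖ * ‖b‖) := by gcongr
        _ = _ := by ring
    have := norm_image_sub_le_of_norm_deriv_le_segment_01' (f := T) (f' := T')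
      (fun s _ => (hT s).hasDerivWithinAt) hb
    rw [hT0, sub_zero] at this
    simpa [T] using this

end RegSpace

end NLS

end

noncomputable section

namespace NLS

/-! ### Classical and distributional derivatives -/

/-- The distributional derivatives of a differentiable function with bounded, square integrable
derivatives are the classical ones. -/
theorem lineDeriv_toLp {W : Weight} {f : X → ℂ} (hf : Reg W 1 f) (j : Fin 3) :
    ∂_{bvec j} (L2.toD (hf.memLp.toLp f)) = L2.toD ((Reg.memLp (hf.2.2 j)).toLp (pd j f)) := by
  ext η
  rw [lineDerivOp_apply_apply, toD_ext, toD_ext]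
  have hint : ∀ (ζ : 𝓢(X, ℂ)) {h : X → ℂ}, MemLp h 2 (volume : Measure X) →
      Integrable (fun x => ζ x * h x) := fun ζ h hh =>
    MemLp.integrable_mul (ζ.memLp 2) hh
  have h1 : ∀ x, HasLineDerivAt ℝ (fun x => η x) (∂_{bvec j} η x) x (bvec j) := fun x => by
    rw [SchwartzMap.lineDerivOp_apply_eq_fderiv]
    exact η.differentiableAt.hasFDerivAt.hasLineDerivAt _
  have h2 : ∀ x, HasLineDerivAt ℝ f (pd j f x) x (bvec j) := fun x =>
    (hf.2.1 x).hasFDerivAt.hasLineDerivAt _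
  have h := integral_bilinear_hasLineDerivAt_right_eq_neg_left_of_integrable
    (μ := (volume : Measure X)) (B := ContinuousLinearMap.mul ℝ ℂ) (f := fun x => η x) (g := f)
    (f' := fun x => ∂_{bvec j} η x) (g' := pd j f) (v := bvec j)
    (hint _ hf.memLp) (hint _ (Reg.memLp (hf.2.2 j))) (hint _ hf.memLp)
    (fun x _ => h1 x) (fun x _ => h2 x)
  simp only [ContinuousLinearMap.mul_apply'] at h
  rw [h, ← integral_neg]
  congr 1; ext x
  rw [neg_apply, neg_mul]

/-- Classical regularity implies Sobolev regularity. -/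
theorem Reg.memSobolev {W : Weight} {k : ℕ} : ∀ {f : X → ℂ} (hf : Reg W k f),
    MemSobolev k 2 (L2.toD (hf.memLp.toLp f)) := by
  induction k with
  | zero => exact fun hf => by rw [Nat.cast_zero]; exact toD_memSobolev _
  | succ k ih =>
    intro f hf
    push_cast
    refine memSobolev_succ (ih hf.of_succ) fun j => ?_
    rw [lineDeriv_toLp (hf.mono (Nat.le_add_left 1 k)) j]
    exact ih (hf.2.2 j)

theorem Reg.mem_Hs {W : Weight} {k : ℕ} {f : X → ℂ} (hf : Reg W k f) {s : ℝ} (hs : s ≤ k) :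
    hf.memLp.toLp f ∈ Hs s := mem_Hs_mono hs hf.memSobolev

/-- Sobolev regularity implies classical regularity, with a loss of two derivatives. -/
theorem exists_reg_of_memSobolev {k : ℕ} : ∀ {u : L2} (_ : MemSobolev (k + 2) 2 u.toD),
    ∃ f : X → ℂ, Reg Weight.one k f ∧ u =ᵐ[volume] f := by
  have base : ∀ {u : L2} (_ : MemSobolev 2 2 u.toD),
      ∃ f : X → ℂ, Reg0 Weight.one f ∧ u =ᵐ[volume] f := by
    intro u hu
    obtain ⟨v, -, h⟩ := exists_fourier_repr (u := u) hu
    refine ⟨Real.Lp.fourierTransformInv v, ⟨(Real.Lp.fourierTransformInv v).continuous,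
      ⟨‖Real.Lp.fourierTransformInv v‖, fun x => ?_⟩, ?_⟩, h⟩
    · simp only [Weight.one, one_mul]
      exact (Real.Lp.fourierTransformInv v).norm_coe_le_norm x
    · simp only [Weight.one, one_smul]
      exact (memLp_congr_ae h).1 (Lp.memLp u)
  induction k with
  | zero => exact fun hu => base (by simpa using hu)
  | succ k ih =>
    intro u hu
    have hd : ∀ j, MemSobolev (k + 2) 2 (∂_{bvec j} u.toD) := fun j => by
      have := hu.lineDerivOp (m := bvec j)
      have e : ((k + 1 : ℕ) : ℝ) + 2 - 1 = k + 2 := by push_cast; ring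
      rwa [e] at this
    have hu2 : MemSobolev 2 2 u.toD := hu.mono (by push_cast; linarith [k.cast_nonneg (α := ℝ)])
    have h0 : ∀ j, ∃ w : L2, ∂_{bvec j} u.toD = w.toD := fun j =>
      memSobolev_zero_iff.1 ((hd j).mono (by positivity))
    choose w hw using h0
    have hw2 : ∀ j, MemSobolev (k + 2) 2 (w j).toD := fun j => hw j ▸ hd j
    choose h hh hwh using fun j => ih (hw2 j)
    obtain ⟨f, hf, huf⟩ := base hu2
    obtain ⟨h1, h2⟩ := exists_hasFDerivAt_repr (u := u) hu2 (w := w)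
      (fun j => (hw2 j).mono (by linarith [k.cast_nonneg (α := ℝ)])) hw hf.1 huf
      (fun j => (hh j).continuous) hwh
    refine ⟨f, ⟨hf, h1, fun j => ?_⟩, huf⟩
    have : pd j f = h j := funext fun x => h2 j x
    rw [this]; exact hh j

/-! ### Functions of the radius -/

/-- The Taylor coefficients of the `n`-th derivative of `t ↦ cosh √t`. -/
def coshCoeff : ℕ → ℕ → ℝ
  | 0, j => ((2 * j).factorial : ℝ)⁻¹
  | n + 1, j => (j + 1) * coshCoeff n (j + 1)

theorem coshCoeff_nonneg (n : ℕ) : ∀ j, 0 ≤ coshCoeff n j := by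
  induction n with
  | zero => intro j; simp only [coshCoeff]; positivity
  | succ n ih => intro j; simp only [coshCoeff]; exact mul_nonneg (by positivity) (ih _)

/-- Uniform bounds in `n`, so that all the derivatives of `cosh √t` are dominated by `cosh √|t|`. -/
theorem coshCoeff_le (n : ℕ) : ∀ j, coshCoeff n j ≤ ((2 * j).factorial : ℝ)⁻¹ := by
  induction n with
  | zero => intro j; exact le_rfl
  | succ n ih =>
    intro j
    simp only [coshCoeff]
    refine (mul_le_mul_of_nonneg_left (ih (j + 1)) (by positivity)).trans ?_
    have e : 2 * (j + 1) = 2 * j + 1 + 1 := by ring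
    rw [e, Nat.factorial_succ, Nat.factorial_succ]
    push_cast
    have : (0 : ℝ) < (2 * j).factorial := by exact_mod_cast Nat.factorial_pos _
    rw [← div_eq_mul_inv, div_le_iff₀ (by positivity)]
    have : ((2 * j).factorial : ℝ)⁻¹ * ((2 * j + 1 + 1) * ((2 * j + 1) * (2 * j).factorial)) =
      (2 * j + 1 + 1) * (2 * j + 1) := by field_simp
    rw [this]
    nlinarith [(j.cast_nonneg : (0 : ℝ) ≤ j)]

/-- The `n`-th derivative of the entire function `t ↦ cosh √t`. -/
def coshSqrt (n : ℕ) (t : ℝ) : ℝ := ∑' j, coshCoeff n j * t ^ j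

theorem summable_coshCoeff (n : ℕ) (t : ℝ) : Summable fun j => coshCoeff n j * t ^ j := by
  have h := (Real.hasSum_cosh (Real.sqrt |t|)).summable
  refine Summable.of_norm_bounded h fun j => ?_
  rw [norm_mul, norm_pow, Real.norm_of_nonneg (coshCoeff_nonneg n j), pow_mul,
    Real.sq_sqrt (abs_nonneg t), Real.norm_eq_abs, div_eq_inv_mul]
  gcongr
  exact coshCoeff_le n j

theorem abs_coshSqrt_le (n : ℕ) (r : ℝ) : |coshSqrt n (r ^ 2)| ≤ Real.cosh r := by
  have h0 : 0 ≤ coshSqrt n (r ^ 2) :=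
    tsum_nonneg fun j => mul_nonneg (coshCoeff_nonneg n j) (by positivity)
  rw [abs_of_nonneg h0, Real.cosh_eq_tsum]
  refine (summable_coshCoeff n _).tsum_le_tsum (fun j => ?_) (Real.hasSum_cosh r).summable
  rw [← pow_mul, div_eq_inv_mul]
  have : (0 : ℝ) ≤ r ^ (2 * j) := by rw [pow_mul]; positivity
  gcongr
  exact coshCoeff_le n j

theorem coshSqrt_zero_sq (r : ℝ) : coshSqrt 0 (r ^ 2) = Real.cosh r := by
  rw [Real.cosh_eq_tsum, coshSqrt]
  congr 1; ext j
  simp only [coshCoeff]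
  rw [← pow_mul, div_eq_inv_mul]

theorem hasDerivAt_coshSqrt (n : ℕ) (t : ℝ) :
    HasDerivAt (coshSqrt n) (coshSqrt (n + 1) t) t := by
  have hs := summable_coshCoeff (n + 1) (|t| + 1)
  have h := hasDerivAt_tsum_of_isPreconnected (𝕜 := ℝ)
    (g := fun j t => coshCoeff n (j + 1) * t ^ (j + 1))
    (g' := fun j t => coshCoeff n (j + 1) * ((j + 1 : ℕ) * t ^ j))
    (u := fun j => coshCoeff (n + 1) j * (|t| + 1) ^ j) (t := Metric.ball 0 (|t| + 1)) (y₀ := 0)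
    (y := t) hs Metric.isOpen_ball (convex_ball _ _).isPreconnected
    (fun j y _ => by simpa using (hasDerivAt_pow (j + 1) y).const_mul (coshCoeff n (j + 1)))
    (fun j y hy => by
      rw [mem_ball_zero_iff, Real.norm_eq_abs] at hy
      rw [norm_mul, norm_mul, norm_pow, Real.norm_of_nonneg (coshCoeff_nonneg _ _),
        Real.norm_of_nonneg (by positivity : (0 : ℝ) ≤ (j + 1 : ℕ)), Real.norm_eq_abs]
      simp only [coshCoeff]
      push_cast
      have := coshCoeff_nonneg n (j + 1)
      have h2 : |y| ^ j ≤ (|t| + 1) ^ j := by gcongr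
      calc coshCoeff n (j + 1) * ((j + 1) * |y| ^ j)
          ≤ coshCoeff n (j + 1) * ((j + 1) * (|t| + 1) ^ j) := by gcongr
        _ = _ := by ring)
    (by simp; positivity) (by simp [summable_zero]) (by simp)
  have e : coshSqrt n = fun z => coshCoeff n 0 + ∑' j, coshCoeff n (j + 1) * z ^ (j + 1) := by
    ext1 z
    rw [coshSqrt, (summable_coshCoeff n z).tsum_eq_zero_add]
    simp
  rw [e]
  refine (h.const_add (coshCoeff n 0)).congr_deriv ?_
  rw [coshSqrt]
  congr 1; ext j
  simp only [coshCoeff]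
  push_cast; ring

/-- Partial derivatives of a function of `|x|²`; these functions are differentiable at the origin
too. -/
theorem pd_radial {F : ℝ → ℝ} {F' : ℝ → ℝ} (hF : ∀ t, HasDerivAt F (F' t) t) (c : ℝ) (j : Fin 3) :
    Differentiable ℝ (fun x : X => F (c * ‖x‖ ^ 2)) ∧
    pd j (fun x : X => F (c * ‖x‖ ^ 2)) = fun x => (2 * c * x j) * F' (c * ‖x‖ ^ 2) := by
  have h : ∀ x : X, HasFDerivAt (fun x : X => F (c * ‖x‖ ^ 2))
      (F' (c * ‖x‖ ^ 2) • (c • (2 • (innerSL ℝ x)))) x := fun x => by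
    have h1 : HasFDerivAt (fun x : X => c * ‖x‖ ^ 2) (c • (2 • (innerSL ℝ x))) x :=
      (HasStrictFDerivAt.hasFDerivAt (hasStrictFDerivAt_norm_sq x)).const_mul c
    exact (hF _).comp_hasFDerivAt x h1
  refine ⟨fun x => (h x).differentiableAt, funext fun x => ?_⟩
  rw [pd, (h x).fderiv]
  simp [bvec, EuclideanSpace.inner_single_right]
  ring

theorem abs_coord_le (x : X) (j : Fin 3) : |x j| ≤ ‖x‖ := by
  simpa using PiLp.norm_apply_le x j

/-- The coordinates grow slower than any exponential. -/
theorem mbdd_coord {ε : ℝ} (hε : 0 < ε) (j : Fin 3) (k : ℕ) :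
    MBdd (fun x => Real.exp (ε * ‖x‖)) (fun _ => 1) k (fun x => x j) := by
  have h1 : ∀ x : X, 1 ≤ Real.exp (ε * ‖x‖) := fun x => Real.one_le_exp (by positivity)
  have hc : ∀ (c : ℝ) (k : ℕ), MBdd (fun x : X => Real.exp (ε * ‖x‖)) (fun _ => 1) k
      (fun _ => c) := by
    intro c k
    have base : ∀ c : ℝ, MBdd (fun x : X => Real.exp (ε * ‖x‖)) (fun _ => 1) 0 (fun _ => c) :=
      fun c => ⟨continuous_const, ‖c‖, fun x => by
        rw [one_mul]; exact le_mul_of_one_le_right (norm_nonneg _) (h1 x)⟩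
    induction k generalizing c with
    | zero => exact base c
    | succ k ih =>
      refine ⟨base c, differentiable_const c, fun i => ?_⟩
      convert ih 0 using 1
      ext x; simp [pd]
  have base : MBdd (fun x => Real.exp (ε * ‖x‖)) (fun _ => 1) 0 (fun x => x j) := by
    refine ⟨by fun_prop, ε⁻¹, fun x => ?_⟩
    rw [one_mul, Real.norm_eq_abs, inv_mul_eq_div, le_div_iff₀ hε]
    have := Real.add_one_le_exp (ε * ‖x‖)
    have h2 := abs_coord_le x j
    nlinarith
  cases k with
  | zero => exact base
  | succ k =>
    have hd : Differentiable ℝ (fun x : X => x j) := by fun_prop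
    refine ⟨base, hd, fun i => ?_⟩
    have : pd i (fun x : X => x j) = fun _ => bvec i j := by
      ext1 x
      exact congrArg (fun L : X →L[ℝ] ℝ => L (bvec i))
        (EuclideanSpace.proj j : X →L[ℝ] ℝ).hasFDerivAt.fderiv
    rw [this]
    exact hc _ k

/-- The functions of the radius which occur in the derivatives of `cosh(γ|x|)`. Every derivative
produces a factor `x_j`, which is absorbed by a small increase of the exponential rate. -/
theorem mbdd_coshSqrt {γ : ℝ} (hγ : 0 < γ) (k : ℕ) : ∀ (n : ℕ) {γ' : ℝ}, γ < γ' →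
    MBdd (fun x => Real.exp (γ' * ‖x‖)) (fun _ => 1) k
      (fun x : X => coshSqrt n (γ ^ 2 * ‖x‖ ^ 2)) := by
  have base : ∀ (n : ℕ) {γ' : ℝ}, γ < γ' → MBdd (fun x => Real.exp (γ' * ‖x‖)) (fun _ => 1) 0
      (fun x : X => coshSqrt n (γ ^ 2 * ‖x‖ ^ 2)) := by
    intro n γ' h
    refine ⟨((pd_radial (hasDerivAt_coshSqrt n) (γ ^ 2) 0).1).continuous, 1, fun x => ?_⟩
    show 1 * ‖coshSqrt n (γ ^ 2 * ‖x‖ ^ 2)‖ ≤ 1 * Real.exp (γ' * ‖x‖)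
    rw [one_mul, one_mul, ← mul_pow, Real.norm_eq_abs]
    refine (abs_coshSqrt_le n _).trans ?_
    rw [Real.cosh_eq, div_le_iff₀ two_pos]
    have h1 : Real.exp (γ * ‖x‖) ≤ Real.exp (γ' * ‖x‖) := by gcongr
    have h2 : Real.exp (-(γ * ‖x‖)) ≤ Real.exp (γ * ‖x‖) := by
      have : 0 ≤ γ * ‖x‖ := by positivity
      gcongr; linarith
    linarith
  induction k with
  | zero => exact base
  | succ k ih =>
    intro n γ' h
    refine ⟨base n h, (pd_radial (hasDerivAt_coshSqrt n) (γ ^ 2) 0).1, fun j => ?_⟩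
    rw [(pd_radial (hasDerivAt_coshSqrt n) (γ ^ 2) j).2]
    have h1 := MBdd.mul (fun _ => zero_le_one) (fun _ => zero_le_one)
      (mbdd_coord (ε := (γ' - γ) / 2) (by linarith) j k)
      (ih (n + 1) (γ' := (γ + γ') / 2) (by linarith))
    have e1 : (fun x : X => Real.exp ((γ' - γ) / 2 * ‖x‖) * Real.exp ((γ + γ') / 2 * ‖x‖)) =
        fun x => Real.exp (γ' * ‖x‖) := by
      ext x; rw [← Real.exp_add]; ring_nf
    simp only [mul_one] at h1
    rw [e1] at h1
    have e2 : (fun x : X => 2 * γ ^ 2 * x j * coshSqrt (n + 1) (γ ^ 2 * ‖x‖ ^ 2)) =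
        fun x => (2 * γ ^ 2) * (x j * coshSqrt (n + 1) (γ ^ 2 * ‖x‖ ^ 2)) := by
      ext x; ring
    rw [e2]
    have hconst : MBdd (fun _ => 1) (fun _ => 1) k (fun _ : X => 2 * γ ^ 2) := by
      have base : ∀ c : ℝ, MBdd (fun _ : X => 1) (fun _ => 1) 0 (fun _ => c) :=
        fun c => ⟨continuous_const, ‖c‖, fun x => by simp⟩
      generalize 2 * γ ^ 2 = c
      clear h1 ih e1 e2
      induction k generalizing c with
      | zero => exact base c
      | succ k ih =>
        refine ⟨base c, differentiable_const c, fun i => ?_⟩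
        convert ih 0 using 1
        ext x; simp [pd]
    simpa only [one_mul] using MBdd.mul (fun _ => zero_le_one) (fun _ => zero_le_one) hconst h1

/-- `cosh(γ|x|)` is a multiplier of all orders from any weight growing faster. -/
theorem mbdd_cosh {γ γ' : ℝ} (hγ : 0 < γ) (h : γ < γ') (k : ℕ) :
    MBdd (fun x => Real.exp (γ' * ‖x‖)) (fun _ => 1) k (fun x : X => Real.cosh (γ * ‖x‖)) := by
  have := mbdd_coshSqrt hγ k 0 h
  simpa only [← mul_pow, coshSqrt_zero_sq] using this

end NLS

end

noncomputable section

namespace NLS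

/-! ### The exponential weight -/

theorem hasDerivAt_tanh (t : ℝ) : HasDerivAt Real.tanh (1 - Real.tanh t ^ 2) t := by
  have h := (Real.hasDerivAt_sinh t).div (Real.hasDerivAt_cosh t) (Real.cosh_pos t).ne'
  have e : Real.tanh = fun t => Real.sinh t / Real.cosh t :=
    funext fun t => Real.tanh_eq_sinh_div_cosh t
  rw [e]
  refine h.congr_deriv ?_
  have := (Real.cosh_pos t).ne'
  field_simp

theorem hasDerivAt_sech (t : ℝ) :
    HasDerivAt (fun t => (Real.cosh t)⁻¹) (-Real.tanh t * (Real.cosh t)⁻¹) t := by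
  refine ((Real.hasDerivAt_cosh t).inv (Real.cosh_pos t).ne').congr_deriv ?_
  rw [Real.tanh_eq_sinh_div_cosh]
  have := (Real.cosh_pos t).ne'
  field_simp

theorem hasDerivAt_cosh' (t : ℝ) : HasDerivAt Real.cosh (Real.tanh t * Real.cosh t) t := by
  refine (Real.hasDerivAt_cosh t).congr_deriv ?_
  rw [Real.tanh_eq_sinh_div_cosh, div_mul_cancel₀ _ (Real.cosh_pos t).ne']

theorem abs_tanh_le_one (t : ℝ) : |Real.tanh t| ≤ 1 := by
  rw [Real.tanh_eq_sinh_div_cosh, abs_div, abs_of_pos (Real.cosh_pos t),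
    div_le_one (Real.cosh_pos t), abs_le]
  constructor
  · rw [Real.sinh_eq, Real.cosh_eq]
    linarith [Real.exp_pos t, Real.exp_pos (-t)]
  · exact (Real.sinh_lt_cosh t).le

open Polynomial in
/-- The functions `P(tanh) s`, `P` a polynomial, are closed under differentiation, because `tanh' =
1 - tanh²`. -/
theorem iteratedDeriv_tanh_mul {s : ℝ → ℝ} {c : ℝ[X]}
    (hs : ∀ t, HasDerivAt s (c.eval (Real.tanh t) * s t) t) (n : ℕ) : ∀ P : ℝ[X], ∃ Q : ℝ[X],
    iteratedDeriv n (fun t => P.eval (Real.tanh t) * s t) =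
      fun t => Q.eval (Real.tanh t) * s t := by
  induction n with
  | zero => exact fun P => ⟨P, by rw [iteratedDeriv_zero]⟩
  | succ n ih =>
    intro P
    obtain ⟨Q, hQ⟩ := ih (P.derivative * (1 - Polynomial.X ^ 2) + P * c)
    refine ⟨Q, ?_⟩
    rw [iteratedDeriv_succ', ← hQ]
    congr 1
    ext1 t
    have h := ((P.hasDerivAt (Real.tanh t)).comp t (hasDerivAt_tanh t)).mul (hs t)
    rw [show (fun t => P.eval (Real.tanh t) * s t) =
      ((fun y => P.eval y) ∘ Real.tanh) * s from rfl, h.deriv]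
    simp
    ring

open Polynomial in
/-- Polynomials in `tanh` multiplied by `s = 1` or `s = sech` are smooth with bounded
derivatives. -/
theorem bddSmooth_tanh_mul {s : ℝ → ℝ} {c : ℝ[X]} (hsm : ContDiff ℝ ∞ s)
    (hs : ∀ t, HasDerivAt s (c.eval (Real.tanh t) * s t) t) (hb : ∀ t, |s t| ≤ 1) (P : ℝ[X])
    (a : ℝ) (j : Fin 3) :
    BddSmooth fun x => ((P.eval (Real.tanh (a * x j)) * s (a * x j) : ℝ) : ℂ) := by
  have htanh : ContDiff ℝ ∞ Real.tanh := by
    have e : Real.tanh = fun t => Real.sinh t / Real.cosh t :=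
      funext fun t => Real.tanh_eq_sinh_div_cosh t
    rw [e]
    exact Real.contDiff_sinh.div Real.contDiff_cosh fun t => (Real.cosh_pos t).ne'
  set f : ℝ → ℝ := fun t => P.eval (Real.tanh t) * s t with hf
  have hfs : ContDiff ℝ ∞ f := by
    refine ContDiff.mul ?_ hsm
    have := (Polynomial.contDiff_aeval P ∞).comp htanh
    simpa [Function.comp_def] using! this
  set L : X →L[ℝ] ℝ := a • (EuclideanSpace.proj j : X →L[ℝ] ℝ) with hL
  have e : (fun x : X => ((f (a * x j) : ℝ) : ℂ)) = Complex.ofRealLI ∘ (f ∘ L) := by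
    ext x; simp [L]
  change BddSmooth fun x => ((f (a * x j) : ℝ) : ℂ)
  rw [e]
  have hfL : ContDiff ℝ ∞ (f ∘ L) := hfs.comp L.contDiff
  refine ⟨Complex.ofRealLI.contDiff.comp hfL, fun n => ?_⟩
  obtain ⟨Q, hQ⟩ := iteratedDeriv_tanh_mul hs n P
  obtain ⟨C, hC⟩ := (isCompact_Icc (a := (-1 : ℝ)) (b := 1)).exists_bound_of_continuousOn
    Q.continuous.continuousOn
  refine ⟨C * ‖L‖ ^ n, fun x => ?_⟩
  rw [LinearIsometry.norm_iteratedFDeriv_comp_left _ (hfL.contDiffAt)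
    (by exact_mod_cast le_top), ContinuousLinearMap.iteratedFDeriv_comp_right L hfs x
    (by exact_mod_cast le_top)]
  refine (ContinuousMultilinearMap.norm_compContinuousLinearMap_le _ _).trans ?_
  rw [norm_iteratedFDeriv_eq_norm_iteratedDeriv, hf, hQ, Finset.prod_const, Finset.card_univ,
    Fintype.card_fin, norm_mul]
  gcongr
  have h1 := hC (Real.tanh (L x)) (abs_le.1 (abs_tanh_le_one _))
  exact (mul_le_of_le_one_right (norm_nonneg _) (hb _)).trans h1

theorem bddSmooth_sech (a : ℝ) (j : Fin 3) :
    BddSmooth fun x => (((Real.cosh (a * x j))⁻¹ : ℝ) : ℂ) := by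
  have := bddSmooth_tanh_mul (s := fun t => (Real.cosh t)⁻¹) (c := -Polynomial.X)
    (Real.contDiff_cosh.inv fun t => (Real.cosh_pos t).ne') (fun t => by
      simpa using hasDerivAt_sech t) (fun t => by
      rw [abs_of_pos (inv_pos.2 (Real.cosh_pos t))]
      exact inv_le_one_of_one_le₀ (Real.one_le_cosh t)) 1 a j
  simpa using this

open Polynomial in
theorem bddSmooth_tanh (P : ℝ[X]) (a : ℝ) (j : Fin 3) :
    BddSmooth fun x => ((P.eval (Real.tanh (a * x j)) : ℝ) : ℂ) := by
  have := bddSmooth_tanh_mul (s := fun _ => 1) (c := 0) contDiff_const (fun t => by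
      simpa using hasDerivAt_const t (1 : ℝ)) (fun t => by simp) P a j
  simpa using this

/-- The weight `W(x) = ∏ⱼ cosh(a xⱼ)`. -/
def expWeight (a : ℝ) : Weight where
  toFun x := ∏ j, Real.cosh (a * x j)
  continuous := by fun_prop
  one_le x := by
    rw [Fin.prod_univ_three]
    exact one_le_mul_of_one_le_of_one_le (one_le_mul_of_one_le_of_one_le (Real.one_le_cosh _)
      (Real.one_le_cosh _)) (Real.one_le_cosh _)

/-- The inverse `ρ(x) = ∏ⱼ sech(a xⱼ)` of the weight. -/
def sechProd (a : ℝ) (x : X) : ℝ := ∏ j, (Real.cosh (a * x j))⁻¹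

theorem expWeight_mul_sechProd (a : ℝ) (x : X) : expWeight a x * sechProd a x = 1 := by
  rw [sechProd, expWeight, ← Finset.prod_mul_distrib]
  exact Finset.prod_eq_one fun j _ => mul_inv_cancel₀ (Real.cosh_pos _).ne'

theorem sechProd_pos (a : ℝ) (x : X) : 0 < sechProd a x :=
  Finset.prod_pos fun j _ => inv_pos.2 (Real.cosh_pos _)

theorem bddSmooth_sechProd (a : ℝ) : BddSmooth fun x => (sechProd a x : ℂ) := by
  have := BddSmooth.prod (Finset.univ : Finset (Fin 3)) (fun i _ => bddSmooth_sech a i)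
  simpa [sechProd] using this

theorem pd_prod {s c : ℝ → ℝ} (hs : ∀ t, HasDerivAt s (c t * s t) t) (a : ℝ) :
    Differentiable ℝ (fun x : X => ∏ j, s (a * x j)) ∧
    ∀ i, pd i (fun x : X => ∏ j, s (a * x j)) = fun x => (a * c (a * x i)) * ∏ j, s (a * x j) := by
  have h1 : ∀ (j : Fin 3) (x : X), HasFDerivAt (fun x : X => s (a * x j))
      ((c (a * x j) * s (a * x j)) • (a • (EuclideanSpace.proj j : X →L[ℝ] ℝ))) x := fun j x => by
    have h2 : HasFDerivAt (fun x : X => a * x j) (a • (EuclideanSpace.proj j : X →L[ℝ] ℝ)) x :=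
      (EuclideanSpace.proj j : X →L[ℝ] ℝ).hasFDerivAt.const_mul a
    exact (hs _).comp_hasFDerivAt x h2
  have e : (fun x : X => ∏ j, s (a * x j)) =
      fun x => s (a * x 0) * s (a * x 1) * s (a * x 2) := by
    ext x; rw [Fin.prod_univ_three]
  have h2 := fun x => ((h1 0 x).mul (h1 1 x)).mul (h1 2 x)
  rw [e]
  refine ⟨fun x => (h2 x).differentiableAt, fun i => funext fun x => ?_⟩
  rw [pd]
  erw [(h2 x).fderiv]
  rw [Fin.prod_univ_three]
  fin_cases i <;> simp [bvec] <;> ring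

theorem BddSmooth.mbdd {b : X → ℝ} (hb : BddSmooth fun x => (b x : ℂ)) (k : ℕ) :
    MBdd (fun _ => 1) (fun _ => 1) k b := by
  have base : ∀ {b : X → ℝ}, BddSmooth (fun x => (b x : ℂ)) → Differentiable ℝ b ∧
      MBdd (fun _ => 1) (fun _ => 1) 0 b ∧ ∀ j, BddSmooth (fun x => ((pd j b x : ℝ) : ℂ)) := by
    intro b hb
    have e : b = fun x => Complex.reCLM (b x : ℂ) := by ext x; simp
    have hd : Differentiable ℝ b := by
      rw [e]; exact Complex.reCLM.differentiable.comp hb.differentiable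
    obtain ⟨C, hC⟩ := hb.bdd
    refine ⟨hd, ⟨hd.continuous, C, fun x => by simpa using hC x⟩, fun j => ?_⟩
    have := hb.deriv (bvec j)
    have e2 : (fun x => fderiv ℝ (fun x => (b x : ℂ)) x (bvec j)) =
        fun x => ((pd j b x : ℝ) : ℂ) := by
      ext1 x
      have h := (Complex.ofRealCLM.hasFDerivAt.comp x (hd x).hasFDerivAt).fderiv
      exact congrArg (fun L : X →L[ℝ] ℂ => L (bvec j)) h
    rwa [e2] at this
  induction k generalizing b with
  | zero => exact (base hb).2.1
  | succ k ih => exact ⟨(base hb).2.1, (base hb).1, fun j => ih ((base hb).2.2 j)⟩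

/-- A function whose logarithmic derivatives `∂_j b / b` are bounded with all their derivatives
satisfies the same bounds as its derivatives of order `0`. -/
theorem MBdd.of_logDeriv {U₁ U₂ : X → ℝ} (hU : ∀ x, 0 ≤ U₂ x) {b : X → ℝ} {c : Fin 3 → X → ℝ}
    (hd : Differentiable ℝ b) (hpd : ∀ j, pd j b = fun x => c j x * b x)
    (hc : ∀ j k, MBdd (fun _ => 1) (fun _ => 1) k (c j)) (h0 : MBdd U₁ U₂ 0 b) (k : ℕ) :
    MBdd U₁ U₂ k b := by
  induction k with
  | zero => exact h0
  | succ k ih =>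
    refine ⟨h0, hd, fun j => ?_⟩
    rw [hpd]
    simpa only [one_mul] using MBdd.mul (fun _ => zero_le_one) hU (hc j k) ih

open Polynomial in
theorem mbdd_tanh (a b : ℝ) (j : Fin 3) (k : ℕ) :
    MBdd (fun _ => 1) (fun _ => 1) k fun x => b * Real.tanh (a * x j) :=
  BddSmooth.mbdd (by
    have := bddSmooth_tanh (C b * Polynomial.X) a j
    simpa only [eval_mul, eval_C, eval_X] using this) k

theorem differentiable_sechProd (a : ℝ) : Differentiable ℝ (sechProd a) := (pd_prod hasDerivAt_sech a).1

theorem pd_sechProd (a : ℝ) (j : Fin 3) :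
    pd j (sechProd a) = fun x => (-a * Real.tanh (a * x j)) * sechProd a x := by
  have := (pd_prod hasDerivAt_sech a).2 j
  refine Eq.trans this (funext fun x => ?_)
  rw [sechProd]; ring

theorem mbdd_sechProd (a : ℝ) (k : ℕ) : MBdd Weight.one (expWeight a) k (sechProd a) := by
  refine MBdd.of_logDeriv (fun x => ((expWeight a).pos x).le) (differentiable_sechProd a)
    (pd_sechProd a) (fun j k => mbdd_tanh _ _ j k) ⟨(differentiable_sechProd a).continuous, 1,
      fun x => ?_⟩ k
  rw [Real.norm_of_nonneg (sechProd_pos a x).le, expWeight_mul_sechProd]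
  simp [Weight.one]

theorem mbdd_expWeight (a : ℝ) (k : ℕ) : MBdd (expWeight a) Weight.one k (expWeight a) := by
  refine MBdd.of_logDeriv (fun x => (Weight.one.pos x).le) (pd_prod hasDerivAt_cosh' a).1
    (pd_prod hasDerivAt_cosh' a).2 (fun j k => mbdd_tanh _ _ j k) ⟨(expWeight a).continuous, 1,
      fun x => ?_⟩ k
  have : ‖∏ j, Real.cosh (a * x j)‖ = expWeight a x := Real.norm_of_nonneg ((expWeight a).pos x).le
  rw [this]
  simp [Weight.one]

/-- The weight dominates `e^{a|x|}` up to a constant. -/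
theorem exp_le_expWeight {a : ℝ} (ha : 0 ≤ a) (x : X) :
    Real.exp (a * ‖x‖) ≤ 8 * expWeight a x := by
  have h1 : ‖x‖ ≤ |x 0| + |x 1| + |x 2| := by
    rw [EuclideanSpace.norm_eq, Real.sqrt_le_left (by positivity)]
    simp only [Fin.sum_univ_three, Real.norm_eq_abs]
    nlinarith [abs_nonneg (x 0), abs_nonneg (x 1), abs_nonneg (x 2),
      mul_nonneg (abs_nonneg (x 0)) (abs_nonneg (x 1)),
      mul_nonneg (abs_nonneg (x 0)) (abs_nonneg (x 2)),
      mul_nonneg (abs_nonneg (x 1)) (abs_nonneg (x 2))]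
  have h2 : ∀ j, Real.exp (a * |x j|) ≤ 2 * Real.cosh (a * x j) := fun j => by
    rw [← Real.cosh_abs, abs_mul, abs_of_nonneg ha, Real.cosh_eq]
    linarith [Real.exp_pos (-(a * |x j|))]
  calc Real.exp (a * ‖x‖) ≤ Real.exp (a * |x 0| + a * |x 1| + a * |x 2|) := by
        gcongr; nlinarith
    _ = Real.exp (a * |x 0|) * Real.exp (a * |x 1|) * Real.exp (a * |x 2|) := by
        rw [Real.exp_add, Real.exp_add]
    _ ≤ (2 * Real.cosh (a * x 0)) * (2 * Real.cosh (a * x 1)) * (2 * Real.cosh (a * x 2)) := by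
        gcongr <;> exact h2 _
    _ = 8 * expWeight a x := by
        rw [expWeight]; simp only [Fin.prod_univ_three]; ring

/-! ### Multiplication operators on `L²` -/

theorem memLp_mul_bdd {b : X → ℂ} (hb : AEStronglyMeasurable b volume)
    {C : ℝ} (hC : ∀ x, ‖b x‖ ≤ C) (u : L2) :
    MemLp (fun x => b x * u x) 2 (volume : Measure X) :=
  MemLp.of_le_mul (c := C) (Lp.memLp u) (hb.mul (Lp.aestronglyMeasurable u))
    (Eventually.of_forall fun x => by rw [norm_mul]; gcongr; exact hC x)

/-- Multiplication by a bounded measurable function. -/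
def mulOp (b : X → ℂ) (C : ℝ) (hb : AEStronglyMeasurable b volume) (hC : ∀ x, ‖b x‖ ≤ C) :
    L2 →L[ℂ] L2 :=
  LinearMap.mkContinuous
    { toFun := fun u => (memLp_mul_bdd hb hC u).toLp _
      map_add' := fun u v => by
        rw [← MemLp.toLp_add]
        apply MemLp.toLp_congr
        filter_upwards [Lp.coeFn_add u v] with x h
        simp only [h, Pi.add_apply, mul_add]
      map_smul' := fun c u => by
        rw [RingHom.id_apply, ← MemLp.toLp_const_smul]
        apply MemLp.toLp_congr
        filter_upwards [Lp.coeFn_smul c u] with x h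
        simp only [h, Pi.smul_apply, smul_eq_mul]
        ring } C fun u => by
      refine Lp.norm_le_mul_norm_of_ae_le_mul ?_
      filter_upwards [(memLp_mul_bdd hb hC u).coeFn_toLp] with x hx
      refine (congrArg norm hx).trans_le ?_
      rw [norm_mul]; gcongr; exact hC x

section MulOp

variable {b c : X → ℂ} {C D : ℝ} {hb : AEStronglyMeasurable b volume} {hC : ∀ x, ‖b x‖ ≤ C}
  {hc : AEStronglyMeasurable c volume} {hD : ∀ x, ‖c x‖ ≤ D}

theorem mulOp_coe (u : L2) : mulOp b C hb hC u =ᵐ[volume] fun x => b x * u x :=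
  (memLp_mul_bdd hb hC u).coeFn_toLp

theorem norm_mulOp_le : ‖mulOp b C hb hC‖ ≤ C := by
  have h0 : 0 ≤ C := (norm_nonneg _).trans (hC 0)
  exact LinearMap.mkContinuous_norm_le _ h0 _

end MulOp

/-- Multiplication by a smooth function with bounded derivatives, as an operator on `L²`. -/
def smoothOp {b : X → ℂ} (hb : BddSmooth b) : L2 →L[ℂ] L2 :=
  mulOp b hb.bdd.choose hb.1.continuous.aestronglyMeasurable hb.bdd.choose_spec

theorem smoothOp_coe {b : X → ℂ} (hb : BddSmooth b) (u : L2) :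
    smoothOp hb u =ᵐ[volume] fun x => b x * u x := mulOp_coe u

theorem smoothOp_toD {b : X → ℂ} (hb : BddSmooth b) (u : L2) :
    (smoothOp hb u).toD = smulLeftCLM ℂ b u.toD := by
  rw [smulLeft_toD hb]; rfl

theorem norm_smoothOp_le {b : X → ℂ} (hb : BddSmooth b) {C : ℝ} (hC : ∀ x, ‖b x‖ ≤ C) :
    ‖smoothOp hb‖ ≤ C := by
  have e : smoothOp hb = mulOp b C hb.1.continuous.aestronglyMeasurable hC := by
    ext1 u; exact Lp.ext ((mulOp_coe u).trans (mulOp_coe u).symm)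
  rw [e]; exact norm_mulOp_le

theorem smoothOp_mem {b : X → ℂ} (hb : BddSmooth b) {k : ℕ} {u : L2} (hu : u ∈ Hs k) :
    smoothOp hb u ∈ Hs k := by
  change MemSobolev _ 2 (smoothOp hb u).toD
  rw [smoothOp_toD]
  exact memSobolev_smulLeft k hb hu

theorem bddSmooth_schwartz (V : 𝓢(X, ℝ)) : BddSmooth fun x => (V x : ℂ) := by
  have hV : ContDiff ℝ ∞ V := V.smooth'
  refine ⟨Complex.ofRealLI.contDiff.comp hV, fun n => ?_⟩
  obtain ⟨C, hC⟩ := V.decay 0 n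
  refine ⟨C, fun x => ?_⟩
  have := hC.2 x
  rw [pow_zero, one_mul] at this
  refine le_trans (le_of_eq ?_) this
  exact LinearIsometry.norm_iteratedFDeriv_comp_left Complex.ofRealLI hV.contDiffAt
    (by exact_mod_cast le_top)

theorem potential_eq (V : 𝓢(X, ℝ)) (u : L2) : potential V u = smoothOp (bddSmooth_schwartz V) u :=
  Lp.ext ((memLp_potential_mul V u).coeFn_toLp.trans (smoothOp_coe _ u).symm)

theorem shifted_eq (V : 𝓢(X, ℝ)) (lam : ℂ) (u : Hs 2) :
    shifted V lam u = -laplacianL2 u + potential V u - lam • (u : L2) := rfl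

end NLS

end

noncomputable section

namespace NLS

/-! ### Exponential decay and regularity of solutions of `(H + κ²) u = f` -/

/-- `∂ⱼρ / ρ = -a tanh(a xⱼ)`. -/
def gradCoeff (a : ℝ) (j : Fin 3) (x : X) : ℝ := -a * Real.tanh (a * x j)

/-- `∂ⱼ²ρ / ρ = a² (2 tanh²(a xⱼ) - 1)`. -/
def lapCoeff (a : ℝ) (j : Fin 3) (x : X) : ℝ := a ^ 2 * (2 * Real.tanh (a * x j) ^ 2 - 1)

theorem bddSmooth_gradCoeff (a : ℝ) (j : Fin 3) : BddSmooth fun x => (gradCoeff a j x : ℂ) := by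
  have := bddSmooth_tanh (Polynomial.C (-a) * Polynomial.X) a j
  simp only [Polynomial.eval_mul, Polynomial.eval_C, Polynomial.eval_X] at this
  exact this

theorem bddSmooth_lapCoeff (a : ℝ) (j : Fin 3) : BddSmooth fun x => (lapCoeff a j x : ℂ) := by
  have := bddSmooth_tanh (Polynomial.C (a ^ 2) * (2 * Polynomial.X ^ 2 - 1)) a j
  simp only [Polynomial.eval_mul, Polynomial.eval_C, Polynomial.eval_X, Polynomial.eval_sub,
    Polynomial.eval_pow, Polynomial.eval_ofNat, Polynomial.eval_one] at this
  exact this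

theorem norm_gradCoeff_le {a : ℝ} (ha : 0 ≤ a) (j : Fin 3) (x : X) :
    ‖(gradCoeff a j x : ℂ)‖ ≤ a := by
  rw [Complex.norm_real, gradCoeff, norm_mul, norm_neg, Real.norm_of_nonneg ha]
  exact mul_le_of_le_one_right ha (abs_tanh_le_one _)

theorem norm_lapCoeff_le (a : ℝ) (j : Fin 3) (x : X) : ‖(lapCoeff a j x : ℂ)‖ ≤ a ^ 2 := by
  rw [Complex.norm_real, lapCoeff, norm_mul, Real.norm_of_nonneg (sq_nonneg a)]
  refine mul_le_of_le_one_right (sq_nonneg a) ?_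
  have h := abs_tanh_le_one (a * x j)
  have h2 : Real.tanh (a * x j) ^ 2 ≤ 1 := by
    rw [← sq_abs]; exact pow_le_one₀ (abs_nonneg _) h
  rw [Real.norm_eq_abs, abs_le]
  constructor <;> nlinarith [sq_nonneg (Real.tanh (a * x j))]

theorem fderiv_ofReal_comp {b : X → ℝ} (hb : Differentiable ℝ b) (x v : X) :
    fderiv ℝ (fun x => (b x : ℂ)) x v = ((fderiv ℝ b x v : ℝ) : ℂ) := by
  have h := (Complex.ofRealCLM.hasFDerivAt.comp x (hb x).hasFDerivAt).fderiv
  exact congrArg (fun L : X →L[ℝ] ℂ => L v) h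

theorem fderiv_sechProd (a : ℝ) (j : Fin 3) (x : X) :
    fderiv ℝ (fun x => (sechProd a x : ℂ)) x (bvec j) =
      (gradCoeff a j x : ℂ) * (sechProd a x : ℂ) := by
  rw [fderiv_ofReal_comp (differentiable_sechProd a), ← Complex.ofReal_mul]
  exact congrArg _ (congrFun (pd_sechProd a j) x)

theorem fderiv_fderiv_sechProd (a : ℝ) (j : Fin 3) (x : X) :
    fderiv ℝ (fun x => fderiv ℝ (fun x => (sechProd a x : ℂ)) x (bvec j)) x (bvec j) =
      (lapCoeff a j x : ℂ) * (sechProd a x : ℂ) := by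
  have e : (fun x => fderiv ℝ (fun x => (sechProd a x : ℂ)) x (bvec j)) =
      fun x => ((gradCoeff a j x * sechProd a x : ℝ) : ℂ) := by
    ext1 x; rw [fderiv_sechProd, Complex.ofReal_mul]
  have h1 : ∀ x, HasFDerivAt (gradCoeff a j)
      ((-a) • ((1 - Real.tanh (a * x j) ^ 2) • (a • (EuclideanSpace.proj j : X →L[ℝ] ℝ)))) x := by
    intro x
    have h2 : HasFDerivAt (fun x : X => a * x j) (a • (EuclideanSpace.proj j : X →L[ℝ] ℝ)) x :=
      (EuclideanSpace.proj j : X →L[ℝ] ℝ).hasFDerivAt.const_mul a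
    exact ((hasDerivAt_tanh _).comp_hasFDerivAt x h2).const_mul (-a)
  have h3 := fun x => (h1 x).mul (differentiable_sechProd a x).hasFDerivAt
  rw [e, fderiv_ofReal_comp (b := fun x => gradCoeff a j x * sechProd a x)
    (fun x => (h3 x).differentiableAt), ← Complex.ofReal_mul]
  congr 1
  erw [(h3 x).fderiv]
  have h4 : fderiv ℝ (sechProd a) x (bvec j) = (-a * Real.tanh (a * x j)) * sechProd a x :=
    congrFun (pd_sechProd a j) x
  simp only [bvec, EuclideanSpace.basisFun_apply] at h4
  simp [h4, bvec, gradCoeff, lapCoeff]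
  ring

/-- The first order perturbation produced by conjugating `-Δ` with the weight, composed with the
free resolvent. -/
def conjOp (a : ℝ) {κ : ℝ} (hκ : 0 < κ) : L2 →L[ℂ] L2 :=
  -∑ j, ((2 : ℂ) • (smoothOp (bddSmooth_gradCoeff a j) ∘L derivFreeRes hκ j) +
    smoothOp (bddSmooth_lapCoeff a j) ∘L freeRes hκ)

/-- The exponential rate `a` is small with respect to `κ`. -/
def SmallRate (a : ℝ) {κ : ℝ} (hκ : 0 < κ) : Prop :=
  0 < a ∧ ∑ j, (2 * (a * ‖derivFreeRes hκ j‖) + a ^ 2 * ‖freeRes hκ‖) < 1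

/-- For small rates the conjugation with the weight is a small perturbation, so that a Neumann
series applies. -/
theorem norm_conjOp_lt {a κ : ℝ} {hκ : 0 < κ} (h : SmallRate a hκ) : ‖conjOp a hκ‖ < 1 := by
  refine lt_of_le_of_lt ?_ h.2
  rw [conjOp, norm_neg]
  refine (norm_sum_le _ _).trans (Finset.sum_le_sum fun j _ => ?_)
  refine (norm_add_le _ _).trans (add_le_add ?_ ?_)
  · rw [norm_smul, Complex.norm_ofNat]
    gcongr
    refine (ContinuousLinearMap.opNorm_comp_le _ _).trans ?_
    gcongr
    exact norm_smoothOp_le _ (norm_gradCoeff_le h.1.le j)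
  · refine (ContinuousLinearMap.opNorm_comp_le _ _).trans ?_
    gcongr
    exact norm_smoothOp_le _ (norm_lapCoeff_le a j)

/-- All sufficiently small positive rates are admissible. -/
theorem eventually_smallRate {κ : ℝ} (hκ : 0 < κ) : ∀ᶠ a in 𝓝[>] (0 : ℝ), SmallRate a hκ := by
  have h : Tendsto (fun a : ℝ => ∑ j, (2 * (a * ‖derivFreeRes hκ j‖) + a ^ 2 * ‖freeRes hκ‖))
      (𝓝[>] 0) (𝓝 0) := by
    have : Continuous fun a : ℝ => ∑ j, (2 * (a * ‖derivFreeRes hκ j‖) + a ^ 2 * ‖freeRes hκ‖) := by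
      fun_prop
    have h2 := this.tendsto 0
    simp at h2
    exact h2.mono_left nhdsWithin_le_nhds
  filter_upwards [h.eventually_lt_const one_pos, self_mem_nhdsWithin] with a h1 h2
  exact ⟨h2, h1⟩

/-- Conjugation of the free equation with the weight. -/
theorem conj_free (a : ℝ) {κ : ℝ} (hκ : 0 < κ) (w : L2) :
    ∃ h : smoothOp (bddSmooth_sechProd a) (freeRes hκ w) ∈ Hs 2,
      (κ ^ 2 : ℂ) • smoothOp (bddSmooth_sechProd a) (freeRes hκ w) - laplacianL2 ⟨_, h⟩ =
        smoothOp (bddSmooth_sechProd a) (w + conjOp a hκ w) := by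
  have hmem : smoothOp (bddSmooth_sechProd a) (freeRes hκ w) ∈ Hs 2 := by
    have := smoothOp_mem (k := 2) (bddSmooth_sechProd a) (u := freeRes hκ w)
      (by simpa using freeRes_mem hκ w)
    simpa using this
  refine ⟨hmem, L2.toD_inj ?_⟩
  set ρ : X → ℂ := fun x => (sechProd a x : ℂ) with hρ
  have hρs : BddSmooth ρ := bddSmooth_sechProd a
  set v : Distr := (freeRes hκ w).toD with hv
  have h1 : ∀ j (f : Distr), smulLeftCLM ℂ (fun x => fderiv ℝ ρ x (bvec j)) f =
      smulLeftCLM ℂ ρ (smulLeftCLM ℂ (fun x => (gradCoeff a j x : ℂ)) f) := by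
    intro j f
    rw [smulLeftCLM_smulLeftCLM_apply (bddSmooth_gradCoeff a j).temperate hρs.temperate]
    congr 2
    exact funext fun x => fderiv_sechProd a j x
  have h2 : ∀ j (f : Distr), smulLeftCLM ℂ (fun x => fderiv ℝ (fun x => fderiv ℝ ρ x (bvec j)) x
      (bvec j)) f = smulLeftCLM ℂ ρ (smulLeftCLM ℂ (fun x => (lapCoeff a j x : ℂ)) f) := by
    intro j f
    rw [smulLeftCLM_smulLeftCLM_apply (bddSmooth_lapCoeff a j).temperate hρs.temperate]
    congr 2
    exact funext fun x => fderiv_fderiv_sechProd a j x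
  -- `Δ(ρ v) = ρ Δv + 2 ∇ρ·∇v + (Δρ) v`, and `∇ρ` and the second derivatives of `ρ` are
  -- bounded multiples of `ρ`
  have h3 : Δ (smulLeftCLM ℂ ρ v) = smulLeftCLM ℂ ρ (Δ v + ∑ j,
      ((2 : ℂ) • smulLeftCLM ℂ (fun x => (gradCoeff a j x : ℂ)) (∂_{bvec j} v) +
        smulLeftCLM ℂ (fun x => (lapCoeff a j x : ℂ)) v)) := by
    have h2s : ∀ g : Distr, (2 : ℂ) • g = g + g := fun g => by ext; simp [two_mul]
    rw [laplacian_eq_sum_bvec, laplacian_eq_sum_bvec, ← Finset.sum_add_distrib, map_sum]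
    refine Finset.sum_congr rfl fun j _ => ?_
    rw [lineDeriv_smulLeft hρs, LineDeriv.lineDerivOp_add, lineDeriv_smulLeft hρs,
      lineDeriv_smulLeft (hρs.deriv _), h1, h2, map_add, map_add, map_smul, h2s]
    abel
  have h4 : (κ ^ 2 : ℂ) • v - Δ v = w.toD := by
    have := congrArg L2.toD (freeRes_right hκ w)
    rwa [L2.toD_sub, L2.toD_smul, laplacianL2_toD] at this
  rw [L2.toD_sub, L2.toD_smul, laplacianL2_toD, smoothOp_toD, smoothOp_toD, L2.toD_add]
  show (κ ^ 2 : ℂ) • smulLeftCLM ℂ ρ v - Δ (smulLeftCLM ℂ ρ v) = _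
  rw [h3, ← map_smul, ← map_sub, ← h4]
  congr 1
  have h5 : (conjOp a hκ w).toD = -∑ j,
      ((2 : ℂ) • smulLeftCLM ℂ (fun x => (gradCoeff a j x : ℂ)) (∂_{bvec j} v) +
        smulLeftCLM ℂ (fun x => (lapCoeff a j x : ℂ)) v) := by
    have e : conjOp a hκ w = (-1 : ℂ) • ∑ j, ((2 : ℂ) • smoothOp (bddSmooth_gradCoeff a j)
        (derivFreeRes hκ j w) + smoothOp (bddSmooth_lapCoeff a j) (freeRes hκ w)) := by
      simp [conjOp]
    have hneg : ∀ g : Distr, (-1 : ℂ) • g = -g := fun g => by ext; simp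
    rw [e, L2.toD_smul, L2.toD_sum, hneg]
    congr 1
    refine Finset.sum_congr rfl fun j _ => ?_
    rw [L2.toD_add, L2.toD_smul, smoothOp_toD, smoothOp_toD, derivFreeRes_toD]
  rw [h5]
  abel

/-- The perturbation is of first order, so that composed with the free resolvent it gains a
derivative. -/
theorem conjOp_mem (a : ℝ) {κ : ℝ} (hκ : 0 < κ) {w : L2} {k : ℕ} (hw : w ∈ Hs k) :
    conjOp a hκ w ∈ Hs (k + 1 : ℕ) := by
  have h1 : MemSobolev (k + 2) 2 (freeRes hκ w).toD := by
    rw [freeRes_toD]; exact memSobolev_freeResD hκ hw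
  have hA : freeRes hκ w ∈ Hs (k + 1 : ℕ) := h1.mono (by push_cast; linarith)
  have hD : ∀ j, derivFreeRes hκ j w ∈ Hs (k + 1 : ℕ) := fun j => by
    change MemSobolev _ 2 (derivFreeRes hκ j w).toD
    rw [derivFreeRes_toD]
    have := h1.lineDerivOp (m := bvec j)
    have e : (k : ℝ) + 2 - 1 = (k + 1 : ℕ) := by push_cast; ring
    rwa [e] at this
  have e : conjOp a hκ w = (-1 : ℂ) • ∑ j, ((2 : ℂ) • smoothOp (bddSmooth_gradCoeff a j)
      (derivFreeRes hκ j w) + smoothOp (bddSmooth_lapCoeff a j) (freeRes hκ w)) := by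
    simp [conjOp]
  rw [e]
  refine Submodule.smul_mem _ _ (Submodule.sum_mem _ fun j _ => Submodule.add_mem _ ?_ ?_)
  · exact Submodule.smul_mem _ _ (smoothOp_mem _ (hD j))
  · exact smoothOp_mem _ hA

/-- Outside a large ball the potential is small. -/
theorem exists_small_outside (V : 𝓢(X, ℝ)) {ε : ℝ} (hε : 0 < ε) :
    ∃ r : ℝ, ∀ x : X, r < ‖x‖ → ‖V x‖ ≤ ε := by
  obtain ⟨C, hC⟩ := V.decay 1 0
  refine ⟨C / ε, fun x hx => ?_⟩
  have h := hC.2 x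
  rw [pow_one, norm_iteratedFDeriv_zero] at h
  rw [div_lt_iff₀ hε] at hx
  have hC0 : 0 < ‖x‖ := by
    by_contra h0
    have : ‖x‖ = 0 := le_antisymm (not_lt.1 h0) (norm_nonneg _)
    rw [this, zero_mul] at hx
    linarith [hC.1]
  by_contra hlt
  push Not at hlt
  nlinarith

/-- Solutions in `H²` of `(H + κ²) u = f` inherit the weighted regularity of `f`. -/
theorem exists_reg_of_shifted (V : 𝓢(X, ℝ)) {a κ : ℝ} {hκ : 0 < κ} (ha : SmallRate a hκ) {k : ℕ}
    {f : X → ℂ} (hf : Reg (expWeight a) k f) (u : Hs 2)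
    (hu : shifted V (-(κ ^ 2 : ℂ)) u =ᵐ[volume] f) :
    ∃ v : X → ℂ, Reg (expWeight a) k v ∧ (u : L2) =ᵐ[volume] v := by
  -- a splitting `V = V₁ + V₂` of the potential, with `V₁` of compact support and `V₂` small
  obtain ⟨ε, hε, hεlt⟩ : ∃ ε > 0, ‖conjOp a hκ‖ + ε * ‖freeRes hκ‖ < 1 := by
    have h := norm_conjOp_lt ha
    refine ⟨(1 - ‖conjOp a hκ‖) / (‖freeRes hκ‖ + 1), div_pos (by linarith) (by positivity), ?_⟩
    have h2 : (1 - ‖conjOp a hκ‖) / (‖freeRes hκ‖ + 1) * ‖freeRes hκ‖ < 1 - ‖conjOp a hκ‖ := by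
      rw [div_mul_eq_mul_div, div_lt_iff₀ (by positivity)]
      nlinarith
    linarith
  obtain ⟨r, hr⟩ := exists_small_outside V hε
  set B : Set X := Metric.closedBall 0 r
  have hBm : MeasurableSet B := measurableSet_closedBall
  have hVm : Measurable fun x => (V x : ℂ) := (bddSmooth_schwartz V).1.continuous.measurable
  set V₁ : X → ℂ := B.indicator fun x => (V x : ℂ) with hV₁
  set V₂ : X → ℂ := Bᶜ.indicator fun x => (V x : ℂ) with hV₂
  have hV12 : ∀ x, V₁ x + V₂ x = V x := fun x =>
    Set.indicator_self_add_compl_apply B (fun x => (V x : ℂ)) x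
  have hV₁m : AEStronglyMeasurable V₁ volume := (hVm.indicator hBm).aestronglyMeasurable
  have hV₂m : AEStronglyMeasurable V₂ volume := (hVm.indicator hBm.compl).aestronglyMeasurable
  have hV₂b : ∀ x, ‖V₂ x‖ ≤ ε := by
    intro x
    by_cases hx : x ∈ B
    · rw [hV₂, Set.indicator_of_notMem (by simpa using hx)]; simpa using hε.le
    · rw [hV₂, Set.indicator_of_mem (by simpa using hx), Complex.norm_real]
      exact hr x (by simpa [B] using hx)
  obtain ⟨C₁, hC₁⟩ : ∃ C, ∀ x, ‖V₁ x‖ ≤ C := by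
    obtain ⟨C, hC⟩ := (bddSmooth_schwartz V).bdd
    refine ⟨C, fun x => (norm_indicator_le_norm_self _ _).trans (hC x)⟩
  obtain ⟨C₂, hC₂⟩ : ∃ C, ∀ x, ‖(expWeight a x : ℂ) * V₁ x‖ ≤ C := by
    obtain ⟨M, hM⟩ := (isCompact_closedBall (0 : X) r).exists_bound_of_continuousOn
      (expWeight a).continuous.continuousOn
    have hM0 : 0 ≤ |M| := abs_nonneg M
    refine ⟨|M| * C₁, fun x => ?_⟩
    have hC10 : 0 ≤ C₁ := (norm_nonneg _).trans (hC₁ x)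
    by_cases hx : x ∈ B
    · rw [norm_mul, Complex.norm_real]
      exact mul_le_mul ((hM x hx).trans (le_abs_self M)) (hC₁ x) (norm_nonneg _) hM0
    · rw [hV₁, Set.indicator_of_notMem hx, mul_zero, norm_zero]; positivity
  have hWm : Continuous fun x => (expWeight a x : ℂ) :=
    Complex.continuous_ofReal.comp (expWeight a).continuous
  set M₁ := mulOp V₁ C₁ hV₁m hC₁
  set M₂ := mulOp V₂ ε hV₂m hV₂b
  set MW := mulOp (fun x => (expWeight a x : ℂ) * V₁ x) C₂
    (hWm.aestronglyMeasurable.mul hV₁m) hC₂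
  set Sρ := smoothOp (bddSmooth_sechProd a)
  have hM₂ : ‖M₂‖ ≤ ε := norm_mulOp_le
  -- the conjugated right-hand side
  have hWf : Reg Weight.one k fun x => expWeight a x • f x := (mbdd_expWeight a k).reg hf
  set h : L2 := hWf.memLp.toLp _ with hh
  set F : L2 := hf.memLp.toLp f
  have hSh : Sρ h = F := by
    apply Lp.ext
    filter_upwards [smoothOp_coe (bddSmooth_sechProd a) h, hWf.memLp.coeFn_toLp,
      hf.memLp.coeFn_toLp] with x h1 h2 h3
    rw [h1, h2, h3, Complex.real_smul, ← mul_assoc, ← Complex.ofReal_mul,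
      mul_comm (sechProd a x), expWeight_mul_sechProd, Complex.ofReal_one, one_mul]
  have hSM : ∀ w : L2, Sρ (MW w) = M₁ w := by
    intro w
    apply Lp.ext
    filter_upwards [smoothOp_coe (bddSmooth_sechProd a) (MW w), mulOp_coe (b := V₁) (C := C₁)
      (hb := hV₁m) (hC := hC₁) w, mulOp_coe (b := fun x => (expWeight a x : ℂ) * V₁ x) (C := C₂)
      (hb := hWm.aestronglyMeasurable.mul hV₁m) (hC := hC₂) w] with x h1 h2 h3
    rw [h1, h2, h3, ← mul_assoc, ← mul_assoc, ← Complex.ofReal_mul, mul_comm (sechProd a x),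
      expWeight_mul_sechProd, Complex.ofReal_one, one_mul]
  have hMS : ∀ w : L2, MW (Sρ w) = M₁ w := by
    intro w
    apply Lp.ext
    filter_upwards [smoothOp_coe (bddSmooth_sechProd a) w, mulOp_coe (b := V₁) (C := C₁)
      (hb := hV₁m) (hC := hC₁) w, mulOp_coe (b := fun x => (expWeight a x : ℂ) * V₁ x) (C := C₂)
      (hb := hWm.aestronglyMeasurable.mul hV₁m) (hC := hC₂) (Sρ w)] with x h1 h2 h3
    rw [h2, h3, h1, mul_right_comm, ← mul_assoc, ← Complex.ofReal_mul,
      expWeight_mul_sechProd, Complex.ofReal_one, one_mul, mul_comm]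
  have hSM₂ : ∀ w : L2, Sρ (M₂ w) = M₂ (Sρ w) := by
    intro w
    apply Lp.ext
    filter_upwards [smoothOp_coe (bddSmooth_sechProd a) (M₂ w), smoothOp_coe (bddSmooth_sechProd a) w,
      mulOp_coe (b := V₂) (C := ε) (hb := hV₂m) (hC := hV₂b) w,
      mulOp_coe (b := V₂) (C := ε) (hb := hV₂m) (hC := hV₂b) (Sρ w)] with x h1 h2 h3 h4
    rw [h1, h3, h4, h2]; ring
  have hpot : ∀ w : L2, potential V w = M₁ w + M₂ w := by
    intro w
    apply Lp.ext
    rw [potential_eq]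
    filter_upwards [smoothOp_coe (bddSmooth_schwartz V) w, Lp.coeFn_add (M₁ w) (M₂ w),
      mulOp_coe (b := V₂) (C := ε) (hb := hV₂m) (hC := hV₂b) w,
      mulOp_coe (b := V₁) (C := C₁) (hb := hV₁m) (hC := hC₁) w] with x h1 h2 h3 h4
    rw [h1, h2, Pi.add_apply, h3, h4, ← add_mul, hV12]
  -- solve the conjugated equation by a Neumann series
  set Q : L2 →L[ℂ] L2 := conjOp a hκ + M₂ ∘L freeRes hκ
  have hQ : ‖Q‖ < 1 := by
    refine lt_of_le_of_lt ?_ hεlt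
    refine (norm_add_le _ _).trans (add_le_add le_rfl ?_)
    exact (ContinuousLinearMap.opNorm_comp_le _ _).trans (by gcongr)
  obtain ⟨w, hw⟩ : ∃ w, w + Q w = h - MW u := by
    have hunit : IsUnit (1 - -Q) := isUnit_one_sub_of_norm_lt_one (by rwa [norm_neg])
    obtain ⟨U, hU⟩ := hunit
    refine ⟨(U⁻¹ : (L2 →L[ℂ] L2)ˣ).1 (h - MW u), ?_⟩
    have := congrArg (fun T : L2 →L[ℂ] L2 => T (h - MW u)) U.mul_inv
    rw [hU] at this
    simpa using this
  obtain ⟨hmem, hconj⟩ := conj_free a hκ w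
  -- `ρ v` is the given solution
  have hFu : -laplacianL2 u + potential V u + (κ ^ 2 : ℂ) • (u : L2) = F := by
    have e : shifted V (-(κ ^ 2 : ℂ)) u = F := Lp.ext (hu.trans hf.memLp.coeFn_toLp.symm)
    rw [← e, shifted_eq, neg_smul, sub_neg_eq_add]
  set v : Hs 2 := ⟨Sρ (freeRes hκ w), hmem⟩ with hv
  have hv2 : (κ ^ 2 : ℂ) • (v : L2) - laplacianL2 v = F - M₁ u - M₂ v := by
    have e : w + conjOp a hκ w = h - MW u - M₂ (freeRes hκ w) := by
      rw [← hw]; simp [Q]; abel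
    refine hconj.trans ?_
    rw [e, map_sub, map_sub, hSM₂]
    exact congrArg₂ _ (congrArg₂ _ hSh (hSM _)) rfl
  have huv : u = v := by
    have e : (κ ^ 2 : ℂ) • ((u - v : Hs 2) : L2) - laplacianL2 (u - v) = -M₂ (u - v : Hs 2) := by
      rw [map_sub, Submodule.coe_sub, smul_sub, map_sub]
      have : (κ ^ 2 : ℂ) • (u : L2) - laplacianL2 u = F - M₁ u - M₂ u := by
        rw [← hFu, hpot]; abel
      rw [sub_sub_sub_comm, this, hv2]
      abel
    have e2 := freeRes_left hκ (u - v)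
    rw [e] at e2
    have e3 : ‖((u - v : Hs 2) : L2)‖ ≤ ‖freeRes hκ‖ * (ε * ‖((u - v : Hs 2) : L2)‖) := by
      conv_lhs => rw [← e2]
      refine ((freeRes hκ).le_opNorm _).trans ?_
      rw [norm_neg]
      gcongr
      exact M₂.le_of_opNorm_le hM₂ _
    have e4 : ε * ‖freeRes hκ‖ < 1 := by linarith [norm_nonneg (conjOp a hκ)]
    have e5 : ‖((u - v : Hs 2) : L2)‖ = 0 := by
      by_contra hne
      have : 0 < ‖((u - v : Hs 2) : L2)‖ := lt_of_le_of_ne (norm_nonneg _) (Ne.symm hne)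
      nlinarith
    have e6 : u - v = 0 := Subtype.ext (norm_eq_zero.1 e5)
    exact sub_eq_zero.1 e6
  -- bootstrap
  have hweq : w = h - conjOp a hκ w - smoothOp (bddSmooth_schwartz V) (freeRes hκ w) := by
    have e1 : MW u = M₁ (freeRes hκ w) := by rw [huv]; exact hMS _
    rw [← potential_eq, hpot, ← e1]
    have : w + (conjOp a hκ w + M₂ (freeRes hκ w)) = h - MW u := hw
    have e2 : h = w + (conjOp a hκ w + M₂ (freeRes hκ w)) + MW u := by rw [this]; abel
    conv_rhs => rw [e2]
    abel
  have hboot : ∀ j ≤ k, w ∈ Hs j := by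
    intro j
    induction j with
    | zero => exact fun _ => by rw [Nat.cast_zero]; exact toD_memSobolev w
    | succ j ih =>
      intro hj
      have hwj := ih (by omega)
      rw [hweq]
      refine Submodule.sub_mem _ (Submodule.sub_mem _ ?_ (conjOp_mem a hκ hwj)) (smoothOp_mem _ ?_)
      · exact hWf.mem_Hs (by exact_mod_cast hj)
      · have h1 : MemSobolev (j + 2) 2 (freeRes hκ w).toD := by
          rw [freeRes_toD]; exact memSobolev_freeResD hκ hwj
        exact h1.mono (by push_cast; linarith)
  have hv' : MemSobolev (k + 2) 2 (freeRes hκ w).toD := by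
    rw [freeRes_toD]; exact memSobolev_freeResD hκ (hboot k le_rfl)
  obtain ⟨p, hp, hvp⟩ := exists_reg_of_memSobolev hv'
  refine ⟨fun x => sechProd a x • p x, (mbdd_sechProd a k).reg hp, ?_⟩
  have e : (u : L2) = Sρ (freeRes hκ w) := by rw [huv]
  rw [e]
  filter_upwards [smoothOp_coe (bddSmooth_sechProd a) (freeRes hκ w), hvp] with x h1 h2
  rw [h1, h2, Complex.real_smul]

end NLS

end

noncomputable section

namespace NLS

/-! ### Compactness of `V (-Δ + κ²)⁻¹` -/

/-- The symbol of the free resolvent decays like `|ξ|⁻²`, which is square integrable in dimension `3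
< 4`. -/
theorem memLp_resSymbol {κ : ℝ} (hκ : 0 < κ) :
    MemLp (fun ξ => (resSymbol κ ξ : ℂ)) 2 (volume : Measure X) := by
  have hc : Continuous fun ξ => (resSymbol κ ξ : ℂ) := (resSymbol_temperate hκ).1.continuous
  rw [memLp_two_iff_integrable_sq_norm hc.aestronglyMeasurable]
  have h := (integrable_rpow_neg_one_add_norm_sq (E := X) (μ := volume) (r := 4)
    (by simp; norm_num)).const_mul ((κ ^ 2)⁻¹ + 1) |>.const_mul ((κ ^ 2)⁻¹ + 1)
  refine h.mono' (hc.norm.pow 2).aestronglyMeasurable (Eventually.of_forall fun ξ => ?_)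
  have h1 : resSymbol κ ξ ≤ ((κ ^ 2)⁻¹ + 1) * (1 + ‖ξ‖ ^ 2)⁻¹ := by
    rw [resSymbol, ← div_eq_mul_inv, le_div_iff₀ (by positivity), inv_mul_le_iff₀ (by positivity)]
    have h1 : (κ ^ 2)⁻¹ * κ ^ 2 = 1 := by field_simp
    have h2 : 1 ≤ (2 * Real.pi) ^ 2 := by nlinarith [Real.pi_gt_three]
    have h3 : 0 ≤ (κ ^ 2)⁻¹ * ((2 * Real.pi) ^ 2 * ‖ξ‖ ^ 2) := by positivity
    nlinarith [sq_nonneg ‖ξ‖, sq_nonneg κ]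
  have h0 : 0 ≤ resSymbol κ ξ := by rw [resSymbol]; positivity
  rw [norm_pow, norm_norm, Complex.norm_real, Real.norm_of_nonneg h0]
  have e : ((1 : ℝ) + ‖ξ‖ ^ 2) ^ (-(4 : ℝ) / 2) = (1 + ‖ξ‖ ^ 2)⁻¹ * (1 + ‖ξ‖ ^ 2)⁻¹ := by
    rw [show (-(4 : ℝ) / 2) = -((2 : ℕ) : ℝ) by norm_num, Real.rpow_neg (by positivity),
      Real.rpow_natCast, sq, mul_inv]
  rw [e, sq]
  calc resSymbol κ ξ * resSymbol κ ξ
      ≤ (((κ ^ 2)⁻¹ + 1) * (1 + ‖ξ‖ ^ 2)⁻¹) * (((κ ^ 2)⁻¹ + 1) * (1 + ‖ξ‖ ^ 2)⁻¹) := by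
        gcongr
    _ = _ := by ring

open FourierTransform in
/-- The values of `(-Δ + κ²)⁻¹ u` are given by uniformly bounded functionals. -/
theorem exists_pointwise_freeRes {κ : ℝ} (hκ : 0 < κ) : ∃ (C : ℝ) (y : X → L2),
    (∀ x, ‖y x‖ ≤ C) ∧ ∀ u, freeRes hκ u =ᵐ[volume] fun x => inner ℂ (y x) u := by
  have hm := memLp_resSymbol hκ
  have hc : Continuous fun ξ => (resSymbol κ ξ : ℂ) := (resSymbol_temperate hκ).1.continuous
  have hcx : ∀ x : X, Continuous fun ξ : X =>
      (starRingEnd ℂ) (Real.fourierChar (inner ℝ ξ x) : ℂ) := fun x =>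
    Complex.continuous_conj.comp (continuous_subtype_val.comp
      (Real.continuous_fourierChar.comp (by fun_prop)))
  have hn : ∀ (x ξ : X), ‖(starRingEnd ℂ) (Real.fourierChar (inner ℝ ξ x) : ℂ) *
      (resSymbol κ ξ : ℂ)‖ = ‖(resSymbol κ ξ : ℂ)‖ := by
    intro x ξ
    rw [norm_mul, RCLike.norm_conj, Circle.norm_coe, one_mul]
  have hmx : ∀ x : X, MemLp (fun ξ : X => (starRingEnd ℂ) (Real.fourierChar (inner ℝ ξ x) : ℂ) *
      (resSymbol κ ξ : ℂ)) 2 (volume : Measure X) := fun x =>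
    hm.of_le ((hcx x).mul hc).aestronglyMeasurable (Eventually.of_forall fun ξ => (hn x ξ).le)
  -- `y_x` has the Fourier transform `e^{-2πi ξ·x} (κ² + 4π²|ξ|²)⁻¹`
  refine ⟨‖hm.toLp _‖, fun x => 𝓕⁻ ((hmx x).toLp _), fun x => ?_, fun u => ?_⟩
  · have e : ‖(𝓕⁻ ((hmx x).toLp _) : L2)‖ = ‖(hmx x).toLp _‖ := by
      rw [← Lp.norm_fourier_eq, FourierTransform.fourier_fourierInv_eq]
    rw [e]
    refine Lp.norm_le_norm_of_ae_le ?_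
    filter_upwards [(hmx x).coeFn_toLp, hm.coeFn_toLp] with ξ h1 h2
    rw [h1, h2, hn]
  · obtain ⟨v, hv, huv⟩ := exists_fourier_repr (freeRes_mem hκ u)
    have hvint : Integrable (v : X → ℂ) := L1.integrable_coeFn v
    have h1 : (𝓕 (freeRes hκ u) : L2) =ᵐ[volume] v := by
      refine ae_eq_of_toD hvint.locallyIntegrable fun η => ?_
      rw [← Lp1_toD_apply, ← hv, L2.toD, ← Lp.fourier_toTemperedDistribution_eq]
    refine huv.trans (Eventually.of_forall fun x => ?_)
    show Real.Lp.fourierTransformInv v x = inner ℂ (𝓕⁻ ((hmx x).toLp _) : L2) u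
    rw [Real.Lp.fourierTransformInv_apply, Real.fourierInv_eq, ← Lp.inner_fourier_eq,
      FourierTransform.fourier_fourierInv_eq, L2.inner_def]
    apply integral_congr_ae
    filter_upwards [h1, fourier_freeRes hκ u, (hmx x).coeFn_toLp] with ξ h2 h3 h4
    rw [← h2, h3, h4]
    simp only [RCLike.inner_apply, map_mul, Complex.conj_conj, Complex.conj_ofReal, Circle.smul_def,
      smul_eq_mul]
    ring

theorem norm_sq_eq_integral (u : L2) : ‖u‖ ^ 2 = ∫ x, ‖u x‖ ^ 2 := by
  have h := inner_self_eq_norm_sq_to_K (𝕜 := ℂ) u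
  rw [L2.inner_def] at h
  have h2 : ∫ x, inner ℂ (u x) (u x) = ((∫ x, ‖u x‖ ^ 2 : ℝ) : ℂ) := by
    rw [← integral_complex_ofReal]
    congr 1; ext x
    rw [inner_self_eq_norm_sq_to_K]; simp
  rw [h2] at h
  refine Complex.ofReal_injective ?_
  rw [h]
  simp

/-- Hilbert–Schmidt operators are compact. -/
theorem isCompactOperator_of_sum_le {H : Type} [NormedAddCommGroup H] [InnerProductSpace ℂ H]
    [CompleteSpace H] (K : H →L[ℂ] H) (M : ℝ)
    (hK : ∀ (ι : Type) (b : ι → H) (s : Finset ι), Orthonormal ℂ b → ∑ i ∈ s, ‖K (b i)‖ ^ 2 ≤ M) :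
    IsCompactOperator K := by
  classical
  obtain ⟨S, b, -⟩ := exists_hilbertBasis ℂ H
  have hsum : Summable fun i => ‖K (b i)‖ ^ 2 :=
    summable_of_sum_le (fun i => sq_nonneg _) fun s => hK S b s b.orthonormal
  -- the finite rank operators `u ↦ ∑_{i ∈ s} ⟨b_i, u⟩ K b_i` converge to `K` in norm
  let T : Finset S → H →L[ℂ] H := fun s => ∑ i ∈ s, (innerSL ℂ (b i)).smulRight (K (b i))
  have hTc : ∀ s, IsCompactOperator (T s) := by
    intro s
    induction s using Finset.induction_on with
    | empty =>
      have : (T ∅ : H → H) = 0 := by ext x; simp [T]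
      rw [this]; exact isCompactOperator_zero
    | insert i s hi ih =>
      have : (T (insert i s) : H → H) = ⇑((innerSL ℂ (b i)).smulRight (K (b i))) + ⇑(T s) := by
        ext x; simp [T, Finset.sum_insert hi]
      rw [this]
      refine IsCompactOperator.add ?_ ih
      have h1 : IsCompactOperator (ContinuousLinearMap.toSpanSingleton ℂ (K (b i))) :=
        isCompactOperator_of_locallyCompactSpace_rng _
      exact h1.comp_clm (innerSL ℂ (b i))
  refine isCompactOperator_of_tendsto (F := T) (l := atTop) ?_ (Eventually.of_forall hTc)
  rw [Metric.tendsto_atTop]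
  intro ε hε
  obtain ⟨s₀, hs₀⟩ := summable_iff_vanishing_norm.1 hsum ((ε / 2) ^ 2) (by positivity)
  refine ⟨s₀, fun s hs => ?_⟩
  rw [dist_eq_norm]
  refine lt_of_le_of_lt ?_ (half_lt_self hε)
  refine ContinuousLinearMap.opNorm_le_bound _ (by positivity) fun u => ?_
  have h1 : HasSum (fun i => inner ℂ (b i) u • K (b i)) (K u) := by
    have := (b.hasSum_repr u).mapL K
    simpa [b.repr_apply_apply] using this
  have h2 : Tendsto (fun G : Finset S => T s u - ∑ i ∈ G, inner ℂ (b i) u • K (b i)) atTop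
      (𝓝 ((T s - K) u)) := by
    rw [sub_apply]
    exact tendsto_const_nhds.sub h1
  refine le_of_tendsto h2.norm ?_
  filter_upwards [eventually_ge_atTop s] with G hG
  have h3 : T s u = ∑ i ∈ s, inner ℂ (b i) u • K (b i) := by simp [T]
  rw [h3, ← Finset.sum_sdiff hG, norm_sub_rev, add_sub_cancel_right]
  have h4 : ∑ i ∈ G \ s, ‖K (b i)‖ ^ 2 < (ε / 2) ^ 2 := by
    have := hs₀ (G \ s) (Finset.disjoint_of_subset_right hs Finset.sdiff_disjoint)
    rwa [Real.norm_of_nonneg (Finset.sum_nonneg fun i _ => sq_nonneg _)] at this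
  calc ‖∑ i ∈ G \ s, inner ℂ (b i) u • K (b i)‖
      ≤ ∑ i ∈ G \ s, ‖inner ℂ (b i) u‖ * ‖K (b i)‖ :=
        (norm_sum_le _ _).trans (Finset.sum_le_sum fun i _ => (norm_smul _ _).le)
    _ ≤ √(∑ i ∈ G \ s, ‖inner ℂ (b i) u‖ ^ 2) * √(∑ i ∈ G \ s, ‖K (b i)‖ ^ 2) :=
        Real.sum_mul_le_sqrt_mul_sqrt _ _ _
    _ ≤ ‖u‖ * (ε / 2) := by
        gcongr
        · rw [← Real.sqrt_sq (norm_nonneg u)]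
          exact Real.sqrt_le_sqrt (b.orthonormal.sum_inner_products_le u)
        · rw [← Real.sqrt_sq (by positivity : 0 ≤ ε / 2)]
          exact Real.sqrt_le_sqrt h4.le
    _ = _ := mul_comm _ _

/-- The potential as a bounded operator. -/
def potL (V : 𝓢(X, ℝ)) : L2 →L[ℂ] L2 := smoothOp (bddSmooth_schwartz V)

theorem potL_apply (V : 𝓢(X, ℝ)) (u : L2) : potL V u = potential V u := (potential_eq V u).symm

/-- `V (-Δ + κ²)⁻¹` is a Hilbert–Schmidt operator. Its values at `x` are `V(x) ⟨y_x, u⟩` with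
bounded `‖y_x‖`, and Bessel's inequality applies for every `x`. -/
theorem isCompactOperator_potL_freeRes (V : 𝓢(X, ℝ)) {κ : ℝ} (hκ : 0 < κ) :
    IsCompactOperator (potL V ∘L freeRes hκ) := by
  obtain ⟨C, y, hy, hAy⟩ := exists_pointwise_freeRes hκ
  have hV : Integrable fun x => ‖V x‖ ^ 2 :=
    (memLp_two_iff_integrable_sq_norm V.continuous.aestronglyMeasurable).1 (V.memLp 2)
  refine isCompactOperator_of_sum_le _ (C ^ 2 * ∫ x, ‖V x‖ ^ 2) fun ι b s hb => ?_
  have hK : ∀ u, (fun x => ‖(potL V ∘L freeRes hκ) u x‖ ^ 2) =ᵐ[volume]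
      fun x => ‖V x‖ ^ 2 * ‖inner ℂ u (y x)‖ ^ 2 := by
    intro u
    filter_upwards [smoothOp_coe (bddSmooth_schwartz V) (freeRes hκ u), hAy u] with x h1 h2
    have : (potL V ∘L freeRes hκ) u x = V x * freeRes hκ u x := h1
    rw [this, h2, norm_mul, Complex.norm_real, mul_pow, norm_inner_symm]
  have hint : ∀ u, Integrable fun x => ‖(potL V ∘L freeRes hκ) u x‖ ^ 2 := fun u =>
    (memLp_two_iff_integrable_sq_norm (Lp.aestronglyMeasurable _)).1 (Lp.memLp _)
  simp only [norm_sq_eq_integral]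
  rw [← integral_finsetSum _ fun i _ => hint (b i), ← integral_const_mul]
  refine integral_mono_ae (integrable_finsetSum _ fun i _ => hint (b i)) (hV.const_mul _) ?_
  have : ∀ᵐ x, ∀ i ∈ s, ‖(potL V ∘L freeRes hκ) (b i) x‖ ^ 2 =
      ‖V x‖ ^ 2 * ‖inner ℂ (b i) (y x)‖ ^ 2 :=
    (ae_ball_iff s.countable_toSet).2 fun i _ => hK (b i)
  filter_upwards [this] with x hx
  rw [Finset.sum_congr rfl hx, ← Finset.mul_sum, mul_comm]
  have h1 := hb.sum_inner_products_le (x := y x) (s := s)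
  gcongr
  exact h1.trans (by gcongr; exact hy x)

/-! ### The spectrum below zero -/

theorem inner_potential (V : 𝓢(X, ℝ)) (u v : L2) :
    inner ℂ (potential V u) v = inner ℂ u (potential V v) := by
  rw [potential_eq, potential_eq, L2.inner_def, L2.inner_def]
  apply integral_congr_ae
  filter_upwards [smoothOp_coe (bddSmooth_schwartz V) u, smoothOp_coe (bddSmooth_schwartz V) v]
    with x h1 h2
  rw [h1, h2]
  simp only [RCLike.inner_apply, map_mul, Complex.conj_ofReal]
  ring

theorem shifted_eq_free (V : 𝓢(X, ℝ)) (κ : ℝ) (u : Hs 2) : shifted V (-(κ ^ 2 : ℂ)) u =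
    ((κ ^ 2 : ℂ) • (u : L2) - laplacianL2 u) + potential V u := by
  rw [shifted_eq, neg_smul]; abel

/-- The Schrödinger operator is symmetric. -/
theorem shifted_symm (V : 𝓢(X, ℝ)) {κ : ℝ} (hκ : 0 < κ) (u v : Hs 2) :
    inner ℂ (shifted V (-(κ ^ 2 : ℂ)) u) (v : L2) =
      inner ℂ (u : L2) (shifted V (-(κ ^ 2 : ℂ)) v) := by
  rw [shifted_eq_free, shifted_eq_free, inner_add_left, inner_add_right, inner_potential]
  congr 1
  conv_lhs => rw [← freeRes_left hκ v]
  conv_rhs => rw [← freeRes_left hκ u]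
  exact (freeRes_symm hκ _ _).symm

theorem mem_eigenspaceH {V : 𝓢(X, ℝ)} {lam : ℂ} {u : L2} :
    u ∈ eigenspaceH V lam ↔ ∃ h : u ∈ Hs 2, shifted V lam ⟨u, h⟩ = 0 := by
  constructor
  · rintro ⟨w, hw, rfl⟩
    exact ⟨w.2, hw⟩
  · rintro ⟨h, h0⟩
    exact ⟨⟨u, h⟩, h0, rfl⟩

theorem shifted_freeRes (V : 𝓢(X, ℝ)) {κ : ℝ} (hκ : 0 < κ) (f : L2) :
    shifted V (-(κ ^ 2 : ℂ)) ⟨freeRes hκ f, freeRes_mem hκ f⟩ = f + (potL V ∘L freeRes hκ) f := by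
  rw [shifted_eq_free]
  show (κ ^ 2 : ℂ) • freeRes hκ f - _ + _ = _
  rw [freeRes_right, ContinuousLinearMap.comp_apply, potL_apply]

theorem exists_freeRes_eq {κ : ℝ} (hκ : 0 < κ) (u : Hs 2) :
    ∃ f : L2, u = ⟨freeRes hκ f, freeRes_mem hκ f⟩ :=
  ⟨_, Subtype.ext (freeRes_left hκ u).symm⟩

/-- Negative eigenvalues have finite multiplicity. -/
theorem finiteDimensional_eigenspaceH (V : 𝓢(X, ℝ)) {κ : ℝ} (hκ : 0 < κ) :
    FiniteDimensional ℂ (eigenspaceH V (-(κ ^ 2 : ℂ))) := by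
  set K : L2 →L[ℂ] L2 := potL V ∘L freeRes hκ with hK
  have hKc : IsCompactOperator K := isCompactOperator_potL_freeRes V hκ
  -- `u = (-Δ + κ²)⁻¹ f` is an eigenfunction iff `f + K f = 0`, and `K` is compact
  set E : Submodule ℂ L2 := LinearMap.ker (1 + K).toLinearMap with hE
  have hEmem : ∀ f, f ∈ E ↔ f + K f = 0 := fun f => by
    simp [E, LinearMap.mem_ker]
  have hEinv : ∀ f ∈ E, K f ∈ E := fun f hf => by
    have : K f = -f := eq_neg_of_add_eq_zero_right ((hEmem f).1 hf)
    rw [this]; exact E.neg_mem hf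
  have hcl : IsClosed (E : Set L2) := (1 + K).isClosed_ker
  have hid : IsCompactOperator (id : E → E) := by
    have h1 := (IsCompactOperator.restrict (f := K.toLinearMap) hKc hEinv hcl).neg
    have e : (-(K.toLinearMap.restrict hEinv : E → E)) = id := by
      ext1 f
      apply Subtype.ext
      have := (hEmem f).1 f.2
      show -(K f) = (f : L2)
      rw [neg_eq_iff_add_eq_zero, add_comm]; exact this
    rwa [e] at h1
  have : FiniteDimensional ℂ E := FiniteDimensional.of_isCompactOperator_id hid
  have hle : eigenspaceH V (-(κ ^ 2 : ℂ)) ≤ E.map (freeRes hκ).toLinearMap := by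
    intro u hu
    obtain ⟨h, h0⟩ := mem_eigenspaceH.1 hu
    obtain ⟨f, hf⟩ := exists_freeRes_eq hκ ⟨u, h⟩
    refine ⟨f, (hEmem f).2 ?_, (congrArg Subtype.val hf).symm⟩
    rw [← shifted_freeRes, ← hf, h0]
  exact Submodule.finiteDimensional_of_le hle

/-- For `λ < 0` and `P` the orthogonal projection onto `ker (H - λ)`, the operator
`H - λ + P : H² → L²` is invertible. -/
theorem exists_reducedResolvent (V : 𝓢(X, ℝ)) {κ : ℝ} (hκ : 0 < κ) :
    ∃ P R : L2 →L[ℂ] L2,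
      (∀ u, P u ∈ eigenspaceH V (-(κ ^ 2 : ℂ))) ∧
      (∀ n ∈ eigenspaceH V (-(κ ^ 2 : ℂ)), P n = n) ∧
      (∀ u, ∀ n ∈ eigenspaceH V (-(κ ^ 2 : ℂ)), inner ℂ n (P u) = inner ℂ n u) ∧
      (∀ f, ∃ h : R f ∈ Hs 2, shifted V (-(κ ^ 2 : ℂ)) ⟨R f, h⟩ + P (R f) = f) ∧
      (∀ u : Hs 2, R (shifted V (-(κ ^ 2 : ℂ)) u + P u) = u) := by
  have := finiteDimensional_eigenspaceH V hκ
  set N := eigenspaceH V (-(κ ^ 2 : ℂ)) with hN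
  set P : L2 →L[ℂ] L2 := N.starProjection with hP
  have hPmem : ∀ u, P u ∈ N := fun u => Submodule.starProjection_apply_mem N u
  have hPid : ∀ n ∈ N, P n = n := fun n hn => Submodule.starProjection_eq_self_iff.2 hn
  have hPinner : ∀ u, ∀ n ∈ N, inner ℂ n (P u) = inner ℂ n u := fun u n hn => by
    have := Submodule.inner_starProjection_left_eq_right N n u
    rw [hPid n hn] at this
    exact this.symm
  -- `H - λ` is symmetric, so its range is orthogonal to its kernel
  have horth : ∀ u : Hs 2, ∀ n ∈ N, inner ℂ n (shifted V (-(κ ^ 2 : ℂ)) u) = 0 := by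
    intro u n hn
    obtain ⟨h, h0⟩ := mem_eigenspaceH.1 hn
    have := shifted_symm V hκ ⟨n, h⟩ u
    rw [h0, inner_zero_left] at this
    exact this.symm
  have hinj : ∀ u : Hs 2, shifted V (-(κ ^ 2 : ℂ)) u + P u = 0 → (u : L2) = 0 := by
    intro u hu
    have h1 : P u = 0 := by
      have h2 : inner ℂ (P u) (shifted V (-(κ ^ 2 : ℂ)) u + P u) = 0 := by rw [hu, inner_zero_right]
      rw [inner_add_right, horth u _ (hPmem u), zero_add] at h2
      exact inner_self_eq_zero.1 h2
    rw [h1, add_zero] at hu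
    have h3 : (u : L2) ∈ N := mem_eigenspaceH.2 ⟨u.2, hu⟩
    rw [← hPid _ h3, h1]
  set A := freeRes hκ with hA
  set K : L2 →L[ℂ] L2 := potL V ∘L A + P ∘L A with hK
  have hPc : IsCompactOperator P := by
    have : ProperSpace N := FiniteDimensional.proper ℂ N
    have h1 : IsCompactOperator (N.subtypeL : N → L2) :=
      isCompactOperator_of_locallyCompactSpace_rng N.subtypeL
    exact h1.comp_clm N.orthogonalProjectionOnto
  have hKc : IsCompactOperator K :=
    (isCompactOperator_potL_freeRes V hκ).add (hPc.comp_clm A)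
  have hshift : ∀ f, shifted V (-(κ ^ 2 : ℂ)) ⟨A f, freeRes_mem hκ f⟩ + P (A f) = f + K f := by
    intro f
    rw [shifted_freeRes, hK, add_apply, add_assoc]; rfl
  -- the Fredholm alternative for `1 + K`, whose kernel is trivial by `hinj`
  have hres : (-1 : ℂ) ∈ resolventSet ℂ K := by
    refine (hKc.hasEigenvalue_or_mem_resolventSet (by norm_num : (-1 : ℂ) ≠ 0)).resolve_left
      fun hev => ?_
    obtain ⟨f, hf⟩ := hev.exists_hasEigenvector
    have h1 : K f = (-1 : ℂ) • f := hf.apply_eq_smul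
    have h2 : A f = 0 := hinj ⟨A f, freeRes_mem hκ f⟩ (by rw [hshift, h1]; simp)
    have h3 : (κ ^ 2 : ℂ) • A f - laplacianL2 ⟨A f, freeRes_mem hκ f⟩ = f := freeRes_right hκ f
    have h4 : (⟨A f, freeRes_mem hκ f⟩ : Hs 2) = 0 := Subtype.ext h2
    rw [h4, h2, smul_zero, map_zero, sub_zero] at h3
    exact hf.2 h3.symm
  obtain ⟨U, hU⟩ : IsUnit (1 + K) := by
    have h1 : IsUnit (algebraMap ℂ (L2 →L[ℂ] L2) (-1) - K) := hres
    have h2 : algebraMap ℂ (L2 →L[ℂ] L2) (-1) - K = -(1 + K) := by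
      rw [map_neg, map_one]; abel
    rw [h2] at h1
    exact (IsUnit.neg_iff _).1 h1
  have hUr : ∀ f, (1 + K) ((U⁻¹ : (L2 →L[ℂ] L2)ˣ).1 f) = f := fun f => by
    have := congrArg (fun T : L2 →L[ℂ] L2 => T f) U.mul_inv
    rw [hU] at this
    exact this
  have hUl : ∀ f, (U⁻¹ : (L2 →L[ℂ] L2)ˣ).1 ((1 + K) f) = f := fun f => by
    have := congrArg (fun T : L2 →L[ℂ] L2 => T f) U.inv_mul
    rw [hU] at this
    exact this
  refine ⟨P, A ∘L (U⁻¹ : (L2 →L[ℂ] L2)ˣ).1, hPmem, hPid, hPinner, fun f => ?_, fun u => ?_⟩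
  · refine ⟨freeRes_mem hκ _, ?_⟩
    exact (hshift _).trans (hUr f)
  · obtain ⟨f, hf⟩ := exists_freeRes_eq hκ u
    have e : shifted V (-(κ ^ 2 : ℂ)) u + P u = (1 + K) f := by
      rw [hf]; exact hshift f
    rw [e, ContinuousLinearMap.comp_apply, hUl, hf]

/-- Every negative eigenvalue belongs to the discrete spectrum. -/
theorem mem_discreteSpectrumH (V : 𝓢(X, ℝ)) {κ : ℝ} (hκ : 0 < κ)
    (hne : eigenspaceH V (-(κ ^ 2 : ℂ)) ≠ ⊥) : (-(κ ^ 2 : ℂ)) ∈ discreteSpectrumH V := by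
  obtain ⟨P, R, hPmem, hPid, hPinner, hR, hRl⟩ := exists_reducedResolvent V hκ
  set lam : ℂ := -(κ ^ 2 : ℂ) with hlam
  have horth : ∀ u : Hs 2, P (shifted V lam u) = 0 := by
    intro u
    have h2 := hPinner (shifted V lam u) _ (hPmem (shifted V lam u))
    obtain ⟨h, h0⟩ := mem_eigenspaceH.1 (hPmem (shifted V lam u))
    have := shifted_symm V hκ ⟨_, h⟩ u
    rw [h0, inner_zero_left] at this
    rw [← this] at h2
    exact inner_self_eq_zero.1 h2
  have hshift : ∀ (μ : ℂ) (u : Hs 2), shifted V μ u = shifted V lam u - (μ - lam) • (u : L2) := by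
    intro μ u
    rw [shifted_eq, shifted_eq, sub_smul]; abel
  refine ⟨?_, ⟨min 1 (‖R‖ + 1)⁻¹, by positivity, ?_⟩, hne, finiteDimensional_eigenspaceH V hκ⟩
  · intro hbij
    refine hne ((Submodule.eq_bot_iff _).2 fun u hu => ?_)
    obtain ⟨h, h0⟩ := mem_eigenspaceH.1 hu
    exact congrArg Subtype.val (hbij.1 (h0.trans (map_zero _).symm))
  · intro μ hμ hdist
    by_contra hne'
    apply hμ
    set η : ℂ := μ - lam with hη
    have hη0 : η ≠ 0 := sub_ne_zero.2 hne'
    rw [dist_eq_norm, ← hη, lt_min_iff] at hdist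
    have hη1 : 1 - η ≠ 0 := by
      intro h
      have : η = 1 := (sub_eq_zero.1 h).symm
      rw [this, norm_one] at hdist
      exact lt_irrefl _ hdist.1
    have hRη : ‖η • R‖ < 1 := by
      rw [norm_smul]
      have h1 := hdist.2
      rw [lt_inv_comm₀ (by rw [norm_pos_iff]; exact hη0) (by positivity)] at h1
      have h2 : 0 < ‖η‖ := norm_pos_iff.2 hη0
      rw [← one_div, lt_div_iff₀ h2] at h1
      nlinarith
    constructor
    · -- injectivity
      rw [injective_iff_map_eq_zero]
      intro u hu
      rw [hshift, sub_eq_zero, ← hη] at hu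
      have hPu : P u = 0 := by
        have := horth u
        rw [hu, map_smul] at this
        exact (smul_eq_zero.1 this).resolve_left hη0
      have h1 := hRl u
      rw [hPu, add_zero, hu, map_smul] at h1
      have h2 : ‖(u : L2)‖ ≤ ‖η • R‖ * ‖(u : L2)‖ := by
        conv_lhs => rw [← h1]
        exact (η • R).le_opNorm _
      have h3 : ‖(u : L2)‖ = 0 := by
        by_contra hne
        have : 0 < ‖(u : L2)‖ := lt_of_le_of_ne (norm_nonneg _) (Ne.symm hne)
        nlinarith
      exact Subtype.ext (norm_eq_zero.1 h3)
    · -- surjectivity, separately on the eigenspace and on its complement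
      intro f
      obtain ⟨hm, h0⟩ := mem_eigenspaceH.1 (hPmem f)
      set f' := f - P f with hf'
      have hPf' : P f' = 0 := by rw [hf', map_sub, hPid _ (hPmem f), sub_self]
      obtain ⟨w, hw⟩ : ∃ w, w - (η • R) w = f' := by
        obtain ⟨U, hU⟩ := isUnit_one_sub_of_norm_lt_one hRη
        refine ⟨(U⁻¹ : (L2 →L[ℂ] L2)ˣ).1 f', ?_⟩
        have := congrArg (fun T : L2 →L[ℂ] L2 => T f') U.mul_inv
        rw [hU] at this
        exact this
      obtain ⟨hmw, hRw⟩ := hR w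
      have hPw : P (R w) = 0 := by
        have h1 := congrArg P hRw
        rw [map_add, horth, zero_add, hPid _ (hPmem _)] at h1
        have h2 := congrArg P hw
        rw [map_sub, hPf', smul_apply, map_smul, h1] at h2
        have h3 : (1 - η) • P w = 0 := by rw [sub_smul, one_smul]; exact h2
        rw [h1]
        exact (smul_eq_zero.1 h3).resolve_left hη1
      refine ⟨⟨R w, hmw⟩ - η⁻¹ • ⟨P f, hm⟩, ?_⟩
      rw [map_sub, map_smul, hshift μ ⟨R w, hmw⟩, hshift μ ⟨P f, hm⟩, ← hη, h0, zero_sub]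
      show shifted V lam ⟨R w, hmw⟩ - η • R w - η⁻¹ • -(η • P f) = f
      have h4 : shifted V lam ⟨R w, hmw⟩ = w := by rwa [hPw, add_zero] at hRw
      rw [h4, smul_neg, smul_smul, inv_mul_cancel₀ hη0, one_smul, sub_neg_eq_add]
      have h5 : w - η • R w = f' := hw
      rw [h5, hf', sub_add_cancel]

/-- The resolvent of `H` is the solution operator. -/
theorem resolventH_eq {V : 𝓢(X, ℝ)} {lam : ℂ} (hinj : Function.Injective (shifted V lam))
    {f : X → ℂ} (u : Hs 2) (hu : ∀ᵐ x, shifted V lam u x = f x) : resolventH V lam f = u := by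
  have h : ∃ u : Hs 2, ∀ᵐ x, shifted V lam u x = f x := ⟨u, hu⟩
  rw [resolventH, dif_pos h]
  congr 1
  refine hinj (Lp.ext ?_)
  filter_upwards [h.choose_spec, hu] with x h1 h2
  rw [h1, h2]

end NLS

end

noncomputable section

namespace NLS

/-! ### Embeddings of the spaces of regular functions -/

namespace RegSpace

variable {W : Weight} {k : ℕ}

theorem reg_ofReal (f : RegSpace W k) : Reg W k (fun x => (f x : ℂ)) := f.reg.clm Complex.ofRealCLM

/-- A function in `RegSpace W k` as an element of `L²`. -/
def toL2 : RegSpace W k →L[ℝ] L2 :=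
  LinearMap.mkContinuous
    { toFun := fun f => f.reg_ofReal.memLp.toLp _
      map_add' := fun f g => by
        rw [← MemLp.toLp_add]
        refine MemLp.toLp_congr _ _ (Eventually.of_forall fun x => ?_)
        simp [add_apply']
      map_smul' := fun c f => by
        rw [RingHom.id_apply, ← MemLp.toLp_const_smul]
        refine MemLp.toLp_congr _ _ (Eventually.of_forall fun x => ?_)
        simp [smul_apply'] } 1 fun f => by
    rw [one_mul]
    refine le_trans ?_ (norm_incl_zero_le f)
    rw [norm_zero_eq]
    refine le_trans ?_ (norm_snd_le _)
    refine Lp.norm_le_norm_of_ae_le ?_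
    filter_upwards [f.reg_ofReal.memLp.coeFn_toLp,
      MemLp.coeFn_toLp (μ := volume) (f := fun x => W x • f x) (incl (Nat.zero_le k) f).reg.2.2]
      with x h1 h2
    have e : (emb0 (incl (Nat.zero_le k) f)).2 x = W x • f x := h2
    refine (congrArg norm h1).trans_le ?_
    rw [e, norm_smul, Complex.norm_real, Real.norm_of_nonneg (W.pos x).le]
    exact le_mul_of_one_le_left (norm_nonneg _) (W.one_le x)

theorem toL2_coe (f : RegSpace W k) : toL2 f =ᵐ[volume] fun x => (f x : ℂ) :=
  f.reg_ofReal.memLp.coeFn_toLp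

theorem toL2_injective : Function.Injective (toL2 (W := W) (k := k)) := by
  intro f g h
  have h1 : (fun x => (f x : ℂ)) =ᵐ[volume] fun x => (g x : ℂ) := by
    refine (toL2_coe f).symm.trans ?_
    rw [h]
    exact toL2_coe g
  have h2 := Measure.eq_of_ae_eq h1 (Complex.continuous_ofReal.comp f.reg.continuous)
    (Complex.continuous_ofReal.comp g.reg.continuous)
  exact ext' fun x => Complex.ofReal_injective (congrFun h2 x)

theorem toL2_inclL {l : ℕ} (h : k ≤ l) (f : RegSpace W l) : toL2 (inclL h f) = toL2 f := rfl

end RegSpace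

theorem MBdd.of_const_mul {W₁ W₂ : X → ℝ} {c : ℝ} {k : ℕ} : ∀ {b : X → ℝ},
    MBdd (fun x => c * W₁ x) W₂ k b → MBdd W₁ W₂ k b := by
  have base : ∀ {b : X → ℝ}, MBdd (fun x => c * W₁ x) W₂ 0 b → MBdd W₁ W₂ 0 b := by
    rintro b ⟨h1, C, hC⟩
    exact ⟨h1, C * c, fun x => by rw [mul_assoc]; exact hC x⟩
  induction k with
  | zero => exact base
  | succ k ih => exact fun h => ⟨base h.1, h.2.1, fun j => ih (h.2.2 j)⟩

/-- `cosh(γ|x|)` is a multiplier from the weight with rate `a > γ` to the trivial weight. -/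
theorem mbdd_cosh_expWeight {γ a : ℝ} (hγ : 0 < γ) (h : γ < a) (k : ℕ) :
    MBdd (expWeight a) Weight.one k (fun x : X => Real.cosh (γ * ‖x‖)) := by
  refine MBdd.of_const_mul (c := 8) ?_
  refine (mbdd_cosh hγ h k).mono (fun x => (Real.exp_pos _).le)
    (fun x => exp_le_expWeight (hγ.trans h).le x) ?_
  exact fun x => le_rfl

theorem reg_cosh_mul {γ a : ℝ} (hγ : 0 < γ) (h : γ < a) {k : ℕ} {f : X → ℂ}
    (hf : Reg (expWeight a) k f) : Reg Weight.one k (fun x => Real.cosh (γ * ‖x‖) • f x) :=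
  (mbdd_cosh_expWeight hγ h k).reg hf

/-- Functions whose derivatives decay with rate `a > γ` belong to `H^s_γ`. -/
theorem mem_weighted_of_reg {γ a : ℝ} (hγ : 0 < γ) (h : γ < a) {k : ℕ} {f : X → ℂ}
    (hf : Reg (expWeight a) k f) {s : ℝ≥0} (hs : (s : ℝ) ≤ k) :
    hf.memLp.toLp f ∈ weighted γ s := by
  have hc := reg_cosh_mul hγ h hf
  refine ⟨hf.mem_Hs hs, ⟨hc.memLp.toLp _, hc.mem_Hs hs⟩, ?_⟩
  filter_upwards [hc.memLp.coeFn_toLp, hf.memLp.coeFn_toLp] with x h1 h2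
  rw [h2]
  refine h1.trans ?_
  rw [Complex.real_smul]

theorem mem_weighted_zero {s : ℝ≥0} {u : L2} (hu : u ∈ Hs s) : u ∈ weighted 0 s := by
  refine ⟨hu, ⟨u, hu⟩, Eventually.of_forall fun x => ?_⟩
  simp

namespace RegSpace

variable {k : ℕ}

/-- Multiplication by the inverse of `cosh(γ|x|)`. -/
def coshInv (γ : ℝ) : L2 →L[ℂ] L2 :=
  mulOp (fun x : X => (((Real.cosh (γ * ‖x‖))⁻¹ : ℝ) : ℂ)) 1
    (Continuous.aestronglyMeasurable (by
      refine Complex.continuous_ofReal.comp (Continuous.inv₀ (by fun_prop) fun x => ?_)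
      exact (Real.cosh_pos _).ne'))
    fun x => by
      rw [Complex.norm_real, norm_inv, Real.norm_of_nonneg (Real.cosh_pos _).le]
      exact inv_le_one_of_one_le₀ (Real.one_le_cosh _)

theorem coshInv_injective (γ : ℝ) : Function.Injective (coshInv γ) := by
  intro u v h
  refine Lp.ext ?_
  have h1 : coshInv γ u =ᵐ[volume] _ := mulOp_coe u
  have h2 : coshInv γ v =ᵐ[volume] _ := mulOp_coe v
  rw [h] at h1
  filter_upwards [h1, h2] with x h1 h2
  rw [h1] at h2
  have hc : (((Real.cosh (γ * ‖x‖))⁻¹ : ℝ) : ℂ) ≠ 0 := by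
    exact_mod_cast inv_ne_zero (Real.cosh_pos _).ne'
  exact mul_left_cancel₀ hc h2

/-- The embedding of the functions with derivatives decaying with rate `a > γ` into `H^s_γ`. -/
def toWSobₗ {γ a : ℝ} (hγ : 0 < γ) (h : γ < a) {s : ℝ≥0} (hs : (s : ℝ) ≤ k) :
    RegSpace (expWeight a) k →ₗ[ℝ] WSob γ s where
  toFun f := WSob.mk (toL2 f) (mem_weighted_of_reg hγ h f.reg_ofReal hs)
  map_add' f g := Subtype.ext (map_add toL2 f g)
  map_smul' c f := Subtype.ext (map_smul toL2 c f)

/-- Both `f ↦ cosh(γ|x|) f` and its composition with the Bessel potential are continuous by the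
closed graph theorem, since they can be undone by continuous injective maps. -/
theorem continuous_toWSobₗ {γ a : ℝ} (hγ : 0 < γ) (h : γ < a) {s : ℝ≥0} (hs : (s : ℝ) ≤ k) :
    Continuous (toWSobₗ hγ h hs : RegSpace (expWeight a) k →ₗ[ℝ] WSob γ s) := by
  -- first `f ↦ cosh(γ|x|) f` is bounded from `RegSpace` to `L²`, by the closed graph theorem
  let T₁ : RegSpace (expWeight a) k →ₗ[ℝ] L2 :=
    ((Hs s).subtype ∘ₗ coshMul γ s).restrictScalars ℝ ∘ₗ toWSobₗ hγ h hs
  have hT₁ : Continuous T₁ := by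
    refine continuous_of_comp_injective T₁ (coshInv γ) (coshInv γ).continuous
      (coshInv_injective γ) ?_
    have e : (fun f => coshInv γ (T₁ f)) = toL2 := by
      ext1 f
      refine Lp.ext ?_
      have h1 : coshInv γ (T₁ f) =ᵐ[volume] _ := mulOp_coe (T₁ f)
      filter_upwards [h1, coshMul_spec γ s (toWSobₗ hγ h hs f)] with x h1 h2
      have h3 : T₁ f x = (Real.cosh (γ * ‖x‖) : ℂ) * toL2 f x := h2
      rw [h1, h3, ← mul_assoc, ← Complex.ofReal_mul, inv_mul_cancel₀ (Real.cosh_pos _).ne',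
        Complex.ofReal_one, one_mul]
    rw [e]
    exact toL2.continuous
  let T : RegSpace (expWeight a) k →ₗ[ℝ] L2 :=
    (WSob.besselCosh γ s).restrictScalars ℝ ∘ₗ toWSobₗ hγ h hs
  have hT : Continuous T := by
    have hj : Continuous fun u : L2 => besselPotential X ℂ (-s) u.toD :=
      (besselPotential X ℂ (-s)).continuous.comp L2.continuous_toD
    have e : ∀ u : L2, besselPotential X ℂ s (besselPotential X ℂ (-s) u.toD) = u.toD := by
      intro u
      rw [besselPotential_besselPotential_apply, neg_add_cancel, besselPotential_zero]
      rfl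
    refine continuous_of_comp_injective T _ hj (fun u v huv => L2.toD_inj ?_) ?_
    · rw [← e u, ← e v]; exact congrArg _ huv
    · have e : (fun f => besselPotential X ℂ (-s) (T f).toD) = fun f => (T₁ f).toD := by
        ext1 f
        have h1 := bessel_spec s (coshMul γ s (toWSobₗ hγ h hs f))
        have h2 : (T f).toD = besselPotential X ℂ s (T₁ f).toD := h1.symm
        rw [h2, besselPotential_besselPotential_apply, add_neg_cancel, besselPotential_zero]
        rfl
      rw [e]
      exact L2.continuous_toD.comp hT₁
  obtain ⟨C, hC⟩ : ∃ C, ∀ f, ‖T f‖ ≤ C * ‖f‖ := ⟨_, (⟨T, hT⟩ : RegSpace (expWeight a) k →L[ℝ] L2).le_opNorm⟩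
  exact AddMonoidHomClass.continuous_of_bound _ C hC

/-- The embedding of the functions with derivatives decaying with rate `a > γ` into `H^s_γ`, as a
continuous map. -/
def toWSob {γ a : ℝ} (hγ : 0 < γ) (h : γ < a) {s : ℝ≥0} (hs : (s : ℝ) ≤ k) :
    RegSpace (expWeight a) k →L[ℝ] WSob γ s := ⟨toWSobₗ hγ h hs, continuous_toWSobₗ hγ h hs⟩

end RegSpace

/-! ### Real solutions of the linear equation -/

/-- The real part, as an operator on `L²`. -/
def reL : L2 →L[ℝ] L2 := (Complex.ofRealCLM ∘L Complex.reCLM).compLpL 2 (volume : Measure X)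

theorem reL_coe (u : L2) : reL u =ᵐ[volume] fun x => ((u x).re : ℂ) :=
  ContinuousLinearMap.coeFn_compLp _ _

/-- The distributional Laplacian of a regular function is the classical one. -/
theorem laplacianL2_reg {W : Weight} {v : X → ℂ} (hv : Reg W 2 v) (h : hv.memLp.toLp v ∈ Hs 2) :
    laplacianL2 ⟨hv.memLp.toLp v, h⟩ =ᵐ[volume] fun x => ∑ j, pd j (pd j v) x := by
  have hv1 : ∀ j, Reg W 1 (pd j v) := fun j => hv.2.2 j
  have hv2 : ∀ j, Reg W 0 (pd j (pd j v)) := fun j => (hv1 j).2.2 j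
  have e : laplacianL2 ⟨hv.memLp.toLp v, h⟩ = ∑ j, (hv2 j).memLp.toLp (pd j (pd j v)) := by
    refine L2.toD_inj ?_
    rw [laplacianL2_toD, laplacian_eq_sum_bvec, L2.toD_sum]
    refine Finset.sum_congr rfl fun j _ => ?_
    have h1 := lineDeriv_toLp (hv.mono (by norm_num : 1 ≤ 2)) j
    have h2 := lineDeriv_toLp (hv1 j) j
    exact (congrArg _ h1).trans h2
  rw [e]
  have : ∀ᵐ x, ∀ j, (hv2 j).memLp.toLp (pd j (pd j v)) x = pd j (pd j v) x :=
    ae_all_iff.2 fun j => (hv2 j).memLp.coeFn_toLp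
  have h3 := Lp.coeFn_finsetSum (μ := (volume : Measure X)) (p := 2) Finset.univ
    (fun j => (hv2 j).memLp.toLp (pd j (pd j v)))
  filter_upwards [h3, this] with x h3 hx
  rw [h3]
  simp only [Finset.sum_apply, hx]

/-- The Schrödinger operator commutes with the real part, on regular functions. -/
theorem shifted_reL {W : Weight} (V : 𝓢(X, ℝ)) (lam : ℝ) (u : Hs 2) {v : X → ℂ} (hv : Reg W 2 v)
    (hu : (u : L2) =ᵐ[volume] v) :
    ∃ h : reL u ∈ Hs 2, shifted V lam ⟨reL u, h⟩ = reL (shifted V lam u) := by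
  have hr : Reg W 2 (fun x => ((v x).re : ℂ)) := hv.clm (Complex.ofRealCLM ∘L Complex.reCLM)
  have e1 : (u : L2) = hv.memLp.toLp v := Lp.ext (hu.trans hv.memLp.coeFn_toLp.symm)
  have e2 : reL u = hr.memLp.toLp _ := by
    refine Lp.ext ((reL_coe u).trans (EventuallyEq.trans ?_ hr.memLp.coeFn_toLp.symm))
    filter_upwards [hu] with x hx
    rw [hx]
  have h : reL u ∈ Hs 2 := e2 ▸ hr.mem_Hs (by norm_num)
  refine ⟨h, Lp.ext ?_⟩
  have hL1 : laplacianL2 u =ᵐ[volume] fun x => ∑ j, pd j (pd j v) x := by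
    have h1 : hv.memLp.toLp v ∈ Hs 2 := e1 ▸ u.2
    have : u = ⟨hv.memLp.toLp v, h1⟩ := Subtype.ext e1
    rw [this]
    exact laplacianL2_reg hv h1
  have hL2 : laplacianL2 ⟨reL u, h⟩ =ᵐ[volume]
      fun x => ∑ j, pd j (pd j (fun x => ((v x).re : ℂ))) x := by
    have h1 : hr.memLp.toLp _ ∈ Hs 2 := e2 ▸ h
    have : (⟨reL u, h⟩ : Hs 2) = ⟨hr.memLp.toLp _, h1⟩ := Subtype.ext e2
    rw [this]
    exact laplacianL2_reg hr h1
  -- the real part commutes with derivatives and with the multiplication by `V`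
  have hpd : ∀ j x, pd j (pd j (fun x => ((v x).re : ℂ))) x = ((pd j (pd j v) x).re : ℂ) := by
    intro j x
    have h1 := pd_clm (j := j) (Complex.ofRealCLM ∘L Complex.reCLM) hv.2.1
    have h2 := pd_clm (j := j) (Complex.ofRealCLM ∘L Complex.reCLM) (hv.2.2 j).2.1
    simp only [ContinuousLinearMap.comp_apply, Complex.reCLM_apply, Complex.ofRealCLM_apply] at h1 h2
    rw [h1, h2]
  rw [shifted_eq, shifted_eq, potential_eq, potential_eq]
  refine EventuallyEq.trans ?_ (reL_coe _).symm
  have hs : ∀ (A B C : L2), (-A + B - C : L2) =ᵐ[volume] fun x => -A x + B x - C x := by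
    intro A B C
    filter_upwards [Lp.coeFn_sub (-A + B) C, Lp.coeFn_add (-A) B, Lp.coeFn_neg A] with x h1 h2 h3
    rw [h1, Pi.sub_apply, h2, Pi.add_apply, h3, Pi.neg_apply]
  filter_upwards [hs (laplacianL2 ⟨reL u, h⟩) (smoothOp (bddSmooth_schwartz V) (reL u))
      ((lam : ℂ) • reL u), hs (laplacianL2 u) (smoothOp (bddSmooth_schwartz V) u) ((lam : ℂ) • u),
    hL1, hL2, smoothOp_coe (bddSmooth_schwartz V) u, smoothOp_coe (bddSmooth_schwartz V) (reL u),
    Lp.coeFn_smul (lam : ℂ) (u : L2), Lp.coeFn_smul (lam : ℂ) (reL u), reL_coe u]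
    with x h1 h2 h3 h4 h5 h6 h7 h8 h9
  rw [h1, h2, h3, h4, h5, h6, h7, h8, Pi.smul_apply, Pi.smul_apply, h9]
  simp [hpd]

/-- The reduced resolvent acts on the spaces of regular functions. -/
theorem exists_resolvent_regSpace (V : 𝓢(X, ℝ)) {a κ : ℝ} {hκ : 0 < κ} (ha : SmallRate a hκ)
    (hfin : ∀ u ∈ eigenspaceH V (-(κ ^ 2 : ℂ)), ∃ v : X → ℂ, u =ᵐ[volume] v ∧
      ∀ k, Reg (expWeight a) k v)
    {P R : L2 →L[ℂ] L2} (hPmem : ∀ u, P u ∈ eigenspaceH V (-(κ ^ 2 : ℂ)))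
    (hPre : ∀ u, P (reL u) = reL (P u))
    (hR : ∀ f, ∃ h : R f ∈ Hs 2, shifted V (-(κ ^ 2 : ℂ)) ⟨R f, h⟩ + P (R f) = f)
    (hRl : ∀ u : Hs 2, R (shifted V (-(κ ^ 2 : ℂ)) u + P u) = u) {k : ℕ} (hk : 2 ≤ k) :
    ∃ S : RegSpace (expWeight a) k →L[ℝ] RegSpace (expWeight a) k,
      ∀ f, (S f).toL2 = R f.toL2 := by
  have hex : ∀ f : RegSpace (expWeight a) k, ∃ v : RegSpace (expWeight a) k, v.toL2 = R f.toL2 := by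
    intro f
    obtain ⟨hm, hs⟩ := hR f.toL2
    obtain ⟨p, hp, hpr⟩ := hfin _ (hPmem (R f.toL2))
    have hreg : Reg (expWeight a) k (fun x => (f x : ℂ) + (-1 : ℝ) • p x) :=
      f.reg_ofReal.add ((hpr k).smul (-1))
    obtain ⟨v, hv, huv⟩ := exists_reg_of_shifted V ha hreg ⟨R f.toL2, hm⟩ (by
      rw [← eq_sub_iff_add_eq] at hs
      rw [hs]
      filter_upwards [Lp.coeFn_sub f.toL2 (P (R f.toL2)), hp, f.toL2_coe] with x h1 h2 h3
      rw [h1, Pi.sub_apply, h2, h3]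
      simp [sub_eq_add_neg])
    have hlam : (-(κ ^ 2 : ℂ)) = ((-(κ ^ 2) : ℝ) : ℂ) := by push_cast; rfl
    obtain ⟨hm', hre⟩ := shifted_reL V (-(κ ^ 2)) ⟨R f.toL2, hm⟩ (hv.mono hk) huv
    have hfre : reL f.toL2 = f.toL2 := by
      refine Lp.ext ((reL_coe _).trans ?_)
      filter_upwards [f.toL2_coe] with x hx
      rw [hx, Complex.ofReal_re]
    -- `Re (R f)` solves the same equation as `R f`, so that `R f` is real
    have h1 : shifted V (-(κ ^ 2 : ℂ)) ⟨reL (R f.toL2), hm'⟩ + P (reL (R f.toL2)) = f.toL2 := by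
      have h2 := congrArg reL hs
      rw [map_add, hfre, ← hPre, hlam] at h2
      rw [hlam]
      exact (congrArg (· + P (reL (R f.toL2))) hre).trans h2
    have h2 := hRl ⟨reL (R f.toL2), hm'⟩
    rw [h1] at h2
    have hr : Reg (expWeight a) k fun x => (v x).re := hv.clm Complex.reCLM
    refine ⟨RegSpace.mk _ hr, ?_⟩
    rw [h2]
    refine Lp.ext ((RegSpace.toL2_coe _).trans (EventuallyEq.trans ?_ (reL_coe _).symm))
    filter_upwards [huv] with x hx
    have hx' : R f.toL2 x = v x := hx
    rw [hx']
    rfl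
  choose T hT using hex
  let S : RegSpace (expWeight a) k →ₗ[ℝ] RegSpace (expWeight a) k :=
    { toFun := T
      map_add' := fun f g => RegSpace.toL2_injective (by
        rw [hT, map_add, map_add, map_add, hT, hT])
      map_smul' := fun c f => RegSpace.toL2_injective (by
        rw [RingHom.id_apply, hT, map_smul RegSpace.toL2 c f, map_smul RegSpace.toL2 c (T f), hT]
        exact (R.restrictScalars ℝ).map_smul c _) }
  -- closed graph theorem
  have hS : Continuous S := by
    refine continuous_of_comp_injective S RegSpace.toL2 RegSpace.toL2.continuous
      RegSpace.toL2_injective ?_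
    have e : (fun f => RegSpace.toL2 (S f)) = fun f => R f.toL2 := funext hT
    rw [e]
    exact R.continuous.comp RegSpace.toL2.continuous
  exact ⟨⟨S, hS⟩, hT⟩

/-- Eigenfunctions decay exponentially, with all their derivatives. -/
theorem exists_reg_of_mem_eigenspaceH (V : 𝓢(X, ℝ)) {a κ : ℝ} {hκ : 0 < κ} (ha : SmallRate a hκ)
    {u : L2} (hu : u ∈ eigenspaceH V (-(κ ^ 2 : ℂ))) : ∃ v : X → ℂ, u =ᵐ[volume] v ∧
      ∀ k, Reg (expWeight a) k v := by
  obtain ⟨h, h0⟩ := mem_eigenspaceH.1 hu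
  have hk : ∀ k, ∃ v : X → ℂ, Reg (expWeight a) k v ∧ u =ᵐ[volume] v := fun k => by
    refine exists_reg_of_shifted V ha (Reg.zero _ k) ⟨u, h⟩ ?_
    rw [h0]
    exact Lp.coeFn_zero _ _ _
  choose v hv huv using hk
  refine ⟨v 0, huv 0, fun k => ?_⟩
  have : v 0 = v k := Measure.eq_of_ae_eq ((huv 0).symm.trans (huv k)) (hv 0).continuous
    (hv k).continuous
  rw [this]
  exact hv k

end NLS

end

end

noncomputable section

namespace NLS

/-! ### Resonant indices: finiteness and domination -/

section Indices

variable {N : ℕ} {ω : Fin N → ℝ}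

theorem sizeIdx_lt_of_lt {m n : Idx N} (h : absIdx n < absIdx m) : sizeIdx n < sizeIdx m := by
  obtain ⟨h1, j, hj⟩ := Pi.lt_def.1 h
  refine Finset.sum_lt_sum (fun i _ => ?_) ⟨j, Finset.mem_univ j, ?_⟩
  · have := h1 i
    simp only [absIdx, Int.abs_eq_natAbs] at this
    omega
  · simp only [absIdx, Int.abs_eq_natAbs] at hj
    omega

/-- Every resonant index dominates a minimal one. -/
theorem exists_Rmin_le {n : Idx N} (hn : n ∈ Res ω) : ∃ n' ∈ Rmin ω, absIdx n' ≤ absIdx n := by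
  induction h : sizeIdx n using Nat.strong_induction_on generalizing n with
  | _ s ih =>
    by_cases hmin : n ∈ Rmin ω
    · exact ⟨n, hmin, le_rfl⟩
    · obtain ⟨p, hp, hlt⟩ : ∃ p ∈ Res ω, absIdx p < absIdx n := by
        by_contra hcon
        exact hmin ⟨hn, hcon⟩
      obtain ⟨n', hn', hle⟩ := ih _ (h ▸ sizeIdx_lt_of_lt hlt) hp rfl
      exact ⟨n', hn', hle.trans hlt.le⟩

/-- The index `(A + 1) e_j - A e_i`. -/
def pairIdx (A : ℕ) (i j : Fin N) : Idx N := Pi.single j ((A : ℤ) + 1) - Pi.single i (A : ℤ)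

theorem absIdx_pairIdx {A : ℕ} {i j : Fin N} (hij : i ≠ j) (l : Fin N) :
    absIdx (pairIdx A i j) l = if l = j then (A : ℤ) + 1 else if l = i then (A : ℤ) else 0 := by
  rw [absIdx, pairIdx, Pi.sub_apply, Pi.single_apply, Pi.single_apply]
  split_ifs with h1 h2 h2
  · exact absurd (h2.symm.trans h1) hij
  · rw [sub_zero, abs_of_nonneg (by positivity)]
  · rw [zero_sub, abs_neg, abs_of_nonneg (by positivity)]
  · simp

/-- For large `A`, the indices `(A + 1) e_j - A e_i` with `ω_i < ω_j` are resonant. -/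
theorem exists_pairIdx_mem (ω : Fin N → ℝ) :
    ∃ A : ℕ, ∀ i j, ω i < ω j → pairIdx A i j ∈ Res ω := by
  have h1 : ∀ p : Fin N × Fin N, ∀ᶠ A : ℕ in atTop, ω p.1 < ω p.2 → pairIdx A p.1 p.2 ∈ Res ω := by
    rintro ⟨i, j⟩
    by_cases h : ω i < ω j
    · have hpos : 0 < ω j - ω i := sub_pos.2 h
      have h2 : Tendsto (fun A : ℕ => ω j + (A : ℝ) * (ω j - ω i)) atTop atTop :=
        tendsto_atTop_add_const_left _ _ (tendsto_natCast_atTop_atTop.atTop_mul_const hpos)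
      filter_upwards [h2.eventually_gt_atTop 0] with A hA _
      have hs : ∀ (l : Fin N) (c : ℤ), ∑ x, (Pi.single l c : Idx N) x = c := fun l c => by
        simp [Finset.sum_pi_single']
      refine ⟨?_, ?_⟩
      · simp only [pairIdx, Pi.sub_apply, Finset.sum_sub_distrib, hs]
        ring
      · have hd : ∀ (l : Fin N) (c : ℤ), ∑ x, ((Pi.single l c : Idx N) x : ℝ) * ω x = c * ω l := by
          intro l c
          rw [Finset.sum_eq_single l]
          · simp
          · intro b _ hb; simp [Pi.single_eq_of_ne hb]
          · simp
        simp only [dotIdx, pairIdx, Pi.sub_apply, Int.cast_sub, sub_mul, Finset.sum_sub_distrib, hd]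
        push_cast
        linarith
    · exact Eventually.of_forall fun _ h' => absurd h' h
  obtain ⟨A, hA⟩ := (eventually_all.2 h1).exists
  exact ⟨A, fun i j h => hA (i, j) h⟩

/-- Minimal indices are bounded. If one coordinate is large and positive and another one large and
negative, then a resonant index `pairIdx A i j` lies strictly below. Otherwise all the coordinates
are bounded on one side, and as their sum is `1` they are bounded on the other side too. -/
theorem abs_le_of_not_exists_lt (hω : StrictMono ω) {A : ℕ}
    (hA : ∀ i j, ω i < ω j → pairIdx A i j ∈ Res ω) {m : Idx N} (hm : ∑ j, m j = 1)
    (hmin : ¬ ∃ n ∈ Res ω, absIdx n < absIdx m) (j : Fin N) : |m j| ≤ N * (A + 1) + 1 := by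
  -- no coordinate exceeds `A` if another one is less than `-A`
  have key : ∀ i j, (A : ℤ) + 1 ≤ m i → m j ≤ -((A : ℤ) + 1) → False := by
    intro i j hi hj
    have hij : i ≠ j := by rintro rfl; omega
    have hle : ∀ p q : Fin N, p ≠ q → (A : ℤ) + 1 ≤ |m p| → (A : ℤ) + 1 ≤ |m q| →
        absIdx (pairIdx A p q) < absIdx m := by
      intro p q hpq hp hq
      refine Pi.lt_def.2 ⟨fun l => ?_, p, ?_⟩
      · rw [absIdx_pairIdx hpq]
        show _ ≤ |m l|
        split_ifs with h1 h2
        · rw [h1]; exact hq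
        · rw [h2]; omega
        · exact abs_nonneg _
      · rw [absIdx_pairIdx hpq, if_neg hpq, if_pos rfl]
        show _ < |m p|
        omega
    have hi' : (A : ℤ) + 1 ≤ |m i| := hi.trans (le_abs_self _)
    have hj' : (A : ℤ) + 1 ≤ |m j| := by
      have := neg_le_abs (m j)
      omega
    rcases lt_or_gt_of_ne (hω.injective.ne hij) with h | h
    · exact hmin ⟨_, hA i j h, hle i j hij hi' hj'⟩
    · exact hmin ⟨_, hA j i h, hle j i hij.symm hj' hi'⟩
  have hsplit : m j = 1 - ∑ i ∈ Finset.univ.erase j, m i := by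
    rw [← hm, ← Finset.add_sum_erase _ _ (Finset.mem_univ j)]; ring
  have hcard : ((Finset.univ.erase j).card : ℤ) ≤ N := by
    have := Finset.card_le_univ (Finset.univ.erase j)
    rw [Fintype.card_fin] at this
    exact_mod_cast this
  have hN1 : (1 : ℤ) ≤ N := by
    have := j.pos
    omega
  have hc1 : ((Finset.univ.erase j).card : ℤ) * (A + 1) ≤ N * (A + 1) := by gcongr
  have hc2 : 1 * ((A : ℤ) + 1) ≤ N * (A + 1) := by gcongr
  by_cases hpos : ∃ i, (A : ℤ) + 1 ≤ m i
  · obtain ⟨i, hi⟩ := hpos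
    have hlow : ∀ l, -((A : ℤ) + 1) ≤ m l := fun l => by
      by_contra hl
      exact key i l hi (by omega)
    have h1 := Finset.card_nsmul_le_sum (Finset.univ.erase j) m _ fun l _ => hlow l
    rw [nsmul_eq_mul] at h1
    have h2 := hlow j
    rw [abs_le]
    constructor <;> linarith
  · push Not at hpos
    have hup : ∀ l, m l ≤ (A : ℤ) + 1 := fun l => (hpos l).le
    have h1 := Finset.sum_le_card_nsmul (Finset.univ.erase j) m _ fun l _ => hup l
    rw [nsmul_eq_mul] at h1
    have h2 := hup j
    rw [abs_le]
    constructor <;> linarith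

theorem finite_of_abs_le (B : ℤ) : {m : Idx N | ∀ j, |m j| ≤ B}.Finite := by
  refine (Set.finite_Icc (fun _ => -B) (fun _ => B) : (Set.Icc (fun _ => -B : Idx N) _).Finite).subset
    fun m hm => ⟨fun j => (abs_le.1 (hm j)).1, fun j => (abs_le.1 (hm j)).2⟩

theorem finite_Rmin (hω : StrictMono ω) : (Rmin ω).Finite := by
  obtain ⟨A, hA⟩ := exists_pairIdx_mem ω
  exact (finite_of_abs_le _).subset fun m hm => abs_le_of_not_exists_lt hω hA hm.1.1 hm.2

theorem finite_NR1 (hω : StrictMono ω) : (NR1 ω).Finite := by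
  obtain ⟨A, hA⟩ := exists_pairIdx_mem ω
  refine (finite_of_abs_le _).subset fun m hm => abs_le_of_not_exists_lt hω hA hm.1.1 ?_
  rintro ⟨n, hn, hlt⟩
  obtain ⟨n', hn', hle⟩ := exists_Rmin_le hn
  exact hm.2 n' hn' (hle.trans_lt hlt)

theorem sum_stdIdx (j : Fin N) : ∑ i, stdIdx j i = 1 := by
  simp [stdIdx, Finset.sum_pi_single']

theorem dotIdx_stdIdx (j : Fin N) : dotIdx ω (stdIdx j) = ω j := by
  rw [dotIdx, Finset.sum_eq_single j]
  · simp [stdIdx]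
  · intro b _ hb; simp [stdIdx, Pi.single_eq_of_ne hb]
  · simp

theorem sizeIdx_stdIdx (j : Fin N) : sizeIdx (stdIdx j) = 1 := by
  rw [sizeIdx, Finset.sum_eq_single j]
  · simp [stdIdx]
  · intro b _ hb; simp [stdIdx, Pi.single_eq_of_ne hb]
  · simp

theorem stdIdx_injective : Function.Injective (stdIdx : Fin N → Idx N) := by
  intro i j h
  by_contra hne
  have := congrFun h i
  simp [stdIdx, Pi.single_eq_of_ne hne] at this

theorem stdIdx_mem_NR1 (hneg : ∀ j, ω j < 0) (j : Fin N) : stdIdx j ∈ NR1 ω := by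
  refine ⟨⟨sum_stdIdx j, by rw [dotIdx_stdIdx]; exact hneg j⟩, fun n hn hlt => ?_⟩
  have h1 := sizeIdx_lt_of_lt hlt
  rw [sizeIdx_stdIdx, Nat.lt_one_iff] at h1
  have h0 : ∀ j, n j = 0 := by
    simpa [sizeIdx, Finset.sum_eq_zero_iff] using h1
  have h2 := hn.1.1
  simp [h0] at h2

/-- The indices outside `NR1` and `Rmin` are dominated by a minimal resonant index. -/
theorem exists_Rmin_lt (hlin : ∀ m : Idx N, m ≠ 0 → dotIdx ω m ≠ 0) {m : Idx N}
    (hm : ∑ j, m j = 1) (h1 : m ∉ NR1 ω) (h2 : m ∉ Rmin ω) :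
    ∃ n ∈ Rmin ω, absIdx n < absIdx m := by
  have hm0 : m ≠ 0 := by rintro rfl; simp at hm
  rcases lt_or_gt_of_ne (hlin m hm0) with h | h
  · by_contra hcon
    push Not at hcon
    exact h1 ⟨⟨hm, h⟩, hcon⟩
  · obtain ⟨p, hp, hlt⟩ : ∃ p ∈ Res ω, absIdx p < absIdx m := by
      by_contra hcon
      exact h2 ⟨⟨hm, h⟩, hcon⟩
    obtain ⟨n', hn', hle⟩ := exists_Rmin_le hp
    exact ⟨n', hn', hle.trans_lt hlt⟩

/-! ### Monomials -/

theorem norm_cpowIdx (z : ℂ) (m : ℤ) : ‖cpowIdx z m‖ = ‖z‖ ^ m.natAbs := by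
  rw [cpowIdx]
  split_ifs with h
  · rw [norm_pow]; congr 1; omega
  · rw [norm_pow, RCLike.norm_conj]; congr 1; omega

theorem norm_monom (z : Fin N → ℂ) (m : Idx N) : ‖monom z m‖ = ∏ j, ‖z j‖ ^ (m j).natAbs := by
  rw [monom, norm_prod]
  exact Finset.prod_congr rfl fun j _ => norm_cpowIdx _ _

theorem norm1_nonneg {K : Type*} [NormedAddCommGroup K] (z : Fin N → K) : 0 ≤ norm1 z :=
  Finset.sum_nonneg fun _ _ => norm_nonneg _

theorem norm_le_norm1 {K : Type*} [NormedAddCommGroup K] (z : Fin N → K) (j : Fin N) : ‖z j‖ ≤ norm1 z :=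
  Finset.single_le_sum (f := fun j => ‖z j‖) (fun _ _ => norm_nonneg _) (Finset.mem_univ j)

theorem norm1_absSq_le (z : Fin N → ℂ) : norm1 (absSq z) ≤ norm1 z ^ 2 := by
  rw [norm1, norm1]
  simp only [absSq, norm_pow, norm_norm]
  exact Finset.sum_sq_le_sq_sum_of_nonneg fun _ _ => norm_nonneg _

theorem norm_monom_le_of_le {z : Fin N → ℂ} (hz : norm1 z ≤ 1) {m n : Idx N}
    (h : absIdx n ≤ absIdx m) : ‖monom z m‖ ≤ ‖monom z n‖ := by
  rw [norm_monom, norm_monom]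
  refine Finset.prod_le_prod (fun _ _ => by positivity) fun j _ => ?_
  refine pow_le_pow_of_le_one (norm_nonneg _) ((norm_le_norm1 z j).trans hz) ?_
  have := h j
  simp only [absIdx, Int.abs_eq_natAbs] at this
  omega

theorem norm_monom_le_one {z : Fin N → ℂ} (hz : norm1 z ≤ 1) (m : Idx N) : ‖monom z m‖ ≤ 1 := by
  rw [norm_monom]
  exact Finset.prod_le_one (fun _ _ => by positivity) fun j _ =>
    pow_le_one₀ (norm_nonneg _) ((norm_le_norm1 z j).trans hz)

theorem sizeIdx_mod_two (m : Idx N) : (sizeIdx m : ℤ) % 2 = (∑ j, m j) % 2 := by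
  rw [sizeIdx, Nat.cast_sum]
  rw [Finset.sum_int_mod, Finset.sum_int_mod Finset.univ 2 m]
  congr 1
  refine Finset.sum_congr rfl fun j _ => ?_
  omega

/-- A strict domination between indices of sum `1` gains two powers of `z`. -/
theorem norm_monom_le_of_lt {z : Fin N → ℂ} (hz : norm1 z ≤ 1) {m n : Idx N}
    (hm : ∑ j, m j = 1) (hn : ∑ j, n j = 1) (h : absIdx n < absIdx m) :
    ‖monom z m‖ ≤ norm1 z ^ 2 * ‖monom z n‖ := by
  have hle : ∀ j, (n j).natAbs ≤ (m j).natAbs := fun j => by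
    have := h.le j
    simp only [absIdx, Int.abs_eq_natAbs] at this
    omega
  have h1 := sizeIdx_lt_of_lt h
  have h2 := sizeIdx_mod_two m
  have h3 := sizeIdx_mod_two n
  rw [hm] at h2
  rw [hn] at h3
  rw [norm_monom, norm_monom]
  have e : ∀ j, ‖z j‖ ^ (m j).natAbs =
      ‖z j‖ ^ ((m j).natAbs - (n j).natAbs) * ‖z j‖ ^ (n j).natAbs := fun j => by
    rw [← pow_add, Nat.sub_add_cancel (hle j)]
  simp only [e, Finset.prod_mul_distrib]
  refine mul_le_mul_of_nonneg_right ?_ (Finset.prod_nonneg fun _ _ => by positivity)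
  calc ∏ j, ‖z j‖ ^ ((m j).natAbs - (n j).natAbs)
      ≤ ∏ j, norm1 z ^ ((m j).natAbs - (n j).natAbs) :=
        Finset.prod_le_prod (fun _ _ => by positivity) fun j _ => by
          gcongr; exact norm_le_norm1 z j
    _ = norm1 z ^ (sizeIdx m - sizeIdx n) := by
        rw [Finset.prod_pow_eq_pow_sum, sizeIdx, sizeIdx, Finset.sum_tsub_distrib _ fun j _ => hle j]
    _ ≤ norm1 z ^ 2 := pow_le_pow_of_le_one (norm1_nonneg z) hz (by omega)

/-- The sum of the products `|z_i| |z_j|` over `i ≠ j`. -/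
def crossSum (z : Fin N → ℂ) : ℝ :=
  ∑ p ∈ Finset.univ.filter (fun p : Fin N × Fin N => p.1 ≠ p.2), ‖z p.1‖ * ‖z p.2‖

theorem crossSum_nonneg (z : Fin N → ℂ) : 0 ≤ crossSum z :=
  Finset.sum_nonneg fun _ _ => by positivity

/-- Two different indices of sum `1` cannot both be supported at one and the same coordinate, so
that a product of the two monomials contains some `z_i z_j` with `i ≠ j`. -/
theorem norm_monom_mul_le {z : Fin N → ℂ} (hz : norm1 z ≤ 1) {m n : Idx N}
    (hm : ∑ j, m j = 1) (hn : ∑ j, n j = 1) (hmn : m ≠ n) :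
    ‖monom z m‖ * ‖monom z n‖ ≤ crossSum z := by
  have hz1 : ∀ j, ‖z j‖ ≤ 1 := fun j => (norm_le_norm1 z j).trans hz
  have hex : ∃ i j, i ≠ j ∧ (m i ≠ 0 ∨ n i ≠ 0) ∧ (m j ≠ 0 ∨ n j ≠ 0) := by
    by_contra hcon
    push Not at hcon
    apply hmn
    obtain ⟨i, hi⟩ : ∃ i, m i ≠ 0 := by
      by_contra h0
      push Not at h0
      simp [h0] at hm
    have h0 : ∀ j, j ≠ i → m j = 0 ∧ n j = 0 := fun j hj => by
      exact hcon i j (Ne.symm hj) (Or.inl hi)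
    rw [Finset.sum_eq_single i (fun j _ hj => (h0 j hj).1) (by simp)] at hm
    rw [Finset.sum_eq_single i (fun j _ hj => (h0 j hj).2) (by simp)] at hn
    ext j
    by_cases hj : j = i
    · rw [hj, hm, hn]
    · rw [(h0 j hj).1, (h0 j hj).2]
  obtain ⟨i, j, hij, hi, hj⟩ := hex
  have h1 : ‖monom z m‖ * ‖monom z n‖ ≤ ‖z i‖ * ‖z j‖ := by
    rw [norm_monom, norm_monom, ← Finset.prod_mul_distrib]
    simp only [← pow_add]
    have hj' : j ∈ Finset.univ.erase i := Finset.mem_erase.2 ⟨hij.symm, Finset.mem_univ j⟩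
    rw [← Finset.mul_prod_erase _ _ (Finset.mem_univ i), ← Finset.mul_prod_erase _ _ hj',
      ← mul_assoc]
    have h2 : ∏ x ∈ (Finset.univ.erase i).erase j, ‖z x‖ ^ ((m x).natAbs + (n x).natAbs) ≤ 1 :=
      Finset.prod_le_one (fun _ _ => by positivity) fun l _ => pow_le_one₀ (norm_nonneg _) (hz1 l)
    have h3 : ∀ l, (m l ≠ 0 ∨ n l ≠ 0) → ‖z l‖ ^ ((m l).natAbs + (n l).natAbs) ≤ ‖z l‖ := by
      intro l hl
      refine pow_le_of_le_one (norm_nonneg _) (hz1 l) ?_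
      omega
    calc _ ≤ ‖z i‖ * ‖z j‖ * 1 := by
          have := h3 i hi
          have := h3 j hj
          gcongr
      _ = _ := mul_one _
  refine h1.trans ?_
  exact Finset.single_le_sum (f := fun p : Fin N × Fin N => ‖z p.1‖ * ‖z p.2‖)
    (fun _ _ => by positivity) (Finset.mem_filter.2 ⟨Finset.mem_univ (i, j), hij⟩)

/-- High powers of the cross terms are dominated by the resonant monomials. -/
theorem exists_crossSum_pow_le (hω : StrictMono ω) : ∃ K : ℕ, ∃ C, 0 ≤ C ∧ ∀ z : Fin N → ℂ,
    norm1 z ≤ 1 → ∀ L, K ≤ L → crossSum z ^ L ≤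
      C ^ L * (norm1 z ^ 2 * ∑ m ∈ (finite_Rmin hω).toFinset, ‖monom z m‖) := by
  -- for `ω_i < ω_j`, the index `(A+1) e_j - A e_i` is resonant, and `|z_i z_j|^{A+2}` is bounded by
  -- `|z_i|²` times the modulus of its monomial
  obtain ⟨A, hA⟩ := exists_pairIdx_mem ω
  set s := Finset.univ.filter (fun p : Fin N × Fin N => p.1 ≠ p.2) with hs
  refine ⟨A + 2, s.card, by positivity, fun z hz L hL => ?_⟩
  obtain ⟨M, rfl⟩ : ∃ M, L = M + 1 := ⟨L - 1, by omega⟩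
  have hz1 : ∀ j, ‖z j‖ ≤ 1 := fun j => (norm_le_norm1 z j).trans hz
  have hp : ∀ p ∈ s, (‖z p.1‖ * ‖z p.2‖) ^ (M + 1) ≤
      norm1 z ^ 2 * ∑ m ∈ (finite_Rmin hω).toFinset, ‖monom z m‖ := by
    have key : ∀ i j, ω i < ω j → (‖z i‖ * ‖z j‖) ^ (M + 1) ≤
        norm1 z ^ 2 * ∑ m ∈ (finite_Rmin hω).toFinset, ‖monom z m‖ := by
      intro i j hij
      have hne : i ≠ j := by rintro rfl; exact lt_irrefl _ hij
      obtain ⟨n, hn, hle⟩ := exists_Rmin_le (hA i j hij)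
      have h1 : ‖monom z (pairIdx A i j)‖ = ‖z j‖ ^ (A + 1) * ‖z i‖ ^ A := by
        rw [norm_monom]
        have e : ∀ l, (pairIdx A i j l).natAbs = if l = j then A + 1 else if l = i then A else 0 := by
          intro l
          have := absIdx_pairIdx (A := A) hne l
          simp only [absIdx, Int.abs_eq_natAbs] at this
          split_ifs at this ⊢ <;> omega
        have hj' : j ∈ Finset.univ.erase i := Finset.mem_erase.2 ⟨hne.symm, Finset.mem_univ j⟩
        rw [← Finset.mul_prod_erase _ _ (Finset.mem_univ i), ← Finset.mul_prod_erase _ _ hj',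
          Finset.prod_eq_one]
        · rw [e, e, if_neg hne, if_pos rfl, if_pos rfl]; ring
        · intro l hl
          simp only [Finset.mem_erase] at hl
          rw [e, if_neg hl.1, if_neg hl.2.1, pow_zero]
      have h2 := norm_monom_le_of_le hz hle
      have h3 : ‖monom z n‖ ≤ ∑ m ∈ (finite_Rmin hω).toFinset, ‖monom z m‖ :=
        Finset.single_le_sum (f := fun m => ‖monom z m‖) (fun _ _ => norm_nonneg _) (by simpa using hn)
      have hzi := norm_nonneg (z i)
      have hzj := norm_nonneg (z j)
      calc (‖z i‖ * ‖z j‖) ^ (M + 1) ≤ (‖z i‖ * ‖z j‖) ^ (A + 2) :=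
            pow_le_pow_of_le_one (by positivity) (mul_le_one₀ (hz1 i) hzj (hz1 j)) hL
        _ = ‖z i‖ ^ 2 * ‖z j‖ * (‖z j‖ ^ (A + 1) * ‖z i‖ ^ A) := by ring
        _ ≤ ‖z i‖ ^ 2 * 1 * (‖z j‖ ^ (A + 1) * ‖z i‖ ^ A) := by gcongr; exact hz1 j
        _ = ‖z i‖ ^ 2 * ‖monom z (pairIdx A i j)‖ := by rw [h1, mul_one]
        _ ≤ norm1 z ^ 2 * ‖monom z n‖ := by gcongr; exact norm_le_norm1 z i
        _ ≤ _ := by gcongr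
    rintro ⟨i, j⟩ hp
    have hij : i ≠ j := (Finset.mem_filter.1 hp).2
    rcases lt_or_gt_of_ne (hω.injective.ne hij) with h | h
    · exact key i j h
    · rw [mul_comm]; exact key j i h
  by_cases hs0 : s = ∅
  · have e0 : crossSum z = 0 := by rw [crossSum, ← hs, hs0, Finset.sum_empty]
    rw [e0, hs0]; simp
  have hcard : (0 : ℝ) < s.card := by
    exact_mod_cast Finset.card_pos.2 (Finset.nonempty_iff_ne_empty.2 hs0)
  have h2 := pow_sum_div_card_le_sum_pow (s := s) (f := fun p => ‖z p.1‖ * ‖z p.2‖)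
    (fun _ _ => by positivity) M
  rw [div_le_iff₀ (by positivity)] at h2
  calc crossSum z ^ (M + 1) ≤ (∑ p ∈ s, (‖z p.1‖ * ‖z p.2‖) ^ (M + 1)) * (s.card : ℝ) ^ M := h2
    _ ≤ (s.card • (norm1 z ^ 2 * ∑ m ∈ (finite_Rmin hω).toFinset, ‖monom z m‖)) * (s.card : ℝ) ^ M := by
        gcongr
        exact Finset.sum_le_card_nsmul _ _ _ hp
    _ = _ := by rw [nsmul_eq_mul, pow_succ]; ring

theorem conj_cpowIdx (z : ℂ) (m : ℤ) : starRingEnd ℂ (cpowIdx z m) = cpowIdx z (-m) := by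
  rw [cpowIdx, cpowIdx]
  rcases lt_trichotomy m 0 with h | rfl | h
  · rw [if_neg (by omega), if_pos (by omega), map_pow, Complex.conj_conj]
  · simp
  · rw [if_pos h.le, if_neg (by omega), map_pow, neg_neg]

/-- Every cancellation of a `z` with a conjugate `z` produces a factor `|z|²`. -/
theorem cpowIdx_mul (z : ℂ) (a b : ℤ) : cpowIdx z a * cpowIdx z b =
    cpowIdx z (a + b) * ((‖z‖ ^ 2 : ℝ) : ℂ) ^ ((a.natAbs + b.natAbs - (a + b).natAbs) / 2) := by
  have hzz : ((‖z‖ ^ 2 : ℝ) : ℂ) = z * starRingEnd ℂ z := by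
    rw [Complex.mul_conj, Complex.normSq_eq_norm_sq]
  -- the case of opposite signs
  have key : ∀ (w : ℂ) (p q : ℕ), w * starRingEnd ℂ w = z * starRingEnd ℂ z → q ≤ p →
      w ^ p * (starRingEnd ℂ w) ^ q = w ^ (p - q) * (z * starRingEnd ℂ z) ^ q := by
    intro w p q hw hqp
    rw [← hw, mul_pow, ← mul_assoc, ← pow_add, Nat.sub_add_cancel hqp]
  have hw := mul_comm (starRingEnd ℂ z) z
  rw [hzz]
  simp only [cpowIdx]
  split_ifs with h1 h2 h3 h3 h2 h3 h3
  · rw [← pow_add, show (a.natAbs + b.natAbs - (a + b).natAbs) / 2 = 0 by omega, pow_zero, mul_one]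
    congr 1; omega
  · omega
  · rw [key z _ _ rfl (by omega)]
    congr 2 <;> omega
  · have := key (starRingEnd ℂ z) (-b).toNat a.toNat (by rw [Complex.conj_conj, hw]) (by omega)
    rw [Complex.conj_conj] at this
    rw [mul_comm, this]
    congr 2 <;> omega
  · rw [mul_comm, key z _ _ rfl (by omega)]
    congr 2 <;> omega
  · have := key (starRingEnd ℂ z) (-a).toNat b.toNat (by rw [Complex.conj_conj, hw]) (by omega)
    rw [Complex.conj_conj] at this
    rw [this]
    congr 2 <;> omega
  · omega
  · rw [← pow_add, show (a.natAbs + b.natAbs - (a + b).natAbs) / 2 = 0 by omega, pow_zero, mul_one]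
    congr 1; omega

/-- The excess `(∑ |a_i| - |∑ a_i|) / 2` of a family of integers. -/
def excess {ι : Type*} (s : Finset ι) (a : ι → ℤ) : ℕ :=
  (∑ i ∈ s, (a i).natAbs - (∑ i ∈ s, a i).natAbs) / 2

theorem natAbs_sum_le {ι : Type*} (s : Finset ι) (a : ι → ℤ) :
    (∑ i ∈ s, a i).natAbs ≤ ∑ i ∈ s, (a i).natAbs := by
  have := Finset.abs_sum_le_sum_abs a s
  zify
  exact this

theorem natAbs_sum_mod_two {ι : Type*} (s : Finset ι) (a : ι → ℤ) :
    (∑ i ∈ s, (a i).natAbs) % 2 = (∑ i ∈ s, a i).natAbs % 2 := by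
  classical
  induction s using Finset.induction_on with
  | empty => simp
  | insert i s hi ih =>
    rw [Finset.sum_insert hi, Finset.sum_insert hi]
    omega

/-- There is no cancellation exactly if the moduli add up. -/
theorem excess_eq_zero_iff {ι : Type*} (s : Finset ι) (a : ι → ℤ) :
    excess s a = 0 ↔ ∑ i ∈ s, (a i).natAbs = (∑ i ∈ s, a i).natAbs := by
  have h1 := natAbs_sum_le s a
  have h2 := natAbs_sum_mod_two s a
  rw [excess]
  omega

theorem prod_cpowIdx {ι : Type*} (s : Finset ι) (a : ι → ℤ) (z : ℂ) :
    ∏ i ∈ s, cpowIdx z (a i) = cpowIdx z (∑ i ∈ s, a i) * ((‖z‖ ^ 2 : ℝ) : ℂ) ^ excess s a := by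
  classical
  induction s using Finset.induction_on with
  | empty => simp [cpowIdx, excess]
  | insert i s hi ih =>
    rw [Finset.prod_insert hi, ih, ← mul_assoc, cpowIdx_mul, mul_assoc, ← pow_add,
      Finset.sum_insert hi]
    congr 2
    have h1 := natAbs_sum_le s a
    have h2 := natAbs_sum_mod_two s a
    rw [excess, excess, Finset.sum_insert hi, Finset.sum_insert hi]
    omega

theorem conj_monom (z : Fin N → ℂ) (m : Idx N) : starRingEnd ℂ (monom z m) = monom z (-m) := by
  rw [monom, monom, map_prod]
  exact Finset.prod_congr rfl fun j _ => conj_cpowIdx _ _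

/-- A product of monomials is a monomial times a product of powers of the `|z_j|²`. -/
theorem prod_monom {ι : Type*} (s : Finset ι) (t : ι → Idx N) (z : Fin N → ℂ) :
    ∏ i ∈ s, monom z (t i) = monom z (∑ i ∈ s, t i) *
      ((∏ j, absSq z j ^ excess s (fun i => t i j) : ℝ) : ℂ) := by
  simp only [monom]
  rw [Finset.prod_comm]
  push_cast
  rw [← Finset.prod_mul_distrib]
  refine Finset.prod_congr rfl fun j _ => ?_
  rw [prod_cpowIdx, Finset.sum_apply]
  simp [absSq]

end Indices

end NLS

end

noncomputable section

namespace NLS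

/-! ### The expansion of the nonlinearity in monomials -/

/-- The coefficient of `Y^r` in the Taylor polynomial of `g(Y)` of order `K` at `y`. -/
def taylorCoeff (K r : ℕ) (g : ℝ → ℝ) (y : ℝ) : ℝ :=
  ∑ p ∈ Finset.range K, (p.factorial : ℝ)⁻¹ * (p.choose r : ℝ) * iteratedDeriv p g y * (-y) ^ (p - r)

theorem contDiff_taylorCoeff (K r : ℕ) {g : ℝ → ℝ} (hg : ContDiff ℝ (⊤ : ℕ∞) g) :
    ContDiff ℝ (⊤ : ℕ∞) (taylorCoeff K r g) := by
  refine ContDiff.sum fun p _ => ?_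
  exact (contDiff_const.mul (RegSpace.contDiff_iteratedDeriv hg p)).mul (contDiff_neg.pow _)

theorem taylorCoeff_zero {K r : ℕ} (hr : r < K) (g : ℝ → ℝ) :
    taylorCoeff K r g 0 = iteratedDeriv r g 0 / r.factorial := by
  rw [taylorCoeff, Finset.sum_eq_single r]
  · simp; ring
  · intro p _ hp
    rcases lt_or_gt_of_ne hp with h | h
    · simp [Nat.choose_eq_zero_of_lt h]
    · rw [neg_zero, zero_pow (by omega), mul_zero]
  · intro h; exact absurd (Finset.mem_range.2 hr) h

/-- The Taylor polynomial of `g` at `y`, rewritten in powers of the variable instead of its distance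
to `y`. -/
theorem sum_taylorCoeff (K : ℕ) (g : ℝ → ℝ) (y Y : ℝ) :
    ∑ r ∈ Finset.range K, taylorCoeff K r g y * Y ^ r =
      ∑ p ∈ Finset.range K, (p.factorial : ℝ)⁻¹ * (iteratedDeriv p g y * (Y - y) ^ p) := by
  simp only [taylorCoeff, Finset.sum_mul]
  rw [Finset.sum_comm]
  refine Finset.sum_congr rfl fun p hp => ?_
  have h1 : (Y - y) ^ p = ∑ r ∈ Finset.range K, Y ^ r * (-y) ^ (p - r) * (p.choose r : ℝ) := by
    rw [sub_eq_add_neg, add_pow]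
    refine Finset.sum_subset (fun r hr => ?_) fun r _ hr => ?_
    · simp only [Finset.mem_range] at hp hr ⊢; omega
    · rw [Finset.mem_range, not_lt] at hr
      rw [Nat.choose_eq_zero_of_lt (by omega), Nat.cast_zero, mul_zero]
  rw [h1, Finset.mul_sum, Finset.mul_sum]
  exact Finset.sum_congr rfl fun r _ => by ring

namespace RegSpace

variable {W : Weight} {k : ℕ}

/-- The product of a nonempty finite sequence of functions. -/
def prodFin : (n : ℕ) → (Fin (n + 1) → RegSpace W k) → RegSpace W k
  | 0, f => f 0
  | n + 1, f => mulL (f 0) (prodFin n (Fin.tail f))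

theorem prodFin_apply (n : ℕ) (f : Fin (n + 1) → RegSpace W k) (x : X) :
    prodFin n f x = ∏ i, f i x := by
  induction n with
  | zero => simp [prodFin]
  | succ n ih =>
    rw [prodFin, mulL_apply, ih]
    exact (Fin.prod_univ_succ fun i => f i x).symm

theorem contDiff_prodFin (n : ℕ) :
    ContDiff ℝ (⊤ : ℕ∞) (prodFin n : (Fin (n + 1) → RegSpace W k) → RegSpace W k) := by
  induction n with
  | zero => exact contDiff_apply ℝ _ 0
  | succ n ih =>
    have h1 : ContDiff ℝ (⊤ : ℕ∞)
        (fun f : Fin (n + 1 + 1) → RegSpace W k => prodFin n (Fin.tail f)) :=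
      ih.comp (contDiff_pi.2 fun i => contDiff_apply ℝ _ i.succ)
    exact ContDiff.clm_apply (mulL.contDiff.comp (contDiff_apply ℝ _ 0)) h1

end RegSpace

open RegSpace

section Expansion

variable {N : ℕ} {W : Weight} {k : ℕ} {I : Finset (Idx N)}

/-- The alternating sum `m_1 - m_2 + m_3 - ⋯` of a tuple. -/
def altSum {r : ℕ} (t : Fin (2 * r + 1) → I) : Idx N := ∑ i : Fin (2 * r + 1), (-1 : ℤ) ^ (i : ℕ) • (t i : Idx N)

/-- The modulus `|z^{m_1}| |z^{m_2}| ⋯ / |z^m|`, `m` the alternating sum of the tuple, as a function of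
`w = |z|²`. -/
def altWeight {r : ℕ} (w : Fin N → ℝ) (t : Fin (2 * r + 1) → I) : ℝ :=
  ∏ j, w j ^ excess Finset.univ fun i : Fin (2 * r + 1) => ((-1 : ℤ) ^ (i : ℕ) • (t i : Idx N)) j

/-- The diagonal part `∑ |z^m|² Φ_m²` of `|∑ z^m Φ_m|²`, as a function of `w = |z|²`. -/
def diagSq (w : Fin N → ℝ) (Φ : I → RegSpace W k) : RegSpace W k :=
  ∑ m : I, (∏ j, w j ^ (m.1 j).natAbs) • mulL (Φ m) (Φ m)

/-- The real functions `g_m(w)` such that `g(|u|²) u` is, up to high order terms,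
`∑ z^m g_m(|z|²)` for `u = ∑ z^m Φ_m`. -/
def gCoeff (K : ℕ) (g : ℝ → ℝ) (m : Idx N) (w : Fin N → ℝ) (Φ : I → RegSpace W k) : RegSpace W k :=
  ∑ r ∈ Finset.range K, ∑ t : Fin (2 * r + 1) → I with altSum t = m,
    altWeight w t • nem (taylorCoeff K r g) (diagSq w Φ) (prodFin (2 * r) fun i => Φ (t i))

/-- The function `ℓ(u)` for `u = ∑ z^m Φ_m`. -/
def linComb (ℓ : ℂ →L[ℝ] ℝ) (z : Fin N → ℂ) (Φ : I → RegSpace W k) : RegSpace W k :=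
  ∑ m : I, ℓ (monom z m.1) • Φ m

/-- The function `|u|²` for `u = ∑ z^m Φ_m`. -/
def sqComb (z : Fin N → ℂ) (Φ : I → RegSpace W k) : RegSpace W k :=
  ∑ m : I, ∑ n : I, (monom z m.1 * starRingEnd ℂ (monom z n.1)).re • mulL (Φ m) (Φ n)

theorem contDiff_diagSq : ContDiff ℝ (⊤ : ℕ∞)
    fun p : (Fin N → ℝ) × (I → RegSpace W k) => diagSq p.1 p.2 := by
  refine ContDiff.sum fun m _ => ContDiff.fun_smul (contDiff_prod fun j _ => ?_) ?_
  · exact ((contDiff_apply ℝ ℝ j).comp contDiff_fst).pow _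
  · have h : ContDiff ℝ (⊤ : ℕ∞) fun p : (Fin N → ℝ) × (I → RegSpace W k) => p.2 m :=
      (contDiff_apply ℝ _ m).comp contDiff_snd
    exact ContDiff.clm_apply (mulL.contDiff.comp h) h

/-- The functions `g_m` depend smoothly on `w` and on the profile. -/
theorem contDiff_gCoeff (K : ℕ) {g : ℝ → ℝ} (hg : ContDiff ℝ (⊤ : ℕ∞) g) (m : Idx N) :
    ContDiff ℝ (⊤ : ℕ∞) fun p : (Fin N → ℝ) × (I → RegSpace W k) => gCoeff K g m p.1 p.2 := by
  refine ContDiff.sum fun r _ => ContDiff.sum fun t _ => ContDiff.fun_smul (contDiff_prod fun j _ => ?_) ?_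
  · exact ((contDiff_apply ℝ ℝ j).comp contDiff_fst).pow _
  · refine (contDiff_nem (contDiff_taylorCoeff K r hg)).comp
      (g := fun p : RegSpace W k × RegSpace W k => nem (taylorCoeff K r g) p.1 p.2)
      (f := fun p : (Fin N → ℝ) × (I → RegSpace W k) =>
        (diagSq p.1 p.2, prodFin (2 * r) fun i => p.2 (t i))) ?_
    refine contDiff_diagSq.prodMk ((contDiff_prodFin _).comp (contDiff_pi.2 fun i => ?_))
    exact (contDiff_apply ℝ _ (t i)).comp contDiff_snd

theorem contDiff_cpowIdx (m : ℤ) : ContDiff ℝ (⊤ : ℕ∞) fun z : ℂ => cpowIdx z m := by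
  simp only [cpowIdx]
  split_ifs
  · exact contDiff_id.pow _
  · exact Complex.conjCLE.contDiff.pow _

theorem contDiff_monom (m : Idx N) : ContDiff ℝ (⊤ : ℕ∞) fun z : Fin N → ℂ => monom z m :=
  contDiff_prod fun j _ => (contDiff_cpowIdx (m j)).comp (contDiff_apply ℝ ℂ j)

theorem contDiff_absSq : ContDiff ℝ (⊤ : ℕ∞) (absSq : (Fin N → ℂ) → Fin N → ℝ) :=
  contDiff_pi.2 fun j => (contDiff_norm_sq ℝ).comp (contDiff_apply ℝ ℂ j)

theorem contDiff_linComb (ℓ : ℂ →L[ℝ] ℝ) : ContDiff ℝ (⊤ : ℕ∞)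
    fun p : (Fin N → ℂ) × (I → RegSpace W k) => linComb ℓ p.1 p.2 := by
  refine ContDiff.sum fun m _ => ContDiff.fun_smul (ℓ.contDiff.comp ((contDiff_monom _).comp contDiff_fst)) ?_
  exact (contDiff_apply ℝ _ m).comp contDiff_snd

theorem contDiff_sqComb : ContDiff ℝ (⊤ : ℕ∞)
    fun p : (Fin N → ℂ) × (I → RegSpace W k) => sqComb p.1 p.2 := by
  have h : ∀ m : I, ContDiff ℝ (⊤ : ℕ∞) fun p : (Fin N → ℂ) × (I → RegSpace W k) => p.2 m :=
    fun m => (contDiff_apply ℝ _ m).comp contDiff_snd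
  have h1 : ∀ m : I, ContDiff ℝ (⊤ : ℕ∞)
      fun p : (Fin N → ℂ) × (I → RegSpace W k) => monom p.1 m.1 :=
    fun m => (contDiff_monom _).comp contDiff_fst
  refine ContDiff.sum fun m _ => ContDiff.sum fun n _ => ContDiff.fun_smul ?_ ?_
  · exact Complex.reCLM.contDiff.comp ((h1 m).mul (Complex.conjCLE.contDiff.comp (h1 n)))
  · exact ContDiff.clm_apply (mulL.contDiff.comp (h m)) (h n)

theorem linComb_apply (ℓ : ℂ →L[ℝ] ℝ) (z : Fin N → ℂ) (Φ : I → RegSpace W k) (x : X) :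
    linComb ℓ z Φ x = ℓ (∑ m : I, monom z m.1 * (Φ m x : ℂ)) := by
  rw [linComb, sum_apply', map_sum]
  refine Finset.sum_congr rfl fun m _ => ?_
  rw [smul_apply', mul_comm (monom z m.1), ← Complex.real_smul, map_smul, smul_eq_mul, mul_comm]

theorem sqComb_apply (z : Fin N → ℂ) (Φ : I → RegSpace W k) (x : X) :
    sqComb z Φ x = ‖∑ m : I, monom z m.1 * (Φ m x : ℂ)‖ ^ 2 := by
  rw [← Complex.normSq_eq_norm_sq, ← Complex.ofReal_re (Complex.normSq _), ← Complex.mul_conj,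
    map_sum, Finset.sum_mul_sum, Complex.re_sum, sqComb, sum_apply']
  refine Finset.sum_congr rfl fun m _ => ?_
  rw [Complex.re_sum, sum_apply']
  refine Finset.sum_congr rfl fun n _ => ?_
  rw [smul_apply', mulL_apply, map_mul, Complex.conj_ofReal, ← Complex.re_mul_ofReal]
  congr 1
  push_cast
  ring

theorem absSq_prod (z : Fin N → ℂ) (m : Idx N) :
    ∏ j, absSq z j ^ (m j).natAbs = (monom z m * starRingEnd ℂ (monom z m)).re := by
  rw [Complex.mul_conj, Complex.ofReal_re, Complex.normSq_eq_norm_sq, norm_monom,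
    ← Finset.prod_pow]
  refine Finset.prod_congr rfl fun j _ => ?_
  rw [absSq, ← pow_mul, ← pow_mul, mul_comm]

/-- The off-diagonal part of `|u|²`. -/
theorem sqComb_sub_diagSq (z : Fin N → ℂ) (Φ : I → RegSpace W k) :
    sqComb z Φ - diagSq (absSq z) Φ = ∑ m : I, ∑ n ∈ Finset.univ.erase m,
      (monom z m.1 * starRingEnd ℂ (monom z n.1)).re • mulL (Φ m) (Φ n) := by
  rw [sqComb, diagSq, ← Finset.sum_sub_distrib]
  refine Finset.sum_congr rfl fun m _ => ?_
  rw [absSq_prod, ← Finset.add_sum_erase _ _ (Finset.mem_univ m), add_sub_cancel_left]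

/-- The factors of the product `u ū u ⋯ u`. -/
def altConj (i : ℕ) (u : ℂ) : ℂ := if Even i then u else starRingEnd ℂ u

theorem prod_altConj (u : ℂ) (r : ℕ) :
    ∏ i : Fin (2 * r + 1), altConj i u = ((‖u‖ ^ 2 : ℝ) : ℂ) ^ r * u := by
  induction r with
  | zero => simp [altConj]
  | succ r ih =>
    have h1 : ∏ i : Fin (2 * (r + 1) + 1), altConj i u =
        (∏ i : Fin (2 * r + 1), altConj i u) * altConj (2 * r + 1) u * altConj (2 * r + 2) u := by
      show ∏ i : Fin (2 * r + 1 + 1 + 1), altConj i u = _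
      rw [Fin.prod_univ_castSucc, Fin.prod_univ_castSucc]
      rfl
    have h2 : altConj (2 * r + 1) u = starRingEnd ℂ u := if_neg (by
      rw [Nat.even_add_one, not_not]; exact even_two_mul r)
    have h3 : altConj (2 * r + 2) u = u := if_pos (by
      rw [show 2 * r + 2 = 2 * (r + 1) by ring]; exact even_two_mul _)
    have h4 : ((‖u‖ ^ 2 : ℝ) : ℂ) = u * starRingEnd ℂ u := by
      rw [Complex.mul_conj, Complex.normSq_eq_norm_sq]
    rw [h1, ih, h2, h3, pow_succ ((‖u‖ ^ 2 : ℝ) : ℂ), h4]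
    ring

theorem altConj_monom (i : ℕ) (z : Fin N → ℂ) (m : Idx N) :
    altConj i (monom z m) = monom z ((-1 : ℤ) ^ i • m) := by
  rw [altConj]
  split_ifs with h
  · rw [h.neg_one_pow, one_smul]
  · rw [(Nat.not_even_iff_odd.1 h).neg_one_pow, neg_one_smul, conj_monom]

/-- The expansion of `|u|^{2r} u = u ū u ⋯ u` for `u = ∑ z^m c_m`, with real `c_m`: the coefficients
depend on `z` only through `|z|²`. -/
theorem pow_mul_sum_monom (z : Fin N → ℂ) (c : I → ℝ) (r : ℕ) :
    ((‖∑ m : I, monom z m.1 * (c m : ℂ)‖ ^ 2 : ℝ) : ℂ) ^ r * ∑ m : I, monom z m.1 * (c m : ℂ) =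
      ∑ t : Fin (2 * r + 1) → I, monom z (altSum t) *
        ((altWeight (absSq z) t * ∏ i, c (t i) : ℝ) : ℂ) := by
  rw [← prod_altConj]
  have h1 : ∀ i : Fin (2 * r + 1), altConj i (∑ m : I, monom z m.1 * (c m : ℂ)) =
      ∑ m : I, altConj i (monom z m.1) * (c m : ℂ) := by
    intro i
    simp only [altConj]
    split_ifs
    · rfl
    · simp [map_sum]
  simp only [h1]
  rw [Finset.prod_univ_sum]
  simp only [Fintype.piFinset_univ]
  refine Finset.sum_congr rfl fun t _ => ?_
  rw [Finset.prod_mul_distrib]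
  simp only [altConj_monom]
  rw [prod_monom]
  push_cast [altWeight, altSum]
  ring

/-- The indices which occur in the expansion of order `K`. -/
def expIdx (I : Finset (Idx N)) (K : ℕ) : Finset (Idx N) :=
  (Finset.range K).biUnion fun r => Finset.univ.image fun t : Fin (2 * r + 1) → I => altSum t

/-- The expansion of the Taylor polynomial of `g(|u|²) u` at the diagonal part of `|u|²`. -/
theorem taylor_eq_sum_gCoeff {K : ℕ} {g : ℝ → ℝ} (hg : ContDiff ℝ (⊤ : ℕ∞) g) (ℓ : ℂ →L[ℝ] ℝ)
    (z : Fin N → ℂ) (Φ : I → RegSpace W k) {M : Finset (Idx N)} (hM : expIdx I K ⊆ M) :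
    ∑ p ∈ Finset.range K, ((p.factorial : ℝ)⁻¹) • nem (iteratedDeriv p g) (diagSq (absSq z) Φ)
      ((mulL (sqComb z Φ - diagSq (absSq z) Φ) ^ p) (linComb ℓ z Φ)) =
    ∑ m ∈ M, ℓ (monom z m) • gCoeff K g m (absSq z) Φ := by
  refine ext' fun x => ?_
  rw [sum_apply', sum_apply']
  simp only [smul_apply', nem_apply (contDiff_iteratedDeriv hg _), mulL_pow_apply, sub_apply',
    linComb_apply]
  set q : ℝ := diagSq (absSq z) Φ x with hq
  obtain ⟨u, hu⟩ : ∃ u : ℂ, u = ∑ m : I, monom z m.1 * (Φ m x : ℂ) := ⟨_, rfl⟩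
  rw [← hu]
  have hcast : ∀ (c : ℝ) (v : ℂ), ℓ ((c : ℂ) * v) = c * ℓ v := fun c v => by
    rw [← Complex.real_smul, map_smul, smul_eq_mul]
  have hcast' : ∀ (c : ℝ) (v : ℂ), ℓ (v * (c : ℂ)) = ℓ v * c := fun c v => by
    rw [mul_comm, hcast, mul_comm]
  -- everything can be evaluated at a point `x`, where `u = ∑ z^m Φ_m(x)`
  have hL : ∑ p ∈ Finset.range K, (p.factorial : ℝ)⁻¹ *
      (iteratedDeriv p g q * ((sqComb z Φ x - q) ^ p * ℓ u)) =
      ℓ (∑ r ∈ Finset.range K, (taylorCoeff K r g q : ℂ) * (((‖u‖ ^ 2 : ℝ) : ℂ) ^ r * u)) := by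
    have h1 := sum_taylorCoeff K g q (‖u‖ ^ 2)
    have h2 : ∀ r, (taylorCoeff K r g q : ℂ) * (((‖u‖ ^ 2 : ℝ) : ℂ) ^ r * u) =
        ((taylorCoeff K r g q * (‖u‖ ^ 2) ^ r : ℝ) : ℂ) * u := fun r => by push_cast; ring
    simp only [h2]
    rw [map_sum, Finset.sum_congr rfl fun r _ => hcast _ u]
    rw [← Finset.sum_mul, h1, Finset.sum_mul, sqComb_apply, ← hu]
    exact Finset.sum_congr rfl fun p _ => by ring
  have hpow : ∀ r, ((‖u‖ ^ 2 : ℝ) : ℂ) ^ r * u = ∑ t : Fin (2 * r + 1) → I, monom z (altSum t) *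
      ((altWeight (absSq z) t * ∏ i, Φ (t i) x : ℝ) : ℂ) :=
    hu ▸ pow_mul_sum_monom z fun m => Φ m x
  rw [hL]
  simp only [hpow]
  have hR : ∀ m ∈ M, ℓ (monom z m) * gCoeff K g m (absSq z) Φ x =
      ∑ r ∈ Finset.range K, ∑ t : Fin (2 * r + 1) → I with altSum t = m,
        ℓ ((taylorCoeff K r g q : ℂ) * (monom z (altSum t) *
          ((altWeight (absSq z) t * ∏ i, Φ (t i) x : ℝ) : ℂ))) := by
    intro m _
    rw [gCoeff, sum_apply', Finset.mul_sum]
    refine Finset.sum_congr rfl fun r _ => ?_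
    rw [sum_apply', Finset.mul_sum]
    refine Finset.sum_congr rfl fun t ht => ?_
    rw [(Finset.mem_filter.1 ht).2, hcast, hcast', smul_apply',
      nem_apply (contDiff_taylorCoeff K r hg), prodFin_apply]
    ring
  -- group the tuples by their alternating sum
  rw [Finset.sum_congr rfl hR, Finset.sum_comm, map_sum]
  refine Finset.sum_congr rfl fun r hr => ?_
  rw [Finset.mul_sum, map_sum]
  refine (Finset.sum_fiberwise_of_maps_to (fun t _ => hM ?_) _).symm
  exact Finset.mem_biUnion.2 ⟨r, hr, Finset.mem_image.2 ⟨t, Finset.mem_univ t, rfl⟩⟩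

/-! ### The functions `g_m` at the origin -/

/-- The diagonal part of `|u|²` vanishes at the origin, as every index of sum `1` is nonzero. -/
theorem diagSq_zero (hI : ∀ m ∈ I, ∑ j, m j = 1) (Φ : I → RegSpace W k) : diagSq 0 Φ = 0 := by
  rw [diagSq]
  refine Finset.sum_eq_zero fun m _ => ?_
  obtain ⟨j, hj⟩ : ∃ j, m.1 j ≠ 0 := by
    by_contra h0
    push Not at h0
    have := hI m.1 m.2
    simp [h0] at this
  rw [Finset.prod_eq_zero (Finset.mem_univ j), zero_smul]
  rw [Pi.zero_apply, zero_pow (by omega)]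

/-- At `w = 0` only the tuples without cancellation survive, that is, those with `∑ |m_l| = |m|`. -/
theorem altWeight_zero {r : ℕ} (t : Fin (2 * r + 1) → I) :
    altWeight 0 t = if ∑ i, absIdx (t i : Idx N) = absIdx (altSum t) then 1 else 0 := by
  have key : ∀ j, (excess Finset.univ fun i : Fin (2 * r + 1) => ((-1 : ℤ) ^ (i : ℕ) • (t i : Idx N)) j) = 0 ↔
      (∑ i, absIdx (t i : Idx N)) j = absIdx (altSum t) j := by
    intro j
    rw [excess_eq_zero_iff]
    have h1 : ∀ i : Fin (2 * r + 1), (((-1 : ℤ) ^ (i : ℕ) • (t i : Idx N)) j).natAbs =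
        ((t i : Idx N) j).natAbs := fun i => by
      simp [Int.natAbs_mul, Int.natAbs_pow]
    simp only [h1]
    rw [absIdx, altSum, Finset.sum_apply, Finset.sum_apply]
    simp only [absIdx, Int.abs_eq_natAbs]
    norm_cast
  split_ifs with h
  · exact Finset.prod_eq_one fun j _ => by rw [(key j).2 (congrFun h j), pow_zero]
  · obtain ⟨j, hj⟩ : ∃ j, (∑ i, absIdx (t i : Idx N)) j ≠ absIdx (altSum t) j := by
      by_contra hcon
      push Not at hcon
      exact h (funext hcon)
    refine Finset.prod_eq_zero (Finset.mem_univ j) ?_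
    rw [Pi.zero_apply, zero_pow]
    exact fun h0 => hj ((key j).1 h0)

theorem gCoeff_zero_apply (hI : ∀ m ∈ I, ∑ j, m j = 1) {K : ℕ} {g : ℝ → ℝ}
    (hg : ContDiff ℝ (⊤ : ℕ∞) g) (m : Idx N) (Φ : I → RegSpace W k) (x : X) :
    gCoeff K g m 0 Φ x = ∑ r ∈ Finset.range K, iteratedDeriv r g 0 / r.factorial *
      ∑ t : Fin (2 * r + 1) → I with altSum t = m ∧ ∑ i, absIdx (t i : Idx N) = absIdx m,
        ∏ i, Φ (t i) x := by
  rw [gCoeff, sum_apply']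
  refine Finset.sum_congr rfl fun r hr => ?_
  rw [sum_apply', ← Finset.filter_filter, Finset.sum_filter (fun t => ∑ i, absIdx _ = absIdx m),
    Finset.mul_sum]
  refine Finset.sum_congr rfl fun t ht => ?_
  rw [smul_apply', altWeight_zero, (Finset.mem_filter.1 ht).2, diagSq_zero hI,
    nem_apply (contDiff_taylorCoeff K r hg), zero_apply', taylorCoeff_zero (Finset.mem_range.1 hr),
    prodFin_apply]
  split_ifs <;> simp

end Expansion

end NLS

end

noncomputable section

namespace NLS

open RegSpace

/-! ### The remainder of the expansion -/

section Remainder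

variable {N : ℕ} {W : Weight} {k : ℕ} {I : Finset (Idx N)}

/-- The real part (for `ℓ = Re`) or imaginary part (for `ℓ = Im`) of the remainder
`g(|u|²) u - ∑_{m ∈ I} z^m g_m(|z|²) - ∑_{m ∈ J} z^m g_m(0)`, where `u = ∑ z^m Φ_m(|z|²)`. -/
def remainder (K : ℕ) (g : ℝ → ℝ) (J : Finset (Idx N)) (ℓ : ℂ →L[ℝ] ℝ)
    (Φ : (Fin N → ℝ) → I → RegSpace W k) (z : Fin N → ℂ) : RegSpace W k :=
  nem g (sqComb z (Φ (absSq z))) (linComb ℓ z (Φ (absSq z))) -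
    ∑ m ∈ I, ℓ (monom z m) • gCoeff K g m (absSq z) (Φ (absSq z)) -
    ∑ m ∈ J, ℓ (monom z m) • gCoeff K g m 0 (Φ 0)

/-- The remainder is as smooth as the profile. -/
theorem contDiffOn_remainder (K : ℕ) {g : ℝ → ℝ} (hg : ContDiff ℝ (⊤ : ℕ∞) g) (J : Finset (Idx N))
    (ℓ : ℂ →L[ℝ] ℝ) {Φ : (Fin N → ℝ) → I → RegSpace W k} {s : Set (Fin N → ℂ)}
    (hΦ : ContDiffOn ℝ (⊤ : ℕ∞) (fun z => Φ (absSq z)) s) :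
    ContDiffOn ℝ (⊤ : ℕ∞) (remainder K g J ℓ Φ) s := by
  have hp : ContDiffOn ℝ (⊤ : ℕ∞) (fun z : Fin N → ℂ => (z, Φ (absSq z))) s :=
    contDiffOn_id.prodMk hΦ
  have hw : ContDiffOn ℝ (⊤ : ℕ∞) (fun z : Fin N → ℂ => (absSq z, Φ (absSq z))) s :=
    contDiff_absSq.contDiffOn.prodMk hΦ
  have hm : ∀ m, ContDiffOn ℝ (⊤ : ℕ∞) (fun z : Fin N → ℂ => ℓ (monom z m)) s := fun m =>
    (ℓ.contDiff.comp (contDiff_monom m)).contDiffOn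
  have h1 := ContDiff.comp_contDiffOn (contDiff_sqComb (I := I) (W := W) (k := k)) hp
  have h2 := ContDiff.comp_contDiffOn (contDiff_linComb (I := I) (W := W) (k := k) ℓ) hp
  have h3 := ContDiff.comp_contDiffOn (contDiff_nem (W := W) (k := k) hg) (h1.prodMk h2)
  have h4 := fun m => ContDiff.comp_contDiffOn
    (contDiff_gCoeff (I := I) (W := W) (k := k) K hg m) hw
  have h5 := ContDiffOn.sum (s := I) fun m _ => (hm m).fun_smul (h4 m)
  have h6 := ContDiffOn.sum (s := J) fun m _ => (hm m).fun_smul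
    (contDiffOn_const (c := gCoeff K g m 0 (Φ 0)))
  exact ContDiffOn.sub (ContDiffOn.sub h3 h5) h6

theorem sum_altSum (hI : ∀ m ∈ I, ∑ j, m j = 1) {r : ℕ} (t : Fin (2 * r + 1) → I) :
    ∑ j, altSum t j = 1 := by
  have h0 : ∑ j, altSum t j = ∑ i : Fin (2 * r + 1), (-1 : ℤ) ^ (i : ℕ) := by
    simp only [altSum, Finset.sum_apply, Pi.smul_apply]
    rw [Finset.sum_comm]
    simp only [← Finset.smul_sum]
    exact Finset.sum_congr rfl fun i _ => by rw [hI _ (t i).2, smul_eq_mul, mul_one]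
  rw [h0]
  clear h0 t
  induction r with
  | zero => simp
  | succ r ih =>
    show ∑ i : Fin (2 * r + 1 + 1 + 1), (-1 : ℤ) ^ (i : ℕ) = 1
    rw [Fin.sum_univ_castSucc, Fin.sum_univ_castSucc]
    have h1 : ∑ i : Fin (2 * r + 1), (-1 : ℤ) ^ ((i.castSucc).castSucc : ℕ) = 1 := ih
    rw [h1]
    have h2 : ((Fin.last (2 * r + 1)).castSucc : ℕ) = 2 * r + 1 := rfl
    have h3 : ((Fin.last (2 * r + 1 + 1)) : ℕ) = 2 * r + 1 + 1 := rfl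
    rw [h2, h3, pow_succ _ (2 * r + 1), pow_succ _ (2 * r), pow_mul]
    norm_num

theorem crossSum_le (z : Fin N → ℂ) : crossSum z ≤ norm1 z ^ 2 := by
  rw [crossSum, norm1, sq, Finset.sum_mul_sum, ← Finset.sum_product']
  exact Finset.sum_le_sum_of_subset_of_nonneg (Finset.subset_univ _) fun _ _ _ => by positivity

theorem norm_absSq_le (z : Fin N → ℂ) : ‖absSq z‖ ≤ norm1 z ^ 2 := by
  refine (pi_norm_le_iff_of_nonneg (by positivity)).2 fun j => ?_
  rw [absSq, norm_pow, norm_norm]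
  have := norm_le_norm1 z j
  gcongr

/-- The off-diagonal part of `|u|²` consists of products of two different monomials. -/
theorem norm_sqComb_sub_diagSq_le {z : Fin N → ℂ} (hz : norm1 z ≤ 1) (hI : ∀ m ∈ I, ∑ j, m j = 1)
    (Φ : I → RegSpace W k) {B : ℝ} (hB : ‖Φ‖ ≤ B) : ‖sqComb z Φ - diagSq (absSq z) Φ‖ ≤
      (I.card ^ 2 * ‖mulL (W := W) (k := k)‖ * B ^ 2) * crossSum z := by
  have hB0 : 0 ≤ B := (norm_nonneg _).trans hB
  have hc := crossSum_nonneg z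
  rw [sqComb_sub_diagSq]
  have hterm : ∀ m n : I, n ∈ Finset.univ.erase m →
      ‖(monom z m.1 * starRingEnd ℂ (monom z n.1)).re • mulL (Φ m) (Φ n)‖ ≤
        crossSum z * (‖mulL (W := W) (k := k)‖ * B * B) := by
    intro m n hmn
    have hne : m.1 ≠ n.1 := fun h => (Finset.mem_erase.1 hmn).1 (Subtype.ext h.symm)
    rw [norm_smul]
    have h1 : ‖(monom z m.1 * starRingEnd ℂ (monom z n.1)).re‖ ≤ crossSum z := by
      refine (Complex.abs_re_le_norm _).trans ?_
      rw [norm_mul, RCLike.norm_conj]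
      exact norm_monom_mul_le hz (hI _ m.2) (hI _ n.2) hne
    have h2 : ‖mulL (Φ m) (Φ n)‖ ≤ ‖mulL (W := W) (k := k)‖ * B * B := by
      refine (mulL.le_opNorm₂ _ _).trans ?_
      have := (norm_le_pi_norm Φ m).trans hB
      have := (norm_le_pi_norm Φ n).trans hB
      gcongr
    gcongr
  have h3 : ∀ m : I, ‖∑ n ∈ Finset.univ.erase m,
      (monom z m.1 * starRingEnd ℂ (monom z n.1)).re • mulL (Φ m) (Φ n)‖ ≤
        I.card * (crossSum z * (‖mulL (W := W) (k := k)‖ * B * B)) := by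
    intro m
    refine (norm_sum_le _ _).trans ((Finset.sum_le_card_nsmul _ _ _ (hterm m)).trans ?_)
    rw [nsmul_eq_mul]
    have : ((Finset.univ.erase m).card : ℝ) ≤ I.card := by
      have := Finset.card_le_univ (Finset.univ.erase m)
      rw [Fintype.card_coe] at this
      exact_mod_cast this
    have h0 := norm_nonneg (mulL (W := W) (k := k))
    gcongr
  refine (norm_sum_le _ _).trans ((Finset.sum_le_card_nsmul _ _ _ fun m _ => h3 m).trans ?_)
  rw [nsmul_eq_mul, Finset.card_univ, Fintype.card_coe]
  exact le_of_eq (by ring)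

theorem norm_linComb_le {z : Fin N → ℂ} (hz : norm1 z ≤ 1) {ℓ : ℂ →L[ℝ] ℝ} (hℓ : ‖ℓ‖ ≤ 1)
    (Φ : I → RegSpace W k) {B : ℝ} (hB : ‖Φ‖ ≤ B) : ‖linComb ℓ z Φ‖ ≤ I.card * B := by
  rw [linComb]
  refine (norm_sum_le _ _).trans ((Finset.sum_le_card_nsmul _ _ B fun m _ => ?_).trans ?_)
  · rw [norm_smul]
    have h1 : ‖ℓ (monom z m.1)‖ ≤ 1 :=
      (ℓ.le_of_opNorm_le hℓ _).trans (by rw [one_mul]; exact norm_monom_le_one hz _)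
    calc _ ≤ 1 * B := by gcongr; exact (norm_le_pi_norm Φ m).trans hB
      _ = B := one_mul _
  · rw [nsmul_eq_mul, Finset.card_univ, Fintype.card_coe]

/-- The remainder is bounded by the minimal resonant monomials, with a gain of two powers of `z`. -/
theorem exists_remainder_le {J : Finset (Idx N)} {ω : Fin N → ℝ} (hω : StrictMono ω)
    (hlin : ∀ m : Idx N, m ≠ 0 → dotIdx ω m ≠ 0) (hImem : ∀ m, m ∈ I ↔ m ∈ NR1 ω)
    (hJmem : ∀ m, m ∈ J ↔ m ∈ Rmin ω) : ∃ K₀ : ℕ, ∀ K, K₀ ≤ K →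
    ∀ {g : ℝ → ℝ}, ContDiff ℝ (⊤ : ℕ∞) g → ∀ (W : Weight) (k : ℕ),
    ∀ Φ : (Fin N → ℝ) → I → RegSpace W k, DifferentiableAt ℝ Φ 0 →
    ∃ δ > 0, ∃ C, 0 ≤ C ∧ ∀ z, norm1 z < δ → ∀ ℓ : ℂ →L[ℝ] ℝ, ‖ℓ‖ ≤ 1 →
      ‖remainder K g J ℓ Φ z‖ ≤ C * (norm1 z ^ 2 * ∑ m ∈ J, ‖monom z m‖) := by
  classical
  obtain ⟨K₀, A, hA, hcross⟩ := exists_crossSum_pow_le hω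
  refine ⟨K₀, fun K hK g hg W k Φ hΦ => ?_⟩
  have hJ : (finite_Rmin hω).toFinset = J := by ext m; rw [hJmem, Set.Finite.mem_toFinset]
  rw [hJ] at hcross
  have hI1 : ∀ m ∈ I, ∑ j, m j = 1 := fun m hm => ((hImem m).1 hm).1.1
  have hJ1 : ∀ m ∈ J, ∑ j, m j = 1 := fun m hm => ((hJmem m).1 hm).1.1
  have hIJ : Disjoint I J := Finset.disjoint_left.2 fun m h1 h2 =>
    lt_asymm ((hImem m).1 h1).1.2 ((hJmem m).1 h2).1.2
  set M : Finset (Idx N) := (expIdx I K ∪ (I ∪ J)) with hM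
  have hM1 : ∀ m ∈ M, ∑ j, m j = 1 := by
    intro m hm
    rcases Finset.mem_union.1 hm with h | h
    · obtain ⟨r, -, h⟩ := Finset.mem_biUnion.1 h
      obtain ⟨t, -, rfl⟩ := Finset.mem_image.1 h
      exact sum_altSum hI1 t
    · rcases Finset.mem_union.1 h with h | h
      exacts [hI1 m h, hJ1 m h]
  -- the bounds near `w = 0`
  obtain ⟨δ₁, hδ₁, C₁, hC₁, htay⟩ := exists_nem_taylor (W := W) (k := k) K hg
  have hgd : ∀ m, DifferentiableAt ℝ (fun w => gCoeff K g m w (Φ w)) 0 := fun m => by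
    have h1 : DifferentiableAt ℝ (fun w : Fin N → ℝ => (w, Φ w)) 0 := differentiableAt_id.prodMk hΦ
    have h2 := (contDiff_gCoeff (I := I) (W := W) (k := k) K hg m).differentiable (by simp) (0, Φ 0)
    have h3 := DifferentiableAt.comp (0 : Fin N → ℝ) h2 h1
    exact h3
  have hq : ContinuousAt (fun w => diagSq w (Φ w)) 0 := by
    have h1 : ContinuousAt (fun w : Fin N → ℝ => (w, Φ w)) 0 := continuousAt_id.prodMk hΦ.continuousAt
    have h2 := (contDiff_diagSq (N := N) (I := I) (W := W) (k := k)).continuous.continuousAt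
      (x := (0, Φ 0))
    have h3 := ContinuousAt.comp (x := (0 : Fin N → ℝ)) h2 h1
    exact h3
  have e1 : ∀ᶠ w in 𝓝 (0 : Fin N → ℝ), ‖Φ w‖ ≤ ‖Φ 0‖ + 1 := by
    have := hΦ.continuousAt.norm.eventually_lt_const (lt_add_one _)
    exact this.mono fun _ h => h.le
  have e2 : ∀ᶠ w in 𝓝 (0 : Fin N → ℝ), ‖diagSq w (Φ w)‖ ≤ δ₁ := by
    have h0 : ‖diagSq 0 (Φ 0)‖ < δ₁ := by rw [diagSq_zero hI1, norm_zero]; exact hδ₁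
    exact (hq.norm.eventually_lt_const h0).mono fun _ h => h.le
  have e3 : ∃ C₂, ∀ᶠ w in 𝓝 (0 : Fin N → ℝ), ∀ m ∈ M,
      ‖gCoeff K g m w (Φ w)‖ ≤ C₂ ∧ ‖gCoeff K g m w (Φ w) - gCoeff K g m 0 (Φ 0)‖ ≤ C₂ * ‖w‖ := by
    have h1 : ∀ m, ∃ c, 0 ≤ c ∧ ∀ᶠ w in 𝓝 (0 : Fin N → ℝ),
        ‖gCoeff K g m w (Φ w)‖ ≤ c ∧ ‖gCoeff K g m w (Φ w) - gCoeff K g m 0 (Φ 0)‖ ≤ c * ‖w‖ := by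
      intro m
      obtain ⟨c, hc⟩ := (hgd m).isBigO_sub.bound
      refine ⟨max (‖gCoeff K g m 0 (Φ 0)‖ + 1) c, le_max_of_le_left (by positivity), ?_⟩
      filter_upwards [hc, (hgd m).continuousAt.norm.eventually_lt_const (lt_add_one _)] with w h1 h2
      rw [sub_zero] at h1
      exact ⟨h2.le.trans (le_max_left _ _), h1.trans (by gcongr; exact le_max_right _ _)⟩
    choose c hc0 hc using h1
    refine ⟨∑ m ∈ M, c m, ?_⟩
    rw [Filter.eventually_all_finset]
    intro m hm
    have hle : c m ≤ ∑ m ∈ M, c m := Finset.single_le_sum (fun m _ => hc0 m) hm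
    filter_upwards [hc m] with w h
    exact ⟨h.1.trans hle, h.2.trans (by gcongr)⟩
  obtain ⟨C₂, e3⟩ := e3
  obtain ⟨η, hη, hball⟩ := Metric.eventually_nhds_iff.1 (e1.and (e2.and e3))
  set B := ‖Φ 0‖ + 1 with hB
  have hB0 : 0 ≤ B := by positivity
  set D := I.card ^ 2 * ‖mulL (W := W) (k := k)‖ * B ^ 2 with hD
  have hD0 : 0 ≤ D := by have := norm_nonneg (mulL (W := W) (k := k)); positivity
  have hDlt : ∀ t : ℝ, t < δ₁ / (D + 1) → 0 ≤ t → D * t ≤ δ₁ := fun t ht ht0 => by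
    rw [lt_div_iff₀ (by positivity)] at ht
    nlinarith
  refine ⟨min 1 (min η (δ₁ / (D + 1))), by positivity,
    C₁ * D ^ K * (I.card * B) * A ^ K + M.card * |C₂|, by positivity, fun z hz ℓ hℓ => ?_⟩
  simp only [lt_min_iff] at hz
  obtain ⟨hz1, hzη, hzδ⟩ := hz
  have hz0 := norm1_nonneg z
  have hzsq : norm1 z ^ 2 ≤ norm1 z := by nlinarith
  obtain ⟨b1, b2, b3⟩ := @hball (absSq z) (by
    rw [dist_zero_right]
    exact ((norm_absSq_le z).trans hzsq).trans_lt hzη)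
  set w := absSq z with hw
  set S := norm1 z ^ 2 * ∑ m ∈ J, ‖monom z m‖ with hS
  have hS0 : 0 ≤ S := mul_nonneg (by positivity) (Finset.sum_nonneg fun _ _ => norm_nonneg _)
  have hd := norm_sqComb_sub_diagSq_le hz1.le hI1 (Φ w) b1
  have hd1 : ‖sqComb z (Φ w) - diagSq w (Φ w)‖ ≤ δ₁ :=
    hd.trans (hDlt _ (((crossSum_le z).trans hzsq).trans_lt hzδ) (crossSum_nonneg z))
  -- the Taylor remainder
  have hT := htay (diagSq w (Φ w)) (sqComb z (Φ w) - diagSq w (Φ w)) (linComb ℓ z (Φ w)) b2 hd1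
  rw [add_sub_cancel, taylor_eq_sum_gCoeff hg ℓ z (Φ w) (M := M) Finset.subset_union_left] at hT
  have hT2 : C₁ * ‖sqComb z (Φ w) - diagSq w (Φ w)‖ ^ K * ‖linComb ℓ z (Φ w)‖ ≤
      C₁ * D ^ K * (I.card * B) * A ^ K * S := by
    have h1 := norm_linComb_le hz1.le hℓ (Φ w) b1
    have h2 := hcross z hz1.le K hK
    have hc0 := crossSum_nonneg z
    calc C₁ * ‖sqComb z (Φ w) - diagSq w (Φ w)‖ ^ K * ‖linComb ℓ z (Φ w)‖
        ≤ C₁ * (D * crossSum z) ^ K * (I.card * B) := by gcongr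
      _ = C₁ * D ^ K * (I.card * B) * crossSum z ^ K := by rw [mul_pow]; ring
      _ ≤ C₁ * D ^ K * (I.card * B) * (A ^ K * S) := by gcongr
      _ = _ := by ring
  -- the other terms
  have hℓm : ∀ m, ‖ℓ (monom z m)‖ ≤ ‖monom z m‖ := fun m =>
    (ℓ.le_of_opNorm_le hℓ _).trans (by rw [one_mul])
  have hsplit : remainder K g J ℓ Φ z =
      (nem g (sqComb z (Φ w)) (linComb ℓ z (Φ w)) - ∑ m ∈ M, ℓ (monom z m) • gCoeff K g m w (Φ w)) +
      ∑ m ∈ M \ I, ℓ (monom z m) • (gCoeff K g m w (Φ w) -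
        if m ∈ J then gCoeff K g m 0 (Φ 0) else 0) := by
    have h1 : ∑ m ∈ M, ℓ (monom z m) • gCoeff K g m w (Φ w) =
        ∑ m ∈ M \ I, ℓ (monom z m) • gCoeff K g m w (Φ w) +
          ∑ m ∈ I, ℓ (monom z m) • gCoeff K g m w (Φ w) :=
      (Finset.sum_sdiff (Finset.subset_union_left.trans Finset.subset_union_right)).symm
    have h2 : ∑ m ∈ M \ I, ℓ (monom z m) • (if m ∈ J then gCoeff K g m 0 (Φ 0) else 0) =
        ∑ m ∈ J, ℓ (monom z m) • gCoeff K g m 0 (Φ 0) := by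
      simp only [smul_ite, smul_zero]
      rw [← Finset.sum_filter]
      refine Finset.sum_congr ?_ fun _ _ => rfl
      ext m
      simp only [Finset.mem_filter, Finset.mem_sdiff]
      refine ⟨fun h => h.2, fun h => ⟨⟨?_, Finset.disjoint_right.1 hIJ h⟩, h⟩⟩
      exact Finset.mem_union_right _ (Finset.mem_union_right _ h)
    simp only [smul_sub, Finset.sum_sub_distrib]
    rw [h1, h2, remainder]
    abel
  rw [hsplit, add_mul]
  refine (norm_add_le _ _).trans (add_le_add (hT.trans hT2) ?_)
  have hterm : ∀ m ∈ M \ I, ‖ℓ (monom z m) • (gCoeff K g m w (Φ w) -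
      if m ∈ J then gCoeff K g m 0 (Φ 0) else 0)‖ ≤ |C₂| * S := by
    intro m hm
    obtain ⟨hmM, hmI⟩ := Finset.mem_sdiff.1 hm
    obtain ⟨c1, c2⟩ := b3 m hmM
    have hsum : ∀ n ∈ J, ‖monom z n‖ ≤ ∑ m ∈ J, ‖monom z m‖ := fun n hn =>
      Finset.single_le_sum (f := fun m => ‖monom z m‖) (fun _ _ => norm_nonneg _) hn
    rw [norm_smul]
    -- for `m ∈ J` the factor `g_m(w) - g_m(0)` is small; any other index of `M` outside `I` lies
    -- strictly above some minimal resonant index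
    split_ifs with hmJ
    · have h3 : ‖gCoeff K g m w (Φ w) - gCoeff K g m 0 (Φ 0)‖ ≤ |C₂| * norm1 z ^ 2 :=
        c2.trans (by gcongr; exacts [le_abs_self _, norm_absSq_le z])
      calc _ ≤ (∑ m ∈ J, ‖monom z m‖) * (|C₂| * norm1 z ^ 2) := by
            gcongr; exact (hℓm m).trans (hsum m hmJ)
        _ = _ := by rw [hS]; ring
    · obtain ⟨n, hn, hlt⟩ := exists_Rmin_lt hlin (hM1 m hmM) (fun h => hmI ((hImem m).2 h))
        (fun h => hmJ ((hJmem m).2 h))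
      rw [sub_zero]
      have h4 := norm_monom_le_of_lt hz1.le (hM1 m hmM) hn.1.1 hlt
      calc _ ≤ (norm1 z ^ 2 * ∑ m ∈ J, ‖monom z m‖) * |C₂| := by
            refine mul_le_mul ((hℓm m).trans (h4.trans ?_)) (c1.trans (le_abs_self _))
              (norm_nonneg _) hS0
            gcongr
            exact hsum n ((hJmem n).2 hn)
        _ = _ := mul_comm _ _
  refine (norm_sum_le _ _).trans ((Finset.sum_le_card_nsmul _ _ _ hterm).trans ?_)
  rw [nsmul_eq_mul, ← mul_assoc]
  gcongr
  exact Finset.sdiff_subset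

end Remainder

end NLS

end

noncomputable section

namespace NLS

/-! ### Smooth implicit functions and triangular maps -/

/-- The implicit function theorem, with smoothness and uniqueness on a ball. -/
theorem exists_implicit_function {E F : Type} [NormedAddCommGroup E] [NormedSpace ℝ E]
    [CompleteSpace E] [NormedAddCommGroup F] [NormedSpace ℝ F] [CompleteSpace F] {f : E × F → F}
    (hf : ContDiff ℝ (⊤ : ℕ∞) f) {a : E} {b : F} (h0 : f (a, b) = 0)
    (hu : IsUnit (fderiv ℝ (fun y => f (a, y)) b)) :
    ∃ δ > 0, ∃ ψ : E → F, ψ a = b ∧ ContDiffOn ℝ (⊤ : ℕ∞) ψ (Metric.ball a δ) ∧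
      (∀ x ∈ Metric.ball a δ, f (x, ψ x) = 0) ∧
      ∀ x ∈ Metric.ball a δ, ∀ y ∈ Metric.ball b δ, f (x, y) = 0 → y = ψ x := by
  -- the inverse function theorem for `(x, y) ↦ (x, f(x, y))`
  let G : E × F → E × F := fun p => (p.1, f p)
  have hG : ContDiff ℝ (⊤ : ℕ∞) G := contDiff_fst.prodMk hf
  have hGd : ∀ p, HasFDerivAt G (fderiv ℝ G p) p := fun p =>
    (hG.differentiable (by simp) p).hasFDerivAt
  have hunit : IsUnit (fderiv ℝ G (a, b)) := by
    set f' := fderiv ℝ f (a, b) with hf'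
    have hfd : HasFDerivAt f f' (a, b) := (hf.differentiable (by simp) _).hasFDerivAt
    have hB : fderiv ℝ (fun y => f (a, y)) b = f' ∘L ContinuousLinearMap.inr ℝ E F := by
      have h2 : HasFDerivAt (fun y : F => (a, y)) (ContinuousLinearMap.inr ℝ E F) b :=
        hasFDerivAt_prodMk_right a b
      exact (hfd.comp b h2).fderiv
    obtain ⟨B, hB'⟩ := hu
    rw [hB] at hB'
    have hGf : fderiv ℝ G (a, b) = (ContinuousLinearMap.fst ℝ E F).prod f' :=
      (hasFDerivAt_fst.prodMk hfd).fderiv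
    have hsplit : ∀ u v, f' (u, v) = f' (u, 0) + B.1 v := fun u v => by
      rw [hB']
      show _ = f' (u, 0) + f' (0, v)
      rw [← map_add]; simp
    let H : E × F →L[ℝ] E × F := (ContinuousLinearMap.fst ℝ E F).prod
      ((B⁻¹).1 ∘L (ContinuousLinearMap.snd ℝ E F -
        f' ∘L ContinuousLinearMap.inl ℝ E F ∘L ContinuousLinearMap.fst ℝ E F))
    have hBr : ∀ v, B.1 ((B⁻¹).1 v) = v := fun v =>
      congrArg (fun T : F →L[ℝ] F => T v) B.mul_inv
    have hBl : ∀ v, (B⁻¹).1 (B.1 v) = v := fun v =>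
      congrArg (fun T : F →L[ℝ] F => T v) B.inv_mul
    rw [hGf]
    refine ⟨⟨(ContinuousLinearMap.fst ℝ E F).prod f', H, ?_, ?_⟩, rfl⟩
    · refine ContinuousLinearMap.ext fun p => Prod.ext rfl ?_
      show f' (p.1, (B⁻¹).1 (p.2 - f' (p.1, 0))) = p.2
      rw [hsplit, hBr, add_sub_cancel]
    · refine ContinuousLinearMap.ext fun p => Prod.ext rfl ?_
      show (B⁻¹).1 (f' p - f' (p.1, 0)) = p.2
      have : f' p = f' (p.1, 0) + B.1 p.2 := hsplit p.1 p.2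
      rw [this, add_sub_cancel_left, hBl]
  have hequiv : ∀ p, IsUnit (fderiv ℝ G p) → ∃ L : (E × F) ≃L[ℝ] (E × F),
      HasFDerivAt G (L : E × F →L[ℝ] E × F) p := by
    rintro p ⟨U, hU⟩
    refine ⟨ContinuousLinearEquiv.unitsEquiv ℝ (E × F) U, ?_⟩
    have : ((ContinuousLinearEquiv.unitsEquiv ℝ (E × F) U : (E × F) ≃L[ℝ] (E × F)) :
        E × F →L[ℝ] E × F) = fderiv ℝ G p := by rw [← hU]; rfl
    rw [this]
    exact hGd p
  obtain ⟨L, hL⟩ := hequiv _ hunit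
  let e := hG.contDiffAt.toOpenPartialHomeomorph G hL (by simp)
  have he : ∀ p, e p = G p := fun p => rfl
  have hsrc : (a, b) ∈ e.source := ContDiffAt.mem_toOpenPartialHomeomorph_source _ hL (by simp)
  have hGab : G (a, b) = (a, 0) := Prod.ext rfl h0
  -- the inverse is smooth wherever the derivative of `G` is invertible, which is an open condition
  set T : Set (E × F) := e.target ∩ e.symm ⁻¹' {p | IsUnit (fderiv ℝ G p)} with hT
  have hTo : IsOpen T := e.isOpen_inter_preimage_symm
    (Units.isOpen.preimage (hG.continuous_fderiv (by simp)))
  have hTa : (a, (0 : F)) ∈ T := by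
    rw [← hGab, ← he]
    refine ⟨e.map_source hsrc, ?_⟩
    show IsUnit (fderiv ℝ G (e.symm (e (a, b))))
    rw [e.left_inv hsrc]
    exact hunit
  have hcont : Continuous fun x : E => (x, (0 : F)) := by fun_prop
  obtain ⟨δ₁, hδ₁, hb₁⟩ := Metric.isOpen_iff.1 (hTo.preimage hcont) a hTa
  obtain ⟨δ₂, hδ₂, hb₂⟩ := Metric.isOpen_iff.1 e.open_source (a, b) hsrc
  refine ⟨min δ₁ δ₂, lt_min hδ₁ hδ₂, fun x => (e.symm (x, 0)).2, ?_, fun x hx => ?_, fun x hx => ?_,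
    fun x hx y hy hxy => ?_⟩
  · show (e.symm (a, 0)).2 = b
    rw [← hGab, ← he, e.left_inv hsrc]
  · obtain ⟨h1, h2⟩ := hb₁ (Metric.ball_subset_ball (min_le_left _ _) hx)
    obtain ⟨L', hL'⟩ := hequiv _ h2
    have h3 : ContDiffAt ℝ (⊤ : ℕ∞) e.symm (x, 0) := e.contDiffAt_symm h1 hL' hG.contDiffAt
    have h4 : ContDiffAt ℝ (⊤ : ℕ∞) (fun x : E => (x, (0 : F))) x :=
      contDiffAt_id.prodMk contDiffAt_const
    have h5 := ContDiffAt.comp x h3 h4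
    exact (contDiff_snd.contDiffAt.comp x h5).contDiffWithinAt
  · obtain ⟨h1, -⟩ := hb₁ (Metric.ball_subset_ball (min_le_left _ _) hx)
    have h2 : G (e.symm (x, 0)) = (x, 0) := e.right_inv h1
    have h3 : (e.symm (x, 0)).1 = x := congrArg Prod.fst h2
    have h4 : f (e.symm (x, 0)) = 0 := congrArg Prod.snd h2
    have h5 : (x, (e.symm (x, 0)).2) = e.symm (x, 0) := Prod.ext h3.symm rfl
    rw [h5, h4]
  · have h1 : (x, y) ∈ e.source := by
      apply hb₂
      rw [Metric.mem_ball, Prod.dist_eq, max_lt_iff]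
      exact ⟨(Metric.mem_ball.1 hx).trans_le (min_le_right _ _),
        (Metric.mem_ball.1 hy).trans_le (min_le_right _ _)⟩
    have h2 : e (x, y) = (x, 0) := Prod.ext rfl hxy
    show y = (e.symm (x, 0)).2
    rw [← h2, e.left_inv h1]

/-- If the components of `T` depend only on the components of smaller size, then the derivative of
`T` is nilpotent, and that of `Ψ - T(Ψ)` is invertible. -/
theorem isUnit_fderiv_of_triangular {ι R : Type} [Fintype ι] [NormedAddCommGroup R]
    [NormedSpace ℝ R] (size : ι → ℕ) {T : (ι → R) → ι → R} {x₀ : ι → R}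
    (hT : DifferentiableAt ℝ T x₀)
    (htri : ∀ x y i, (∀ j, size j < size i → x j = y j) → T x i = T y i) :
    IsUnit (fderiv ℝ (fun x => x - T x) x₀) := by
  set D := fderiv ℝ T x₀ with hD
  have h1 : fderiv ℝ (fun x => x - T x) x₀ = 1 - D :=
    ((hasFDerivAt_id x₀).sub hT.hasFDerivAt).fderiv
  rw [h1]
  refine IsNilpotent.isUnit_one_sub ?_
  have key : ∀ η i, (∀ j, size j < size i → η j = 0) → D η i = 0 := by
    intro η i hη
    have h2 : HasDerivAt (fun s : ℝ => T (x₀ + s • η)) (D η) 0 := by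
      have h3 : HasDerivAt (fun s : ℝ => x₀ + s • η) η 0 := by
        simpa using ((hasDerivAt_id (0 : ℝ)).smul_const η).const_add x₀
      have h4 : HasFDerivAt T D (x₀ + (0 : ℝ) • η) := by
        rw [zero_smul, add_zero]; exact hT.hasFDerivAt
      exact h4.comp_hasDerivAt 0 h3
    have h5 := hasDerivAt_pi.1 h2 i
    have h6 : (fun s : ℝ => T (x₀ + s • η) i) = fun _ => T x₀ i := by
      ext1 s
      exact htri _ _ _ fun j hj => by simp [hη j hj]
    rw [h6] at h5
    exact h5.unique (hasDerivAt_const _ _)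
  -- each application of `D` removes one more level of sizes
  have hpow : ∀ n η i, size i < n → (D ^ n) η i = 0 := by
    intro n
    induction n with
    | zero => intro η i hi; exact absurd hi (Nat.not_lt_zero _)
    | succ n ih =>
      intro η i hi
      rw [pow_succ']
      exact key _ _ fun j hj => ih η j (by omega)
  refine ⟨Finset.univ.sup size + 1, ContinuousLinearMap.ext fun η => funext fun i => ?_⟩
  exact hpow _ η i (Nat.lt_succ_of_le (Finset.le_sup (Finset.mem_univ i)))

/-! ### The linear equations of the profile -/

section Solver

variable {N : ℕ} {ω : Fin N → ℝ} {V : 𝓢(X, ℝ)} {φ : Fin N → L2}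

/-- `√(-m·ω)`. -/
def rate (ω : Fin N → ℝ) (m : Idx N) : ℝ := √(-dotIdx ω m)

theorem rate_pos {m : Idx N} (hm : m ∈ NR1 ω) : 0 < rate ω m :=
  Real.sqrt_pos.2 (neg_pos.2 hm.1.2)

theorem neg_rate_sq {m : Idx N} (hm : m ∈ NR1 ω) : (-(rate ω m ^ 2 : ℂ)) = (dotIdx ω m : ℂ) := by
  rw [← Complex.ofReal_pow, rate, Real.sq_sqrt (neg_pos.2 hm.1.2).le]
  push_cast
  ring

open Classical in
/-- The orthogonal projection to `ker (H - m·ω)`. -/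
def projIdx (φ : Fin N → L2) (m : Idx N) (u : L2) : L2 :=
  if h : ∃ j, m = stdIdx j then (inner ℂ (φ h.choose) u : ℂ) • φ h.choose else 0

theorem projIdx_stdIdx (φ : Fin N → L2) (j : Fin N) (u : L2) :
    projIdx φ (stdIdx j) u = (inner ℂ (φ j) u : ℂ) • φ j := by
  have h : ∃ i, (stdIdx j : Idx N) = stdIdx i := ⟨j, rfl⟩
  rw [projIdx, dif_pos h, ← stdIdx_injective h.choose_spec]

theorem projIdx_of_notMem (φ : Fin N → L2) {m : Idx N} (hm : m ∉ NR0) (u : L2) :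
    projIdx φ m u = 0 := by
  have h : ¬ ∃ i, m = stdIdx i := fun ⟨i, hi⟩ => hm ⟨i, hi.symm⟩
  rw [projIdx, dif_neg h]

/-- Simple eigenvalues: every eigenfunction is a multiple of `φ_j`. -/
theorem eigenspaceH_eq_span (hsimple : ∀ j, Module.finrank ℂ (eigenspaceH V (ω j)) = 1)
    (hφ : ∀ j, φ j ∈ eigenspaceH V (ω j)) (hφnorm : ∀ j, ‖φ j‖ = 1) (j : Fin N) {u : L2}
    (hu : u ∈ eigenspaceH V (ω j)) : u = (inner ℂ (φ j) u : ℂ) • φ j := by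
  have hne : (⟨φ j, hφ j⟩ : eigenspaceH V (ω j)) ≠ 0 := by
    intro h
    have := congrArg (fun v : eigenspaceH V (ω j) => ‖(v : L2)‖) h
    simp [hφnorm] at this
  obtain ⟨c, hc⟩ := (finrank_eq_one_iff_of_nonzero' _ hne).1 (hsimple j) ⟨u, hu⟩
  have hc' : c • φ j = u := congrArg Subtype.val hc
  have h1 : inner ℂ (φ j) (φ j) = (1 : ℂ) := by
    rw [inner_self_eq_norm_sq_to_K, hφnorm]; simp
  rw [← hc', inner_smul_right, h1, mul_one]

/-- The only eigenvalues among the `m·ω` are the `e_j·ω`. -/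
theorem eigenspaceH_eq_bot (hspec : discreteSpectrumH V = Set.range (fun j => (ω j : ℂ)))
    (hlin : ∀ m : Idx N, m ≠ 0 → dotIdx ω m ≠ 0) {m : Idx N} (hm : m ∈ NR1 ω) (h0 : m ∉ NR0) :
    eigenspaceH V (dotIdx ω m) = ⊥ := by
  by_contra hne
  rw [← neg_rate_sq hm] at hne
  have h1 := mem_discreteSpectrumH V (rate_pos hm) hne
  rw [neg_rate_sq hm, hspec] at h1
  obtain ⟨j, hj⟩ := h1
  have h2 : dotIdx ω (m - stdIdx j) = 0 := by
    have e : dotIdx ω (m - stdIdx j) = dotIdx ω m - dotIdx ω (stdIdx j) := by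
      simp only [dotIdx, Pi.sub_apply, Int.cast_sub, sub_mul, Finset.sum_sub_distrib]
    have hj' : ω j = dotIdx ω m := Complex.ofReal_injective hj
    rw [e, dotIdx_stdIdx, hj', sub_self]
  refine hlin _ (fun h => h0 ⟨j, ?_⟩) h2
  exact (sub_eq_zero.1 h).symm

/-- `H - m·ω` is injective for `m ∈ NR₁ \ NR₀`. -/
theorem shifted_injective (hspec : discreteSpectrumH V = Set.range (fun j => (ω j : ℂ)))
    (hlin : ∀ m : Idx N, m ≠ 0 → dotIdx ω m ≠ 0) {m : Idx N} (hm : m ∈ NR1 ω) (h0 : m ∉ NR0) :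
    Function.Injective (shifted V (dotIdx ω m)) := by
  rw [injective_iff_map_eq_zero]
  intro u hu
  have h1 : (u : L2) ∈ eigenspaceH V (dotIdx ω m) := mem_eigenspaceH.2 ⟨u.2, hu⟩
  rw [eigenspaceH_eq_bot hspec hlin hm h0] at h1
  exact Subtype.ext ((Submodule.mem_bot ℂ).1 h1)

/-- For real `p`, taking the inner product with `p` commutes with the real part. -/
theorem inner_reL {p : L2} (hp : ∀ᵐ x, (p x).im = 0) (u : L2) :
    inner ℂ p (reL u) = (((inner ℂ p u : ℂ).re : ℝ) : ℂ) := by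
  have h1 : (inner ℂ p u : ℂ).re = ∫ x, (p x).re * (u x).re := by
    rw [L2.inner_def]
    have h2 := integral_re (𝕜 := ℂ) (L2.integrable_inner (𝕜 := ℂ) p u)
    refine (h2.symm.trans ?_)
    apply integral_congr_ae
    filter_upwards [hp] with x hx
    simp [RCLike.inner_apply, hx]
    ring
  rw [h1, L2.inner_def, ← integral_complex_ofReal]
  apply integral_congr_ae
  filter_upwards [hp, reL_coe u] with x hx hu
  rw [hu, RCLike.inner_apply]
  have : (starRingEnd ℂ) (p x) = ((p x).re : ℂ) := by
    apply Complex.ext <;> simp [hx]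
  rw [this]
  push_cast
  ring

theorem reL_smul_of_real {p : L2} (hp : ∀ᵐ x, (p x).im = 0) (c : ℂ) :
    reL (c • p) = ((c.re : ℝ) : ℂ) • p := by
  refine Lp.ext ((reL_coe _).trans ?_)
  filter_upwards [hp, Lp.coeFn_smul c p, Lp.coeFn_smul ((c.re : ℝ) : ℂ) p] with x hx h1 h2
  rw [h1, h2]
  apply Complex.ext <;> simp [hx]

/-- Solution operators for the equations `(H - m·ω + P) u = f`, `P` the projection to the kernel of
`H - m·ω`, which act on all the spaces of regular functions. -/
theorem exists_solver (hspec : discreteSpectrumH V = Set.range (fun j => (ω j : ℂ)))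
    (hsimple : ∀ j, Module.finrank ℂ (eigenspaceH V (ω j)) = 1)
    (hlin : ∀ m : Idx N, m ≠ 0 → dotIdx ω m ≠ 0)
    (hφ : ∀ j, φ j ∈ eigenspaceH V (ω j)) (hφnorm : ∀ j, ‖φ j‖ = 1)
    (hφreal : ∀ j, ∀ᵐ x, (φ j x).im = 0) {m : Idx N} (hm : m ∈ NR1 ω) {a : ℝ}
    (ha : SmallRate a (rate_pos hm)) :
    ∃ R : L2 →L[ℂ] L2,
      (∀ f, ∃ h : R f ∈ Hs 2, shifted V (dotIdx ω m) ⟨R f, h⟩ + projIdx φ m (R f) = f) ∧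
      ∀ k, 2 ≤ k → ∃ S : RegSpace (expWeight a) k →L[ℝ] RegSpace (expWeight a) k,
        ∀ f, (S f).toL2 = R f.toL2 := by
  obtain ⟨P, R, hPmem, hPid, hPinner, hR, hRl⟩ := exists_reducedResolvent V (rate_pos hm)
  -- `P` is the projection to the span of `φ_j` for `m = e_j`, and `0` otherwise
  have hP : ∀ u, P u = projIdx φ m u := by
    intro u
    have h1 := hPmem u
    rw [neg_rate_sq hm] at h1
    by_cases h0 : m ∈ NR0
    · obtain ⟨j, rfl⟩ := h0
      have h2 : φ j ∈ eigenspaceH V (-(rate ω (stdIdx j) ^ 2 : ℂ)) := by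
        rw [neg_rate_sq hm, dotIdx_stdIdx]; exact hφ j
      rw [dotIdx_stdIdx] at h1
      rw [projIdx_stdIdx, ← hPinner u _ h2]
      exact eigenspaceH_eq_span hsimple hφ hφnorm j h1
    · rw [eigenspaceH_eq_bot hspec hlin hm h0] at h1
      rw [projIdx_of_notMem φ h0]
      exact (Submodule.mem_bot ℂ).1 h1
  have hPre : ∀ u, P (reL u) = reL (P u) := by
    intro u
    rw [hP, hP]
    by_cases h0 : m ∈ NR0
    · obtain ⟨j, rfl⟩ := h0
      rw [projIdx_stdIdx, projIdx_stdIdx, reL_smul_of_real (hφreal j), inner_reL (hφreal j)]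
    · rw [projIdx_of_notMem φ h0, projIdx_of_notMem φ h0, map_zero]
  refine ⟨R, fun f => ?_, fun k hk => ?_⟩
  · have := hR f
    rw [neg_rate_sq hm] at this
    obtain ⟨h, h1⟩ := this
    exact ⟨h, by rw [← hP]; exact h1⟩
  · exact exists_resolvent_regSpace V ha (fun u hu => exists_reg_of_mem_eigenspaceH V ha hu) hPmem
      hPre hR hRl hk

/-- The eigenfunctions belong to all the spaces of regular functions. -/
theorem exists_eigenfunction (hneg : ∀ j, ω j < 0) (hφ : ∀ j, φ j ∈ eigenspaceH V (ω j))
    (hφreal : ∀ j, ∀ᵐ x, (φ j x).im = 0) {a : ℝ} (j : Fin N)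
    (ha : SmallRate a (rate_pos (stdIdx_mem_NR1 hneg j))) :
    ∀ k, ∃ f : RegSpace (expWeight a) k, f.toL2 = φ j := by
  intro k
  have h1 : φ j ∈ eigenspaceH V (-(rate ω (stdIdx j) ^ 2 : ℂ)) := by
    rw [neg_rate_sq (stdIdx_mem_NR1 hneg j), dotIdx_stdIdx]; exact hφ j
  obtain ⟨v, hv, hvr⟩ := exists_reg_of_mem_eigenspaceH V ha h1
  refine ⟨RegSpace.mk _ ((hvr k).clm Complex.reCLM), Lp.ext ((RegSpace.toL2_coe _).trans ?_)⟩
  filter_upwards [hv, hφreal j] with x h1 h2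
  rw [h1] at h2 ⊢
  exact Complex.ext rfl h2.symm

end Solver

end NLS

end

noncomputable section

namespace NLS

open RegSpace

/-! ### The functions `φ̃_m(0)` and `G_m` -/

section AtOrigin

variable {N : ℕ} {ω : Fin N → ℝ} {V : 𝓢(X, ℝ)} {φ : Fin N → L2} {W : Weight} {k : ℕ}
  {I : Finset (Idx N)} {K : ℕ} {g : ℝ → ℝ}

theorem diagSq_apply (w : Fin N → ℝ) (Φ : I → RegSpace W k) (x : X) :
    diagSq w Φ x = ∑ m : I, (∏ j, w j ^ (m.1 j).natAbs) * (Φ m x * Φ m x) := by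
  rw [diagSq, sum_apply']
  exact Finset.sum_congr rfl fun m _ => by rw [smul_apply', mulL_apply]

theorem gCoeff_apply (hg : ContDiff ℝ (⊤ : ℕ∞) g) (m : Idx N) (w : Fin N → ℝ)
    (Φ : I → RegSpace W k) (x : X) : gCoeff K g m w Φ x =
      ∑ r ∈ Finset.range K, ∑ t : Fin (2 * r + 1) → I with altSum t = m,
        altWeight w t * (taylorCoeff K r g (diagSq w Φ x) * ∏ i, Φ (t i) x) := by
  rw [gCoeff, sum_apply']
  refine Finset.sum_congr rfl fun r _ => ?_
  rw [sum_apply']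
  refine Finset.sum_congr rfl fun t _ => ?_
  rw [smul_apply', nem_apply (contDiff_taylorCoeff K r hg), prodFin_apply]

/-- The functions `g_m` do not depend on the regularity. -/
theorem gCoeff_inclL (hg : ContDiff ℝ (⊤ : ℕ∞) g) {l : ℕ} (h : k ≤ l) (m : Idx N)
    (w : Fin N → ℝ) (Φ : I → RegSpace W l) :
    inclL h (gCoeff K g m w Φ) = gCoeff K g m w (fun n => inclL h (Φ n)) := by
  refine ext' fun x => ?_
  rw [inclL_apply, gCoeff_apply hg, gCoeff_apply hg]
  simp only [diagSq_apply, inclL_apply]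

theorem mem_decomp_of_tuple (hI : ∀ m ∈ I, m ∈ NR1 ω) {m : Idx N} {r : ℕ}
    {t : Fin (2 * r + 1) → I} (h1 : altSum t = m) (h2 : ∑ i, absIdx (t i : Idx N) = absIdx m) :
    (fun i => (t i : Idx N)) ∈ decomp ω r m := ⟨fun i => hI _ (t i).2, h1, h2⟩

/-- At the origin, `g_m` depends only on the components of smaller size. -/
theorem gCoeff_zero_congr (hI : ∀ m ∈ I, m ∈ NR1 ω) (hg : ContDiff ℝ (⊤ : ℕ∞) g) (hg0 : g 0 = 0)
    (m : Idx N) {Φ Φ' : I → RegSpace W k}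
    (h : ∀ n : I, sizeIdx (n : Idx N) < sizeIdx m → Φ n = Φ' n) :
    gCoeff K g m 0 Φ = gCoeff K g m 0 Φ' := by
  have hI' : ∀ m ∈ I, ∑ j, m j = 1 := fun m hm => (hI m hm).1.1
  refine ext' fun x => ?_
  rw [gCoeff_zero_apply hI' hg, gCoeff_zero_apply hI' hg]
  refine Finset.sum_congr rfl fun r _ => ?_
  cases r with
  | zero => simp [hg0]
  | succ r =>
    congr 1
    refine Finset.sum_congr rfl fun t ht => Finset.prod_congr rfl fun i _ => ?_
    obtain ⟨-, h1, h2⟩ := Finset.mem_filter.1 ht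
    rw [h _ (sizeIdx_lt ω (mem_decomp_of_tuple hI h1 h2) i)]

/-- At the origin `g_{e_j}` vanishes: `e_j` has size `1` and is not a sum without cancellation of
three or more indices. -/
theorem gCoeff_zero_stdIdx (hI : ∀ m ∈ I, m ∈ NR1 ω) (hg : ContDiff ℝ (⊤ : ℕ∞) g) (hg0 : g 0 = 0)
    (j : Fin N) (Φ : I → RegSpace W k) : gCoeff K g (stdIdx j) 0 Φ = 0 := by
  refine ext' fun x => ?_
  rw [gCoeff_zero_apply (fun m hm => (hI m hm).1.1) hg, zero_apply']
  refine Finset.sum_eq_zero fun r _ => ?_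
  cases r with
  | zero => simp [hg0]
  | succ r =>
    rw [Finset.sum_eq_zero, mul_zero]
    intro t ht
    obtain ⟨-, h1, h2⟩ := Finset.mem_filter.1 ht
    have h3 := sizeIdx_lt ω (mem_decomp_of_tuple hI h1 h2) 0
    have h4 := sizeIdx_pos ω (hI _ (t 0).2)
    rw [sizeIdx_stdIdx] at h3
    omega

/-- A decomposition into `2r + 1` nonzero indices needs an index of size at least `2r + 1`. Hence
the sums over `k` in the definition of `G_m` are finite. -/
theorem decomp_eq_empty {m : Idx N} {r : ℕ} (h : sizeIdx m < r) : decomp ω r m = ∅ := by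
  refine Set.eq_empty_of_forall_notMem fun p hp => ?_
  obtain ⟨h1, -, h3⟩ := hp
  have hs : ∑ i, sizeIdx (p i) = sizeIdx m := by
    simp only [sizeIdx]
    rw [Finset.sum_comm]
    refine Finset.sum_congr rfl fun j _ => ?_
    have := congrFun h3 j
    simp only [Finset.sum_apply, absIdx] at this
    zify
    exact this
  have h4 : ∑ i : Fin (2 * r + 1), 1 ≤ ∑ i, sizeIdx (p i) :=
    Finset.sum_le_sum fun i _ => sizeIdx_pos ω (h1 i)
  simp at h4
  omega

/-- The sum over `A(r, m)` as a sum over tuples of elements of the finite set `I = NR₁`. -/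
theorem finsum_decomp (hI : ∀ m, m ∈ I ↔ m ∈ NR1 ω) (m : Idx N) (r : ℕ) (v : Idx N → ℂ) :
    ∑ᶠ p : decomp ω r m, ∏ i, v (p.1 i) =
      ∑ t : Fin (2 * r + 1) → I with altSum t = m ∧ ∑ i, absIdx (t i : Idx N) = absIdx m,
        ∏ i, v (t i) := by
  classical
  rw [finsum_set_coe_eq_finsum_mem (s := decomp ω r m) (f := fun p => ∏ i, v (p i))]
  have hinj : Function.Injective
      (fun (t : Fin (2 * r + 1) → I) (i : Fin (2 * r + 1)) => (t i : Idx N)) :=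
    fun t t' h => funext fun i => Subtype.ext (congrFun h i)
  have e : decomp ω r m = ((Finset.univ.filter fun t : Fin (2 * r + 1) → I => altSum t = m ∧
      ∑ i, absIdx (t i : Idx N) = absIdx m).image fun t i => (t i : Idx N) : Finset _) := by
    ext p
    simp only [Finset.coe_image, Set.mem_image, Finset.mem_coe, Finset.mem_filter,
      Finset.mem_univ, true_and]
    constructor
    · rintro ⟨h1, h2, h3⟩
      exact ⟨fun i => ⟨p i, (hI _).2 (h1 i)⟩, ⟨h2, h3⟩, rfl⟩
    · rintro ⟨t, ⟨h1, h2⟩, rfl⟩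
      exact mem_decomp_of_tuple (fun m hm => (hI m).1 hm) h1 h2
  rw [e, finsum_mem_coe_finset, Finset.sum_image fun t _ t' _ h => hinj h]

/-- The sums which define `φ̃_m(0)` and `G_m` are the values of `g_m` at the origin. -/
theorem finsum_eq_gCoeff (hI : ∀ m, m ∈ I ↔ m ∈ NR1 ω) (hg : ContDiff ℝ (⊤ : ℕ∞) g)
    (hg0 : g 0 = 0) {m : Idx N} (hK : sizeIdx m < K) {Φ : I → RegSpace W k} {x : X}
    {v : Idx N → ℂ} (hv : ∀ n : I, sizeIdx (n : Idx N) < sizeIdx m → v n = Φ n x) :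
    ∑ᶠ r : ℕ, ((iteratedDeriv (r + 1) g 0 / (Nat.factorial (r + 1) : ℝ) : ℝ) : ℂ) *
      ∑ᶠ p : decomp ω (r + 1) m, ∏ i, v (p.1 i) = (gCoeff K g m 0 Φ x : ℂ) := by
  obtain ⟨K, rfl⟩ : ∃ K', K = K' + 1 := ⟨K - 1, by omega⟩
  have hI' : ∀ m ∈ I, m ∈ NR1 ω := fun m hm => (hI m).1 hm
  rw [gCoeff_zero_apply (fun m hm => (hI' m hm).1.1) hg, Finset.sum_range_succ']
  rw [finsum_eq_sum_of_support_subset (s := Finset.range K)]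
  · simp only [iteratedDeriv_zero, hg0, zero_div, zero_mul, add_zero]
    push_cast
    refine Finset.sum_congr rfl fun r _ => ?_
    congr 1
    rw [finsum_decomp hI]
    refine Finset.sum_congr rfl fun t ht => Finset.prod_congr rfl fun i _ => ?_
    obtain ⟨-, h1, h2⟩ := Finset.mem_filter.1 ht
    exact hv _ (sizeIdx_lt ω (mem_decomp_of_tuple hI' h1 h2) i)
  · intro r hr
    by_contra hcon
    rw [Finset.mem_coe, Finset.mem_range, not_lt] at hcon
    refine hr ?_
    have : IsEmpty (decomp ω (r + 1) m) :=
      Set.isEmpty_coe_sort.2 (decomp_eq_empty (by omega))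
    show _ * _ = _
    rw [finsum_of_isEmpty, mul_zero]

theorem phiTilde_stdIdx (j : Fin N) : phiTilde V g ω φ (stdIdx j) = φ j := by
  have h : ∃ i, (stdIdx j : Idx N) = stdIdx i := ⟨j, rfl⟩
  rw [phiTilde, dif_pos h, ← stdIdx_injective h.choose_spec]

theorem phiTilde_of_notMem {m : Idx N} (h0 : m ∉ NR0) : phiTilde V g ω φ m =
    -resolventH V (dotIdx ω m) (fun x => ∑ᶠ k : ℕ,
      ((iteratedDeriv (k + 1) g 0 / (Nat.factorial (k + 1) : ℝ) : ℝ) : ℂ) *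
        ∑ᶠ p : decomp ω (k + 1) m, ∏ i, phiTilde V g ω φ (p.1 i) x) := by
  have h : ¬ ∃ i, m = stdIdx i := fun ⟨i, hi⟩ => h0 ⟨i, hi.symm⟩
  rw [phiTilde, dif_neg h]

/-- The functions `G_m` are regular and decay exponentially. -/
theorem Gres_ae_eq (hI : ∀ m, m ∈ I ↔ m ∈ NR1 ω) (hg : ContDiff ℝ (⊤ : ℕ∞) g)
    (hg0 : g 0 = 0) {m : Idx N} (hK : sizeIdx m < K) {Φ : I → RegSpace W k}
    (hΦ : ∀ n : I, sizeIdx (n : Idx N) < sizeIdx m → toL2 (Φ n) = phiTilde V g ω φ n) :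
    Gres V g ω φ m =ᵐ[volume] fun x => (gCoeff K g m 0 Φ x : ℂ) := by
  have h1 : ∀ᵐ x, ∀ n : I, toL2 (Φ n) x = Φ n x := ae_all_iff.2 fun n => toL2_coe (Φ n)
  filter_upwards [h1] with x hx
  exact finsum_eq_gCoeff hI hg hg0 hK (v := fun n => phiTilde V g ω φ n x) fun n hn => by
    rw [← hΦ n hn, hx]

/-- One step of the recursion for `φ̃_m(0)`. -/
theorem phiTilde_eq (hspec : discreteSpectrumH V = Set.range (fun j => (ω j : ℂ)))
    (hlin : ∀ m : Idx N, m ≠ 0 → dotIdx ω m ≠ 0) (hI : ∀ m, m ∈ I ↔ m ∈ NR1 ω)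
    (hg : ContDiff ℝ (⊤ : ℕ∞) g) (hg0 : g 0 = 0) {m : Idx N} (hm : m ∈ NR1 ω) (h0 : m ∉ NR0)
    (hK : sizeIdx m < K) {Φ : I → RegSpace W k}
    (hΦ : ∀ n : I, sizeIdx (n : Idx N) < sizeIdx m → toL2 (Φ n) = phiTilde V g ω φ n)
    {R : L2 →L[ℂ] L2}
    (hR : ∀ f, ∃ h : R f ∈ Hs 2, shifted V (dotIdx ω m) ⟨R f, h⟩ + projIdx φ m (R f) = f) :
    phiTilde V g ω φ m = -R (toL2 (gCoeff K g m 0 Φ)) := by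
  obtain ⟨h, h1⟩ := hR (toL2 (gCoeff K g m 0 Φ))
  rw [projIdx_of_notMem φ h0, add_zero] at h1
  rw [phiTilde_of_notMem h0]
  congr 1
  refine resolventH_eq (shifted_injective hspec hlin hm h0) ⟨_, h⟩ ?_
  rw [h1]
  filter_upwards [toL2_coe (gCoeff K g m 0 Φ),
    Gres_ae_eq (V := V) (φ := φ) hI hg hg0 hK hΦ] with x h2 h3
  rw [h2, ← h3]
  rfl

end AtOrigin

end NLS

end

noncomputable section

namespace NLS

open RegSpace

/-! ### The equations of the profile -/

section Equations

variable {N : ℕ} {ω : Fin N → ℝ} {V : 𝓢(X, ℝ)} {φ : Fin N → L2} {W : Weight} {k : ℕ}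
  {I : Finset (Idx N)} {K : ℕ} {g : ℝ → ℝ}

theorem ofReal_smul_L2 (c : ℝ) (u : L2) : (c : ℂ) • u = c • u := by
  refine Lp.ext ?_
  filter_upwards [Lp.coeFn_smul (c : ℂ) u, Lp.coeFn_smul c u] with x h1 h2
  rw [h1, h2, Pi.smul_apply, Pi.smul_apply, Complex.coe_smul]

/-- The functional `f ↦ Re ⟨u, f⟩`. -/
def pairing (u : L2) : RegSpace W k →L[ℝ] ℝ :=
  Complex.reCLM ∘L ((innerSL ℂ u).restrictScalars ℝ) ∘L toL2

theorem pairing_apply (u : L2) (f : RegSpace W k) : pairing u f = (inner ℂ u (toL2 f) : ℂ).re := rfl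

theorem reL_toL2 (f : RegSpace W k) : reL (toL2 f) = toL2 f := by
  refine Lp.ext ((reL_coe _).trans ?_)
  filter_upwards [toL2_coe f] with x hx
  rw [hx, Complex.ofReal_re]

theorem inner_toL2 {p : L2} (hp : ∀ᵐ x, (p x).im = 0) (f : RegSpace W k) :
    inner ℂ p (toL2 f) = (pairing p f : ℂ) := by
  rw [pairing_apply, ← inner_reL hp, reL_toL2]

/-- The family `Φ_{e_j} = φ_j`, `Φ_m = 0` for the other indices. -/
def baseProfile (p : Fin N → RegSpace W k) (m : I) : RegSpace W k :=
  ∑ j, if (m : Idx N) = stdIdx j then p j else 0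

theorem baseProfile_stdIdx (p : Fin N → RegSpace W k) {j : Fin N} (h : stdIdx j ∈ I) :
    baseProfile p ⟨stdIdx j, h⟩ = p j := by
  rw [baseProfile, Finset.sum_eq_single j]
  · simp
  · intro i _ hi
    rw [if_neg fun e => hi (stdIdx_injective e).symm]
  · simp

theorem baseProfile_of_notMem (p : Fin N → RegSpace W k) {m : I} (h : (m : Idx N) ∉ NR0) :
    baseProfile p m = 0 :=
  Finset.sum_eq_zero fun j _ => if_neg fun e => h ⟨j, e.symm⟩

/-- The shifts `ϖ_j - ω_j = ⟨φ_j, g_{e_j}⟩` of the frequencies. -/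
def freqShift (K : ℕ) (g : ℝ → ℝ) (φ : Fin N → L2) (w : Fin N → ℝ) (Φ : I → RegSpace W k)
    (j : Fin N) : ℝ := pairing (φ j) (gCoeff K g (stdIdx j) w Φ)

/-- The map whose fixed points are the solutions `Φ` of
`H Φ_m = (m·ϖ) Φ_m - g_m`, normalized by `⟨φ_j, Φ_{e_j}⟩ = 1`. -/
def profileMap (K : ℕ) (g : ℝ → ℝ) (φ : Fin N → L2) (S : I → RegSpace W k →L[ℝ] RegSpace W k)
    (p : Fin N → RegSpace W k) (w : Fin N → ℝ) (Φ : I → RegSpace W k) (m : I) : RegSpace W k :=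
  baseProfile p m + S m (dotIdx (freqShift K g φ w Φ) m • Φ m - gCoeff K g m w Φ)

theorem contDiff_freqShift (hg : ContDiff ℝ (⊤ : ℕ∞) g) (φ : Fin N → L2) : ContDiff ℝ (⊤ : ℕ∞)
    fun q : (Fin N → ℝ) × (I → RegSpace W k) => freqShift K g φ q.1 q.2 :=
  contDiff_pi.2 fun j => (pairing (φ j)).contDiff.comp (contDiff_gCoeff K hg (stdIdx j))

/-- `profileMap` is smooth, jointly in `w` and `Φ`. -/
theorem contDiff_profileMap (hg : ContDiff ℝ (⊤ : ℕ∞) g) (φ : Fin N → L2)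
    (S : I → RegSpace W k →L[ℝ] RegSpace W k) (p : Fin N → RegSpace W k) : ContDiff ℝ (⊤ : ℕ∞)
    fun q : (Fin N → ℝ) × (I → RegSpace W k) => profileMap K g φ S p q.1 q.2 := by
  refine contDiff_pi.2 fun m => ?_
  have h1 : ContDiff ℝ (⊤ : ℕ∞) fun q : (Fin N → ℝ) × (I → RegSpace W k) =>
      dotIdx (freqShift K g φ q.1 q.2) (m : Idx N) :=
    ContDiff.sum fun j _ => contDiff_const.mul (contDiff_pi.1 (contDiff_freqShift hg φ) j)
  have h2 : ContDiff ℝ (⊤ : ℕ∞) fun q : (Fin N → ℝ) × (I → RegSpace W k) => q.2 m :=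
    (contDiff_apply ℝ _ m).comp contDiff_snd
  have h3 := h1.fun_smul h2
  have h4 := contDiff_gCoeff (I := I) (W := W) (k := k) K hg m
  have h5 := ContDiff.fun_comp (S m).contDiff (ContDiff.sub h3 h4)
  exact ContDiff.add (contDiff_const (c := baseProfile p m)) h5

/-- There is no shift of the frequencies at the origin. -/
theorem freqShift_zero (hI : ∀ m ∈ I, m ∈ NR1 ω) (hg : ContDiff ℝ (⊤ : ℕ∞) g) (hg0 : g 0 = 0)
    (Φ : I → RegSpace W k) : freqShift K g φ 0 Φ = 0 := by
  funext j
  rw [freqShift, gCoeff_zero_stdIdx hI hg hg0, map_zero, Pi.zero_apply]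

theorem dotIdx_zero (m : Idx N) : dotIdx 0 m = 0 := by simp [dotIdx]

theorem dotIdx_add (a b : Fin N → ℝ) (m : Idx N) : dotIdx (a + b) m = dotIdx a m + dotIdx b m := by
  simp [dotIdx, mul_add, Finset.sum_add_distrib]

theorem profileMap_zero (hI : ∀ m ∈ I, m ∈ NR1 ω) (hg : ContDiff ℝ (⊤ : ℕ∞) g) (hg0 : g 0 = 0)
    (S : I → RegSpace W k →L[ℝ] RegSpace W k) (p : Fin N → RegSpace W k) (Φ : I → RegSpace W k)
    (m : I) : profileMap K g φ S p 0 Φ m = baseProfile p m - S m (gCoeff K g m 0 Φ) := by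
  rw [profileMap, freqShift_zero hI hg hg0, dotIdx_zero, zero_smul, zero_sub, map_neg,
    sub_eq_add_neg]

/-- A fixed point of `profileMap` solves the equations of the profile. -/
theorem schrodinger_of_profileMap (hI : ∀ m ∈ I, m ∈ NR1 ω)
    (hφ : ∀ j, φ j ∈ eigenspaceH V (ω j)) (hφnorm : ∀ j, ‖φ j‖ = 1)
    (hφreal : ∀ j, ∀ᵐ x, (φ j x).im = 0) {R : I → L2 →L[ℂ] L2}
    (hR : ∀ m : I, ∀ f, ∃ h : R m f ∈ Hs 2,
      shifted V (dotIdx ω m) ⟨R m f, h⟩ + projIdx φ m (R m f) = f)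
    {S : I → RegSpace W k →L[ℝ] RegSpace W k} (hS : ∀ m f, toL2 (S m f) = R m (toL2 f))
    {p : Fin N → RegSpace W k} (hp : ∀ j, toL2 (p j) = φ j) {w : Fin N → ℝ}
    {Φ : I → RegSpace W k} (hΦ : Φ = profileMap K g φ S p w Φ)
    (hε : ∀ j, freqShift K g φ w Φ j < 1) (m : I) :
    ∃ h : toL2 (Φ m) ∈ Hs 2, schrodinger V ⟨toL2 (Φ m), h⟩ =
      ((dotIdx (ω + freqShift K g φ w Φ) m : ℝ) : ℂ) • toL2 (Φ m) - toL2 (gCoeff K g m w Φ) := by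
  set ε := freqShift K g φ w Φ with hεdef
  obtain ⟨F, hF⟩ : ∃ F, F = dotIdx ε m • Φ m - gCoeff K g m w Φ := ⟨_, rfl⟩
  have hFt : toL2 F = ((dotIdx ε m : ℝ) : ℂ) • toL2 (Φ m) - toL2 (gCoeff K g m w Φ) := by
    rw [hF, map_sub, map_smul, ofReal_smul_L2]
  have hΦm : toL2 (Φ m) = toL2 (baseProfile p m) + R m (toL2 F) := by
    rw [← hS, ← map_add, hF, hεdef]
    exact congrArg toL2 (congrFun hΦ m)
  obtain ⟨hu, h1⟩ := hR m (toL2 F)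
  -- the first summand of `Φ_m` lies in the kernel of `H - m·ω`
  have hb : ∃ h : toL2 (baseProfile p m) ∈ Hs 2,
      shifted V (dotIdx ω m) ⟨toL2 (baseProfile p m), h⟩ = 0 := by
    refine mem_eigenspaceH.1 ?_
    by_cases h0 : (m : Idx N) ∈ NR0
    · obtain ⟨j, hj⟩ := h0
      obtain ⟨m, hm⟩ := m
      obtain rfl : stdIdx j = m := hj
      rw [baseProfile_stdIdx, hp, dotIdx_stdIdx]
      exact hφ j
    · rw [baseProfile_of_notMem p h0, map_zero]
      exact Submodule.zero_mem _
  obtain ⟨hbm, hb0⟩ := hb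
  -- the second summand is orthogonal to the kernel, so that the projection drops out of the equation
  have hproj : projIdx φ m (R m (toL2 F)) = 0 := by
    by_cases h0 : (m : Idx N) ∈ NR0
    · obtain ⟨j, hj⟩ := h0
      obtain ⟨m, hm⟩ := m
      obtain rfl : stdIdx j = m := hj
      change projIdx φ (stdIdx j) _ = 0
      rw [projIdx_stdIdx] at h1 ⊢
      rw [baseProfile_stdIdx, hp] at hΦm
      -- `⟨φ_j, Ψ⟩` for the second summand `Ψ` of `Φ_{e_j}`
      set c : ℂ := inner ℂ (φ j) (R ⟨stdIdx j, hm⟩ (toL2 F)) with hc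
      have hnorm : inner ℂ (φ j) (φ j) = (1 : ℂ) := by
        rw [inner_self_eq_norm_sq_to_K, hφnorm]; simp
      have hdot : dotIdx ε (stdIdx j) = ε j := dotIdx_stdIdx j
      have hinF : inner ℂ (φ j) (toL2 F) = (ε j : ℂ) * c := by
        rw [hFt, hΦm, inner_sub_right, inner_smul_right, inner_add_right, hnorm, ← hc,
          inner_toL2 (hφreal j)]
        change ((dotIdx ε (stdIdx j) : ℝ) : ℂ) * _ - (ε j : ℂ) = _
        rw [hdot]
        ring
      have hsym : inner ℂ (φ j) (shifted V (dotIdx ω (stdIdx j)) ⟨_, hu⟩) = (0 : ℂ) := by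
        obtain ⟨h2, h3⟩ := mem_eigenspaceH.1 (hφ j)
        have h4 := shifted_symm V (rate_pos (hI _ hm)) ⟨φ j, h2⟩ ⟨_, hu⟩
        rw [neg_rate_sq (hI _ hm)] at h4
        rw [dotIdx_stdIdx] at h4 ⊢
        rw [h3, inner_zero_left] at h4
        exact h4.symm
      have h5 := congrArg (fun v => (inner ℂ (φ j) v : ℂ)) h1
      simp only [inner_add_right, inner_smul_right] at h5
      rw [hsym, hnorm, hinF, mul_one, zero_add] at h5
      have h6 : ((1 : ℂ) - (ε j : ℂ)) * c = 0 := by rw [sub_mul, one_mul, ← h5, sub_self]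
      have h7 : (1 : ℂ) - (ε j : ℂ) ≠ 0 := by
        rw [← Complex.ofReal_one, ← Complex.ofReal_sub]
        exact_mod_cast (sub_pos.2 (hε j)).ne'
      rw [(mul_eq_zero.1 h6).resolve_left h7, zero_smul]
    · exact projIdx_of_notMem φ h0 _
  rw [hproj, add_zero] at h1
  have hmem : toL2 (Φ m) ∈ Hs 2 := hΦm ▸ (Hs 2).add_mem hbm hu
  refine ⟨hmem, ?_⟩
  have h2 : shifted V (dotIdx ω m) ⟨toL2 (Φ m), hmem⟩ = toL2 F := by
    have e : (⟨toL2 (Φ m), hmem⟩ : Hs 2) = ⟨_, hbm⟩ + ⟨_, hu⟩ := Subtype.ext hΦm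
    rw [e, map_add, hb0, h1, zero_add]
  have h3 : schrodinger V ⟨toL2 (Φ m), hmem⟩ = toL2 F + (dotIdx ω m : ℂ) • toL2 (Φ m) := by
    rw [← h2, shifted, LinearMap.sub_apply, LinearMap.smul_apply, Submodule.coe_subtype,
      sub_add_cancel]
  rw [h3, hFt, dotIdx_add, Complex.ofReal_add, add_smul]
  abel

/-- `profileMap` is compatible with the inclusions between the regularities. -/
theorem inclL_profileMap (hg : ContDiff ℝ (⊤ : ℕ∞) g) {l : ℕ} (h : k ≤ l) {R : I → L2 →L[ℂ] L2}
    {S : I → RegSpace W k →L[ℝ] RegSpace W k} (hS : ∀ m f, toL2 (S m f) = R m (toL2 f))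
    {S' : I → RegSpace W l →L[ℝ] RegSpace W l} (hS' : ∀ m f, toL2 (S' m f) = R m (toL2 f))
    {p : Fin N → RegSpace W k} (hp : ∀ j, toL2 (p j) = φ j)
    {p' : Fin N → RegSpace W l} (hp' : ∀ j, toL2 (p' j) = φ j) (w : Fin N → ℝ)
    (Φ : I → RegSpace W l) (m : I) : inclL h (profileMap K g φ S' p' w Φ m) =
      profileMap K g φ S p w (fun n => inclL h (Φ n)) m := by
  have h1 : freqShift K g φ w (fun n => inclL h (Φ n)) = freqShift K g φ w Φ := by
    funext j
    rw [freqShift, ← gCoeff_inclL hg]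
    rfl
  have h2 : inclL h (baseProfile p' m) = baseProfile p m := by
    rw [baseProfile, baseProfile, map_sum]
    refine Finset.sum_congr rfl fun j _ => ?_
    split_ifs
    · exact toL2_injective (by rw [toL2_inclL, hp, hp'])
    · exact map_zero _
  rw [profileMap, profileMap, map_add, h2, h1]
  congr 1
  refine toL2_injective ?_
  rw [toL2_inclL, hS, hS', ← gCoeff_inclL hg, ← map_smul, ← map_sub, toL2_inclL]

/-- At the origin, `profileMap` is the recursion for `φ̃_m(0)`. -/
theorem toL2_profileMap_zero (hspec : discreteSpectrumH V = Set.range (fun j => (ω j : ℂ)))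
    (hlin : ∀ m : Idx N, m ≠ 0 → dotIdx ω m ≠ 0) (hI : ∀ m, m ∈ I ↔ m ∈ NR1 ω)
    (hg : ContDiff ℝ (⊤ : ℕ∞) g) (hg0 : g 0 = 0) {R : I → L2 →L[ℂ] L2}
    (hR : ∀ m : I, ∀ f, ∃ h : R m f ∈ Hs 2,
      shifted V (dotIdx ω m) ⟨R m f, h⟩ + projIdx φ m (R m f) = f)
    {S : I → RegSpace W k →L[ℝ] RegSpace W k} (hS : ∀ m f, toL2 (S m f) = R m (toL2 f))
    {p : Fin N → RegSpace W k} (hp : ∀ j, toL2 (p j) = φ j) {m : I}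
    (hK : sizeIdx (m : Idx N) < K) {Φ : I → RegSpace W k}
    (hΦ : ∀ n : I, sizeIdx (n : Idx N) < sizeIdx (m : Idx N) → toL2 (Φ n) = phiTilde V g ω φ n) :
    toL2 (profileMap K g φ S p 0 Φ m) = phiTilde V g ω φ m := by
  have hI' : ∀ m ∈ I, m ∈ NR1 ω := fun m hm => (hI m).1 hm
  rw [profileMap_zero hI' hg hg0]
  by_cases h0 : (m : Idx N) ∈ NR0
  · obtain ⟨j, hj⟩ := h0
    obtain ⟨m, hm⟩ := m
    obtain rfl : stdIdx j = m := hj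
    rw [gCoeff_zero_stdIdx hI' hg hg0, map_zero, sub_zero, baseProfile_stdIdx, hp]
    exact (phiTilde_stdIdx j).symm
  · rw [baseProfile_of_notMem p h0, zero_sub, map_neg, hS,
      phiTilde_eq hspec hlin hI hg hg0 (hI' _ m.2) h0 hK hΦ (hR m)]

/-- Iterating `profileMap` at `w = 0` computes the functions `φ̃_m(0)` in the order of increasing
size, and they form a fixed point. -/
theorem exists_phiTilde (hspec : discreteSpectrumH V = Set.range (fun j => (ω j : ℂ)))
    (hlin : ∀ m : Idx N, m ≠ 0 → dotIdx ω m ≠ 0) (hI : ∀ m, m ∈ I ↔ m ∈ NR1 ω)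
    (hg : ContDiff ℝ (⊤ : ℕ∞) g) (hg0 : g 0 = 0) {R : I → L2 →L[ℂ] L2}
    (hR : ∀ m : I, ∀ f, ∃ h : R m f ∈ Hs 2,
      shifted V (dotIdx ω m) ⟨R m f, h⟩ + projIdx φ m (R m f) = f)
    {S : I → RegSpace W k →L[ℝ] RegSpace W k} (hS : ∀ m f, toL2 (S m f) = R m (toL2 f))
    {p : Fin N → RegSpace W k} (hp : ∀ j, toL2 (p j) = φ j)
    (hK : ∀ m ∈ I, sizeIdx m < K) :
    ∃ Φ : I → RegSpace W k, (∀ m : I, toL2 (Φ m) = phiTilde V g ω φ m) ∧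
      Φ = profileMap K g φ S p 0 Φ := by
  have key : ∀ n : ℕ, ∃ Φ : I → RegSpace W k,
      ∀ m : I, sizeIdx (m : Idx N) < n → toL2 (Φ m) = phiTilde V g ω φ m := by
    intro n
    induction n with
    | zero => exact ⟨0, fun m hm => absurd hm (Nat.not_lt_zero _)⟩
    | succ n ih =>
      obtain ⟨Φ, hΦ⟩ := ih
      refine ⟨profileMap K g φ S p 0 Φ, fun m hm => ?_⟩
      exact toL2_profileMap_zero hspec hlin hI hg hg0 hR hS hp (hK _ m.2) fun n' hn' =>
        hΦ n' (by omega)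
  obtain ⟨Φ, hΦ⟩ := key K
  have hΦ' : ∀ m : I, toL2 (Φ m) = phiTilde V g ω φ m := fun m => hΦ m (hK _ m.2)
  refine ⟨Φ, hΦ', funext fun m => toL2_injective ?_⟩
  rw [hΦ' m]
  exact (toL2_profileMap_zero hspec hlin hI hg hg0 hR hS hp (hK _ m.2) fun n _ => hΦ' n).symm

end Equations

end NLS

end

noncomputable section

namespace NLS

open RegSpace

section Equations

variable {N : ℕ} {ω : Fin N → ℝ} {V : 𝓢(X, ℝ)} {φ : Fin N → L2} {W : Weight} {k : ℕ}
  {I : Finset (Idx N)} {K : ℕ} {g : ℝ → ℝ}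

/-- Smooth solutions of the equations of the profile, at one regularity. -/
theorem exists_profileMap_fixedPoint
    (hspec : discreteSpectrumH V = Set.range (fun j => (ω j : ℂ)))
    (hlin : ∀ m : Idx N, m ≠ 0 → dotIdx ω m ≠ 0) (hI : ∀ m, m ∈ I ↔ m ∈ NR1 ω)
    (hg : ContDiff ℝ (⊤ : ℕ∞) g) (hg0 : g 0 = 0) {R : I → L2 →L[ℂ] L2}
    (hR : ∀ m : I, ∀ f, ∃ h : R m f ∈ Hs 2,
      shifted V (dotIdx ω m) ⟨R m f, h⟩ + projIdx φ m (R m f) = f)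
    {S : I → RegSpace W k →L[ℝ] RegSpace W k} (hS : ∀ m f, toL2 (S m f) = R m (toL2 f))
    {p : Fin N → RegSpace W k} (hp : ∀ j, toL2 (p j) = φ j)
    (hK : ∀ m ∈ I, sizeIdx m < K) :
    ∃ δ > 0, ∃ Φ : (Fin N → ℝ) → I → RegSpace W k,
      (∀ m : I, toL2 (Φ 0 m) = phiTilde V g ω φ m) ∧
      ContDiffOn ℝ (⊤ : ℕ∞) Φ (Metric.ball 0 δ) ∧
      (∀ w ∈ Metric.ball 0 δ, Φ w = profileMap K g φ S p w (Φ w)) ∧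
      ∀ w ∈ Metric.ball 0 δ, ∀ Φ' ∈ Metric.ball (Φ 0) δ,
        Φ' = profileMap K g φ S p w Φ' → Φ' = Φ w := by
  obtain ⟨Φ₀, h0, h1⟩ := exists_phiTilde (W := W) hspec hlin hI hg hg0 hR hS hp hK
  have hsm := contDiff_profileMap (K := K) hg φ S p
  have hF := ContDiff.sub contDiff_snd hsm
  have hT := ContDiff.comp hsm (contDiff_prodMk_right (𝕜 := ℝ) (0 : Fin N → ℝ))
  have hu : IsUnit (fderiv ℝ (fun Φ : I → RegSpace W k => Φ - profileMap K g φ S p 0 Φ) Φ₀) := by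
    refine isUnit_fderiv_of_triangular (fun m : I => sizeIdx (m : Idx N))
      (hT.differentiable (by simp) _) fun Φ Φ' m h => ?_
    have hI' : ∀ m ∈ I, m ∈ NR1 ω := fun m hm => (hI m).1 hm
    rw [profileMap_zero hI' hg hg0, profileMap_zero hI' hg hg0,
      gCoeff_zero_congr hI' hg hg0 m h]
  obtain ⟨δ, hδ, Φ, h2, h3, h4, h5⟩ := exists_implicit_function hF (a := 0) (b := Φ₀)
    (sub_eq_zero.2 h1) hu
  refine ⟨δ, hδ, Φ, fun m => h2 ▸ h0 m, h3, fun w hw => sub_eq_zero.1 (h4 w hw),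
    fun w hw Φ' hΦ' h6 => h5 w hw Φ' (h2 ▸ hΦ') (sub_eq_zero.2 h6)⟩

/-- The solutions of the equations of the profile, of all regularities: `U_m(w) = Φ_m(w)` and
`ε(w) = ϖ(w) - ω` do not depend on the regularity `k`, the size of their domain does. -/
theorem exists_profile_family
    (hspec : discreteSpectrumH V = Set.range (fun j => (ω j : ℂ)))
    (hlin : ∀ m : Idx N, m ≠ 0 → dotIdx ω m ≠ 0) (hI : ∀ m, m ∈ I ↔ m ∈ NR1 ω)
    (hφ : ∀ j, φ j ∈ eigenspaceH V (ω j)) (hφnorm : ∀ j, ‖φ j‖ = 1)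
    (hφreal : ∀ j, ∀ᵐ x, (φ j x).im = 0)
    (hg : ContDiff ℝ (⊤ : ℕ∞) g) (hg0 : g 0 = 0) {R : I → L2 →L[ℂ] L2}
    (hR : ∀ m : I, ∀ f, ∃ h : R m f ∈ Hs 2,
      shifted V (dotIdx ω m) ⟨R m f, h⟩ + projIdx φ m (R m f) = f)
    (hS : ∀ m k, 2 ≤ k → ∃ S : RegSpace W k →L[ℝ] RegSpace W k, ∀ f, toL2 (S f) = R m (toL2 f))
    (hp : ∀ j k, ∃ f : RegSpace W k, toL2 f = φ j)
    (hK : ∀ m ∈ I, sizeIdx m < K) :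
    ∃ (U : (Fin N → ℝ) → I → L2) (ε : (Fin N → ℝ) → Fin N → ℝ), ε 0 = 0 ∧ ∀ k, 2 ≤ k →
      ∃ δ > 0, ∃ Φ : (Fin N → ℝ) → I → RegSpace W k,
        (∀ m : I, toL2 (Φ 0 m) = phiTilde V g ω φ m) ∧
        ContDiffOn ℝ (⊤ : ℕ∞) Φ (Metric.ball 0 δ) ∧ ContDiffOn ℝ (⊤ : ℕ∞) ε (Metric.ball 0 δ) ∧
        ∀ w ∈ Metric.ball 0 δ, ∀ m : I, toL2 (Φ w m) = U w m ∧
          ∃ h : U w m ∈ Hs 2, schrodinger V ⟨U w m, h⟩ =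
            ((dotIdx (ω + ε w) m : ℝ) : ℂ) • U w m - toL2 (gCoeff K g m w (Φ w)) := by
  have hI' : ∀ m ∈ I, m ∈ NR1 ω := fun m hm => (hI m).1 hm
  choose S hS using hS
  choose p hp using hp
  obtain ⟨δ₂, hδ₂, Φ₂, h1, h2, h3, h4⟩ := exists_profileMap_fixedPoint (W := W) hspec hlin hI hg
    hg0 hR (fun m => hS m 2 le_rfl) (fun j => hp j 2) hK
  have hε :=
    ContDiff.comp_contDiffOn (contDiff_freqShift (I := I) (W := W) (k := 2) (K := K) hg φ)
      (contDiffOn_id.prodMk h2)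
  refine ⟨fun w m => toL2 (Φ₂ w m), fun w => freqShift K g φ w (Φ₂ w),
    freqShift_zero hI' hg hg0 _, fun k hk => ?_⟩
  obtain ⟨δ, hδ, Φ, g1, g2, g3, g4⟩ := exists_profileMap_fixedPoint (W := W) hspec hlin hI hg hg0
    hR (fun m => hS m k hk) (fun j => hp j k) hK
  have hΦ0 : (fun m => inclL hk (Φ 0 m)) = Φ₂ 0 :=
    funext fun m => toL2_injective (by rw [toL2_inclL, h1, g1])
  -- close to the origin, the solution of regularity `k` is the one of regularity `2`
  have hnear : ∀ᶠ w in 𝓝 (0 : Fin N → ℝ), (fun m => inclL hk (Φ w m)) ∈ Metric.ball (Φ₂ 0) δ₂ := by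
    have hc : ContinuousAt (fun w => fun m => inclL hk (Φ w m)) 0 := by
      refine continuousAt_pi.2 fun m => ?_
      have hc1 : ContinuousAt Φ 0 := g2.continuousOn.continuousAt (Metric.ball_mem_nhds _ hδ)
      exact (inclL hk).continuous.continuousAt.comp ((continuousAt_apply m _).comp hc1)
    have : Metric.ball (Φ₂ 0) δ₂ ∈ 𝓝 ((fun w => fun m => inclL hk (Φ w m)) 0) := by
      show _ ∈ 𝓝 (fun m => inclL hk (Φ 0 m))
      rw [hΦ0]; exact Metric.ball_mem_nhds _ hδ₂
    exact hc this
  -- `schrodinger_of_profileMap` needs `ε_j < 1`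
  have hsmall : ∀ᶠ w in 𝓝 (0 : Fin N → ℝ), ∀ j, freqShift K g φ w (Φ₂ w) j < 1 := by
    refine eventually_all.2 fun j => ?_
    have hc1 : ContinuousAt (fun w => freqShift K g φ w (Φ₂ w) j) 0 :=
      (continuousAt_apply j _).comp (hε.continuousOn.continuousAt (Metric.ball_mem_nhds _ hδ₂))
    have h5 : freqShift K g φ 0 (Φ₂ 0) j < 1 := by
      rw [freqShift_zero hI' hg hg0]; exact one_pos
    exact hc1.eventually (gt_mem_nhds h5)
  obtain ⟨δ', hδ', hb⟩ := Metric.eventually_nhds_iff_ball.1 (hnear.and hsmall)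
  refine ⟨min δ' (min δ δ₂), lt_min hδ' (lt_min hδ hδ₂), Φ, g1,
    g2.mono (Metric.ball_subset_ball ((min_le_right _ _).trans (min_le_left _ _))),
    hε.mono (Metric.ball_subset_ball ((min_le_right _ _).trans (min_le_right _ _))),
    fun w hw m => ?_⟩
  have hw1 : w ∈ Metric.ball (0 : Fin N → ℝ) δ' := Metric.ball_subset_ball (min_le_left _ _) hw
  have hw2 : w ∈ Metric.ball (0 : Fin N → ℝ) δ :=
    Metric.ball_subset_ball ((min_le_right _ _).trans (min_le_left _ _)) hw
  have hw3 : w ∈ Metric.ball (0 : Fin N → ℝ) δ₂ :=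
    Metric.ball_subset_ball ((min_le_right _ _).trans (min_le_right _ _)) hw
  obtain ⟨hb1, hb2⟩ := hb w hw1
  -- uniqueness in the implicit function theorem
  have heq : (fun m => inclL hk (Φ w m)) = Φ₂ w := by
    refine h4 w hw3 _ hb1 (funext fun m => ?_)
    rw [← inclL_profileMap hg hk (fun m => hS m 2 le_rfl) (fun m => hS m k hk) (fun j => hp j 2)
      (fun j => hp j k)]
    exact congrArg (inclL hk) (congrFun (g3 w hw2) m)
  have hfs : freqShift K g φ w (Φ w) = freqShift K g φ w (Φ₂ w) := by
    funext j
    rw [freqShift, freqShift, ← heq, ← gCoeff_inclL hg]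
    rfl
  have hU : toL2 (Φ w m) = toL2 (Φ₂ w m) := congrArg toL2 (congrFun heq m)
  refine ⟨hU, ?_⟩
  have h6 := schrodinger_of_profileMap hI' hφ hφnorm hφreal hR (fun m => hS m k hk)
    (fun j => hp j k) (g3 w hw2) (by rw [hfs]; exact hb2) m
  rw [hfs] at h6
  simp only [hU] at h6
  exact h6

end Equations

end NLS

end

noncomputable section

namespace NLS

open RegSpace

/-! ### The evolution of the profile -/

section Evolution

variable {N : ℕ} {V : 𝓢(X, ℝ)} {W : Weight} {k l : ℕ} {I : Finset (Idx N)} {K : ℕ} {g : ℝ → ℝ}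

theorem eq_of_toL2_eq {f : RegSpace W k} {f' : RegSpace W l} (h : toL2 f = toL2 f') (x : X) :
    f x = f' x := by
  have h1 : (fun x => (f x : ℂ)) =ᵐ[volume] fun x => (f' x : ℂ) :=
    (toL2_coe f).symm.trans (h ▸ toL2_coe f')
  have h2 := Measure.eq_of_ae_eq h1 (Complex.continuous_ofReal.comp f.reg.continuous)
    (Complex.continuous_ofReal.comp f'.reg.continuous)
  exact Complex.ofReal_injective (congrFun h2 x)

theorem toL2_eq_of_eq {f : RegSpace W k} {f' : RegSpace W l} (h : ∀ x, f x = f' x) :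
    toL2 f = toL2 f' := by
  refine Lp.ext ((toL2_coe f).trans (EventuallyEq.trans ?_ (toL2_coe f').symm))
  exact Eventually.of_forall fun x => congrArg _ (h x)

/-- The values of the remainder. -/
theorem remainder_apply (hg : ContDiff ℝ (⊤ : ℕ∞) g) (J : Finset (Idx N)) (ℓ : ℂ →L[ℝ] ℝ)
    (Φ : (Fin N → ℝ) → I → RegSpace W k) (z : Fin N → ℂ) (x : X) {u : ℂ}
    (hu : u = ∑ m : I, monom z m.1 * (Φ (absSq z) m x : ℂ)) :
    remainder K g J ℓ Φ z x = ℓ ((g (‖u‖ ^ 2) : ℂ) * u -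
      ∑ m ∈ I, monom z m * (gCoeff K g m (absSq z) (Φ (absSq z)) x : ℂ) -
      ∑ m ∈ J, monom z m * (gCoeff K g m 0 (Φ 0) x : ℂ)) := by
  have hcast : ∀ (c : ℝ) (v : ℂ), ℓ ((c : ℂ) * v) = c * ℓ v := fun c v => by
    rw [← Complex.real_smul, map_smul, smul_eq_mul]
  have hcast' : ∀ (c : ℝ) (v : ℂ), ℓ (v * (c : ℂ)) = ℓ v * c := fun c v => by
    rw [mul_comm, hcast, mul_comm]
  rw [remainder, sub_apply', sub_apply', sum_apply', sum_apply', nem_apply hg, linComb_apply,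
    sqComb_apply, ← hu, map_sub, map_sub, map_sum, map_sum, hcast]
  simp only [hcast', smul_apply']

/-- The remainder does not depend on the regularity. -/
theorem remainder_congr (hg : ContDiff ℝ (⊤ : ℕ∞) g) (J : Finset (Idx N)) (ℓ : ℂ →L[ℝ] ℝ)
    {Φ : (Fin N → ℝ) → I → RegSpace W k} {Φ' : (Fin N → ℝ) → I → RegSpace W l} {z : Fin N → ℂ}
    (hz : ∀ m, toL2 (Φ (absSq z) m) = toL2 (Φ' (absSq z) m))
    (h0 : ∀ m, toL2 (Φ 0 m) = toL2 (Φ' 0 m)) :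
    toL2 (remainder K g J ℓ Φ z) = toL2 (remainder K g J ℓ Φ' z) := by
  refine toL2_eq_of_eq fun x => ?_
  rw [remainder_apply hg J ℓ Φ z x rfl, remainder_apply hg J ℓ Φ' z x rfl]
  simp only [gCoeff_apply hg, diagSq_apply, fun m => eq_of_toL2_eq (hz m) x,
    fun m => eq_of_toL2_eq (h0 m) x]

theorem monom_stdIdx (z : Fin N → ℂ) (j : Fin N) : monom z (stdIdx j) = z j := by
  rw [monom, Finset.prod_eq_single j]
  · simp [stdIdx, cpowIdx]
  · intro i _ hi
    simp [stdIdx, cpowIdx, hi]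
  · simp

theorem cpowIdx_phase (θ t : ℝ) (z : ℂ) (m : ℤ) :
    cpowIdx (Complex.exp (-Complex.I * (θ : ℂ) * (t : ℂ)) * z) m =
      Complex.exp (-Complex.I * ((m * θ : ℝ) : ℂ) * (t : ℂ)) * cpowIdx z m := by
  rw [cpowIdx, cpowIdx]
  split_ifs with h
  · rw [mul_pow, ← Complex.exp_nat_mul]
    congr 2
    obtain ⟨n, rfl⟩ := Int.eq_ofNat_of_zero_le h
    push_cast [Int.toNat_natCast]
    ring
  · rw [map_mul, mul_pow, ← Complex.exp_conj, ← Complex.exp_nat_mul]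
    congr 2
    obtain ⟨n, hn⟩ := Int.eq_ofNat_of_zero_le (a := -m) (by omega)
    obtain rfl : m = -n := by omega
    simp only [neg_neg, Int.toNat_natCast, map_mul, map_neg, Complex.conj_I, Complex.conj_ofReal]
    push_cast
    ring

/-- Under the flow `z_j ↦ e^{-iθ_j t} z_j` the monomial of index `m` rotates with the frequency
`m·θ`. -/
theorem monom_phase (θ : Fin N → ℝ) (t : ℝ) (z : Fin N → ℂ) (m : Idx N) :
    monom (fun j => Complex.exp (-Complex.I * (θ j : ℂ) * (t : ℂ)) * z j) m =
      Complex.exp (-Complex.I * ((dotIdx θ m : ℝ) : ℂ) * (t : ℂ)) * monom z m := by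
  simp only [monom, cpowIdx_phase, Finset.prod_mul_distrib]
  rw [← Complex.exp_sum, dotIdx]
  push_cast
  rw [Finset.mul_sum, Finset.sum_mul]

theorem norm_exp_phase (θ t : ℝ) : ‖Complex.exp (-Complex.I * (θ : ℂ) * (t : ℂ))‖ = 1 := by
  rw [show -Complex.I * (θ : ℂ) * (t : ℂ) = ((-(θ * t) : ℝ) : ℂ) * Complex.I by push_cast; ring]
  exact Complex.norm_exp_ofReal_mul_I _

theorem absSq_phase (θ : Fin N → ℝ) (t : ℝ) (z : Fin N → ℂ) :
    absSq (fun j => Complex.exp (-Complex.I * (θ j : ℂ) * (t : ℂ)) * z j) = absSq z := by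
  funext j
  rw [absSq, absSq, norm_mul, norm_exp_phase, one_mul]

theorem finsum_subtype_eq_sum {s : Set (Idx N)} {M : Type*} [AddCommMonoid M]
    (hI : ∀ m, m ∈ I ↔ m ∈ s) (f : Idx N → M) : ∑ᶠ m : s, f m.1 = ∑ m ∈ I, f m := by
  rw [finsum_set_coe_eq_finsum_mem, ← finsum_mem_coe_finset]
  congr 1
  funext m
  have : m ∈ s ↔ m ∈ (I : Set (Idx N)) := by rw [Finset.mem_coe, hI]
  simp only [this]

theorem coeFn_sum_smul (c : I → ℂ) (f : I → L2) :
    (∑ m, c m • f m : L2) =ᵐ[volume] fun x => ∑ m, c m * f m x := by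
  have h1 := Lp.coeFn_finsetSum (μ := (volume : Measure X)) (p := 2) Finset.univ
    (fun m => c m • f m)
  have h2 : ∀ᵐ x, ∀ m : I, (c m • f m : L2) x = c m * f m x :=
    ae_all_iff.2 fun m => Lp.coeFn_smul (c m) (f m)
  filter_upwards [h1, h2] with x h1 h2
  rw [h1]
  simp only [Finset.sum_apply, h2]

/-- If `H U_m = (m·ϖ) U_m - g_m`, then `u = ∑ z(t)^m U_m` solves the equation with the forcing term
`∑ z(t)^m g_m - g(|u|²) u`. -/
theorem isForcedSolution_sum {U G : I → L2} {θ : Fin N → ℝ}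
    (hU : ∀ m : I, ∃ h : U m ∈ Hs 2,
      schrodinger V ⟨U m, h⟩ = ((dotIdx θ m : ℝ) : ℂ) • U m - G m) {z : ℝ → Fin N → ℂ} {z₀ : Fin N → ℂ}
    (hz : ∀ t j, z t j = Complex.exp (-Complex.I * (θ j : ℂ) * (t : ℂ)) * z₀ j)
    {F : ℝ → X → ℂ} {u : ℝ → L2} (hu : ∀ t, u t = ∑ m : I, monom (z t) m.1 • U m)
    (hF : ∀ t, ∀ᵐ x, F t x =
      (g (‖∑ m : I, monom (z t) m.1 * U m x‖ ^ 2) : ℂ) * ∑ m : I, monom (z t) m.1 * U m x -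
        ∑ m : I, monom (z t) m.1 * G m x) :
    IsForcedSolution V g F u := by
  -- each summand `z(t)^m U_m` rotates with the frequency `m·θ`
  have hmon : ∀ t (m : I), monom (z t) m.1 =
      Complex.exp (-Complex.I * ((dotIdx θ m.1 : ℝ) : ℂ) * (t : ℂ)) * monom z₀ m.1 := fun t m => by
    rw [← monom_phase, funext (hz t)]
  have hder : ∀ (m : I) (t : ℝ), HasDerivAt (fun t => monom (z t) m.1)
      (-Complex.I * ((dotIdx θ m.1 : ℝ) : ℂ) * monom (z t) m.1) t := by
    intro m t
    have h1 : HasDerivAt (fun t : ℝ => -Complex.I * ((dotIdx θ m.1 : ℝ) : ℂ) * (t : ℂ))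
        (-Complex.I * ((dotIdx θ m.1 : ℝ) : ℂ) * 1) t :=
      (Complex.ofRealCLM.hasDerivAt (x := t)).const_mul _
    have h2 := h1.cexp.mul_const (monom z₀ m.1)
    simp only [hmon]
    refine h2.congr_deriv ?_
    ring
  have hcont : ∀ m : I, Continuous fun t => monom (z t) m.1 := fun m =>
    continuous_iff_continuousAt.2 fun t => (hder m t).continuousAt
  have hu' : u = fun t => ∑ m : I, monom (z t) m.1 • U m := funext hu
  have hmem : ∀ m : I, U m ∈ Hs 2 := fun m => (hU m).1
  have hderu : ∀ t, HasDerivAt u (∑ m : I,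
      (-Complex.I * ((dotIdx θ m.1 : ℝ) : ℂ) * monom (z t) m.1) • U m) t := by
    intro t
    rw [hu']
    exact HasDerivAt.fun_sum fun m _ => (hder m t).smul_const (U m)
  have hutmem : ∀ t, u t ∈ Hs 2 := fun t => by
    rw [hu t]
    exact Submodule.sum_mem _ fun m _ => Submodule.smul_mem _ _ (hmem m)
  refine ⟨⟨fun t => ∑ m : I, monom (z t) m.1 • WSob.mk (U m) (mem_weighted_zero (s := 2) (hmem m)),
    continuous_finsetSum _ fun m _ => (hcont m).smul continuous_const, fun t => ?_⟩, ?_,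
    fun t => ⟨hutmem t, ?_⟩⟩
  · rw [hu t, map_sum]
    exact Finset.sum_congr rfl fun m _ => map_smul WSob.toL2 _ _
  · rw [contDiff_one_iff_deriv]
    refine ⟨fun t => (hderu t).differentiableAt, ?_⟩
    rw [funext fun t => (hderu t).deriv]
    exact continuous_finsetSum _ fun m _ => (continuous_const.mul (hcont m)).smul continuous_const
  · have hH : schrodinger V ⟨u t, hutmem t⟩ =
        ∑ m : I, monom (z t) m.1 • (((dotIdx θ m.1 : ℝ) : ℂ) • U m - G m) := by
      have e : (⟨u t, hutmem t⟩ : Hs 2) = ∑ m : I, monom (z t) m.1 • ⟨U m, hmem m⟩ := by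
        refine Subtype.ext ?_
        rw [Submodule.coe_sum]
        exact hu t
      rw [e, map_sum]
      refine Finset.sum_congr rfl fun m _ => ?_
      rw [map_smul]
      exact congrArg _ (hU m).2
    rw [(hderu t).deriv, hH]
    have h3 : ∀ᵐ x, ∀ m : I, (((dotIdx θ m.1 : ℝ) : ℂ) • U m - G m : L2) x =
        ((dotIdx θ m.1 : ℝ) : ℂ) * U m x - G m x := by
      refine ae_all_iff.2 fun m => ?_
      filter_upwards [Lp.coeFn_sub (((dotIdx θ m.1 : ℝ) : ℂ) • U m) (G m),
        Lp.coeFn_smul ((dotIdx θ m.1 : ℝ) : ℂ) (U m)] with x h1 h2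
      rw [h1, Pi.sub_apply, h2, Pi.smul_apply, smul_eq_mul]
    have h4 : u t =ᵐ[volume] fun x => ∑ m : I, monom (z t) m.1 * U m x := by
      rw [hu t]
      exact coeFn_sum_smul _ _
    filter_upwards [coeFn_sum_smul (fun m : I =>
        -Complex.I * ((dotIdx θ m.1 : ℝ) : ℂ) * monom (z t) m.1) U,
      coeFn_sum_smul (fun m : I => monom (z t) m.1)
        (fun m => ((dotIdx θ m.1 : ℝ) : ℂ) • U m - G m), h3, h4, hF t] with x h1 h2 h3 h4 h5
    rw [h1, h2, h4, h5]
    simp only [h3]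
    rw [Finset.mul_sum]
    have h6 : ∀ m : I, Complex.I * (-Complex.I * ((dotIdx θ m.1 : ℝ) : ℂ) * monom (z t) m.1 * U m x) =
        monom (z t) m.1 * (((dotIdx θ m.1 : ℝ) : ℂ) * U m x - G m x) + monom (z t) m.1 * G m x := by
      intro m
      linear_combination (-((dotIdx θ m.1 : ℝ) : ℂ) * monom (z t) m.1 * U m x) * Complex.I_sq
    simp only [h6, Finset.sum_add_distrib]
    ring

end Evolution

end NLS

end

noncomputable section

namespace NLS

open RegSpace

/-! ### Existence of refined profiles -/

section Existence

variable {N : ℕ} {ω : Fin N → ℝ} {V : 𝓢(X, ℝ)} {φ : Fin N → L2} {I J : Finset (Idx N)}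
  {g : ℝ → ℝ}

theorem norm_le_norm1_real (w : Fin N → ℝ) : ‖w‖ ≤ norm1 w :=
  (pi_norm_le_iff_of_nonneg (norm1_nonneg w)).2 fun j => norm_le_norm1 w j

/-- The profiles of all regularities, together with the bounds on the remainders. -/
theorem exists_profile_levels (hω : StrictMono ω) (hneg : ∀ j, ω j < 0)
    (hspec : discreteSpectrumH V = Set.range (fun j => (ω j : ℂ)))
    (hsimple : ∀ j, Module.finrank ℂ (eigenspaceH V (ω j)) = 1)
    (hlin : ∀ m : Idx N, m ≠ 0 → dotIdx ω m ≠ 0)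
    (hφ : ∀ j, φ j ∈ eigenspaceH V (ω j)) (hφnorm : ∀ j, ‖φ j‖ = 1)
    (hφreal : ∀ j, ∀ᵐ x, (φ j x).im = 0) {a : ℝ}
    (ha : ∀ m, ∀ hm : m ∈ NR1 ω, SmallRate a (rate_pos hm))
    (hI : ∀ m, m ∈ I ↔ m ∈ NR1 ω) (hJ : ∀ m, m ∈ J ↔ m ∈ Rmin ω)
    (hg : ContDiff ℝ (⊤ : ℕ∞) g) (hg0 : g 0 = 0) :
    ∃ K : ℕ, (∀ m ∈ J, sizeIdx m < K) ∧
    ∃ (U : (Fin N → ℝ) → I → L2) (ε : (Fin N → ℝ) → Fin N → ℝ), ε 0 = 0 ∧ ∀ k, 2 ≤ k →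
      ∃ δ > 0, ∃ C, 0 ≤ C ∧ ∃ Φ : (Fin N → ℝ) → I → RegSpace (expWeight a) k, δ ≤ 1 ∧
        (∀ m : I, toL2 (Φ 0 m) = phiTilde V g ω φ m) ∧
        ContDiffOn ℝ (⊤ : ℕ∞) Φ (Metric.ball 0 δ) ∧ ContDiffOn ℝ (⊤ : ℕ∞) ε (Metric.ball 0 δ) ∧
        (∀ w ∈ Metric.ball 0 δ, ∀ m : I, toL2 (Φ w m) = U w m ∧
          ∃ h : U w m ∈ Hs 2, schrodinger V ⟨U w m, h⟩ =
            ((dotIdx (ω + ε w) m : ℝ) : ℂ) • U w m - toL2 (gCoeff K g m w (Φ w))) ∧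
        ∀ z, norm1 z < δ → ∀ ℓ : ℂ →L[ℝ] ℝ, ‖ℓ‖ ≤ 1 →
          ‖remainder K g J ℓ Φ z‖ ≤ C * (norm1 z ^ 2 * ∑ m ∈ J, ‖monom z m‖) := by
  obtain ⟨K₀, hK₀⟩ := exists_remainder_le hω hlin hI hJ
  obtain ⟨K, hK, hKI, hKJ⟩ : ∃ K, K₀ ≤ K ∧ (∀ m ∈ I, sizeIdx m < K) ∧ ∀ m ∈ J, sizeIdx m < K := by
    refine ⟨K₀ + I.sup sizeIdx + J.sup sizeIdx + 1, by omega, fun m hm => ?_, fun m hm => ?_⟩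
    · have := Finset.le_sup (f := sizeIdx) hm
      omega
    · have := Finset.le_sup (f := sizeIdx) hm
      omega
  have hI' : ∀ m ∈ I, m ∈ NR1 ω := fun m hm => (hI m).1 hm
  choose R hR hS using fun m : I =>
    exists_solver hspec hsimple hlin hφ hφnorm hφreal (hI' m m.2) (ha m (hI' m m.2))
  obtain ⟨U, ε, hε0, hlev⟩ := exists_profile_family hspec hlin hI hφ hφnorm hφreal hg hg0 hR hS
    (fun j => exists_eigenfunction hneg hφ hφreal j (ha _ (stdIdx_mem_NR1 hneg j))) hKI
  refine ⟨K, hKJ, U, ε, hε0, fun k hk => ?_⟩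
  obtain ⟨δ, hδ, Φ, h0, h1, h2, h3⟩ := hlev k hk
  have hd : DifferentiableAt ℝ Φ 0 :=
    (h1.contDiffAt (Metric.ball_mem_nhds _ hδ)).differentiableAt (by simp)
  obtain ⟨δ', hδ', C, hC, h4⟩ := hK₀ K hK hg (expWeight a) k Φ hd
  have hle : min 1 (min δ δ') ≤ δ := (min_le_right _ _).trans (min_le_left _ _)
  have hsub : Metric.ball (0 : Fin N → ℝ) (min 1 (min δ δ')) ⊆ Metric.ball 0 δ :=
    Metric.ball_subset_ball hle
  exact ⟨min 1 (min δ δ'), lt_min one_pos (lt_min hδ hδ'), C, hC, Φ, min_le_left _ _, h0,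
    h1.mono hsub, h2.mono hsub, fun w hw => h3 w (hsub hw),
    fun z hz => h4 z (hz.trans_le ((min_le_right _ _).trans (min_le_right _ _)))⟩

/-- The part `z·φ` of the profile. -/
theorem sum_monom_baseProfile {W : Weight} {k : ℕ} (hneg : ∀ j, ω j < 0)
    (hI : ∀ m, m ∈ I ↔ m ∈ NR1 ω) {p : Fin N → RegSpace W k} (hp : ∀ j, toL2 (p j) = φ j)
    (z : Fin N → ℂ) :
    ∑ m : I, monom z m.1 • toL2 (baseProfile p m) = ∑ j, z j • φ j := by
  have h1 : ∀ m : I, monom z m.1 • toL2 (baseProfile p m) =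
      ∑ j, if m.1 = stdIdx j then z j • φ j else 0 := by
    intro m
    rw [baseProfile, map_sum, Finset.smul_sum]
    refine Finset.sum_congr rfl fun j _ => ?_
    split_ifs with h
    · rw [hp, h, monom_stdIdx]
    · rw [map_zero, smul_zero]
  simp only [h1]
  rw [Finset.sum_comm]
  refine Finset.sum_congr rfl fun j _ => ?_
  have hj : stdIdx j ∈ I := (hI _).2 (stdIdx_mem_NR1 hneg j)
  rw [Finset.sum_eq_single ⟨stdIdx j, hj⟩]
  · simp
  · intro m _ hm
    exact if_neg fun h => hm (Subtype.ext h)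
  · simp

/-- Existence of refined profiles. For `H^s_γ` the profile of regularity `k = ⌈s⌉ + 2` is used. -/
theorem exists_isRefinedProfile (hω : StrictMono ω) (hneg : ∀ j, ω j < 0)
    (hspec : discreteSpectrumH V = Set.range (fun j => (ω j : ℂ)))
    (hsimple : ∀ j, Module.finrank ℂ (eigenspaceH V (ω j)) = 1)
    (hlin : ∀ m : Idx N, m ≠ 0 → dotIdx ω m ≠ 0)
    (hφ : ∀ j, φ j ∈ eigenspaceH V (ω j)) (hφnorm : ∀ j, ‖φ j‖ = 1)
    (hφreal : ∀ j, ∀ᵐ x, (φ j x).im = 0) {γ a : ℝ} (hγ : 0 < γ) (hγa : γ < a)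
    (ha : ∀ m, ∀ hm : m ∈ NR1 ω, SmallRate a (rate_pos hm))
    (hmem : ∀ (s : ℝ≥0) (j : Fin N), φ j ∈ weighted γ s)
    (hg : ContDiff ℝ (⊤ : ℕ∞) g) (hg0 : g 0 = 0) :
    ∃ P : ProfileData N γ, IsRefinedProfile V g ω hmem P := by
  classical
  obtain ⟨I, hI⟩ : ∃ I : Finset (Idx N), ∀ m, m ∈ I ↔ m ∈ NR1 ω :=
    ⟨(finite_NR1 hω).toFinset, fun m => Set.Finite.mem_toFinset _⟩
  obtain ⟨J, hJ⟩ : ∃ J : Finset (Idx N), ∀ m, m ∈ J ↔ m ∈ Rmin ω :=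
    ⟨(finite_Rmin hω).toFinset, fun m => Set.Finite.mem_toFinset _⟩
  obtain ⟨K, hKJ, U, ε, hε0, hlev⟩ := exists_profile_levels hω hneg hspec hsimple hlin hφ hφnorm
    hφreal ha hI hJ hg hg0
  choose δ hδ C hC Φ hδ1 hΦ0 hΦsm hεsm hΦeq hrem using
    fun l : ℕ => hlev (l + 2) (Nat.le_add_left 2 l)
  choose p hp using fun (l : ℕ) (j : Fin N) => exists_eigenfunction hneg hφ hφreal j (ha _ (stdIdx_mem_NR1 hneg j)) (l + 2)
  have hs : ∀ s : ℝ≥0, (s : ℝ) ≤ ((⌈s⌉₊ + 2 : ℕ) : ℝ) := fun s => by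
    have h1 : (s : ℝ) ≤ (⌈s⌉₊ : ℝ) := by exact_mod_cast Nat.le_ceil s
    push_cast
    linarith
  let E : (s : ℝ≥0) → RegSpace (expWeight a) (⌈s⌉₊ + 2) →L[ℝ] WSob γ s :=
    fun s => toWSob hγ hγa (hs s)
  -- in `L²`, the embedding `E` is the identity
  have hE : ∀ s f, WSob.toL2 (E s f) = toL2 f := fun s f => rfl
  have hEinj : ∀ s f, toL2 f = 0 → E s f = 0 := fun s f h => by
    have : f = 0 := toL2_injective (h.trans (map_zero toL2).symm)
    rw [this, map_zero]
  -- the radii have to be monotone in the regularity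
  let d : ℝ≥0 → ℝ := fun s => (Finset.range (⌈s⌉₊ + 1)).inf' ⟨0, by simp⟩ δ
  have hd0 : ∀ s, 0 < d s := fun s => (Finset.lt_inf'_iff _).2 fun l _ => hδ l
  have hdle : ∀ s, d s ≤ δ ⌈s⌉₊ := fun s => Finset.inf'_le _ (by simp)
  have hdanti : Antitone d := fun s t h => Finset.inf'_mono _
    (Finset.range_mono (Nat.add_le_add_right (Nat.ceil_mono h) 1)) _
  have hball : ∀ s w, norm1 w < d s ^ 2 → w ∈ Metric.ball (0 : Fin N → ℝ) (δ ⌈s⌉₊) := by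
    intro s w hw
    rw [mem_ball_zero_iff]
    have h1 : d s ^ 2 ≤ d s := by
      rw [sq]; exact mul_le_of_le_one_left (hd0 s).le ((hdle s).trans (hδ1 _))
    exact ((norm_le_norm1_real w).trans_lt hw).trans_le (h1.trans (hdle s))
  have hballz : ∀ s z, norm1 z < d s → absSq z ∈ Metric.ball (0 : Fin N → ℝ) (δ ⌈s⌉₊) := by
    intro s z hz
    refine hball s _ ((norm1_absSq_le z).trans_lt ?_)
    exact pow_lt_pow_left₀ hz (norm1_nonneg z) two_ne_zero
  let P : ProfileData N γ :=
    { δ := d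
      C := fun s => 2 * (‖E s‖ * C ⌈s⌉₊) + 1
      ψ := fun s m w => if h : m ∈ I then
        E s (Φ ⌈s⌉₊ w ⟨m, h⟩ - baseProfile (p ⌈s⌉₊) ⟨m, h⟩) else 0
      ϖ := fun _ w => ω + ε w
      R := fun s z => E s (remainder K g J Complex.reCLM (Φ ⌈s⌉₊) z) +
        Complex.I • E s (remainder K g J Complex.imCLM (Φ ⌈s⌉₊) z) }
  have hψ : ∀ s m w (h : m ∈ I), P.ψ s m w =
      E s (Φ ⌈s⌉₊ w ⟨m, h⟩ - baseProfile (p ⌈s⌉₊) ⟨m, h⟩) := fun s m w h => dif_pos h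
  have hRt : ∀ s z, WSob.toL2 (P.R s z) = toL2 (remainder K g J Complex.reCLM (Φ ⌈s⌉₊) z) +
      Complex.I • toL2 (remainder K g J Complex.imCLM (Φ ⌈s⌉₊) z) := fun s z => rfl
  -- the profile in `L²`: the terms `ψ_m` are `U_m` without its part `z·φ`
  have hprofile : ∀ s z, norm1 z < d s → WSob.toL2 (P.profile ω hmem s z) =
      ∑ m : I, monom z m.1 • U (absSq z) m := by
    intro s z hz
    have h1 : ∑ᶠ m : NR1 ω, monom z m.1 • P.ψ s m.1 (absSq z) =
        ∑ m : I, monom z m.1 • E s (Φ ⌈s⌉₊ (absSq z) m - baseProfile (p ⌈s⌉₊) m) := by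
      rw [finsum_subtype_eq_sum hI fun m => monom z m • P.ψ s m (absSq z),
        ← Finset.sum_coe_sort I]
      exact Finset.sum_congr rfl fun m _ => by rw [hψ s m.1 _ m.2]
    rw [ProfileData.profile, h1, map_add, map_sum, map_sum]
    simp only [map_smul, hE]
    simp only [map_sub, smul_sub, Finset.sum_sub_distrib]
    rw [sum_monom_baseProfile hneg hI (hp _), add_sub_left_comm]
    have h2 : ∑ j, z j • WSob.toL2 (WSob.mk (φ j) (hmem s j)) = ∑ j, z j • φ j := rfl
    rw [h2, sub_self, add_zero]
    exact Finset.sum_congr rfl fun m _ => by rw [(hΦeq ⌈s⌉₊ _ (hballz s z hz) m).1]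
  refine ⟨P, ?_⟩
  refine
    { δ_pos := hd0
      C_pos := fun s => by
        have := mul_nonneg (norm_nonneg (E s)) (hC ⌈s⌉₊)
        show 0 < 2 * (‖E s‖ * C ⌈s⌉₊) + 1
        linarith
      δ_anti := hdanti
      ψ_smooth := fun s m hm => ?_
      ϖ_smooth := fun s => ?_
      R_smooth := fun s => ?_
      ϖ_zero := fun s => ?_
      ψ_zero := fun s m hm => ?_
      ψ_init := fun s m hm => ?_
      R_bound := fun s z hz => ?_
      G_mem := fun m hm s => ?_
      solves := fun s z hz => ?_
      compat := fun s₁ s₂ h12 z hz => ?_ }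
  -- smoothness of `ψ`, `ϖ` and `R`
  · have h : m ∈ I := (hI m).2 hm
    have h1 : ContDiffOn ℝ (⊤ : ℕ∞) (Φ ⌈s⌉₊) {w | norm1 w < d s ^ 2} :=
      (hΦsm ⌈s⌉₊).mono fun w hw => hball s w hw
    have h2 := ContDiffOn.sub (contDiffOn_pi.1 h1 ⟨m, h⟩)
      (contDiffOn_const (c := baseProfile (p ⌈s⌉₊) ⟨m, h⟩))
    have h3 := ContDiff.comp_contDiffOn (E s).contDiff h2
    refine h3.congr fun w _ => ?_
    exact hψ s m w h
  · exact contDiffOn_const.add ((hεsm ⌈s⌉₊).mono fun w hw => hball s w hw)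
  · have h1 : ContDiffOn ℝ (⊤ : ℕ∞) (fun z : Fin N → ℂ => Φ ⌈s⌉₊ (absSq z)) {z | norm1 z < d s} :=
      (hΦsm ⌈s⌉₊).comp contDiff_absSq.contDiffOn fun z hz => hballz s z hz
    have h2 := ContDiff.comp_contDiffOn (E s).contDiff
      (contDiffOn_remainder K hg J Complex.reCLM h1)
    have h3 := ContDiff.comp_contDiffOn (E s).contDiff
      (contDiffOn_remainder K hg J Complex.imCLM h1)
    exact ContDiffOn.add h2 (ContDiffOn.const_smul Complex.I h3)
  · show ω + ε 0 = ω
    rw [hε0, add_zero]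
  · obtain ⟨j, rfl⟩ := hm
    have h : stdIdx j ∈ I := (hI _).2 (stdIdx_mem_NR1 hneg j)
    rw [hψ s _ _ h]
    refine hEinj s _ ?_
    rw [map_sub, hΦ0, baseProfile_stdIdx, hp, phiTilde_stdIdx, sub_self]
  · have h : m ∈ I := (hI _).2 hm.1
    rw [hψ s _ _ h, hE, baseProfile_of_notMem _ hm.2, sub_zero]
    exact hΦ0 _ _
  -- the bound on `R`, from those on its real and imaginary parts
  · rw [finsum_subtype_eq_sum hJ fun m => ‖monom z m‖]
    have hz' : norm1 z < δ ⌈s⌉₊ := lt_of_lt_of_le hz (hdle s)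
    set B := norm1 z ^ 2 * ∑ m ∈ J, ‖monom z m‖ with hB
    have hB0 : 0 ≤ B := mul_nonneg (sq_nonneg _) (Finset.sum_nonneg fun _ _ => norm_nonneg _)
    have h1 : ∀ ℓ : ℂ →L[ℝ] ℝ, ‖ℓ‖ ≤ 1 →
        ‖E s (remainder K g J ℓ (Φ ⌈s⌉₊) z)‖ ≤ ‖E s‖ * C ⌈s⌉₊ * B := fun ℓ hℓ =>
      ((E s).le_opNorm _).trans (by
        rw [mul_assoc]
        exact mul_le_mul_of_nonneg_left (hrem ⌈s⌉₊ z hz' ℓ hℓ) (norm_nonneg _))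
    have h2 := h1 Complex.reCLM (by rw [Complex.reCLM_norm])
    have h3 := h1 Complex.imCLM (by rw [Complex.imCLM_norm])
    have h4 : ‖P.R s z‖ ≤ _ := norm_add_le _ _
    rw [norm_smul, Complex.norm_I, one_mul] at h4
    show ‖P.R s z‖ ≤ (2 * (‖E s‖ * C ⌈s⌉₊) + 1) * norm1 z ^ 2 * ∑ m ∈ J, ‖monom z m‖
    rw [mul_assoc, ← hB]
    linarith
  -- regularity and decay of `G_m`
  · refine ⟨toL2 (gCoeff K g m 0 (Φ ⌈s⌉₊ 0)),
      mem_weighted_of_reg hγ hγa (gCoeff K g m 0 (Φ ⌈s⌉₊ 0)).reg_ofReal (hs s), ?_⟩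
    filter_upwards [toL2_coe (gCoeff K g m 0 (Φ ⌈s⌉₊ 0)), Gres_ae_eq (V := V) (φ := φ) hI hg hg0
      (hKJ m ((hJ m).2 hm)) fun n _ => hΦ0 ⌈s⌉₊ n] with x h1 h2
    rw [h1, h2]
  -- the evolution equation; `|z(t)|²` is constant along the flow
  · have hw : absSq z ∈ Metric.ball (0 : Fin N → ℝ) (δ ⌈s⌉₊) := hballz s z hz
    have habs : ∀ t, absSq (P.flow s z t) = absSq z := fun t => absSq_phase _ t z
    have hn1 : ∀ t, norm1 (P.flow s z t) = norm1 z := fun t =>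
      Finset.sum_congr rfl fun j _ => by
        rw [ProfileData.flow, norm_mul, norm_exp_phase, one_mul]
    refine isForcedSolution_sum (U := U (absSq z))
      (G := fun m : I => toL2 (gCoeff K g m (absSq z) (Φ ⌈s⌉₊ (absSq z))))
      (θ := ω + ε (absSq z)) (fun m => (hΦeq ⌈s⌉₊ _ hw m).2) (z := P.flow s z) (z₀ := z)
      (fun t j => rfl) (fun t => ?_) fun t => ?_
    · rw [hprofile s _ ((hn1 t).trans_lt hz), habs]
    · have hGres : ∀ᵐ x, ∀ m : J, Gres V g ω φ m x = (gCoeff K g m.1 0 (Φ ⌈s⌉₊ 0) x : ℂ) :=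
        ae_all_iff.2 fun m => Gres_ae_eq hI hg hg0 (hKJ m m.2) fun n _ => hΦ0 ⌈s⌉₊ n
      have hU : ∀ᵐ x, ∀ m : I, U (absSq z) m x = (Φ ⌈s⌉₊ (absSq z) m x : ℂ) :=
        ae_all_iff.2 fun m => by
          rw [← (hΦeq ⌈s⌉₊ _ hw m).1]
          exact toL2_coe _
      have hgc : ∀ᵐ x, ∀ m : I, toL2 (gCoeff K g m (absSq z) (Φ ⌈s⌉₊ (absSq z))) x =
          (gCoeff K g m.1 (absSq z) (Φ ⌈s⌉₊ (absSq z)) x : ℂ) := ae_all_iff.2 fun m => toL2_coe _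
      have hRc := hRt s (P.flow s z t)
      rw [hRc]
      filter_upwards [hGres, hU, hgc,
        Lp.coeFn_add (toL2 (remainder K g J Complex.reCLM (Φ ⌈s⌉₊) (P.flow s z t)))
          (Complex.I • toL2 (remainder K g J Complex.imCLM (Φ ⌈s⌉₊) (P.flow s z t))),
        Lp.coeFn_smul Complex.I (toL2 (remainder K g J Complex.imCLM (Φ ⌈s⌉₊) (P.flow s z t))),
        toL2_coe (remainder K g J Complex.reCLM (Φ ⌈s⌉₊) (P.flow s z t)),
        toL2_coe (remainder K g J Complex.imCLM (Φ ⌈s⌉₊) (P.flow s z t))]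
        with x h1 h2 h3 h4 h5 h6 h7
      rw [h4, Pi.add_apply, h5, Pi.smul_apply, h6, h7,
        remainder_apply hg J Complex.reCLM (Φ ⌈s⌉₊) (P.flow s z t) x rfl,
        remainder_apply hg J Complex.imCLM (Φ ⌈s⌉₊) (P.flow s z t) x rfl,
        Complex.reCLM_apply, Complex.imCLM_apply, smul_eq_mul, mul_comm Complex.I,
        Complex.re_add_im, habs]
      rw [finsum_subtype_eq_sum hJ fun m => monom (P.flow s z t) m * Gres V g ω φ m x,
        ← Finset.sum_coe_sort J, ← Finset.sum_coe_sort J, ← Finset.sum_coe_sort I]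
      simp only [h1, h2, h3]
      ring
  -- compatibility of the regularities, since `U` and `ε` do not depend on them
  · have hz1 : norm1 z < d s₁ := lt_of_lt_of_le hz (hdanti h12.le)
    have hw1 := hballz s₁ z hz1
    have hw2 := hballz s₂ z hz
    have hΦU : ∀ m : I, toL2 (Φ ⌈s₁⌉₊ (absSq z) m) = toL2 (Φ ⌈s₂⌉₊ (absSq z) m) := fun m => by
      rw [(hΦeq _ _ hw1 m).1, (hΦeq _ _ hw2 m).1]
    have hΦU0 : ∀ m : I, toL2 (Φ ⌈s₁⌉₊ 0 m) = toL2 (Φ ⌈s₂⌉₊ 0 m) := fun m => by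
      rw [hΦ0, hΦ0]
    refine ⟨fun m hm => ?_, rfl, ?_⟩
    · have h : m ∈ I := (hI m).2 hm
      rw [hψ _ _ _ h, hψ _ _ _ h, hE, hE, map_sub, map_sub, hΦU]
      congr 1
      rw [baseProfile, baseProfile, map_sum, map_sum]
      refine Finset.sum_congr rfl fun j _ => ?_
      split_ifs
      · rw [hp, hp]
      · rw [map_zero, map_zero]
    · rw [hRt, hRt, remainder_congr hg J Complex.reCLM hΦU hΦU0,
        remainder_congr hg J Complex.imCLM hΦU hΦU0]

end Existence

end NLS

end

noncomputable section

namespace NLS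

/-! ### Standing waves -/

section StandingWaves

variable {N : ℕ} {ω : Fin N → ℝ} {V : 𝓢(X, ℝ)} {φ : Fin N → L2} {g : ℝ → ℝ} {γ : ℝ}

theorem norm1_single (j : Fin N) (z : ℂ) : norm1 (Pi.single j z : Fin N → ℂ) = ‖z‖ := by
  rw [norm1, Finset.sum_eq_single j]
  · rw [Pi.single_eq_same]
  · intro i _ hi
    rw [Pi.single_eq_of_ne hi, norm_zero]
  · simp

/-- On the coordinate axis `ℂ e_j`, all monomials of total degree `1` except `z_j` vanish. -/
theorem monom_single_eq_zero {j : Fin N} {m : Idx N} (h1 : ∑ i, m i = 1) (hm : m ≠ stdIdx j)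
    (z : ℂ) : monom (Pi.single j z) m = 0 := by
  obtain ⟨i, hij, hi⟩ : ∃ i, i ≠ j ∧ m i ≠ 0 := by
    by_contra hcon
    push Not at hcon
    rw [Finset.sum_eq_single j (fun i _ hi => hcon i hi) (by simp)] at h1
    refine hm (funext fun i => ?_)
    by_cases hij : i = j
    · rw [hij, h1, stdIdx, Pi.single_eq_same]
    · rw [hcon i hij, stdIdx, Pi.single_eq_of_ne hij]
  refine Finset.prod_eq_zero (Finset.mem_univ i) ?_
  rw [← norm_eq_zero, norm_cpowIdx, Pi.single_eq_of_ne hij, norm_zero, zero_pow (by omega)]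

/-- Resonant monomials vanish on the axes: an index supported at `j` and of sum `1` is `e_j`, and
`e_j·ω < 0`. -/
theorem monom_single_Rmin (hneg : ∀ j, ω j < 0) {m : Idx N} (hm : m ∈ Rmin ω) (j : Fin N) (z : ℂ) :
    monom (Pi.single j z) m = 0 := by
  refine monom_single_eq_zero hm.1.1 (fun h => ?_) z
  have h1 := hm.1.2
  rw [h, dotIdx_stdIdx] at h1
  exact absurd h1 (hneg j).not_gt

theorem absSq_single_smul (j : Fin N) {c : ℂ} (hc : ‖c‖ = 1) (z : ℂ) :
    absSq (Pi.single j (c * z)) = absSq (Pi.single j z) := by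
  funext i
  by_cases hij : i = j
  · subst hij
    simp [absSq, hc]
  · simp [absSq, hij]

/-- On the axes only the monomial `z_j` survives in the profile. -/
theorem ProfileData.profile_single (P : ProfileData N γ) (hneg : ∀ j, ω j < 0)
    (hmem : ∀ (s : ℝ≥0) (j : Fin N), φ j ∈ weighted γ s) (s : ℝ≥0) (j : Fin N) (z : ℂ) :
    P.profile ω hmem s (Pi.single j z) = z • WSob.mk (φ j) (hmem s j) +
      z • P.ψ s (stdIdx j) (absSq (Pi.single j z)) := by
  rw [ProfileData.profile]
  congr 1
  · rw [Finset.sum_eq_single j]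
    · rw [Pi.single_eq_same]
    · intro i _ hi
      rw [Pi.single_eq_of_ne hi, zero_smul]
    · simp
  · rw [finsum_eq_single _ (⟨stdIdx j, stdIdx_mem_NR1 hneg j⟩ : NR1 ω)]
    · rw [monom_stdIdx, Pi.single_eq_same]
    · intro m hm
      rw [monom_single_eq_zero m.2.1.1 (fun h => hm (Subtype.ext h)), zero_smul]

theorem ProfileData.flow_single (P : ProfileData N γ) (s : ℝ≥0) (j : Fin N) (z : ℂ) (t : ℝ) :
    P.flow s (Pi.single j z) t = Pi.single j (Complex.exp
      (-Complex.I * (P.ϖ s (absSq (Pi.single j z)) j : ℂ) * (t : ℂ)) * z) := by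
  funext i
  rw [ProfileData.flow]
  by_cases hij : i = j
  · subst hij
    rw [Pi.single_eq_same, Pi.single_eq_same]
  · rw [Pi.single_eq_of_ne hij, Pi.single_eq_of_ne hij, mul_zero]

theorem IsForcedSolution.congr_ae {F F' : ℝ → X → ℂ} {u : ℝ → L2}
    (h : IsForcedSolution V g F u) (hF : ∀ t, F t =ᵐ[volume] F' t) : IsForcedSolution V g F' u := by
  refine ⟨h.1, h.2.1, fun t => ?_⟩
  obtain ⟨h1, h2⟩ := h.2.2 t
  refine ⟨h1, ?_⟩
  filter_upwards [h2, hF t] with x h3 h4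
  rw [h3, h4]

variable {hmem : ∀ (s : ℝ≥0) (j : Fin N), φ j ∈ weighted γ s} {P : ProfileData N γ}

/-- By its bound, the remainder vanishes on the axes together with the resonant monomials. -/
theorem IsRefinedProfile.R_single (hP : IsRefinedProfile V g ω hmem P) (hneg : ∀ j, ω j < 0)
    (s : ℝ≥0) (j : Fin N) {z : ℂ} (hz : ‖z‖ < P.δ s) : P.R s (Pi.single j z) = 0 := by
  have h1 := hP.R_bound s (Pi.single j z) (by rwa [norm1_single])
  have h2 : ∑ᶠ m : Rmin ω, ‖monom (Pi.single j z : Fin N → ℂ) m.1‖ = 0 := by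
    rw [finsum_congr fun m => by rw [monom_single_Rmin hneg m.2 j z, norm_zero], finsum_zero]
  rw [h2, mul_zero] at h1
  exact norm_le_zero_iff.1 h1

/-- On the coordinate axis `ℂ e_j` the forcing terms vanish. -/
theorem IsRefinedProfile.isSolution_single (hP : IsRefinedProfile V g ω hmem P)
    (hneg : ∀ j, ω j < 0) (s : ℝ≥0) (j : Fin N) {z : ℂ} (hz : ‖z‖ < P.δ s) :
    IsSolution V g (fun t => WSob.toL2 (P.profile ω hmem s (Pi.single j (Complex.exp
      (-Complex.I * (P.ϖ s (absSq (Pi.single j z)) j : ℂ) * (t : ℂ)) * z)))) := by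
  have h1 := hP.solves s (Pi.single j z) (by rwa [norm1_single])
  simp only [P.flow_single] at h1
  refine h1.congr_ae fun t => ?_
  rw [hP.R_single hneg s j (by rwa [norm_mul, norm_exp_phase, one_mul]), map_zero]
  filter_upwards [Lp.coeFn_zero ℂ 2 (volume : Measure X)] with x hx
  rw [hx, Pi.zero_apply, add_zero]
  rw [finsum_congr fun m : Rmin ω => by rw [monom_single_Rmin hneg m.2 j, zero_mul], finsum_zero]

theorem ProfileData.profile_single_phase (P : ProfileData N γ) (hneg : ∀ j, ω j < 0)
    (hmem : ∀ (s : ℝ≥0) (j : Fin N), φ j ∈ weighted γ s) (s : ℝ≥0) (j : Fin N) {c : ℂ}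
    (hc : ‖c‖ = 1) (z : ℂ) : P.profile ω hmem s (Pi.single j (c * z)) =
      c • P.profile ω hmem s (Pi.single j z) := by
  rw [P.profile_single hneg, P.profile_single hneg, absSq_single_smul j hc, smul_add, smul_smul,
    smul_smul]

theorem norm1_lt_mem_nhds {r : ℝ} (hr : 0 < r) : {w : Fin N → ℝ | norm1 w < r} ∈ 𝓝 0 := by
  have h1 : Continuous fun w : Fin N → ℝ => norm1 w :=
    continuous_finsetSum _ fun j _ => (continuous_apply j).norm
  refine h1.continuousAt.eventually (gt_mem_nhds ?_)
  simpa [norm1] using hr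

theorem tendsto_absSq_single (j : Fin N) :
    Tendsto (fun z : ℂ => absSq (Pi.single j z : Fin N → ℂ)) (𝓝 0) (𝓝 0) := by
  have h1 : Continuous fun z : ℂ => absSq (Pi.single j z : Fin N → ℂ) :=
    contDiff_absSq.continuous.comp
      (ContinuousLinearMap.single ℂ (fun _ : Fin N => ℂ) j).continuous
  have h2 : absSq (Pi.single j (0 : ℂ) : Fin N → ℂ) = 0 := by
    funext i
    simp [absSq]
  rw [← h2]
  exact h1.tendsto 0

theorem IsRefinedProfile.tendsto_freq (hP : IsRefinedProfile V g ω hmem P) (s : ℝ≥0) (j : Fin N) :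
    Tendsto (fun z : ℂ => P.ϖ s (absSq (Pi.single j z)) j) (𝓝 0) (𝓝 (ω j)) := by
  have h1 : ContinuousAt (P.ϖ s) 0 :=
    (hP.ϖ_smooth s).continuousOn.continuousAt (norm1_lt_mem_nhds (pow_pos (hP.δ_pos s) 2))
  have h2 := (h1.tendsto.comp (tendsto_absSq_single j))
  rw [hP.ϖ_zero] at h2
  exact (continuous_apply j).continuousAt.tendsto.comp h2

theorem IsRefinedProfile.profile_single_isLittleO (hP : IsRefinedProfile V g ω hmem P)
    (hneg : ∀ j, ω j < 0) (s : ℝ≥0) (j : Fin N) :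
    (fun z : ℂ => P.profile ω hmem s (Pi.single j z) - z • WSob.mk (φ j) (hmem s j))
      =o[𝓝 0] (fun z : ℂ => z) := by
  have h1 : ContinuousAt (P.ψ s (stdIdx j)) 0 :=
    (hP.ψ_smooth s _ (stdIdx_mem_NR1 hneg j)).continuousOn.continuousAt
      (norm1_lt_mem_nhds (pow_pos (hP.δ_pos s) 2))
  have h2 := h1.tendsto.comp (tendsto_absSq_single j)
  rw [hP.ψ_zero s _ ⟨j, rfl⟩] at h2
  have h3 := (isBigO_refl (fun z : ℂ => z) (𝓝 0)).smul_isLittleO ((isLittleO_one_iff ℂ).2 h2)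
  simp only [smul_eq_mul, mul_one] at h3
  refine h3.congr_left fun z => ?_
  rw [P.profile_single hneg, add_sub_cancel_left]
  rfl

end StandingWaves

end NLS

end

theorem corollary1p7 (V : 𝓢(NLS.X, ℝ)) (N : ℕ) (hN : 2 ≤ N) (ω : Fin N → ℝ)
    (hω : StrictMono ω) (hωneg : ∀ j, ω j < 0)
    (hspec : NLS.discreteSpectrumH V = Set.range (fun j => (ω j : ℂ)))
    (hsimple : ∀ j, Module.finrank ℂ (NLS.eigenspaceH V (ω j)) = 1)
    (hlin : ∀ m : NLS.Idx N, m ≠ 0 → NLS.dotIdx ω m ≠ 0)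
    (φ : Fin N → NLS.L2) (hφ : ∀ j, φ j ∈ NLS.eigenspaceH V (ω j)) (hφnorm : ∀ j, ‖φ j‖ = 1)
    (hφreal : ∀ j, ∀ᵐ x, (φ j x).im = 0) :
    ∃ γ > 0, ∃ hmem : ∀ (s : ℝ≥0) (j : Fin N), φ j ∈ NLS.weighted γ s,
      ∀ g : ℝ → ℝ, ContDiff ℝ (⊤ : ℕ∞) g → g 0 = 0 →
      (∀ n : ℕ, ∃ C > 0, ∀ s : ℝ,
        |iteratedDeriv n g s| ≤ C * Real.sqrt (1 + |s| ^ 2) ^ (2 - (n : ℤ))) →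
      (∃ P : NLS.ProfileData N γ, NLS.IsRefinedProfile V g ω hmem P) ∧
      ∀ P : NLS.ProfileData N γ, NLS.IsRefinedProfile V g ω hmem P →
        ∀ s : ℝ≥0, 0 < s → ∀ j : Fin N,
          (∀ z : ℂ, ‖z‖ < P.δ s →
            let ϖ : ℝ := P.ϖ s (NLS.absSq (Pi.single j z)) j
            let u : ℝ → NLS.WSob γ s := fun t =>
              P.profile ω hmem s (Pi.single j (Complex.exp (-Complex.I * (ϖ : ℂ) * (t : ℂ)) * z))
            NLS.IsSolution V g (fun t => NLS.WSob.toL2 (u t)) ∧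
            ∀ t, u t = Complex.exp (-Complex.I * (ϖ : ℂ) * (t : ℂ)) •
              P.profile ω hmem s (Pi.single j z)) ∧
          Tendsto (fun z : ℂ => P.ϖ s (NLS.absSq (Pi.single j z)) j) (𝓝 0) (𝓝 (ω j)) ∧
          (fun z : ℂ => P.profile ω hmem s (Pi.single j z) - z • NLS.WSob.mk (φ j) (hmem s j))
            =o[𝓝 0] (fun z : ℂ => z) := by
  -- a rate of decay which is admissible for all the finitely many equations
  obtain ⟨a, ha, ha0⟩ : ∃ a : ℝ,
      (∀ m, ∀ hm : m ∈ NLS.NR1 ω, NLS.SmallRate a (NLS.rate_pos hm)) ∧ 0 < a := by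
    have h1 : ∀ᶠ a in 𝓝[>] (0 : ℝ), ∀ m : NLS.NR1 ω, NLS.SmallRate a (NLS.rate_pos m.2) := by
      have : Finite (NLS.NR1 ω) := NLS.finite_NR1 hω
      exact eventually_all.2 fun m => NLS.eventually_smallRate (NLS.rate_pos m.2)
    obtain ⟨a, h2, h3⟩ := (h1.and self_mem_nhdsWithin).exists
    exact ⟨a, fun m hm => h2 ⟨m, hm⟩, h3⟩
  -- decay with rate `a` leaves room for the weight with any rate less than `a`
  have hmem : ∀ (s : ℝ≥0) (j : Fin N), φ j ∈ NLS.weighted (a / 2) s := by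
    intro s j
    obtain ⟨f, hf⟩ := NLS.exists_eigenfunction hωneg hφ hφreal j
      (ha _ (NLS.stdIdx_mem_NR1 hωneg j)) ⌈s⌉₊
    rw [← hf]
    exact NLS.mem_weighted_of_reg (half_pos ha0) (half_lt_self ha0) f.reg_ofReal
      (by exact_mod_cast Nat.le_ceil s)
  refine ⟨a / 2, half_pos ha0, hmem, fun g hg hg0 _ => ⟨?_, fun P hP s _ j => ⟨fun z hz => ?_, ?_, ?_⟩⟩⟩
  · exact NLS.exists_isRefinedProfile hω hωneg hspec hsimple hlin hφ hφnorm hφreal (half_pos ha0)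
      (half_lt_self ha0) ha hmem hg hg0
  · exact ⟨hP.isSolution_single hωneg s j hz, fun t =>
      P.profile_single_phase hωneg hmem s j (NLS.norm_exp_phase _ _) z⟩
  · exact hP.tendsto_freq s j
  · exact hP.profile_single_isLittleO hωneg s j
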